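/- **Setting.** Let $d\ge 2$; points of $\mathbb{R}^d$ are row vectors. Let $\mathrm{S}=\mathrm{S}_1^{d-1}$ be the unit sphere with Lebesgue measure $\omega$, and $\mathrm{T}^1(\mathbb{R}^d)=\mathbb{R}^d\times \mathrm{S}$. Let $R:\mathrm{S}\to\mathrm{SO}(d)$ satisfy $vR(v)=e_1$ for all $v$ and be continuous on $\mathrm{S}$ minus one point, and put $D_\rho=\mathrm{diag}(\rho^{d-1},\rho^{-1},\dots,\rho^{-1})$. Let $\Sigma$ be a compact metric space with a Borel probability measure $\mathsf m$, $\mathcal X=\mathbb{R}^d\times\Sigma$, $\mu_{\mathcal X}=\mathrm{vol}\times\mathsf m$. Let $N(\mathcal X)$ be the space of locally finite counting measures on $\mathcal X$ with the vague topology, and $N_s(\mathcal X)\subset N(\mathcal X)$ the subspace of simple ones, identified with the locally finite subsets of $\mathcal X$; $P(\cdot)$ denotes Borel probability measures with the weak topology. Linear maps and translations act on $\mathcal X$ through the first factor. Let $\mathcal P\subset\mathbb{R}^d$ be locally finite with constant asymptotic density $c_{\mathcal P}>0$, i.e. $\#(\mathcal P\cap TB)/T^d\to c_{\mathcal P}\,\mathrm{vol}(B)$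 as $T\to\infty$ for every bounded $B\subset\mathbb{R}^d$ with $\mathrm{vol}(\partial B)=0$. (A set has asymptotic density zero if the same holds for it with $c_{\mathcal P}$ replaced by $0$.) Let $\varsigma:\mathcal P\to\Sigma$ be a map and $\widetilde{\mathcal P}=\{(p,\varsigma(p)):p\in\mathcal P\}$. For $q\in\mathbb{R}^d$, $v\in\mathrm{S}$, $0<\rho<1$ set $$\mathcal Q_\rho(q,v)=\{((p-q)R(v)D_\rho,\varsigma(p)) : p\in\mathcal P,\ p\ne q\}\in N_s(\mathcal X).$$ For $\lambda\in P(\mathrm{S})$ let $\mu_{q,\rho}^{(\lambda)}$ be the distribution of $\mathcal Q_\rho(q,v)$ for $v$ random with law $\lambda$. Let $\varsigma\mapsto\mu_\varsigma$ be a continuous map $\Sigma\to P(N(\mathcal X))$, and assume: * **[P1]** $\#(\widetilde{\mathcal P}\cap TB)/T^d\to c_{\mathcal P}\,\mu_{\mathcal X}(B)$ as $T\to\infty$ for every bounded $B\subset\mathcal X$ with $\mu_{\mathcal X}(\partial B)=0$, where $TB=\{(Tw,s):(w,s)\in B\}$. * **[P2]** There is $\mathcal E\subset\mathcal P$ of asymptotic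 density zero such that for all $T\ge1$ and all $\lambda\in P(\mathrm{S})$ absolutely continuous with respect to $\omega$, $\mu_{q,\rho}^{(\lambda)}\to\mu_{\varsigma(q)}$ weakly as $\rho\to0$, uniformly over $q\in\mathcal P\setminus\mathcal E$ with $\|q\|<T\rho^{1-d}$ (uniformity with respect to a metric realizing the weak topology). * **[P3]** For every bounded Borel set $B\subset\mathbb{R}^d$, $$\lim_{\xi\to\infty}\limsup_{\rho\to0}\,[\mathrm{vol}\times\omega]\{(q,v)\in B\times \mathrm{S}:\mathcal Q_\rho(\rho^{1-d}q,v)\cap(\mathfrak Z_\xi\times\Sigma)=\emptyset\}=0,$$ where $\mathfrak Z_\xi=\{x: 0<x_1<\xi,\ x_2^2+\dots+x_d^2<1\}$. * **[Q1]** Each $\mu_\varsigma$ is invariant under every $K\in\mathrm{SO}(d)$ with $e_1K=e_1$. * **[Q2]** For each $\varsigma$, $\mu_\varsigma(\{\nu:\exists x_1\in\mathbb{R},\ \nu(\{x_1\}\times\mathbb{R}^{d-1}\times\Sigma)>1\})=0$. * **[Q3]** For every $\varepsilon>0$ there is $r>0$ such that $\mu_\varsigma(\{\nu:\nu(\mathcal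 B^d(x,r)\times\Sigma)=0\})<\varepsilon$ for all $\varsigma\in\Sigma$, $x\in\mathbb{R}^d$, where $\mathcal B^d(x,r)$ is the open ball with center $x$ and radius $r$. Fix $c\in\mathbb{R}$ and a nonempty bounded open set $\mathfrak D\subset\mathbb{R}^{d-1}$ with $\mathrm{vol}(\partial\mathfrak D)=0$, and let $\mathfrak C_\tau=(c,c+\tau)\times\mathfrak D$. For $x\in\mathbb{R}^d$, $\varsigma\in\Sigma$ let $\overline\mu_\varsigma^{(x)}$ be the distribution of $(Y+x)\cup\{(x,\varsigma)\}$ for $Y$ random with law $\mu_\varsigma$ (by [Q2], $Y\in N_s(\mathcal X)$ almost surely). **Theorem.** The formula $$\mu(A)=c_{\mathcal P}\int_\Sigma\int_0^\infty\int_{\mathfrak D}\overline\mu_\varsigma^{(c+\tau,b)}\bigl(\{Y\in N_s(\mathcal X): Y\cap(\mathfrak C_\tau\times\Sigma)=\emptyset\text{ and }Y\in A\}\bigr)\,db\,d\tau\,d\mathsf m(\varsigma),\qquad A\subset N_s(\mathcal X)\text{ Borel},$$ defines a Borel probability measure $\mu$ on $N_s(\mathcal X)$, and for every Borel probability measure $\Lambda$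 on $\mathrm{T}^1(\mathbb{R}^d)$ that is absolutely continuous with respect to $\mathrm{vol}\times\omega$, the distribution $\mu_\rho^{(\Lambda)}\in P(N_s(\mathcal X))$ of $\mathcal Q_\rho(\rho^{1-d}q,v)$, for $(q,v)$ random with law $\Lambda$, converges weakly to $\mu$ as $\rho\to0$. In particular the limit does not depend on $\Lambda$. -/

import Mathlib

open MeasureTheory Filter Topology Set
open scoped ENNReal CompactlySupported

namespace LorentzGas

/-! ### Point sets, counting measures and the vague topology -/

section PointProcesses

universe u

/-- A locally finite subset of a space `X`. On a locally compact second countable Hausdorff space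
these are the elements of `N_s(X)`, the simple counting measures. -/
@[ext]
structure PointSet (X : Type u) [TopologicalSpace X] where
  carrier : Set X
  finite_inter : ∀ K : Set X, IsCompact K → (carrier ∩ K).Finite

/-- The space `N(X)` of counting measures on `X`: locally finite sums of unit point masses. -/
def CountingMeasure (X : Type u) [TopologicalSpace X] [MeasurableSpace X] : Type u :=
  {η : Measure X // (∀ K : Set X, IsCompact K → η K < ∞) ∧
    ∃ (ι : Type u) (x : ι → X), η = Measure.sum fun i => Measure.dirac (x i)}

variable {X : Type u} [TopologicalSpace X] [MeasurableSpace X]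

/-- The vague topology: the coarsest one for which `η ↦ ∫ f dη` is continuous for every
continuous, compactly supported `f`. -/
noncomputable instance : TopologicalSpace (CountingMeasure X) :=
  TopologicalSpace.induced (fun (η : CountingMeasure X) (f : C_c(X, ℝ)) => ∫ x, f x ∂η.1)
    inferInstance

noncomputable instance : MeasurableSpace (CountingMeasure X) := borel _

instance : BorelSpace (CountingMeasure X) := ⟨rfl⟩

variable [T2Space X] [BorelSpace X]

/-- The identification of a locally finite set `Y` with the counting measure `∑_{y ∈ Y} δ_y`. -/
noncomputable def PointSet.toCounting (Y : PointSet X) : CountingMeasure X :=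
  ⟨Measure.sum fun y : Y.carrier => Measure.dirac (y : X), by
    refine ⟨fun K hK => ?_, Y.carrier, Subtype.val, rfl⟩
    rw [Measure.sum_apply _ hK.measurableSet]
    have h1 : ∀ y : Y.carrier, Measure.dirac (y : X) K = K.indicator (fun _ => (1 : ℝ≥0∞)) y :=
      fun y => Measure.dirac_apply' _ hK.measurableSet
    simp_rw [h1]
    rw [tsum_subtype Y.carrier (K.indicator fun _ => (1 : ℝ≥0∞)), Set.indicator_indicator,
      ← tsum_subtype (Y.carrier ∩ K) (fun _ => (1 : ℝ≥0∞))]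
    have := (Y.finite_inter K hK).to_subtype
    have := Fintype.ofFinite (Y.carrier ∩ K : Set X)
    rw [tsum_fintype]
    simp⟩

/-- The vague topology on `N_s(X)`, as a subspace of `N(X)`. -/
noncomputable instance : TopologicalSpace (PointSet X) :=
  TopologicalSpace.induced PointSet.toCounting inferInstance

noncomputable instance : MeasurableSpace (PointSet X) := borel _

instance : BorelSpace (PointSet X) := ⟨rfl⟩

/-- The image of a locally finite set under a homeomorphism. -/
def PointSet.map (e : X ≃ₜ X) (Y : PointSet X) : PointSet X where
  carrier := e '' Y.carrier
  finite_inter K hK := by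
    have h : e '' Y.carrier ∩ K = e '' (Y.carrier ∩ e ⁻¹' K) := by
      ext x
      constructor
      · rintro ⟨⟨y, hy, rfl⟩, hK⟩
        exact ⟨y, ⟨hy, hK⟩, rfl⟩
      · rintro ⟨y, ⟨hy, hK⟩, rfl⟩
        exact ⟨⟨y, hy, rfl⟩, hK⟩
    rw [h]
    exact (Y.finite_inter _ (e.isCompact_preimage.2 hK)).image _

/-- The point set `Y ∪ {x}`. -/
def PointSet.insert (x : X) (Y : PointSet X) : PointSet X where
  carrier := Y.carrier ∪ {x}
  finite_inter K hK := by
    rw [Set.union_inter_distrib_right]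
    exact (Y.finite_inter K hK).union ((Set.finite_singleton x).subset Set.inter_subset_left)

/-- The push-forward of a counting measure under a homeomorphism. -/
noncomputable def CountingMeasure.map (e : X ≃ₜ X) (η : CountingMeasure X) : CountingMeasure X :=
  ⟨η.1.map e, by
    refine ⟨fun K hK => ?_, ?_⟩
    · rw [Measure.map_apply e.continuous.measurable hK.measurableSet]
      exact η.2.1 _ (e.isCompact_preimage.2 hK)
    · obtain ⟨ι, x, h⟩ := η.2.2
      refine ⟨ι, fun i => e (x i), ?_⟩
      rw [h, Measure.map_sum e.continuous.aemeasurable]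
      congr 1
      funext i
      exact Measure.map_dirac' e.continuous.measurable _⟩

theorem PointSet.integral_toCounting (Y : PointSet X) (f : C_c(X, ℝ)) :
    ∫ x, f x ∂(Y.toCounting).1 = ∑' y : Y.carrier, f y := by
  have hfin : IsFiniteMeasureOnCompacts (Y.toCounting).1 := ⟨fun K hK => Y.toCounting.2.1 K hK⟩
  have hint : Integrable f (Measure.sum fun y : Y.carrier => Measure.dirac (y : X)) :=
    Continuous.integrable_of_hasCompactSupport (μ := (Y.toCounting).1) f.continuous
      f.hasCompactSupport
  have h := (hasSum_integral_measure hint).tsum_eq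
  refine h.symm.trans (tsum_congr fun y => ?_)
  exact integral_dirac' _ _ f.continuous.stronglyMeasurable

end PointProcesses

/-! ### Uniform weak convergence -/

section UniformConvergence

/-- The parameter `ρ` ranges over `(0,1)`. -/
abbrev Radius : Type := Set.Ioo (0 : ℝ) 1

/-- The filter `ρ → 0` on `(0,1)`. -/
def toZero : Filter Radius := Filter.comap ((↑) : Radius → ℝ) (𝓝 0)

/-- The topology of weak convergence of probability measures on `S`. -/
noncomputable abbrev weakTopology (S : Type*) [TopologicalSpace S] [MeasurableSpace S] [BorelSpace S] :
    TopologicalSpace (ProbabilityMeasure S) :=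
  inferInstance

/-- `a ρ j` converges weakly to `ν j` as `ρ → 0`, uniformly over `j ∈ J ρ`, measured in some metric
realizing the weak topology. (If the `ν j` stay in a fixed compact set of probability measures then
the choice of the metric is immaterial.) -/
def UniformWeakLimit {J S : Type*} [TopologicalSpace S] [MeasurableSpace S] [BorelSpace S]
    (Jset : Radius → Set J) (a : Radius → J → ProbabilityMeasure S)
    (ν : J → ProbabilityMeasure S) : Prop :=
  ∃ D : MetricSpace (ProbabilityMeasure S),
    D.toPseudoMetricSpace.toUniformSpace.toTopologicalSpace = weakTopology S ∧
    ∀ ε : ℝ, 0 < ε → ∃ ρ₀ : Radius, ∀ ρ : Radius, ρ < ρ₀ → ∀ j ∈ Jset ρ,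
      D.dist (a ρ j) (ν j) < ε

end UniformConvergence

/-! ### Geometry: the dimension is `d = n + 1`, points are row vectors -/

section Geometry

/-- `ℝ^d` with `d = n + 1`. -/
abbrev E (n : ℕ) : Type := EuclideanSpace ℝ (Fin (n + 1))

/-- The unit sphere of `ℝ^d`. -/
abbrev Sph (n : ℕ) : Type := Metric.sphere (0 : E n) 1

/-- The Lebesgue (surface) measure `ω` on the unit sphere. -/
noncomputable def omega (n : ℕ) : Measure (Sph n) := (volume : Measure (E n)).toSphere

/-- The point `(t, b) ∈ ℝ × ℝ^{d-1} = ℝ^d`. -/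
def consPt {n : ℕ} (t : ℝ) (b : EuclideanSpace ℝ (Fin n)) : E n :=
  WithLp.toLp 2 (Fin.cons t (WithLp.ofLp b))

/-- The projection `(x₁, x₂, …, x_d) ↦ (x₂, …, x_d)`. -/
def tailPt {n : ℕ} (x : E n) : EuclideanSpace ℝ (Fin n) :=
  WithLp.toLp 2 (fun i => x i.succ)

/-- The row vector product `x A`. -/
def rowMul {n : ℕ} (x : E n) (A : Matrix (Fin (n + 1)) (Fin (n + 1)) ℝ) : E n :=
  WithLp.toLp 2 (Matrix.vecMul (WithLp.ofLp x) A)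

theorem rowMul_mul {n : ℕ} (x : E n) (A B : Matrix (Fin (n + 1)) (Fin (n + 1)) ℝ) :
    rowMul (rowMul x A) B = rowMul x (A * B) := by
  simp [rowMul, Matrix.vecMul_vecMul]

theorem rowMul_one {n : ℕ} (x : E n) : rowMul x 1 = x := by
  simp [rowMul]

theorem continuous_rowMul {n : ℕ} :
    Continuous fun p : E n × Matrix (Fin (n + 1)) (Fin (n + 1)) ℝ => rowMul p.1 p.2 := by
  refine (PiLp.continuous_toLp 2 _).comp ?_
  exact Continuous.matrix_vecMul ((PiLp.continuous_ofLp 2 _).comp continuous_fst) continuous_snd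

/-- The homeomorphism `x ↦ x A` for an invertible matrix `A`. -/
noncomputable def rowMulHomeo {n : ℕ} (A : Matrix (Fin (n + 1)) (Fin (n + 1)) ℝ)
    (hA : IsUnit A.det) : E n ≃ₜ E n where
  toFun x := rowMul x A
  invFun x := rowMul x A⁻¹
  left_inv x := by
    change rowMul (rowMul x A) A⁻¹ = x
    rw [rowMul_mul, Matrix.mul_nonsing_inv _ hA, rowMul_one]
  right_inv x := by
    change rowMul (rowMul x A⁻¹) A = x
    rw [rowMul_mul, Matrix.nonsing_inv_mul _ hA, rowMul_one]
  continuous_toFun := continuous_rowMul.comp (continuous_id.prodMk continuous_const)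
  continuous_invFun := continuous_rowMul.comp (continuous_id.prodMk continuous_const)

/-- The matrix `D_ρ = diag(ρ^{d-1}, ρ⁻¹, …, ρ⁻¹)`. -/
noncomputable def Dmat (n : ℕ) (ρ : ℝ) : Matrix (Fin (n + 1)) (Fin (n + 1)) ℝ :=
  Matrix.diagonal (Fin.cons (ρ ^ n) fun _ => ρ⁻¹)

/-- A choice of rotations `R(v) ∈ SO(d)` with `v R(v) = e₁`, continuous on the sphere minus one
point. -/
structure FrameRotation (n : ℕ) where
  toFun : Sph n → Matrix.specialOrthogonalGroup (Fin (n + 1)) ℝ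
  rowMul_eq : ∀ v : Sph n, rowMul (v : E n) (toFun v).1 = EuclideanSpace.single 0 1
  exists_continuousOn : ∃ v₀ : Sph n, ContinuousOn toFun {v₀}ᶜ

theorem isUnit_det_rotation {n : ℕ} (A : Matrix.specialOrthogonalGroup (Fin (n + 1)) ℝ) :
    IsUnit A.1.det := by
  rw [(Matrix.mem_specialOrthogonalGroup_iff.1 A.2).2]
  exact isUnit_one

theorem isUnit_det_frame {n : ℕ} (A : Matrix.specialOrthogonalGroup (Fin (n + 1)) ℝ)
    (ρ : Radius) : IsUnit (A.1 * Dmat n ρ).det := by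
  have h1 : A.1.det = 1 := (Matrix.mem_specialOrthogonalGroup_iff.1 A.2).2
  have h2 : (ρ : ℝ) ≠ 0 := ne_of_gt ρ.2.1
  rw [Matrix.det_mul, h1, one_mul, Dmat, Matrix.det_diagonal, Fin.prod_univ_succ]
  simp [h2]

/-- The open cylinder `(c, c + τ) × 𝔇` in `ℝ^d`. -/
def cylinder {n : ℕ} (c : ℝ) (U : Set (EuclideanSpace ℝ (Fin n))) (τ : ℝ) : Set (E n) :=
  {x | c < x 0 ∧ x 0 < c + τ ∧ tailPt x ∈ U}

end Geometry

/-! ### Scatterer configurations and their rescaled images -/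

section Scatterers

variable {n : ℕ} {M : Type*} [MetricSpace M]

/-- The homeomorphism `(w, s) ↦ (e w, s)` of `ℝ^d × Σ`. -/
def onPoints (M : Type*) [MetricSpace M] (e : E n ≃ₜ E n) : E n × M ≃ₜ E n × M :=
  e.prodCongr (Homeomorph.refl M)

/-- The marked point set `{(p, ς(p)) : p ∈ P}`. -/
def marked (P : PointSet (E n)) (mark : P.carrier → M) : PointSet (E n × M) where
  carrier := Set.range fun p : P.carrier => ((p : E n), mark p)
  finite_inter K hK := by
    have hf := P.finite_inter _ (hK.image continuous_fst)
    have hf' : (Subtype.val ⁻¹' (Prod.fst '' K) : Set P.carrier).Finite := by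
      refine Set.Finite.of_finite_image (f := Subtype.val) (hf.subset ?_)
        Subtype.val_injective.injOn
      rintro _ ⟨p, hp, rfl⟩
      exact ⟨p.2, hp⟩
    refine (hf'.image fun p : P.carrier => ((p : E n), mark p)).subset ?_
    rintro _ ⟨⟨p, rfl⟩, hp⟩
    exact ⟨p, ⟨_, hp, rfl⟩, rfl⟩

/-- Remove from a marked point set the points located at `q`. -/
def without (Y : PointSet (E n × M)) (q : E n) : PointSet (E n × M) where
  carrier := {x ∈ Y.carrier | x.1 ≠ q}
  finite_inter K hK := (Y.finite_inter K hK).subset fun _ hx => ⟨hx.1.1, hx.2⟩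

/-- The change of coordinates `w ↦ (w - q) R(v) D_ρ` to the rescaled particle frame. -/
noncomputable def frame (R : FrameRotation n) (ρ : Radius) (q : E n) (v : Sph n) : E n ≃ₜ E n :=
  (Homeomorph.subRight q).trans
    (rowMulHomeo ((R.toFun v).1 * Dmat n ρ) (isUnit_det_frame (R.toFun v) ρ))

/-- The point set `𝒬_ρ(q, v) = (P̃_q - q) R(v) D_ρ`. -/
noncomputable def Qset (R : FrameRotation n) (P : PointSet (E n)) (mark : P.carrier → M)
    (ρ : Radius) (q : E n) (v : Sph n) : PointSet (E n × M) :=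
  (without (marked P mark) q).map (onPoints M (frame R ρ q v))

theorem norm_rowMul_orthogonal (A : Matrix.specialOrthogonalGroup (Fin (n + 1)) ℝ) (x : E n) :
    ‖rowMul x A.1‖ = ‖x‖ := by
  have h : A.1 * A.1.transpose = 1 :=
    (Matrix.mem_orthogonalGroup_iff _ _).1 (Matrix.mem_specialOrthogonalGroup_iff.1 A.2).1
  have key : ∀ y : E n, ‖y‖ ^ 2 = dotProduct y.ofLp y.ofLp := fun y => by
    rw [EuclideanSpace.norm_sq_eq]
    simp [dotProduct, sq]
  have h2 : ‖rowMul x A.1‖ ^ 2 = ‖x‖ ^ 2 := by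
    rw [key, key]
    simp only [rowMul]
    rw [← Matrix.dotProduct_mulVec, Matrix.mulVec_vecMul, h]
    simp
  exact (sq_eq_sq₀ (norm_nonneg _) (norm_nonneg _)).1 h2

theorem le_norm_rowMul_Dmat (ρ : Radius) (x : E n) :
    (ρ : ℝ) ^ n * ‖x‖ ≤ ‖rowMul x (Dmat n ρ)‖ := by
  have hρ := ρ.2.1
  have hρ1 := ρ.2.2
  have hp : (0 : ℝ) < (ρ : ℝ) ^ n := pow_pos hρ n
  refine (sq_le_sq₀ (mul_nonneg hp.le (norm_nonneg _)) (norm_nonneg _)).1 ?_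
  rw [mul_pow, EuclideanSpace.norm_sq_eq, EuclideanSpace.norm_sq_eq, Finset.mul_sum]
  refine Finset.sum_le_sum fun i _ => ?_
  simp only [rowMul, Dmat, Matrix.vecMul_diagonal, norm_mul, mul_pow]
  rw [mul_comm]
  refine mul_le_mul_of_nonneg_left ?_ (sq_nonneg _)
  refine Fin.cases ?_ (fun j => ?_) i
  · simp [abs_of_pos hρ]
  · simp only [Fin.cons_succ, Real.norm_eq_abs, sq_abs]
    have h1 : (ρ : ℝ) ^ n ≤ 1 := pow_le_one₀ hρ.le hρ1.le
    have h2 : 1 ≤ (ρ : ℝ)⁻¹ := (one_le_inv₀ hρ).2 hρ1.le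
    exact pow_le_pow_left₀ hp.le (h1.trans h2) 2

theorem le_norm_frame (R : FrameRotation n) (ρ : Radius) (q : E n) (v : Sph n) (x : E n) :
    (ρ : ℝ) ^ n * ‖x - q‖ ≤ ‖frame R ρ q v x‖ := by
  have h : frame R ρ q v x = rowMul (rowMul (x - q) (R.toFun v).1) (Dmat n ρ) := by
    rw [rowMul_mul]; rfl
  rw [h, ← norm_rowMul_orthogonal (R.toFun v) (x - q)]
  exact le_norm_rowMul_Dmat ρ _

theorem PointSet.countable_carrier (P : PointSet (E n)) : P.carrier.Countable := by
  have h : P.carrier ⊆ ⋃ k : ℕ, P.carrier ∩ Metric.closedBall 0 k := by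
    intro p hp
    obtain ⟨k, hk⟩ := exists_nat_ge ‖p‖
    exact Set.mem_iUnion.2 ⟨k, hp, by simpa using hk⟩
  exact (Set.countable_iUnion fun k : ℕ =>
    (P.finite_inter _ (isCompact_closedBall 0 (k : ℝ))).countable).mono h

theorem without_eq_self (P : PointSet (E n)) (mark : P.carrier → M) (q : E n)
    (hq : q ∉ P.carrier) : without (marked P mark) q = marked P mark := by
  ext x
  constructor
  · exact fun h => h.1
  · rintro ⟨p, rfl⟩
    exact ⟨⟨p, rfl⟩, fun h => hq (h ▸ p.2)⟩

variable [CompactSpace M] [MeasurableSpace M] [BorelSpace M]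

theorem continuousOn_map_frame (R : FrameRotation n) (ρ : Radius) (V : Set (Sph n))
    (hV : ContinuousOn R.toFun V) (Z : PointSet (E n × M)) :
    ContinuousOn (fun x : E n × Sph n => Z.map (onPoints M (frame R ρ x.1 x.2)))
      (Set.univ ×ˢ V) := by
  rw [continuousOn_iff_continuous_domRestrict]
  refine continuous_induced_rng.2 (continuous_induced_rng.2 (continuous_pi fun f => ?_))
  have hR : Continuous fun x : (Set.univ ×ˢ V : Set (E n × Sph n)) => (R.toFun x.1.2).1 := by
    refine continuous_subtype_val.comp ?_
    exact hV.comp_continuous (continuous_snd.comp continuous_subtype_val) fun x => x.2.2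
  have hc : ∀ z : Z.carrier, Continuous fun x : (Set.univ ×ˢ V : Set (E n × Sph n)) =>
      f (onPoints M (frame R ρ x.1.1 x.1.2) z) := by
    intro z
    refine f.continuous.comp (Continuous.prodMk ?_ continuous_const)
    refine continuous_rowMul.comp (Continuous.prodMk ?_ (hR.mul continuous_const))
    exact continuous_const.sub (continuous_fst.comp continuous_subtype_val)
  obtain ⟨r, hr⟩ := (f.hasCompactSupport.isCompact.image
    (continuous_fst (X := E n) (Y := M))).isBounded.exists_norm_le
  have hp : (0 : ℝ) < (ρ : ℝ) ^ n := pow_pos ρ.2.1 n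
  have hsupp : ∀ (x : E n × Sph n) (z : Z.carrier), f (onPoints M (frame R ρ x.1 x.2) z) ≠ 0 →
      ‖z.1.1 - x.1‖ ≤ r / (ρ : ℝ) ^ n := by
    intro x z hz
    rw [le_div_iff₀ hp, mul_comm]
    refine (le_norm_frame R ρ x.1 x.2 z.1.1).trans (hr _ ?_)
    exact ⟨_, subset_tsupport _ hz, rfl⟩
  have hfin : ∀ (q : E n) (C : ℝ), {z : Z.carrier | ‖z.1.1 - q‖ ≤ C}.Finite := by
    intro q C
    have h := Z.finite_inter (Metric.closedBall q C ×ˢ Set.univ)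
      ((isCompact_closedBall q C).prod isCompact_univ)
    refine Set.Finite.of_finite_image (f := Subtype.val) (h.subset ?_)
      Subtype.val_injective.injOn
    rintro _ ⟨z, hz, rfl⟩
    exact ⟨z.2, by simpa [dist_eq_norm] using hz⟩
  have hlf : LocallyFinite fun z : Z.carrier =>
      Function.support fun x : (Set.univ ×ˢ V : Set (E n × Sph n)) =>
        f (onPoints M (frame R ρ x.1.1 x.1.2) z) := by
    intro x₀
    refine ⟨{x | ‖x.1.1 - x₀.1.1‖ < 1}, ?_, ?_⟩
    · refine IsOpen.mem_nhds ?_ (by simp)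
      exact isOpen_lt (((continuous_fst.comp continuous_subtype_val).sub continuous_const).norm)
        continuous_const
    · refine (hfin x₀.1.1 (r / (ρ : ℝ) ^ n + 1)).subset ?_
      rintro z ⟨x, hx1, hx2⟩
      have h1 := hsupp x.1 z hx1
      have h2 : ‖x.1.1 - x₀.1.1‖ < 1 := hx2
      have h3 := norm_add_le (z.1.1 - x.1.1) (x.1.1 - x₀.1.1)
      rw [sub_add_sub_cancel] at h3
      exact h3.trans (by linarith)
  refine (continuous_finsum hc hlf).congr fun x => ?_
  have hsum : (Function.support fun z : Z.carrier =>
      f (onPoints M (frame R ρ x.1.1 x.1.2) z)).Finite :=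
    (hfin x.1.1 (r / (ρ : ℝ) ^ n)).subset fun z hz => hsupp x.1 z hz
  rw [← tsum_eq_finsum (L := SummationFilter.unconditional _) hsum]
  refine Eq.trans ?_ (PointSet.integral_toCounting _ f).symm
  exact (Equiv.Set.image _ Z.carrier
    (onPoints M (frame R ρ x.1.1 x.1.2)).injective).tsum_eq
      (fun y : (onPoints M (frame R ρ x.1.1 x.1.2) '' Z.carrier : Set (E n × M)) => f y)

theorem measurable_map_frame (R : FrameRotation n) (ρ : Radius) (Z : PointSet (E n × M)) :
    Measurable fun x : E n × Sph n => Z.map (onPoints M (frame R ρ x.1 x.2)) := by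
  obtain ⟨v₀, hv₀⟩ := R.exists_continuousOn
  have h1 := continuousOn_map_frame R ρ _ hv₀ Z
  have h2 := continuousOn_map_frame R ρ {v₀} (continuousOn_singleton _ _) Z
  refine measurable_of_measurable_union_cover (Set.univ ×ˢ {v₀}ᶜ) (Set.univ ×ˢ {v₀})
    (MeasurableSet.univ.prod (measurableSet_singleton v₀).compl)
    (MeasurableSet.univ.prod (measurableSet_singleton v₀)) ?_ ?_ ?_
  · rintro ⟨q, v⟩ -
    by_cases h : v = v₀ <;> simp [h]
  · exact (continuousOn_iff_continuous_domRestrict.1 h1).measurable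
  · exact (continuousOn_iff_continuous_domRestrict.1 h2).measurable

theorem measurable_Qset_dir (R : FrameRotation n) (P : PointSet (E n)) (mark : P.carrier → M)
    (ρ : Radius) (q : E n) : Measurable fun v : Sph n => Qset R P mark ρ q v := by
  have h2 : Measurable fun v : Sph n => (q, v) := measurable_const.prodMk measurable_id
  unfold Qset
  generalize without (marked P mark) q = Z
  intro A hA
  exact h2 (measurable_map_frame R ρ Z hA)

theorem measurable_toCounting :
    Measurable (PointSet.toCounting : PointSet (E n × M) → CountingMeasure (E n × M)) :=
  Continuous.measurable continuous_induced_dom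

theorem measurable_Qset (R : FrameRotation n) (P : PointSet (E n)) (mark : P.carrier → M)
    (ρ : Radius) : Measurable fun x : E n × Sph n => Qset R P mark ρ x.1 x.2 := by
  have hP := P.countable_carrier
  intro A hA
  have h : (fun x : E n × Sph n => Qset R P mark ρ x.1 x.2) ⁻¹' A =
      ((fun x : E n × Sph n => (marked P mark).map (onPoints M (frame R ρ x.1 x.2))) ⁻¹' A ∩
        Prod.fst ⁻¹' P.carrierᶜ) ∪
      ⋃ p ∈ P.carrier, ((fun x : E n × Sph n =>
        (without (marked P mark) p).map (onPoints M (frame R ρ x.1 x.2))) ⁻¹' A ∩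
          Prod.fst ⁻¹' {p}) := by
    ext x
    by_cases hx : x.1 ∈ P.carrier
    · simp [Qset, hx]
    · simp [Qset, hx, without_eq_self P mark x.1 hx]
  rw [h]
  refine ((measurable_map_frame R ρ _ hA).inter
    (measurable_fst hP.measurableSet.compl)).union ?_
  exact MeasurableSet.biUnion hP fun p _ =>
    (measurable_map_frame R ρ _ hA).inter (measurable_fst (measurableSet_singleton p))

/-- The distribution of `𝒬_ρ(q, v)` for `v` random with law `lam`, as a point process, i.e. as a
probability measure on `N(ℝ^d × Σ)`. -/
noncomputable def microLaw (R : FrameRotation n) (P : PointSet (E n)) (mark : P.carrier → M)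
    (ρ : Radius) (q : E n) (lam : ProbabilityMeasure (Sph n)) :
    ProbabilityMeasure (CountingMeasure (E n × M)) :=
  lam.map (f := fun v => (Qset R P mark ρ q v).toCounting)
    (measurable_toCounting.comp (measurable_Qset_dir R P mark ρ q)).aemeasurable

/-- The distribution of `𝒬_ρ(ρ^{1-d} q, v)` for `(q, v)` random with law `Lam`, as a probability
measure on `N_s(ℝ^d × Σ)`. -/
noncomputable def macroLaw (R : FrameRotation n) (P : PointSet (E n)) (mark : P.carrier → M)
    (ρ : Radius) (Lam : ProbabilityMeasure (E n × Sph n)) :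
    ProbabilityMeasure (PointSet (E n × M)) :=
  Lam.map (f := fun x => Qset R P mark ρ (((ρ : ℝ) ^ n)⁻¹ • x.1) x.2)
    ((measurable_Qset R P mark ρ).comp
      ((measurable_fst.const_smul (((ρ : ℝ) ^ n)⁻¹)).prodMk measurable_snd)).aemeasurable

end Scatterers

/-! ### The hypotheses on the scatterer configuration and on the limit processes -/

section Hypotheses

variable {n : ℕ} {M : Type*} [MetricSpace M]

/-- The set `A ⊆ ℝ^d` has constant asymptotic density `δ`. -/
def HasAsymptoticDensity (A : Set (E n)) (δ : ℝ) : Prop :=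
  ∀ B : Set (E n), Bornology.IsBounded B → volume (frontier B) = 0 →
    Tendsto (fun T : ℝ => ((A ∩ (fun w => T • w) '' B).ncard : ℝ) / T ^ (n + 1)) atTop
      (𝓝 (δ * volume.real B))

variable [CompactSpace M] [MeasurableSpace M] [BorelSpace M]

/-- Uniform density: the marked points are asymptotically equidistributed with respect to
`cP · (vol × m)`. -/
def UniformDensity (P : PointSet (E n)) (mark : P.carrier → M) (cP : ℝ) (m : Measure M) : Prop :=
  ∀ B : Set (E n × M), Bornology.IsBounded B → (volume.prod m) (frontier B) = 0 →
    Tendsto (fun T : ℝ =>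
        (((marked P mark).carrier ∩ (fun x => (T • x.1, x.2)) '' B).ncard : ℝ) / T ^ (n + 1)) atTop
      (𝓝 (cP * (volume.prod m).real B))

/-- Spherical equidistribution, uniformly over the non-exceptional scatterers in the ball of
radius `T ρ^{1-d}`. -/
def SphericalEquidistribution (R : FrameRotation n) (P : PointSet (E n)) (mark : P.carrier → M)
    (μ : M → ProbabilityMeasure (CountingMeasure (E n × M))) : Prop :=
  ∃ Exc : Set P.carrier, HasAsymptoticDensity (Subtype.val '' Exc) 0 ∧
    ∀ T : ℝ, 1 ≤ T → ∀ lam : ProbabilityMeasure (Sph n), (lam : Measure (Sph n)) ≪ omega n →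
      UniformWeakLimit
        (fun ρ => {q : P.carrier | (q : E n) ∈ Metric.ball 0 (T * ((ρ : ℝ) ^ n)⁻¹) ∧ q ∉ Exc})
        (fun ρ q => microLaw R P mark ρ q lam) (fun q => μ (mark q))

/-- No escape of mass. -/
def NoEscapeOfMass (R : FrameRotation n) (P : PointSet (E n)) (mark : P.carrier → M) : Prop :=
  ∀ B : Set (E n), Bornology.IsBounded B → MeasurableSet B →
    Tendsto (fun ξ : ℝ => limsup (fun ρ : Radius =>
        (volume.prod (omega n)) {x : E n × Sph n | x.1 ∈ B ∧
          (Qset R P mark ρ (((ρ : ℝ) ^ n)⁻¹ • x.1) x.2).carrier ∩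
            cylinder 0 (Metric.ball 0 1) ξ ×ˢ Set.univ = ∅}) toZero)
      atTop (𝓝 0)

/-- Each `μ ς` is invariant under the rotations `K ∈ SO(d)` with `e₁ K = e₁`. -/
def RotationInvariant (μ : M → ProbabilityMeasure (CountingMeasure (E n × M))) : Prop :=
  ∀ (ς : M) (K : Matrix.specialOrthogonalGroup (Fin (n + 1)) ℝ),
    rowMul (EuclideanSpace.single 0 1 : E n) K.1 = EuclideanSpace.single 0 1 →
    Measure.map (CountingMeasure.map (onPoints M (rowMulHomeo K.1 (isUnit_det_rotation K))))
      (μ ς : Measure (CountingMeasure (E n × M))) = μ ς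

/-- Coincidence-free first coordinates. -/
def CoincidenceFree (μ : M → ProbabilityMeasure (CountingMeasure (E n × M))) : Prop :=
  ∀ ς : M, (μ ς : Measure (CountingMeasure (E n × M)))
    {η | ∃ t : ℝ, 1 < η.1 {x : E n × M | x.1 0 = t}} = 0

/-- Small probability of large voids. -/
def SmallVoids (μ : M → ProbabilityMeasure (CountingMeasure (E n × M))) : Prop :=
  ∀ ε : ℝ, 0 < ε → ∃ r : ℝ, 0 < r ∧ ∀ (ς : M) (x : E n),
    (μ ς : Measure (CountingMeasure (E n × M)))
      {η | η.1 (Metric.ball x r ×ˢ Set.univ) = 0} < ENNReal.ofReal ε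

end Hypotheses

/-! ### The macroscopic limit process -/

section MacroscopicLimit

variable {n : ℕ} {M : Type*} [MetricSpace M] [CompactSpace M] [MeasurableSpace M] [BorelSpace M]

/-- The point set `Y_{(x, ς)} = (Y + x) ∪ {(x, ς)}`. -/
def shiftInsert (Y : PointSet (E n × M)) (x : E n) (ς : M) : PointSet (E n × M) :=
  (Y.map (onPoints M (Homeomorph.addRight x))).insert (x, ς)

/-- The value on `A ⊆ N_s(ℝ^d × Σ)` of the law of `(Ξ + x) ∪ {(x, ς)}`, where `Ξ` has law `ν`:
the `ν`-probability that `Ξ` is a simple point process `Y` with `Y_{(x, ς)} ∈ A`. -/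
noncomputable def shiftedLaw (ν : ProbabilityMeasure (CountingMeasure (E n × M))) (x : E n) (ς : M)
    (A : Set (PointSet (E n × M))) : ℝ≥0∞ :=
  (ν : Measure (CountingMeasure (E n × M)))
    (PointSet.toCounting '' {Y : PointSet (E n × M) | shiftInsert Y x ς ∈ A})

/-- The value `cP ∫_Σ ∫_0^∞ ∫_𝔇 μ̄_ς^{(c+τ,b)}{Y : Y ∩ ((c,c+τ) × 𝔇) = ∅, Y ∈ A} db dτ dm(ς)`
of the macroscopic limit measure on the set `A`. -/
noncomputable def limitValue (cP : ℝ) (m : Measure M)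
    (μ : M → ProbabilityMeasure (CountingMeasure (E n × M)))
    (c : ℝ) (U : Set (EuclideanSpace ℝ (Fin n))) (A : Set (PointSet (E n × M))) : ℝ≥0∞ :=
  ENNReal.ofReal cP * ∫⁻ ς, ∫⁻ τ in Set.Ioi (0 : ℝ), ∫⁻ b in U,
    shiftedLaw (μ ς) (consPt (c + τ) b) ς
      {Y | Y.carrier ∩ cylinder c U τ ×ˢ Set.univ = ∅ ∧ Y ∈ A} ∂volume ∂volume ∂m

end MacroscopicLimit

end LorentzGas

set_option linter.unusedSectionVars false

namespace LorentzGas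

/-! ### Vague topology: continuity, second countability, atoms. -/

section VagueTopology

universe u

variable {X : Type u} [TopologicalSpace X] [MeasurableSpace X]

/-! Put d = n + 1. By [P3], moved and rescaled to the given cylinder, the cylinder of length ξ in
the particle frame contains a scatterer for all (q, v) in a bounded region outside a set whose
measure is small when ξ is large and ρ is small. For almost every (q, v) no two scatterers have the
same first coordinate, so exactly one scatterer p in the cylinder comes first. Seen from q, the
configuration is the one seen from p, translated by the position y of p, with p added
(`Qset_eq_shiftInsert`); that p comes first means that p sees nothing in a window determined by y.
For fixed p and v the map from q to y is affine with constant Jacobian. Decomposing an expectation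
according to p and substituting y for q therefore gives an exact identity (`integral_hit_eq`): the
expectation over the particles that hit the cylinder is the integral over y in the cylinder of a sum
over p, normalized by ρ^(n(n+1)), of integrals over v.

In terms of y, the initial position is ρ^n p - y_1 v up to O(ρ^d). For fixed y, [P2] replaces the
integral over v by an expectation under the law attached to the mark of p, and [P1] turns the sum
over p into an integral over position and mark (`tendsto_avg_observable`, `tendsto_avg_hitWeight`).
Translation invariance of volume leaves only the total mass of the initial density, which is why the
limit does not depend on Λ. Dominated convergence integrates over y, and then ξ tends to infinity.
The constant observable 1 shows that the limit has mass one, so nothing is lost. Radon-Nikodym and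
density of C_c in L^1 reach all absolutely continuous Λ.

The real difficulty is that "the window is empty" is not a continuous condition: for almost every y
and mark, the limit process must have no point on the boundary of the window. Fubini in y handles
the part of the boundary that moves with y. The face x_1 = 0, the hyperplane of p itself, does not
move, and [Q2] speaks only of coincidences among the points seen from p, not of coincidences with p.
It is excluded by a mass transport argument (`sum_slabCount_le`, `ae_measure_face_eq_zero`): if p
has a neighbour a almost in its own hyperplane, then by [Q3] there is, with high probability, a
third scatterer q near a chosen point far from this hyperplane, and q sees p and a as a near
coincidence. Charging p to q and exchanging the sums bounds the frequency of such p by a quantity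
which [Q2] sends to zero.

Weak convergence is tested on `Tame` functionals, for which the dependence on the mark of an added
point is uniformly continuous. The limit is constructed on counting measures, shown to be
concentrated on simple ones, and then pulled back to point sets. -/

instance (η : CountingMeasure X) : IsFiniteMeasureOnCompacts η.1 := ⟨fun K hK => η.2.1 K hK⟩

variable [T2Space X]

theorem CountingMeasure.continuous_integral [BorelSpace X] {f : X → ℝ} (hf : Continuous f)
    (hc : HasCompactSupport f) : Continuous fun η : CountingMeasure X => ∫ x, f x ∂η.1 :=
  let φ : C_c(X, ℝ) := ⟨⟨f, hf⟩, hc⟩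
  have h : Continuous fun (η : CountingMeasure X) (φ : C_c(X, ℝ)) => ∫ x, φ x ∂η.1 :=
    continuous_induced_dom
  (continuous_apply φ).comp h

theorem exists_cutoff [LocallyCompactSpace X] {K : Set X} (hK : IsCompact K) :
    ∃ χ : X → ℝ, Continuous χ ∧ HasCompactSupport χ ∧ (∀ x, 0 ≤ χ x) ∧ (∀ x, χ x ≤ 1) ∧
      ∀ x ∈ K, χ x = 1 := by
  obtain ⟨f, hf1, -, hf2, hf3⟩ := exists_continuous_one_zero_of_isCompact hK isClosed_empty
    (disjoint_empty K)
  exact ⟨f, f.continuous, hf2, fun x => (hf3 x).1, fun x => (hf3 x).2, fun x hx => hf1 hx⟩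

/-- Integrals over counting measures depend continuously on the measure and on parameters. -/
theorem CountingMeasure.continuous_integral_param [LocallyCompactSpace X] [BorelSpace X]
    {Y : Type*} [TopologicalSpace Y] {θ : X → Y → ℝ} (hθ : Continuous fun p : X × Y => θ p.1 p.2)
    (hsupp : ∀ y₀, ∃ K, IsCompact K ∧ ∀ᶠ y in 𝓝 y₀, ∀ x ∉ K, θ x y = 0) :
    Continuous fun p : CountingMeasure X × Y => ∫ x, θ x p.2 ∂p.1.1 := by
  have hθy : ∀ y, Continuous fun x => θ x y := fun y =>
    hθ.comp (Continuous.prodMk_left y)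
  have hθc : ∀ y, HasCompactSupport fun x => θ x y := fun y => by
    obtain ⟨K, hK, h0⟩ := hsupp y
    exact HasCompactSupport.intro hK h0.self_of_nhds
  have hint : ∀ (η : CountingMeasure X) y, Integrable (fun x => θ x y) η.1 := fun η y =>
    (hθy y).integrable_of_hasCompactSupport (hθc y)
  rw [continuous_iff_continuousAt]
  rintro ⟨η₀, y₀⟩
  obtain ⟨K, hK, h0⟩ := hsupp y₀
  obtain ⟨χ, hχ, hχc, hχ0, -, hχ1⟩ := exists_cutoff hK
  rw [ContinuousAt, Metric.tendsto_nhds]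
  intro ε hε
  -- Since χ = 1 on K, the mass of K stays below C + 1 for η near η₀. A uniform change of θ by
  -- ε/2/(C + 1) on K then costs at most ε/2.
  set C := ∫ x, χ x ∂η₀.1 with hC
  have hC0 : 0 ≤ C := integral_nonneg hχ0
  have h1 : ∀ᶠ p : CountingMeasure X × Y in 𝓝 (η₀, y₀), ∫ x, χ x ∂p.1.1 < C + 1 :=
    ((CountingMeasure.continuous_integral hχ hχc).comp continuous_fst).continuousAt.eventually_lt
      continuousAt_const (by simp [hC])
  have h2 : ∀ᶠ p : CountingMeasure X × Y in 𝓝 (η₀, y₀),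
      dist (∫ x, θ x y₀ ∂p.1.1) (∫ x, θ x y₀ ∂η₀.1) < ε / 2 :=
    Metric.tendsto_nhds.1 ((CountingMeasure.continuous_integral (hθy y₀) (hθc y₀)).comp
      continuous_fst).continuousAt _ (half_pos hε)
  have h3 : ∀ᶠ p : CountingMeasure X × Y in 𝓝 (η₀, y₀), ∀ x ∈ K,
      dist (θ x y₀) (θ x p.2) < ε / 2 / (C + 1) := by
    -- Currying makes y ↦ θ(·, y) continuous for the compact-open topology, and convergence there is
    -- uniform on K.
    let F : C(Y, C(X, ℝ)) := ContinuousMap.curry ⟨fun p : Y × X => θ p.2 p.1,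
      hθ.comp continuous_swap⟩
    have hF : Tendsto F (𝓝 y₀) (𝓝 (F y₀)) := F.continuous.tendsto y₀
    have := (ContinuousMap.tendsto_iff_forall_isCompact_tendstoUniformlyOn.1 hF) K hK
    have h4 := Metric.tendstoUniformlyOn_iff.1 this (ε / 2 / (C + 1)) (by positivity)
    exact (continuous_snd.tendsto (η₀, y₀)).eventually h4
  filter_upwards [h1, h2, h3, (continuous_snd.tendsto (η₀, y₀)).eventually h0] with p hp1 hp2 hp3 hp0
  have h5 : dist (∫ x, θ x p.2 ∂p.1.1) (∫ x, θ x y₀ ∂p.1.1) ≤ ε / 2 / (C + 1) * (C + 1) := by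
    rw [dist_eq_norm, ← integral_sub (hint _ _) (hint _ _)]
    refine (norm_integral_le_of_norm_le ((hχ.integrable_of_hasCompactSupport hχc).const_mul
      (ε / 2 / (C + 1))) (Eventually.of_forall fun x => ?_)).trans ?_
    · by_cases hx : x ∈ K
      · rw [hχ1 x hx, mul_one, ← dist_eq_norm, dist_comm]
        exact (hp3 x hx).le
      · rw [hp0 x hx, h0.self_of_nhds x hx, sub_self, norm_zero]
        exact mul_nonneg (by positivity) (hχ0 x)
    · rw [integral_const_mul]
      gcongr
  have h6 : ε / 2 / (C + 1) * (C + 1) = ε / 2 := by field_simp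
  have := dist_triangle (∫ x, θ x p.2 ∂p.1.1) (∫ x, θ x y₀ ∂p.1.1) (∫ x, θ x y₀ ∂η₀.1)
  change dist (∫ x, θ x p.2 ∂p.1.1) (∫ x, θ x y₀ ∂η₀.1) < ε
  linarith

/-- Countably many integrals induce the vague topology: the cutoffs of a compact exhaustion, which
control mass, and for each compact set of the exhaustion a dense sequence of functions vanishing
outside it. Second countability gives countable subcovers and Borel σ-algebras on products. -/
instance [LocallyCompactSpace X] [SecondCountableTopology X] [BorelSpace X] :
    SecondCountableTopology (CountingMeasure X) := by
  let K := CompactExhaustion.choice X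
  choose χ hχ hχc hχ0 _ hχ1 using fun k : ℕ => exists_cutoff (K.isCompact k)
  let S : ℕ → Set C(X, ℝ) := fun k => {f | ∀ x ∉ K k, f x = 0}
  have : ∀ k, Nonempty (S k) := fun k => ⟨⟨0, fun x _ => rfl⟩⟩
  let f : ℕ → ℕ → C(X, ℝ) := fun k j => (TopologicalSpace.denseSeq (S k) j).1
  have hf0 : ∀ k j, ∀ x ∉ K k, f k j x = 0 := fun k j => (TopologicalSpace.denseSeq (S k) j).2
  let Ψ : CountingMeasure X → (ℕ → ℝ) × (ℕ × ℕ → ℝ) := fun η =>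
    (fun k => ∫ x, χ k x ∂η.1, fun p => ∫ x, f p.1 p.2 x ∂η.1)
  have hΨ : Continuous Ψ := by
    refine .prodMk (continuous_pi fun k => ?_) (continuous_pi fun p => ?_)
    · exact CountingMeasure.continuous_integral (hχ k) (hχc k)
    · exact CountingMeasure.continuous_integral (f p.1 p.2).continuous
        (HasCompactSupport.intro (K.isCompact p.1) (hf0 p.1 p.2))
  have hind : IsInducing Ψ := by
    rw [isInducing_iff_nhds]
    intro η₀
    refine le_antisymm (hΨ.tendsto η₀).le_comap ?_
    rw [nhds_induced, ← tendsto_iff_comap, tendsto_pi_nhds]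
    intro φ
    have ht : Tendsto Ψ (comap Ψ (𝓝 (Ψ η₀))) (𝓝 (Ψ η₀)) := tendsto_comap
    have t1 : ∀ k, Tendsto (fun η : CountingMeasure X => ∫ x, χ k x ∂η.1)
        (comap Ψ (𝓝 (Ψ η₀))) (𝓝 (∫ x, χ k x ∂η₀.1)) := fun k =>
      (((continuous_apply k).comp continuous_fst).tendsto (Ψ η₀)).comp ht
    have t2 : ∀ k j, Tendsto (fun η : CountingMeasure X => ∫ x, f k j x ∂η.1)
        (comap Ψ (𝓝 (Ψ η₀))) (𝓝 (∫ x, f k j x ∂η₀.1)) := fun k j =>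
      (((continuous_apply (k, j)).comp continuous_snd).tendsto (Ψ η₀)).comp ht
    obtain ⟨k, hk⟩ := K.exists_superset_of_isCompact φ.hasCompactSupport.isCompact
    have hφ0 : ∀ x ∉ K k, φ x = 0 := fun x hx =>
      image_eq_zero_of_notMem_tsupport fun h => hx (hk h)
    rw [Metric.tendsto_nhds]
    intro ε hε
    set C := ∫ x, χ k x ∂η₀.1 with hC
    have hC0 : 0 ≤ C := integral_nonneg (hχ0 k)
    set δ := ε / 3 / (C + 1) with hδ
    have hδ0 : 0 < δ := by positivity
    obtain ⟨j, hj⟩ : ∃ j, ∀ x ∈ K k, dist (f k j x) (φ x) < δ := by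
      let φ' : S k := ⟨⟨φ, φ.continuous⟩, hφ0⟩
      have hU : {g : S k | ∀ x ∈ K k, dist (φ'.1 x) (g.1 x) < δ} ∈ 𝓝 φ' := by
        have h1 : Tendsto (fun g : S k => g.1) (𝓝 φ') (𝓝 φ'.1) :=
          continuous_subtype_val.tendsto φ'
        have h2 := (ContinuousMap.tendsto_iff_forall_isCompact_tendstoUniformlyOn.1 h1) _
          (K.isCompact k)
        exact Metric.tendstoUniformlyOn_iff.1 h2 δ hδ0
      obtain ⟨j, hj⟩ := (TopologicalSpace.denseRange_denseSeq (S k)).exists_mem_open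
        isOpen_interior ⟨φ', mem_interior_iff_mem_nhds.2 hU⟩
      refine ⟨j, fun x hx => ?_⟩
      rw [dist_comm]
      exact interior_subset hj x hx
    have key : ∀ η : CountingMeasure X,
        dist (∫ x, φ x ∂η.1) (∫ x, f k j x ∂η.1) ≤ δ * ∫ x, χ k x ∂η.1 := by
      intro η
      have hfint : Integrable (f k j) η.1 := (f k j).continuous.integrable_of_hasCompactSupport
        (HasCompactSupport.intro (K.isCompact k) (hf0 k j))
      have hφint : Integrable φ η.1 :=
        φ.continuous.integrable_of_hasCompactSupport φ.hasCompactSupport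
      rw [dist_eq_norm, ← integral_sub hφint hfint, ← integral_const_mul]
      refine norm_integral_le_of_norm_le (((hχ k).integrable_of_hasCompactSupport
        (hχc k)).const_mul δ) (Eventually.of_forall fun x => ?_)
      by_cases hx : x ∈ K k
      · rw [hχ1 k x hx, mul_one, ← dist_eq_norm, dist_comm]
        exact (hj x hx).le
      · rw [hφ0 x hx, hf0 k j x hx, sub_self, norm_zero]
        exact mul_nonneg hδ0.le (hχ0 k x)
    have e1 : ∀ᶠ η in comap Ψ (𝓝 (Ψ η₀)), ∫ x, χ k x ∂η.1 < C + 1 :=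
      (t1 k).eventually_lt_const (by simp [hC])
    filter_upwards [e1, Metric.tendsto_nhds.1 (t2 k j) (ε / 3) (by positivity)] with η h1 h2
    have k1 := key η
    have k2 := key η₀
    rw [dist_comm] at k2
    have h6 : δ * (C + 1) = ε / 3 := by rw [hδ]; field_simp
    have h7 : δ * ∫ x, χ k x ∂η.1 < δ * (C + 1) := mul_lt_mul_of_pos_left h1 hδ0
    have h8 : δ * C ≤ δ * (C + 1) := by gcongr; linarith
    have := dist_triangle4 (∫ x, φ x ∂η.1) (∫ x, f k j x ∂η.1) (∫ x, f k j x ∂η₀.1)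
      (∫ x, φ x ∂η₀.1)
    change dist (∫ x, φ x ∂η.1) (∫ x, φ x ∂η₀.1) < ε
    linarith
  exact hind.secondCountableTopology

variable [BorelSpace X]

theorem PointSet.isInducing_toCounting :
    IsInducing (PointSet.toCounting : PointSet X → CountingMeasure X) := ⟨rfl⟩

theorem PointSet.lintegral_toCounting (Y : PointSet X) {f : X → ℝ≥0∞} (hf : Measurable f) :
    ∫⁻ x, f x ∂Y.toCounting.1 = ∑' y : Y.carrier, f y := by
  refine (lintegral_sum_measure _ _).trans (tsum_congr fun y => lintegral_dirac' _ hf)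

theorem PointSet.toCounting_apply (Y : PointSet X) {B : Set X} (hB : MeasurableSet B) :
    Y.toCounting.1 B = ∑' y : Y.carrier, B.indicator 1 (y : X) := by
  rw [← lintegral_indicator_one hB, Y.lintegral_toCounting (measurable_one.indicator hB)]

theorem PointSet.toCounting_apply_eq_zero (Y : PointSet X) {B : Set X} (hB : MeasurableSet B) :
    Y.toCounting.1 B = 0 ↔ Y.carrier ∩ B = ∅ := by
  rw [Y.toCounting_apply hB, ENNReal.tsum_eq_zero]
  simp only [indicator_apply_eq_zero, Pi.one_apply, one_ne_zero, imp_false, Subtype.forall]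
  rw [← disjoint_iff_inter_eq_empty, disjoint_left]

theorem PointSet.toCounting_injective :
    Function.Injective (PointSet.toCounting : PointSet X → CountingMeasure X) := by
  intro Y Z h
  have key : ∀ (Y : PointSet X) x, x ∈ Y.carrier ↔ Y.toCounting.1 {x} ≠ 0 := by
    intro Y x
    rw [Ne, Y.toCounting_apply_eq_zero (measurableSet_singleton x)]
    simp
  ext x
  rw [key, key, h]

/-- A counting measure all of whose atoms are simple comes from a point set. -/
theorem CountingMeasure.mem_range_toCounting (η : CountingMeasure X)
    (h : ∀ x, η.1 {x} ≤ 1) : η ∈ range (PointSet.toCounting : PointSet X → CountingMeasure X) := by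
  obtain ⟨ι, x, hx⟩ := η.2.2
  have happ : ∀ B, MeasurableSet B → η.1 B = ∑' i, B.indicator 1 (x i) := by
    intro B hB
    rw [hx, Measure.sum_apply _ hB]
    exact tsum_congr fun i => Measure.dirac_apply' _ hB
  -- Two equal indices would put mass 2 on one point.
  have hinj : Function.Injective x := by
    intro i j hij
    by_contra hne
    classical
    have h1 := h (x i)
    rw [happ _ (measurableSet_singleton _)] at h1
    have h2 := ENNReal.sum_le_tsum (f := fun k => ({x i} : Set X).indicator 1 (x k)) {i, j}
    rw [Finset.sum_pair hne] at h2
    simp only [hij, mem_singleton_iff, indicator_of_mem, Pi.one_apply] at h2 h1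
    have := h2.trans h1
    norm_num at this
  let Y : PointSet X := ⟨range x, fun K hK => by
    have h1 : η.1 K < ∞ := η.2.1 K hK
    rw [happ K hK.measurableSet] at h1
    have h2 : (x ⁻¹' K).Finite := by
      have := ENNReal.finite_const_le_of_tsum_ne_top h1.ne one_ne_zero
      refine this.subset fun i hi => ?_
      simp [indicator_of_mem (show x i ∈ K from hi)]
    refine (h2.image x).subset ?_
    rintro _ ⟨⟨i, rfl⟩, hi⟩
    exact ⟨i, hi, rfl⟩⟩
  refine ⟨Y, Subtype.ext (Measure.ext fun B hB => ?_)⟩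
  rw [Y.toCounting_apply hB, happ B hB]
  exact ((Equiv.ofInjective x hinj).tsum_eq
    (fun y : range x => B.indicator (1 : X → ℝ≥0∞) (y : X))).symm

/-- A set of nonzero mass contains an atom, which alone contributes 1. This gap between 0 and 1 is
what allows void indicators to be approximated by continuous functionals. -/
theorem CountingMeasure.one_le_of_ne_zero (η : CountingMeasure X) {B : Set X}
    (hB : MeasurableSet B) (h : η.1 B ≠ 0) : 1 ≤ η.1 B := by
  obtain ⟨ι, x, hx⟩ := η.2.2
  rw [hx, Measure.sum_apply _ hB] at h ⊢
  rw [Ne, ENNReal.tsum_eq_zero, not_forall] at h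
  obtain ⟨i, hi⟩ := h
  refine le_trans ?_ (ENNReal.le_tsum i)
  rw [Measure.dirac_apply' _ hB] at hi ⊢
  by_cases hm : x i ∈ B <;> simp_all

end VagueTopology

end LorentzGas

namespace LorentzGas

/-! ### The filter ρ → 0. -/

instance : toZero.IsCountablyGenerated := by unfold toZero; infer_instance

instance : toZero.NeBot := by
  unfold toZero
  rw [comap_neBot_iff]
  intro t ht
  obtain ⟨ε, hε, h⟩ := Metric.mem_nhds_iff.1 ht
  refine ⟨⟨min (ε / 2) (1 / 2), by positivity, by
    exact (min_le_right _ _).trans_lt (by norm_num)⟩, h ?_⟩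
  have h1 : (0 : ℝ) < min (ε / 2) (1 / 2) := by positivity
  rw [mem_ball_zero_iff, Real.norm_of_nonneg h1.le]
  exact (min_le_left _ _).trans_lt (half_lt_self hε)

theorem tendsto_toZero : Tendsto ((↑) : Radius → ℝ) toZero (𝓝 0) := tendsto_comap

theorem eventually_toZero_lt {δ : ℝ} (hδ : 0 < δ) : ∀ᶠ ρ : Radius in toZero, (ρ : ℝ) < δ :=
  tendsto_toZero.eventually_lt_const hδ

/-- Here d ≥ 2 enters: the macroscopic length scale ρ^(1-d) must diverge for asymptotic densities to
be applicable. -/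
theorem tendsto_inv_pow_toZero {n : ℕ} (hn : 1 ≤ n) :
    Tendsto (fun ρ : Radius => ((ρ : ℝ) ^ n)⁻¹) toZero atTop := by
  refine tendsto_inv_nhdsGT_zero.comp (tendsto_nhdsWithin_iff.2 ⟨?_, ?_⟩)
  · have := tendsto_toZero.pow n
    rwa [zero_pow (by omega)] at this
  · exact Eventually.of_forall fun ρ => pow_pos ρ.2.1 n

/-! ### Translating a configuration and adding a point. -/

section Shift

variable {n : ℕ} {M : Type*} [MetricSpace M] [CompactSpace M] [MeasurableSpace M] [BorelSpace M]

/-- The counting measure `η`, translated by `y`, with an additional atom at `(y, s)`. -/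
noncomputable def shiftAdd (η : CountingMeasure (E n × M)) (y : E n) (s : M) :
    CountingMeasure (E n × M) :=
  ⟨(η.map (onPoints M (Homeomorph.addRight y))).1 + Measure.dirac (y, s), by
    refine ⟨fun K hK => ?_, ?_⟩
    · rw [Measure.add_apply]
      refine ENNReal.add_lt_top.2 ⟨(η.map _).2.1 K hK, ?_⟩
      exact measure_lt_top _ _
    · obtain ⟨ι, x, h⟩ := (η.map (onPoints M (Homeomorph.addRight y))).2.2
      refine ⟨ι ⊕ PUnit, Sum.elim x fun _ => (y, s), ?_⟩
      rw [h]
      ext B hB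
      rw [Measure.add_apply, Measure.sum_apply _ hB, Measure.sum_apply _ hB,
        ENNReal.summable.tsum_sum ENNReal.summable]
      simp⟩

theorem integral_shiftAdd (η : CountingMeasure (E n × M)) (y : E n) (s : M) {f : E n × M → ℝ}
    (hf : Continuous f) (hc : HasCompactSupport f) :
    ∫ x, f x ∂(shiftAdd η y s).1 = ∫ x, f (x.1 + y, x.2) ∂η.1 + f (y, s) := by
  have h1 : Integrable f (η.map (onPoints M (Homeomorph.addRight y))).1 :=
    hf.integrable_of_hasCompactSupport hc
  have h2 : Integrable f (Measure.dirac (y, s)) := hf.integrable_of_hasCompactSupport hc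
  unfold shiftAdd
  rw [integral_add_measure h1 h2, integral_dirac]
  congr 1
  exact integral_map (onPoints M (Homeomorph.addRight y)).continuous.aemeasurable
    hf.aestronglyMeasurable

/-- If x + y has norm at most r and y is within 1 of y₀, then x has norm at most r + ‖y₀‖ + 1. This
is the local uniformity of supports required by `CountingMeasure.continuous_integral_param`. -/
theorem hasCompactSupport_comp_add {f : E n × M → ℝ} (hc : HasCompactSupport f) :
    ∀ y₀ : E n, ∃ K, IsCompact K ∧ ∀ᶠ y in 𝓝 y₀, ∀ x : E n × M, x ∉ K →
      f (x.1 + y, x.2) = 0 := by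
  intro y₀
  obtain ⟨r, hr⟩ := (hc.isCompact.image
    (continuous_fst (X := E n) (Y := M))).isBounded.exists_norm_le
  refine ⟨Metric.closedBall 0 (r + ‖y₀‖ + 1) ×ˢ univ,
    (isCompact_closedBall _ _).prod isCompact_univ, ?_⟩
  filter_upwards [Metric.ball_mem_nhds y₀ one_pos] with y hy x hx
  by_contra h
  have h1 : ‖x.1 + y‖ ≤ r := hr _ ⟨_, subset_tsupport _ h, rfl⟩
  apply hx
  have h2 : ‖x.1‖ ≤ ‖x.1 + y‖ + ‖y‖ := by simpa using norm_sub_le (x.1 + y) y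
  have h3 : ‖y‖ ≤ ‖y₀‖ + ‖y - y₀‖ := norm_le_norm_add_norm_sub' y y₀
  rw [mem_ball_iff_norm] at hy
  simp only [mem_prod, mem_closedBall_zero_iff, mem_univ, and_true]
  linarith

/-- Tested against f in C_c, the shifted measure gives the integral of a translate of f plus a value
of f; the first is continuous jointly in the measure and the translation. -/
theorem continuous_shiftAdd :
    Continuous fun p : CountingMeasure (E n × M) × (E n × M) => shiftAdd p.1 p.2.1 p.2.2 := by
  refine continuous_induced_rng.2 (continuous_pi fun f => ?_)
  have h : ∀ p : CountingMeasure (E n × M) × (E n × M),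
      ∫ x, f x ∂(shiftAdd p.1 p.2.1 p.2.2).1 = ∫ x, f (x.1 + p.2.1, x.2) ∂p.1.1 + f p.2 :=
    fun p => integral_shiftAdd p.1 p.2.1 p.2.2 f.continuous f.hasCompactSupport
  refine Continuous.congr ?_ fun p => (h p).symm
  refine Continuous.add ?_ (f.continuous.comp continuous_snd)
  have h2 : Continuous fun q : (E n × M) × E n => f (q.1.1 + q.2, q.1.2) :=
    f.continuous.comp (by fun_prop)
  exact (CountingMeasure.continuous_integral_param (θ := fun (x : E n × M) y => f (x.1 + y, x.2)) h2
    (hasCompactSupport_comp_add f.hasCompactSupport)).comp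
    (continuous_fst.prodMk (continuous_fst.comp continuous_snd))

theorem PointSet.toCounting_map (Y : PointSet (E n × M)) (e : E n × M ≃ₜ E n × M) :
    (Y.map e).toCounting = Y.toCounting.map e := by
  refine Subtype.ext (Measure.ext fun B hB => ?_)
  rw [PointSet.toCounting_apply _ hB]
  change _ = Measure.map e Y.toCounting.1 B
  rw [Measure.map_apply e.continuous.measurable hB,
    Y.toCounting_apply (e.continuous.measurable hB)]
  exact ((Equiv.Set.image e Y.carrier e.injective).tsum_eq
    (fun y : (e '' Y.carrier : Set (E n × M)) => B.indicator (1 : E n × M → ℝ≥0∞) y)).symm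

theorem PointSet.toCounting_insert (Y : PointSet (E n × M)) {x : E n × M} (hx : x ∉ Y.carrier) :
    (Y.insert x).toCounting.1 = Y.toCounting.1 + Measure.dirac x := by
  refine Measure.ext fun B hB => ?_
  rw [PointSet.toCounting_apply _ hB, Measure.add_apply, Y.toCounting_apply hB,
    Measure.dirac_apply' _ hB]
  have hd : Disjoint Y.carrier {x} := disjoint_singleton_right.2 hx
  have := Summable.tsum_union_disjoint (f := B.indicator (1 : E n × M → ℝ≥0∞)) hd
    ENNReal.summable ENNReal.summable
  refine Eq.trans this ?_
  congr 1
  exact tsum_singleton x (B.indicator (1 : E n × M → ℝ≥0∞))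

/-- A union of sets forgets multiplicity while a sum of measures keeps it. The two constructions
agree when the added point is not already a translated one, that is, when Y has no point (0, s). -/
theorem toCounting_shiftInsert (Y : PointSet (E n × M)) (y : E n) (s : M)
    (h : ((0 : E n), s) ∉ Y.carrier) :
    (shiftInsert Y y s).toCounting = shiftAdd Y.toCounting y s := by
  refine Subtype.ext ?_
  unfold shiftInsert shiftAdd
  rw [PointSet.toCounting_insert, PointSet.toCounting_map]
  rintro ⟨⟨a, b⟩, hz, hz2⟩
  have h1 : a + y = y := congrArg Prod.fst hz2
  have h2 : b = s := congrArg Prod.snd hz2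
  rw [add_eq_right] at h1
  subst h1 h2
  exact h hz

/-- The points whose translates by `y` lie in the cylinder in front of `y`. -/
def window (M : Type*) (c : ℝ) (U : Set (EuclideanSpace ℝ (Fin n))) (y : E n) : Set (E n × M) :=
  {x | x.1 + y ∈ cylinder c U (y 0 - c)}

theorem mem_window {c : ℝ} {U : Set (EuclideanSpace ℝ (Fin n))} {y : E n} {x : E n × M} :
    x ∈ window M c U y ↔ c - y 0 < x.1 0 ∧ x.1 0 < 0 ∧ tailPt x.1 + tailPt y ∈ U := by
  have h : tailPt (x.1 + y) = tailPt x.1 + tailPt y := rfl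
  simp only [window, cylinder, mem_ofPred_eq, h, PiLp.add_apply]
  constructor
  · rintro ⟨h1, h2, h3⟩
    exact ⟨by linarith, by linarith, h3⟩
  · rintro ⟨h1, h2, h3⟩
    exact ⟨by linarith, by linarith, h3⟩

theorem continuous_tailPt : Continuous (tailPt : E n → EuclideanSpace ℝ (Fin n)) := by
  unfold tailPt
  fun_prop

theorem isOpen_window {c : ℝ} {U : Set (EuclideanSpace ℝ (Fin n))} (hU : IsOpen U) :
    IsOpen {p : (E n × M) × E n | p.1 ∈ window M c U p.2} := by
  have h : {p : (E n × M) × E n | p.1 ∈ window M c U p.2} =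
      {p | c - p.2 0 < p.1.1 0} ∩ ({p | p.1.1 0 < 0} ∩
        {p | tailPt p.1.1 + tailPt p.2 ∈ U}) := by
    ext p
    exact mem_window
  rw [h]
  have ht := continuous_tailPt (n := n)
  refine (isOpen_lt (by fun_prop) (by fun_prop)).inter
    ((isOpen_lt (by fun_prop) (by fun_prop)).inter (hU.preimage (by fun_prop)))

theorem measurableSet_window {c : ℝ} {U : Set (EuclideanSpace ℝ (Fin n))} (hU : IsOpen U)
    (y : E n) : MeasurableSet (window M c U y) :=
  ((isOpen_window hU).preimage (Continuous.prodMk_left y)).measurableSet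

/-- The cylinder is open and y lies on the hyperplane of its far face, so the added point never
counts and only the translated points matter. -/
theorem shiftInsert_inter_eq_empty {c : ℝ} {U : Set (EuclideanSpace ℝ (Fin n))} (hU : IsOpen U)
    (Y : PointSet (E n × M)) (y : E n) (s : M) :
    (shiftInsert Y y s).carrier ∩ cylinder c U (y 0 - c) ×ˢ univ = ∅ ↔
      Y.toCounting.1 (window M c U y) = 0 := by
  rw [PointSet.toCounting_apply_eq_zero _ (measurableSet_window hU y)]
  simp only [eq_empty_iff_forall_notMem]
  constructor
  · rintro h x ⟨hx1, hx2⟩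
    exact h (x.1 + y, x.2) ⟨Or.inl ⟨x, hx1, rfl⟩, hx2, mem_univ _⟩
  · rintro h z ⟨⟨x, hx, rfl⟩ | hz, hz2, -⟩
    · exact h x ⟨hx, hz2⟩
    · rw [mem_singleton_iff.1 hz] at hz2
      have := hz2.2.1
      simp at this

end Shift

/-! ### Tame functionals and weak convergence. -/

section Tame

variable {n : ℕ} {M : Type*} [MetricSpace M] [CompactSpace M] [MeasurableSpace M] [BorelSpace M]

/-- Continuous functions on the space of counting measures which depend on the mark of an added
point in a uniformly continuous way. -/
structure Tame (f : CountingMeasure (E n × M) → ℝ) : Prop where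
  continuous : Continuous f
  modulus : ∀ y : E n, ∀ ε : ℝ, 0 < ε → ∃ δ : ℝ, 0 < δ ∧ ∀ s s' : M, dist s s' < δ →
    ∀ η, dist (f (shiftAdd η y s)) (f (shiftAdd η y s')) ≤ ε

theorem Tame.const (a : ℝ) : Tame fun _ : CountingMeasure (E n × M) => a :=
  ⟨continuous_const, fun _ ε hε => ⟨1, one_pos, fun _ _ _ _ => by simpa using hε.le⟩⟩

theorem Tame.add {f g : CountingMeasure (E n × M) → ℝ} (hf : Tame f) (hg : Tame g) :
    Tame fun η => f η + g η := by
  refine ⟨hf.continuous.add hg.continuous, fun y ε hε => ?_⟩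
  obtain ⟨δ, hδ, h⟩ := hf.modulus y (ε / 2) (half_pos hε)
  obtain ⟨δ', hδ', h'⟩ := hg.modulus y (ε / 2) (half_pos hε)
  refine ⟨min δ δ', lt_min hδ hδ', fun s s' hs η => ?_⟩
  refine (dist_add_add_le _ _ _ _).trans ?_
  linarith [h s s' (hs.trans_le (min_le_left _ _)) η, h' s s' (hs.trans_le (min_le_right _ _)) η]

/-- The functional f may be unbounded and its modulus is uniform in η, so continuity of u alone
would not suffice. -/
theorem Tame.comp {f : CountingMeasure (E n × M) → ℝ} (hf : Tame f) {u : ℝ → ℝ}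
    (hu : UniformContinuous u) : Tame fun η => u (f η) := by
  refine ⟨hu.continuous.comp hf.continuous, fun y ε hε => ?_⟩
  obtain ⟨ε', hε', h⟩ := Metric.uniformContinuous_iff.1 hu ε hε
  obtain ⟨δ, hδ, h'⟩ := hf.modulus y (ε' / 2) (half_pos hε')
  exact ⟨δ, hδ, fun s s' hs η => (h ((h' s s' hs η).trans_lt (half_lt_self hε'))).le⟩

theorem Tame.sum {ι : Type*} (I : Finset ι) {f : ι → CountingMeasure (E n × M) → ℝ}
    (hf : ∀ i, Tame (f i)) : Tame fun η => ∑ i ∈ I, f i η := by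
  classical
  induction I using Finset.induction_on with
  | empty => simpa using Tame.const 0
  | insert i I hi ih => simpa [Finset.sum_insert hi] using (hf i).add ih

/-- Changing the mark of the added point changes the integral by f(y, s) - f(y, s'), whatever η is,
and f(y, ·) is uniformly continuous on the compact mark space. -/
theorem Tame.integral (f : C_c(E n × M, ℝ)) : Tame fun η => ∫ x, f x ∂η.1 := by
  refine ⟨CountingMeasure.continuous_integral f.continuous f.hasCompactSupport,
    fun y ε hε => ?_⟩
  have hu : UniformContinuous fun s : M => f (y, s) :=
    CompactSpace.uniformContinuous_of_continuous (f.continuous.comp (by fun_prop))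
  obtain ⟨δ, hδ, h⟩ := Metric.uniformContinuous_iff.1 hu ε hε
  refine ⟨δ, hδ, fun s s' hs η => ?_⟩
  have h1 := integral_shiftAdd η y s f.continuous f.hasCompactSupport
  have h2 := integral_shiftAdd η y s' f.continuous f.hasCompactSupport
  refine (congrArg₂ dist h1 h2).trans_le ?_
  rw [dist_add_left]
  exact (h hs).le

theorem uniformContinuous_abs_sub (a : ℝ) : UniformContinuous fun t : ℝ => |t - a| :=
  (LipschitzWith.of_dist_le_mul (K := 1) fun s t => by
    rw [Real.dist_eq, Real.dist_eq, NNReal.coe_one, one_mul]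
    refine (abs_abs_sub_abs_le _ _).trans ?_
    simp).uniformContinuous

theorem uniformContinuous_max_zero_sub (a : ℝ) : UniformContinuous fun t : ℝ => max 0 (1 - a * t) :=
  (LipschitzWith.id.const_max 0).uniformContinuous.comp
    (uniformContinuous_const.sub (uniformContinuous_id.const_mul' a))

theorem uniformContinuous_min_one_mul (a : ℝ) : UniformContinuous fun t : ℝ => min 1 (a * t) :=
  (LipschitzWith.id.const_min 1).uniformContinuous.comp (uniformContinuous_id.const_mul' a)

/-- A basic neighbourhood of η₀ restricts finitely many integrals. Take 1 - k Σ |∫ φ dη - ∫ φ dη₀|,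
cut at zero, with k at least the inverse of every tolerance: where this is positive, all the
restrictions hold. -/
theorem exists_tame_of_mem_isOpen {O : Set (CountingMeasure (E n × M))} (hO : IsOpen O)
    {η₀ : CountingMeasure (E n × M)} (h₀ : η₀ ∈ O) :
    ∃ f : CountingMeasure (E n × M) → ℝ, Tame f ∧ (∀ η, 0 ≤ f η) ∧ 0 < f η₀ ∧
      ∀ η ∉ O, f η = 0 := by
  have h1 := hO.mem_nhds h₀
  rw [nhds_induced, mem_comap] at h1
  obtain ⟨t, ht, hsub⟩ := h1
  rw [nhds_pi, Filter.mem_pi] at ht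
  obtain ⟨I, hI, u, hu, hsub'⟩ := ht
  choose r hr hru using fun φ => Metric.mem_nhds_iff.1 (hu φ)
  let J := hI.toFinset
  obtain ⟨k, hk⟩ : ∃ k : ℝ, ∀ φ ∈ J, (r φ)⁻¹ ≤ k := by
    obtain ⟨k, hk⟩ := (J.image fun φ => (r φ)⁻¹).bddAbove
    exact ⟨k, fun φ hφ => hk (by simpa using ⟨φ, hφ, rfl⟩)⟩
  refine ⟨fun η => max 0 (1 - k * ∑ φ ∈ J, |∫ x, φ x ∂η.1 - ∫ x, φ x ∂η₀.1|),
    (Tame.sum J fun φ => (Tame.integral φ).comp (uniformContinuous_abs_sub _)).comp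
      (uniformContinuous_max_zero_sub k), fun η => le_max_left _ _, by simp, fun η hη => ?_⟩
  refine max_eq_left ?_
  by_contra! hlt
  refine hη (hsub (hsub' fun φ hφ => hru φ ?_))
  rw [Metric.mem_ball, Real.dist_eq]
  have hφJ : φ ∈ J := hI.mem_toFinset.2 hφ
  have h2 := Finset.single_le_sum
    (f := fun φ : C_c(E n × M, ℝ) => |∫ x, φ x ∂η.1 - ∫ x, φ x ∂η₀.1|)
    (fun i _ => abs_nonneg _) hφJ
  beta_reduce at h2
  have h3 := hk φ hφJ
  have h4 : 0 < (r φ)⁻¹ := inv_pos.2 (hr φ)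
  have h5 : (r φ)⁻¹ * |∫ x, φ x ∂η.1 - ∫ x, φ x ∂η₀.1| < 1 := by
    refine lt_of_le_of_lt (mul_le_mul h3 h2 (abs_nonneg _) (h4.le.trans h3)) (by linarith)
  rwa [inv_mul_lt_one₀ (hr φ)] at h5

/-- Indicators of open sets are increasing limits of tame functions. -/
theorem exists_tame_seq {O : Set (CountingMeasure (E n × M))} (hO : IsOpen O) :
    ∃ F : ℕ → CountingMeasure (E n × M) → ℝ, (∀ k, Tame (F k)) ∧ (∀ k η, 0 ≤ F k η) ∧
      (∀ k η, F k η ≤ O.indicator 1 η) ∧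
      ∀ η, Tendsto (fun k => F k η) atTop (𝓝 (O.indicator 1 η)) := by
  rcases O.eq_empty_or_nonempty with rfl | hne
  · exact ⟨fun _ _ => 0, fun _ => Tame.const 0, fun _ _ => le_rfl, fun _ _ => by simp,
      fun _ => by simp⟩
  choose f hf hf0 hfpos hfO using fun η₀ : O => exists_tame_of_mem_isOpen hO η₀.2
  -- By second countability, countably many positivity sets already cover O.
  obtain ⟨T, hT, hTU⟩ := TopologicalSpace.isOpen_iUnion_countable (fun η₀ => {η | 0 < f η₀ η})
    fun η₀ => isOpen_lt continuous_const (hf η₀).continuous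
  have hcov : O ⊆ ⋃ η₀ ∈ T, {η | 0 < f η₀ η} := by
    rw [hTU]
    exact fun η hη => mem_iUnion.2 ⟨⟨η, hη⟩, hfpos ⟨η, hη⟩⟩
  have hTne : T.Nonempty := by
    obtain ⟨η, hη⟩ := hne
    obtain ⟨η₀, h⟩ := mem_iUnion.1 (hcov hη)
    obtain ⟨h, -⟩ := mem_iUnion.1 h
    exact ⟨η₀, h⟩
  obtain ⟨e, he⟩ := hT.exists_eq_range hTne
  -- On O some summand is positive, and the growing factor k eventually lifts the sum beyond 1; off
  -- O every summand is zero.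
  refine ⟨fun k η => min 1 ((k : ℝ) * ∑ j ∈ Finset.range k, f (e j) η),
    fun k => (Tame.sum _ fun j => hf (e j)).comp (uniformContinuous_min_one_mul _),
    fun k η => le_min zero_le_one (mul_nonneg (Nat.cast_nonneg _)
      (Finset.sum_nonneg fun j _ => hf0 _ _)), fun k η => ?_, fun η => ?_⟩
  · by_cases hη : η ∈ O
    · simp [hη]
    · simp [hη, hfO _ η hη]
  · by_cases hη : η ∈ O
    · have h1 := hcov hη
      simp only [he, mem_range, mem_iUnion, mem_ofPred_eq, exists_prop, exists_exists_eq_and] at h1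
      obtain ⟨j, hj⟩ := h1
      simp only [indicator_of_mem hη, Pi.one_apply]
      refine tendsto_const_nhds.congr' ?_
      obtain ⟨N, hN⟩ := exists_nat_gt (f (e j) η)⁻¹
      filter_upwards [eventually_ge_atTop (max N (j + 1))] with k hk
      refine (min_eq_left ?_).symm
      have h2 : f (e j) η ≤ ∑ j ∈ Finset.range k, f (e j) η :=
        Finset.single_le_sum (f := fun j => f (e j) η) (fun i _ => hf0 _ _)
          (Finset.mem_range.2 (by omega))
      have h3 : (f (e j) η)⁻¹ ≤ k := hN.le.trans (by exact_mod_cast (le_max_left _ _).trans hk)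
      calc (1 : ℝ) = (f (e j) η)⁻¹ * f (e j) η := (inv_mul_cancel₀ hj.ne').symm
        _ ≤ _ := mul_le_mul h3 h2 hj.le (by positivity)
    · simp [hη, hfO _ η hη]

theorem integrable_of_le_one {Ω : Type*} [MeasurableSpace Ω] {ν : Measure Ω} [IsFiniteMeasure ν]
    {f : Ω → ℝ} (hf : Measurable f) (h0 : ∀ η, 0 ≤ f η) (h1 : ∀ η, f η ≤ 1) : Integrable f ν :=
  Integrable.of_bound hf.aestronglyMeasurable 1
    (Eventually.of_forall fun η => by rw [Real.norm_of_nonneg (h0 η)]; exact h1 η)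

theorem tendsto_integral_indicator {Ω : Type*} [MeasurableSpace Ω] {ν : Measure Ω}
    [IsFiniteMeasure ν] {O : Set Ω} (hO : MeasurableSet O) {F : ℕ → Ω → ℝ}
    (hF : ∀ k, Measurable (F k)) (h0 : ∀ k η, 0 ≤ F k η) (h1 : ∀ k η, F k η ≤ O.indicator 1 η)
    (hlim : ∀ η, Tendsto (fun k => F k η) atTop (𝓝 (O.indicator 1 η))) :
    Tendsto (fun k => ∫ η, F k η ∂ν) atTop (𝓝 (ν.real O)) := by
  rw [← integral_indicator_one hO]
  refine tendsto_integral_of_dominated_convergence (fun _ => 1)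
    (fun k => (hF k).aestronglyMeasurable) (integrable_const _) (fun k => ?_)
    (Eventually.of_forall hlim)
  refine Eventually.of_forall fun η => ?_
  rw [Real.norm_of_nonneg (h0 k η)]
  exact (h1 k η).trans (indicator_le_self' (fun _ _ => zero_le_one) η)

/-- Tame functions determine weak convergence of simple point processes. -/
theorem tendsto_of_tame {ι : Type*} {L : Filter ι} [L.IsCountablyGenerated] [L.NeBot]
    {νs : ι → ProbabilityMeasure (PointSet (E n × M))} {ν : ProbabilityMeasure (PointSet (E n × M))}
    (h : ∀ f : CountingMeasure (E n × M) → ℝ, Tame f → (∀ η, 0 ≤ f η) → (∀ η, f η ≤ 1) →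
      Tendsto (fun i => ∫ Y, f Y.toCounting ∂(νs i : Measure (PointSet (E n × M)))) L
        (𝓝 (∫ Y, f Y.toCounting ∂(ν : Measure (PointSet (E n × M)))))) :
    Tendsto νs L (𝓝 ν) := by
  refine tendsto_of_forall_isOpen_le_liminf' fun G hG => ?_
  -- Open sets of point sets are traces of open sets O of counting measures. The portmanteau
  -- criterion needs only a lower bound for the lim inf, which tame minorants of the indicator of O
  -- provide.
  obtain ⟨O, hO, rfl⟩ := PointSet.isInducing_toCounting.isOpen_iff.1 hG
  obtain ⟨F, hF, hF0, hF1, hlim⟩ := exists_tame_seq hO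
  have hm : ∀ k, Measurable fun Y : PointSet (E n × M) => F k Y.toCounting := fun k =>
    (hF k).continuous.measurable.comp measurable_toCounting
  have hF2 : ∀ k η, F k η ≤ 1 := fun k η =>
    (hF1 k η).trans (indicator_le_self' (fun _ _ => zero_le_one) η)
  have h1 := tendsto_integral_indicator (ν := (ν : Measure (PointSet (E n × M))))
    hG.measurableSet hm (fun k Y => hF0 k _) (fun k Y => hF1 k _) (fun Y => hlim _)
  have h2 := (ENNReal.continuous_ofReal.tendsto _).comp h1
  rw [ofReal_measureReal] at h2
  refine le_of_tendsto' h2 fun k => ?_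
  have h3 := (ENNReal.continuous_ofReal.tendsto _).comp (h (F k) (hF k) (hF0 k) (hF2 k))
  refine h3.liminf_eq.ge.trans (liminf_le_liminf (Eventually.of_forall fun i => ?_))
  simp only [Function.comp_apply]
  rw [← ofReal_measureReal]
  refine ENNReal.ofReal_le_ofReal ?_
  rw [← integral_indicator_one hG.measurableSet]
  refine integral_mono (integrable_of_le_one (hm k) (fun _ => hF0 k _) fun _ => hF2 k _)
    ((integrable_const (1 : ℝ)).indicator hG.measurableSet) fun Y => hF1 k _

/-- A bounded continuous function has a continuous expectation. -/
theorem continuous_integral_prob {μ : M → ProbabilityMeasure (CountingMeasure (E n × M))}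
    (hμ : Continuous μ) {f : CountingMeasure (E n × M) → ℝ} (hf : Continuous f) {C : ℝ}
    (hC : ∀ η, |f η| ≤ C) :
    Continuous fun s => ∫ η, f η ∂(μ s : Measure (CountingMeasure (E n × M))) := by
  let F := BoundedContinuousFunction.ofNormedAddCommGroup f hf C hC
  rw [continuous_iff_continuousAt]
  intro s
  exact ProbabilityMeasure.tendsto_iff_forall_integral_tendsto.1 (hμ.tendsto s) F

/-- Open sets are a generating π-system, and on each of them the mass is a pointwise limit of
continuous functions of the mark. This makes the family μ a Markov kernel. -/
theorem measurable_measure_of_continuous {μ : M → ProbabilityMeasure (CountingMeasure (E n × M))}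
    (hμ : Continuous μ) :
    Measurable fun s => (μ s : Measure (CountingMeasure (E n × M))) := by
  refine Measurable.measure_of_isPiSystem_of_isProbabilityMeasure
    (S := {O | IsOpen O}) rfl isPiSystem_isOpen fun O hO => ?_
  replace hO : IsOpen O := hO
  obtain ⟨F, hF, hF0, hF1, hlim⟩ := exists_tame_seq hO
  have hF2 : ∀ k η, |F k η| ≤ 1 := fun k η => by
    rw [abs_of_nonneg (hF0 k η)]
    exact (hF1 k η).trans (indicator_le_self' (fun _ _ => zero_le_one) η)
  have h1 : Measurable fun s => (μ s : Measure (CountingMeasure (E n × M))).real O := by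
    refine measurable_of_tendsto_metrizable
      (fun k => (continuous_integral_prob hμ (hF k).continuous (hF2 k)).measurable) ?_
    exact tendsto_pi_nhds.2 fun s => tendsto_integral_indicator hO.measurableSet
      (fun k => (hF k).continuous.measurable) hF0 hF1 hlim
  have h2 := ENNReal.measurable_ofReal.comp h1
  have h3 : (fun s => (μ s : Measure (CountingMeasure (E n × M))) O) =
      ENNReal.ofReal ∘ fun s => (μ s : Measure (CountingMeasure (E n × M))).real O :=
    funext fun s => (ofReal_measureReal (measure_ne_top _ _)).symm
  rwa [h3]

end Tame

end LorentzGas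

namespace LorentzGas

/-! ### Averages over scatterers and asymptotic density. -/

section Averages

variable {n : ℕ} {M : Type*}

theorem PointSet.finite_scaled (P : PointSet (E n)) (T : ℝ) (ρ : Radius) :
    {p : P.carrier | ‖(ρ : ℝ) ^ n • (p : E n)‖ ≤ T}.Finite := by
  have hp : (0 : ℝ) < (ρ : ℝ) ^ n := pow_pos ρ.2.1 n
  have h := P.finite_inter _ (isCompact_closedBall 0 (T / (ρ : ℝ) ^ n))
  refine Set.Finite.of_finite_image (f := Subtype.val) (h.subset ?_) Subtype.val_injective.injOn
  rintro _ ⟨p, hp', rfl⟩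
  refine ⟨p.2, ?_⟩
  rw [mem_closedBall_zero_iff, le_div_iff₀ hp, mul_comm]
  simpa [norm_smul, abs_of_pos ρ.2.1] using hp'

/-- The scatterers in the ball of radius `T ρ^{1-d}`. -/
noncomputable def nearPts (P : PointSet (E n)) (T : ℝ) (ρ : Radius) : Finset P.carrier :=
  (P.finite_scaled T ρ).toFinset

theorem mem_nearPts {P : PointSet (E n)} {T : ℝ} {ρ : Radius} {p : P.carrier} :
    p ∈ nearPts P T ρ ↔ ‖(ρ : ℝ) ^ n • (p : E n)‖ ≤ T := by
  simp [nearPts]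

/-- The normalized sum over the scatterers in the ball of radius `T ρ^{1-d}`. -/
noncomputable def avg (P : PointSet (E n)) (T : ℝ) (ρ : Radius) (h : P.carrier → ℝ) : ℝ :=
  (ρ : ℝ) ^ (n * (n + 1)) * ∑ p ∈ nearPts P T ρ, h p

variable {P : PointSet (E n)}

theorem avg_mono {T : ℝ} {ρ : Radius} {h h' : P.carrier → ℝ}
    (H : ∀ p ∈ nearPts P T ρ, h p ≤ h' p) : avg P T ρ h ≤ avg P T ρ h' :=
  mul_le_mul_of_nonneg_left (Finset.sum_le_sum H) (pow_nonneg ρ.2.1.le _)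

theorem avg_nonneg {T : ℝ} {ρ : Radius} {h : P.carrier → ℝ} (H : ∀ p, 0 ≤ h p) :
    0 ≤ avg P T ρ h :=
  mul_nonneg (pow_nonneg ρ.2.1.le _) (Finset.sum_nonneg fun p _ => H p)

theorem avg_add {T : ℝ} {ρ : Radius} (h h' : P.carrier → ℝ) :
    avg P T ρ (fun p => h p + h' p) = avg P T ρ h + avg P T ρ h' := by
  simp [avg, Finset.sum_add_distrib, mul_add]

theorem avg_sub {T : ℝ} {ρ : Radius} (h h' : P.carrier → ℝ) :
    avg P T ρ (fun p => h p - h' p) = avg P T ρ h - avg P T ρ h' := by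
  simp [avg, Finset.sum_sub_distrib, mul_sub]

theorem avg_const_mul {T : ℝ} {ρ : Radius} (a : ℝ) (h : P.carrier → ℝ) :
    avg P T ρ (fun p => a * h p) = a * avg P T ρ h := by
  simp only [avg, ← Finset.mul_sum]
  ring

theorem abs_avg_le {T : ℝ} {ρ : Radius} (h : P.carrier → ℝ) :
    |avg P T ρ h| ≤ avg P T ρ fun p => |h p| := by
  rw [avg, abs_mul, abs_of_nonneg (pow_nonneg ρ.2.1.le _)]
  exact mul_le_mul_of_nonneg_left (Finset.abs_sum_le_sum_abs _ _) (pow_nonneg ρ.2.1.le _)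

theorem avg_indicator {T : ℝ} {ρ : Radius} {S : Set P.carrier} (hS : S ⊆ nearPts P T ρ) :
    avg P T ρ (S.indicator 1) = (ρ : ℝ) ^ (n * (n + 1)) * S.ncard := by
  classical
  have hfin : S.Finite := (nearPts P T ρ).finite_toSet.subset hS
  rw [avg, ← Finset.sum_subset (s₁ := hfin.toFinset)]
  · rw [Finset.sum_congr rfl (g := fun _ => (1 : ℝ))]
    · rw [Finset.sum_const, nsmul_one, ncard_eq_toFinset_card S hfin]
    · intro p hp
      simp [hfin.mem_toFinset.1 hp]
  · intro p hp
    exact hS (hfin.mem_toFinset.1 hp)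
  · intro p _ hp
    rw [hfin.mem_toFinset] at hp
    simp [hp]

/-- At the scale ρ^(-n) the density is normalized by its d-th power, and the inverse of this is the
factor ρ^(n(n+1)) in `avg`. Spheres are null, so balls are admissible test sets. -/
theorem tendsto_avg_of_density (hn : 1 ≤ n) {S : Set P.carrier} {δ : ℝ}
    (h : HasAsymptoticDensity (Subtype.val '' S) δ) {T : ℝ} (hT : 0 < T) :
    Tendsto (fun ρ => avg P T ρ (S.indicator 1)) toZero
      (𝓝 (δ * volume.real (Metric.closedBall (0 : E n) T))) := by
  classical
  have hfr : volume (frontier (Metric.closedBall (0 : E n) T)) = 0 := by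
    rw [frontier_closedBall _ hT.ne']
    exact Measure.addHaar_sphere _ _ _
  have h1 := (h _ Metric.isBounded_closedBall hfr).comp (tendsto_inv_pow_toZero hn)
  refine h1.congr fun ρ => ?_
  have hp : (0 : ℝ) < (ρ : ℝ) ^ n := pow_pos ρ.2.1 n
  have e1 : avg P T ρ (S.indicator 1) =
      avg P T ρ ((S ∩ nearPts P T ρ).indicator 1) := by
    unfold avg
    congr 1
    refine Finset.sum_congr rfl fun p hp => ?_
    simp [indicator_apply, hp]
  rw [e1, avg_indicator inter_subset_right, Function.comp_apply, div_eq_mul_inv, mul_comm]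
  congr 1
  · rw [inv_pow, inv_inv, ← pow_mul]
  · rw [← ncard_image_of_injective _ Subtype.val_injective]
    congr 2
    ext x
    simp only [mem_inter_iff, mem_image, Subtype.exists, exists_and_right, exists_eq_right,
      Finset.mem_coe, mem_nearPts, mem_closedBall_zero_iff]
    constructor
    · rintro ⟨hx, w, hw, rfl⟩
      refine ⟨hx, ?_⟩
      rwa [smul_smul, mul_inv_cancel₀ hp.ne', one_smul]
    · rintro ⟨hx, hle⟩
      refine ⟨hx, _, hle, ?_⟩
      rw [smul_smul, inv_mul_cancel₀ hp.ne', one_smul]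

theorem eventually_avg_one_le (hn : 1 ≤ n) {cP : ℝ} (hP : HasAsymptoticDensity P.carrier cP)
    (T : ℝ) : ∃ C : ℝ, 0 ≤ C ∧ ∀ᶠ ρ in toZero, avg P T ρ (fun _ => 1) ≤ C := by
  -- The density is tested on a ball of positive radius, whereas T is arbitrary.
  have hT : 0 < max T 1 := lt_max_of_lt_right one_pos
  have h := tendsto_avg_of_density hn (S := univ) (δ := cP) (by simpa using hP) hT
  refine ⟨|cP * volume.real (Metric.closedBall (0 : E n) (max T 1))| + 1, by positivity, ?_⟩
  filter_upwards [h.eventually_lt_const (lt_of_le_of_lt (le_abs_self _) (lt_add_one _))] with ρ hρ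
  refine le_trans ?_ hρ.le
  simp only [indicator_univ, avg, Pi.one_apply]
  refine mul_le_mul_of_nonneg_left ?_ (pow_nonneg ρ.2.1.le _)
  refine Finset.sum_le_sum_of_subset_of_nonneg (fun p hp => ?_) fun _ _ _ => zero_le_one
  rw [mem_nearPts] at hp ⊢
  exact hp.trans (le_max_left _ _)

variable [MetricSpace M] [CompactSpace M] [MeasurableSpace M] [BorelSpace M]

theorem tendsto_avg_indicator (hn : 1 ≤ n) {mark : P.carrier → M} {cP : ℝ} {m : Measure M}
    (hP1 : UniformDensity P mark cP m) {T : ℝ} {B : Set (E n × M)}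
    (hB : ∀ z ∈ B, ‖z.1‖ ≤ T) (hfr : (volume.prod m) (frontier B) = 0) :
    Tendsto (fun ρ : Radius => avg P T ρ
      ({p : P.carrier | ((ρ : ℝ) ^ n • (p : E n), mark p) ∈ B}.indicator 1)) toZero
      (𝓝 (cP * (volume.prod m).real B)) := by
  have hbdd : Bornology.IsBounded B := by
    refine ((isCompact_closedBall (0 : E n) T).prod (isCompact_univ (X := M))).isBounded.subset ?_
    exact fun z hz => ⟨by simpa using hB z hz, mem_univ _⟩
  refine ((hP1 B hbdd hfr).comp (tendsto_inv_pow_toZero hn)).congr fun ρ => ?_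
  have hp : (0 : ℝ) < (ρ : ℝ) ^ n := pow_pos ρ.2.1 n
  rw [avg_indicator, Function.comp_apply, div_eq_mul_inv, mul_comm]
  · congr 1
    · rw [inv_pow, inv_inv, ← pow_mul]
    · have hinj : Function.Injective fun p : P.carrier => ((p : E n), mark p) := fun p q h =>
        Subtype.ext (congrArg Prod.fst h)
      rw [← ncard_image_of_injective _ hinj]
      congr 2
      ext x
      constructor
      · rintro ⟨⟨p, rfl⟩, w, hw, h⟩
        refine ⟨p, ?_, rfl⟩
        have h1 : ((ρ : ℝ) ^ n)⁻¹ • w.1 = p := congrArg Prod.fst h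
        have h2 : w.2 = mark p := congrArg Prod.snd h
        rw [mem_ofPred_eq, ← h1, ← h2, smul_smul, mul_inv_cancel₀ hp.ne', one_smul]
        exact hw
      · rintro ⟨p, hpB, rfl⟩
        refine ⟨⟨p, rfl⟩, _, hpB, Prod.ext ?_ rfl⟩
        change ((ρ : ℝ) ^ n)⁻¹ • ((ρ : ℝ) ^ n • (p : E n)) = p
        rw [smul_smul, inv_mul_cancel₀ hp.ne', one_smul]
  · intro p hpB
    exact Finset.mem_coe.2 (mem_nearPts.2 (hB ((ρ : ℝ) ^ n • (p : E n), mark p) hpB))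

theorem integral_Ioc_indicator_le {x C : ℝ} (hx0 : 0 ≤ x) (hxC : x ≤ C) :
    ∫ t in Ioc 0 C, (Iic x).indicator (fun _ => (1 : ℝ)) t = x := by
  rw [setIntegral_indicator measurableSet_Iic, setIntegral_const, Ioc_inter_Iic,
    inf_eq_right.2 hxC]
  simp [hx0]

/-- Layer cake: a is the integral over t of the indicators of {a ≥ t}, whose averages converge when
the boundary is null. Dominated convergence in t, with a bound on the number of scatterers,
finishes. -/
theorem tendsto_avg_of_nonneg (hn : 1 ≤ n) {mark : P.carrier → M} {cP : ℝ}
    (hP : HasAsymptoticDensity P.carrier cP) {m : Measure M} [IsProbabilityMeasure m]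
    (hP1 : UniformDensity P mark cP m) {T : ℝ} {a : E n × M → ℝ} (ha : Continuous a)
    (h0 : ∀ z, 0 ≤ a z) (hsupp : ∀ z : E n × M, T < ‖z.1‖ → a z = 0) :
    Tendsto (fun ρ : Radius => avg P T ρ fun p => a ((ρ : ℝ) ^ n • (p : E n), mark p)) toZero
      (𝓝 (cP * ∫ z, a z ∂(volume.prod m))) := by
  have hK := (isCompact_closedBall (0 : E n) T).prod (isCompact_univ (X := M))
  have hcs : HasCompactSupport a := by
    refine HasCompactSupport.intro hK fun z hz => hsupp z ?_
    by_contra! h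
    exact hz ⟨by simpa using h, mem_univ _⟩
  obtain ⟨C, hC⟩ := ha.bounded_above_of_compact_support hcs
  have haC : ∀ z, a z ≤ C := fun z => (le_abs_self _).trans (hC z)
  have hint : Integrable a (volume.prod m) := ha.integrable_of_hasCompactSupport hcs
  have e1 : ∀ ρ : Radius, (avg P T ρ fun p => a ((ρ : ℝ) ^ n • (p : E n), mark p)) =
      ∫ t in Ioc 0 C, avg P T ρ
        ({p : P.carrier | ((ρ : ℝ) ^ n • (p : E n), mark p) ∈ {z | t ≤ a z}}.indicator 1) := by
    intro ρ
    unfold avg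
    rw [integral_const_mul, integral_finsetSum]
    · congr 1
      refine Finset.sum_congr rfl fun p _ => ?_
      exact (integral_Ioc_indicator_le (h0 _) (haC _)).symm
    · intro p _
      exact (integrable_const (1 : ℝ)).indicator measurableSet_Iic
  simp_rw [e1]
  rw [hint.integral_eq_integral_Ioc_meas_le (Eventually.of_forall h0) (Eventually.of_forall haC),
    ← integral_const_mul]
  obtain ⟨C', hC'0, hC'⟩ := eventually_avg_one_le hn hP T
  refine tendsto_integral_filter_of_dominated_convergence (fun _ => C') ?_ ?_
    (integrable_const _) ?_
  · refine Eventually.of_forall fun ρ => ?_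
    unfold avg
    refine AEStronglyMeasurable.const_mul (Finset.aestronglyMeasurable_fun_sum _ fun p _ => ?_) _
    exact ((integrable_const (1 : ℝ)).indicator measurableSet_Iic).aestronglyMeasurable
  · filter_upwards [hC'] with ρ hρ
    refine Eventually.of_forall fun t => ?_
    refine (Real.norm_of_nonneg (avg_nonneg fun p =>
      indicator_nonneg (fun _ _ => zero_le_one) p)).trans_le ?_
    refine le_trans (avg_mono fun p _ => ?_) hρ
    exact indicator_le_self' (fun _ _ => zero_le_one) p
  -- The boundary of {a ≥ t} lies in the level set {a = t}, and only countably many level sets have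
  -- positive measure.
  · have hcount := Measure.countable_meas_level_set_pos (μ := volume.prod m) ha.measurable
    have hae : ∀ᵐ t : ℝ, t ∉ {t : ℝ | 0 < (volume.prod m) {z | a z = t}} :=
      hcount.ae_notMem _
    rw [ae_restrict_iff' measurableSet_Ioc]
    filter_upwards [hae] with t ht ht0
    refine tendsto_avg_indicator (B := {z | t ≤ a z}) hn hP1 (fun z hz => ?_) ?_
    · by_contra! h
      have := hsupp z h
      rw [mem_ofPred_eq, this] at hz
      exact absurd ht0.1 (not_lt.2 hz)
    · refine measure_mono_null (frontier_le_subset_eq continuous_const ha) ?_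
      rw [not_lt, nonpos_iff_eq_zero] at ht
      refine measure_mono_null (fun z hz => ?_) ht
      exact hz.symm

theorem tendsto_avg (hn : 1 ≤ n) {mark : P.carrier → M} {cP : ℝ}
    (hP : HasAsymptoticDensity P.carrier cP) {m : Measure M} [IsProbabilityMeasure m]
    (hP1 : UniformDensity P mark cP m) {T : ℝ} {a : E n × M → ℝ} (ha : Continuous a)
    (hsupp : ∀ z : E n × M, T < ‖z.1‖ → a z = 0) :
    Tendsto (fun ρ : Radius => avg P T ρ fun p => a ((ρ : ℝ) ^ n • (p : E n), mark p)) toZero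
      (𝓝 (cP * ∫ z, a z ∂(volume.prod m))) := by
  have hcs : ∀ b : E n × M → ℝ, (∀ z : E n × M, T < ‖z.1‖ → b z = 0) → HasCompactSupport b := by
    intro b hb
    refine HasCompactSupport.intro ((isCompact_closedBall (0 : E n) T).prod
      (isCompact_univ (X := M))) fun z hz => hb z ?_
    by_contra! h
    exact hz ⟨by simpa using h, mem_univ _⟩
  have hp : Continuous fun z => max (a z) 0 := ha.max continuous_const
  have hm : Continuous fun z => max (-a z) 0 := ha.neg.max continuous_const
  have sp : ∀ z : E n × M, T < ‖z.1‖ → max (a z) 0 = 0 := fun z hz => by simp [hsupp z hz]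
  have sm : ∀ z : E n × M, T < ‖z.1‖ → max (-a z) 0 = 0 := fun z hz => by simp [hsupp z hz]
  have h1 := tendsto_avg_of_nonneg hn hP hP1 hp (fun z => le_max_right _ _) sp
  have h2 := tendsto_avg_of_nonneg hn hP hP1 hm (fun z => le_max_right _ _) sm
  have e : ∀ x : ℝ, max x 0 - max (-x) 0 = x := fun x => by
    rcases le_total 0 x with h | h
    · rw [max_eq_left h, max_eq_right (by linarith), sub_zero]
    · rw [max_eq_right h, max_eq_left (by linarith)]; ring
  have h3 := h1.sub h2
  rw [← mul_sub, ← integral_sub (hp.integrable_of_hasCompactSupport (hcs _ sp))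
    (hm.integrable_of_hasCompactSupport (hcs _ sm))] at h3
  simp_rw [← avg_sub, e] at h3
  exact h3

end Averages

end LorentzGas

namespace LorentzGas

/-! ### Uniform spherical equidistribution, averaged over scatterers. -/

section Equidistribution

variable {n : ℕ} {M : Type*} [MetricSpace M] [CompactSpace M] [MeasurableSpace M] [BorelSpace M]

instance : IsFiniteMeasure (omega n) := by unfold omega; infer_instance

/-- A continuous function is uniformly continuous at the points of a compact set for every metric
inducing the topology. Hence the metric chosen in [P2] does not matter once the limits form a
compact family. -/
theorem exists_dist_lt_of_isCompact {S : Type*} {t : TopologicalSpace S} (D : MetricSpace S)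
    (hD : D.toPseudoMetricSpace.toUniformSpace.toTopologicalSpace = t) {K : Set S}
    (hK : @IsCompact S t K) {Φ : S → ℝ} (hΦ : Continuous[t, _] Φ) {ε : ℝ} (hε : 0 < ε) :
    ∃ δ : ℝ, 0 < δ ∧ ∀ P ∈ K, ∀ Q, D.dist Q P < δ → |Φ Q - Φ P| < ε := by
  subst hD
  have hu := hK.uniformContinuousAt_of_continuousAt Φ (fun x _ => hΦ.continuousAt)
    (Metric.dist_mem_uniformity hε)
  obtain ⟨δ, hδ, h⟩ := Metric.mem_uniformity_dist.1 hu
  refine ⟨δ, hδ, fun P hP Q hQ => ?_⟩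
  have hQ' : dist P Q < δ := by rw [dist_comm]; exact hQ
  have h1 : dist (Φ P) (Φ Q) < ε := h hQ' hP
  rwa [dist_comm, Real.dist_eq] at h1

/-- Uniform weak convergence to a compact family gives uniform convergence of expectations. -/
theorem UniformWeakLimit.eventually_integral {J S : Type*} [TopologicalSpace S] [MeasurableSpace S]
    [BorelSpace S] {Jset : Radius → Set J} {a : Radius → J → ProbabilityMeasure S}
    {ν : J → ProbabilityMeasure S} (h : UniformWeakLimit Jset a ν)
    {K : Set (ProbabilityMeasure S)} (hK : IsCompact K) (hν : ∀ j, ν j ∈ K)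
    {F : S → ℝ} (hF : Continuous F) {C : ℝ} (hC : ∀ x, |F x| ≤ C) {ε : ℝ} (hε : 0 < ε) :
    ∀ᶠ ρ in toZero, ∀ j ∈ Jset ρ,
      |∫ x, F x ∂(a ρ j : Measure S) - ∫ x, F x ∂(ν j : Measure S)| < ε := by
  obtain ⟨D, hD, hlim⟩ := h
  let Fb := BoundedContinuousFunction.ofNormedAddCommGroup F hF C hC
  have hcont : Continuous fun P : ProbabilityMeasure S => ∫ x, F x ∂(P : Measure S) :=
    continuous_iff_continuousAt.2 fun P =>
      ProbabilityMeasure.tendsto_iff_forall_integral_tendsto.1 tendsto_id Fb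
  obtain ⟨δ, hδ, hd⟩ := exists_dist_lt_of_isCompact D hD hK hcont hε
  obtain ⟨ρ₀, hρ₀⟩ := hlim δ hδ
  filter_upwards [eventually_toZero_lt ρ₀.2.1] with ρ hρ j hj
  exact hd _ (hν j) _ (hρ₀ ρ hρ j hj)

theorem integral_microLaw (R : FrameRotation n) (P : PointSet (E n)) (mark : P.carrier → M)
    (ρ : Radius) (q : E n) (lam : ProbabilityMeasure (Sph n))
    {F : CountingMeasure (E n × M) → ℝ} (hF : Continuous F) :
    ∫ η, F η ∂(microLaw R P mark ρ q lam : Measure (CountingMeasure (E n × M))) =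
      ∫ v, F (Qset R P mark ρ q v).toCounting ∂(lam : Measure (Sph n)) := by
  unfold microLaw
  rw [ProbabilityMeasure.toMeasure_map]
  exact integral_map (measurable_toCounting.comp
    (measurable_Qset_dir R P mark ρ q)).aemeasurable hF.measurable.aestronglyMeasurable

/-- Spherical equidistribution for a fixed exceptional set. -/
def EquidistributionOff (R : FrameRotation n) (P : PointSet (E n)) (mark : P.carrier → M)
    (μ : M → ProbabilityMeasure (CountingMeasure (E n × M))) (Exc : Set P.carrier) : Prop :=
  ∀ T : ℝ, 1 ≤ T → ∀ lam : ProbabilityMeasure (Sph n), (lam : Measure (Sph n)) ≪ omega n →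
    UniformWeakLimit
      (fun ρ => {q : P.carrier | (q : E n) ∈ Metric.ball 0 (T * ((ρ : ℝ) ^ n)⁻¹) ∧ q ∉ Exc})
      (fun ρ q => microLaw R P mark ρ q lam) (fun q => μ (mark q))

variable {R : FrameRotation n} {P : PointSet (E n)} {mark : P.carrier → M}
  {μ : M → ProbabilityMeasure (CountingMeasure (E n × M))}

/-- Normalized, k is the density of an absolutely continuous law of v, to which [P2] applies. The
limit laws lie in the image of the compact mark space under μ, which is compact. -/
theorem EquidistributionOff.eventually_density {Exc : Set P.carrier}
    (h : EquidistributionOff R P mark μ Exc) (hμ : Continuous μ) {k : Sph n → ℝ}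
    (hk : Continuous k) (hk0 : ∀ v, 0 ≤ k v) {F : CountingMeasure (E n × M) → ℝ}
    (hF : Continuous F) {C : ℝ} (hC : ∀ x, |F x| ≤ C) (T : ℝ) {ε : ℝ} (hε : 0 < ε) :
    ∀ᶠ ρ in toZero, ∀ p ∈ nearPts P T ρ, p ∉ Exc →
      |∫ v, k v * F (Qset R P mark ρ p v).toCounting ∂(omega n) -
        (∫ v, k v ∂(omega n)) *
          ∫ η, F η ∂(μ (mark p) : Measure (CountingMeasure (E n × M)))| ≤ ε := by
  set I := ∫ v, k v ∂(omega n) with hI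
  have hkint : Integrable k (omega n) :=
    hk.integrable_of_hasCompactSupport (HasCompactSupport.of_compactSpace _)
  have hI0 : 0 ≤ I := integral_nonneg hk0
  -- A density of integral zero cannot be normalized, but then both terms vanish.
  rcases hI0.eq_or_lt with h0 | hIpos
  · have hz : k =ᵐ[omega n] 0 := (integral_eq_zero_iff_of_nonneg hk0 hkint).1 h0.symm
    refine Eventually.of_forall fun ρ p _ _ => ?_
    rw [← h0, zero_mul, sub_zero, integral_eq_zero_of_ae]
    · simpa using hε.le
    · filter_upwards [hz] with v hv
      simp [hv]
  · let f : Sph n → ℝ≥0∞ := fun v => ENNReal.ofReal (k v / I)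
    have hf : Measurable f := (ENNReal.measurable_ofReal.comp (hk.measurable.div_const I))
    have hprob : IsProbabilityMeasure ((omega n).withDensity f) := by
      refine ⟨?_⟩
      rw [withDensity_apply _ MeasurableSet.univ, Measure.restrict_univ,
        ← ofReal_integral_eq_lintegral_ofReal (hkint.div_const I)
          (Eventually.of_forall fun v => div_nonneg (hk0 v) hI0), integral_div, ← hI,
        div_self hIpos.ne', ENNReal.ofReal_one]
    let lam : ProbabilityMeasure (Sph n) := ⟨(omega n).withDensity f, hprob⟩
    have hac : (lam : Measure (Sph n)) ≪ omega n := withDensity_absolutelyContinuous _ _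
    -- This radius is at least 1, and its open ball contains the closed ball of radius T that
    -- defines `nearPts`.
    have h1 := (h (max T 0 + 1) (by simp) lam hac).eventually_integral
      (isCompact_range hμ) (fun j => mem_range_self _) hF hC (div_pos hε hIpos)
    filter_upwards [h1] with ρ hρ p hp hpE
    have hpos : (0 : ℝ) < (ρ : ℝ) ^ n := pow_pos ρ.2.1 n
    have h2 := hρ p ⟨by
      rw [mem_ball_zero_iff, ← div_eq_mul_inv, lt_div_iff₀ hpos, mul_comm]
      have := mem_nearPts.1 hp
      rw [norm_smul, Real.norm_of_nonneg hpos.le] at this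
      linarith [le_max_left T 0], hpE⟩
    rw [integral_microLaw R P mark ρ p lam hF] at h2
    have h3 : ∫ v, F (Qset R P mark ρ p v).toCounting ∂(lam : Measure (Sph n)) =
        (∫ v, k v * F (Qset R P mark ρ p v).toCounting ∂(omega n)) / I := by
      change ∫ v, F (Qset R P mark ρ p v).toCounting ∂((omega n).withDensity f) = _
      rw [integral_withDensity_eq_integral_toReal_smul hf
        (Eventually.of_forall fun v => ENNReal.ofReal_lt_top), ← integral_div]
      refine integral_congr_ae (Eventually.of_forall fun v => ?_)
      simp only [f]
      rw [ENNReal.toReal_ofReal (div_nonneg (hk0 v) hI0), smul_eq_mul]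
      ring
    rw [h3] at h2
    have h4 : ∀ x y : ℝ, |x / I - y| < ε / I → |x - I * y| ≤ ε := by
      intro x y hxy
      have e : x - I * y = I * (x / I - y) := by field_simp
      rw [e, abs_mul, abs_of_pos hIpos]
      rw [lt_div_iff₀ hIpos] at hxy
      linarith
    exact h4 _ _ h2

/-- Families of observables depending on a mark in a uniformly continuous way. -/
structure MarkedObservable (F : M → CountingMeasure (E n × M) → ℝ) (C : ℝ) : Prop where
  continuous : ∀ s, Continuous (F s)
  bound : ∀ s η, |F s η| ≤ C
  modulus : ∀ ε : ℝ, 0 < ε → ∃ δ : ℝ, 0 < δ ∧ ∀ s s' : M, dist s s' < δ →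
    ∀ η, |F s η - F s' η| ≤ ε

theorem integrable_bounded {Ω : Type*} [MeasurableSpace Ω] {ν : Measure Ω} [IsFiniteMeasure ν]
    {f : Ω → ℝ} (hf : Measurable f) {C : ℝ} (hC : ∀ x, |f x| ≤ C) : Integrable f ν :=
  Integrable.of_bound hf.aestronglyMeasurable C (Eventually.of_forall hC)

theorem abs_integral_sub_le {Ω : Type*} [MeasurableSpace Ω] {ν : Measure Ω} [IsFiniteMeasure ν]
    {f g : Ω → ℝ} (hf : Integrable f ν) (hg : Integrable g ν) {ε : ℝ}
    (h : ∀ x, |f x - g x| ≤ ε) : |∫ x, f x ∂ν - ∫ x, g x ∂ν| ≤ ε * ν.real univ := by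
  rw [← integral_sub hf hg]
  have h1 : ∀ᵐ x ∂ν, ‖f x - g x‖ ≤ ε := Eventually.of_forall h
  exact norm_integral_le_of_norm_le_const h1

theorem MarkedObservable.continuous_expect {F : M → CountingMeasure (E n × M) → ℝ} {C : ℝ}
    (hF : MarkedObservable F C) (hμ : Continuous μ) :
    Continuous fun s => ∫ η, F s η ∂(μ s : Measure (CountingMeasure (E n × M))) := by
  rw [Metric.continuous_iff]
  intro s₀ ε hε
  obtain ⟨δ, hδ, h⟩ := hF.modulus (ε / 2) (half_pos hε)
  obtain ⟨δ', hδ', h'⟩ := Metric.continuous_iff.1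
    (continuous_integral_prob hμ (hF.continuous s₀) (hF.bound s₀)) s₀ (ε / 2) (half_pos hε)
  refine ⟨min δ δ', lt_min hδ hδ', fun s hs => ?_⟩
  have hi : ∀ s, Integrable (F s) (μ s₀ : Measure (CountingMeasure (E n × M))) := fun s =>
    integrable_bounded (hF.continuous s).measurable (hF.bound s)
  have hi' : ∀ s', Integrable (F s') (μ s : Measure (CountingMeasure (E n × M))) := fun s =>
    integrable_bounded (hF.continuous s).measurable (hF.bound s)
  have h1 := abs_integral_sub_le (hi' s) (hi' s₀) (h s s₀ (hs.trans_le (min_le_left _ _)))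
  have h2 := h' s (hs.trans_le (min_le_right _ _))
  rw [probReal_univ, mul_one] at h1
  rw [Real.dist_eq] at h2 ⊢
  refine (abs_sub_le _ _ _).trans_lt (by linarith)

theorem mul_sub_mul_abs_le {a b a' b' A B : ℝ} (ha : |a| ≤ A) (hb' : |b'| ≤ B) :
    |a * b - a' * b'| ≤ A * |b - b'| + |a - a'| * B := by
  have e : a * b - a' * b' = a * (b - b') + (a - a') * b' := by ring
  rw [e]
  refine (abs_add_le _ _).trans ?_
  rw [abs_mul, abs_mul]
  gcongr

/-- Averages over the scatterers of the expectations of observables of `𝒬_ρ(p, v)` converge. -/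
theorem tendsto_avg_observable (hn : 1 ≤ n) {cP : ℝ}
    (hP : HasAsymptoticDensity P.carrier cP) {m : Measure M} [IsProbabilityMeasure m]
    (hP1 : UniformDensity P mark cP m) (hP2 : SphericalEquidistribution R P mark μ)
    (hμ : Continuous μ) {T : ℝ} {g : E n × Sph n → ℝ} (hg : Continuous g) (hg0 : ∀ z, 0 ≤ g z)
    (hsupp : ∀ z : E n × Sph n, T < ‖z.1‖ → g z = 0)
    {F : M → CountingMeasure (E n × M) → ℝ} {C : ℝ} (hF : MarkedObservable F C) :
    Tendsto (fun ρ : Radius => avg P T ρ fun p =>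
        ∫ v, g ((ρ : ℝ) ^ n • (p : E n), v) * F (mark p) (Qset R P mark ρ p v).toCounting
          ∂(omega n)) toZero
      (𝓝 (cP * ∫ z, (∫ v, g (z.1, v) ∂(omega n)) *
        (∫ η, F z.2 η ∂(μ z.2 : Measure (CountingMeasure (E n × M)))) ∂(volume.prod m))) := by
  obtain ⟨Exc, hExc, hoff⟩ := hP2
  replace hoff : EquidistributionOff R P mark μ Exc := hoff
  have hne : Nonempty M := nonempty_of_isProbabilityMeasure m
  set K : Set (E n × M) := Metric.closedBall (0 : E n) T ×ˢ univ with hKdef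
  have hK : IsCompact K := (isCompact_closedBall (0 : E n) T).prod isCompact_univ
  have hgcs : HasCompactSupport g := by
    refine HasCompactSupport.intro ((isCompact_closedBall (0 : E n) T).prod
      (isCompact_univ (X := Sph n))) fun z hz => hsupp z ?_
    by_contra! h
    exact hz ⟨by simpa using h, mem_univ _⟩
  -- The bound is evaluated at the empty configuration.
  have hC0 : 0 ≤ C := (abs_nonneg _).trans (hF.bound hne.some ⟨0, by simp, PEmpty, PEmpty.elim, by simp⟩)
  obtain ⟨G, hG⟩ := hg.bounded_above_of_compact_support hgcs
  have hG0 : 0 ≤ G := by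
    by_contra! h
    have hE : IsEmpty (Sph n) := ⟨fun v => absurd ((norm_nonneg _).trans (hG (0, v))) (by linarith)⟩
    have := (NormedSpace.sphere_nonempty (E := E n) (x := 0) (r := 1)).2 zero_le_one
    exact hE.elim ⟨_, this.some_mem⟩
  set W := (omega n).real univ with hW
  have hW0 : 0 ≤ W := measureReal_nonneg
  have hgx : ∀ x, Continuous fun v => g (x, v) := fun x => hg.comp (by fun_prop)
  have hgint : ∀ x, Integrable (fun v => g (x, v)) (omega n) := fun x =>
    integrable_bounded (hgx x).measurable fun v => hG _
  have hQm : ∀ (ρ : Radius) (p : E n) s,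
      Measurable fun v => F s (Qset R P mark ρ p v).toCounting := fun ρ p s =>
    (hF.continuous s).measurable.comp
      (measurable_toCounting.comp (measurable_Qset_dir R P mark ρ p))
  have hprodint : ∀ (ρ : Radius) (p : E n) x s,
      Integrable (fun v => g (x, v) * F s (Qset R P mark ρ p v).toCounting) (omega n) := by
    intro ρ p x s
    refine integrable_bounded (C := G * C) ((hgx x).measurable.mul (hQm ρ p s)) fun v => ?_
    rw [abs_mul]
    exact mul_le_mul (hG _) (hF.bound _ _) (abs_nonneg _) hG0
  have hFint : ∀ s s', Integrable (F s) (μ s' : Measure (CountingMeasure (E n × M))) :=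
    fun s s' => integrable_bounded (hF.continuous s).measurable (hF.bound s)
  -- The argument z of the weight and the observable is decoupled from the scatterer p. For each
  -- fixed z, [P2] brings `e` close to `l` uniformly in p; equicontinuity in z extends this to all z
  -- in the compact set K, after which z may be set to the rescaled position and mark of p.
  let e : Radius → P.carrier → E n × M → ℝ := fun ρ p z =>
    ∫ v, g (z.1, v) * F z.2 (Qset R P mark ρ p v).toCounting ∂(omega n)
  let l : P.carrier → E n × M → ℝ := fun p z => (∫ v, g (z.1, v) ∂(omega n)) *
    ∫ η, F z.2 η ∂(μ (mark p) : Measure (CountingMeasure (E n × M)))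
  have hIg : ∀ x, |∫ v, g (x, v) ∂(omega n)| ≤ G * W := fun x =>
    norm_integral_le_of_norm_le_const (Eventually.of_forall fun v => hG (x, v))
  have hIF : ∀ s s', |∫ η, F s η ∂(μ s' : Measure (CountingMeasure (E n × M)))| ≤ C := by
    intro s s'
    have h : ‖∫ η, F s η ∂(μ s' : Measure (CountingMeasure (E n × M)))‖ ≤ _ :=
      norm_integral_le_of_norm_le_const (Eventually.of_forall (hF.bound s))
    rw [probReal_univ, mul_one] at h
    exact h
  have he : ∀ ρ p z, |e ρ p z| ≤ G * C * W := fun ρ p z => by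
    have h1 : ∀ᵐ v ∂(omega n), ‖g (z.1, v) * F z.2 (Qset R P mark ρ p v).toCounting‖ ≤ G * C :=
      Eventually.of_forall fun v => by
        rw [norm_mul]
        exact mul_le_mul (hG _) (hF.bound _ _) (abs_nonneg _) hG0
    exact norm_integral_le_of_norm_le_const h1
  have hl : ∀ p z, |l p z| ≤ G * C * W := fun p z => by
    rw [abs_mul]
    refine (mul_le_mul (hIg _) (hIF _ _) (abs_nonneg _) (by positivity)).trans_eq (by ring)
  -- equicontinuity
  have equi : ∀ ε : ℝ, 0 < ε → ∀ z₀ : E n × M, ∀ᶠ z in 𝓝 z₀, ∀ ρ p,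
      |e ρ p z - e ρ p z₀| ≤ ε ∧ |l p z - l p z₀| ≤ ε := by
    intro ε hε z₀
    set ε' := ε / ((G + C) * (W + 1) + 1) with hε'
    have hden : 0 < (G + C) * (W + 1) + 1 := by positivity
    have hε'0 : 0 < ε' := div_pos hε hden
    have hε'le : ε' * ((G + C) * (W + 1)) ≤ ε := by
      have : ε' * ((G + C) * (W + 1) + 1) = ε := by rw [hε']; field_simp
      nlinarith
    have h1 : ∀ᶠ z in 𝓝 z₀, ∀ v, |g (z.1, v) - g (z₀.1, v)| ≤ ε' := by
      obtain ⟨δ, hδ, h⟩ := Metric.uniformContinuous_iff.1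
        (hgcs.uniformContinuous_of_continuous hg) ε' hε'0
      have h2 : ∀ᶠ z : E n × M in 𝓝 z₀, dist z.1 z₀.1 < δ :=
        (continuous_fst.tendsto z₀).eventually (Metric.ball_mem_nhds _ hδ)
      filter_upwards [h2] with z hz v
      rw [← Real.dist_eq]
      refine (h ?_).le
      rw [Prod.dist_eq]
      exact max_lt hz (by simpa using hδ)
    have h2 : ∀ᶠ z in 𝓝 z₀, ∀ η, |F z.2 η - F z₀.2 η| ≤ ε' := by
      obtain ⟨δ, hδ, h⟩ := hF.modulus ε' hε'0
      have h2 : ∀ᶠ z : E n × M in 𝓝 z₀, dist z.2 z₀.2 < δ :=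
        (continuous_snd.tendsto z₀).eventually (Metric.ball_mem_nhds _ hδ)
      filter_upwards [h2] with z hz η
      exact h _ _ hz η
    filter_upwards [h1, h2] with z hz1 hz2 ρ p
    constructor
    · have := abs_integral_sub_le (hprodint ρ p z.1 z.2) (hprodint ρ p z₀.1 z₀.2)
        (ε := ε' * (G + C)) fun v => by
          refine (mul_sub_mul_abs_le (hG _) (hF.bound _ _)).trans ?_
          have a1 := mul_le_mul_of_nonneg_left (hz2 (Qset R P mark ρ p v).toCounting) hG0
          have a2 := mul_le_mul_of_nonneg_right (hz1 v) hC0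
          linarith
      refine this.trans (le_trans ?_ hε'le)
      rw [mul_assoc]
      have : (0 : ℝ) ≤ ε' * (G + C) := by positivity
      nlinarith
    · have a1 := abs_integral_sub_le (hgint z.1) (hgint z₀.1) hz1
      have a2 := abs_integral_sub_le (hFint z.2 (mark p)) (hFint z₀.2 (mark p)) hz2
      rw [probReal_univ, mul_one] at a2
      refine (mul_sub_mul_abs_le (hIg _) (hIF _ _)).trans ?_
      have a3 := mul_le_mul_of_nonneg_left a2 (show 0 ≤ G * W by positivity)
      have a4 := mul_le_mul_of_nonneg_right a1 hC0
      refine le_trans (add_le_add a3 a4) (le_trans ?_ hε'le)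
      have : (0 : ℝ) ≤ ε' * (G + C) := by positivity
      nlinarith
  -- uniform convergence of the expectations
  have unif : ∀ ε : ℝ, 0 < ε → ∀ᶠ ρ in toZero, ∀ p ∈ nearPts P T ρ, p ∉ Exc →
      ∀ z ∈ K, |e ρ p z - l p z| ≤ ε := by
    intro ε hε
    obtain ⟨t, -, ht⟩ := hK.elim_nhds_subcover _ fun z₀ _ => equi (ε / 3) (by positivity) z₀
    have h1 : ∀ᶠ ρ in toZero, ∀ z₀ ∈ t, ∀ p ∈ nearPts P T ρ, p ∉ Exc →
        |e ρ p z₀ - l p z₀| ≤ ε / 3 := by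
      rw [Filter.eventually_all_finset]
      intro z₀ _
      exact hoff.eventually_density hμ (hgx z₀.1) (fun v => hg0 _) (hF.continuous z₀.2)
        (hF.bound z₀.2) T (by positivity)
    filter_upwards [h1] with ρ hρ p hp hpE z hz
    obtain ⟨z₀, hz₀, hzz⟩ := mem_iUnion₂.1 (ht hz)
    have b1 := hρ z₀ hz₀ p hp hpE
    obtain ⟨b2, b3⟩ := hzz ρ p
    rw [abs_sub_comm] at b3
    have := abs_sub_le (e ρ p z) (e ρ p z₀) (l p z)
    have := abs_sub_le (e ρ p z₀) (l p z₀) (l p z)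
    linarith
  let a : E n × M → ℝ := fun z => (∫ v, g (z.1, v) ∂(omega n)) *
    ∫ η, F z.2 η ∂(μ z.2 : Measure (CountingMeasure (E n × M)))
  have hacont : Continuous a := by
    refine Continuous.mul ?_ ((hF.continuous_expect hμ).comp continuous_snd)
    have : Continuous fun x : E n => ∫ v, g (x, v) ∂(omega n) := by
      refine continuous_of_dominated (bound := fun _ => G)
        (fun x => (hgx x).aestronglyMeasurable) (fun x => Eventually.of_forall fun v => hG _)
        (integrable_const _) (Eventually.of_forall fun v => hg.comp (by fun_prop))
    exact this.comp continuous_fst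
  have hasupp : ∀ z : E n × M, T < ‖z.1‖ → a z = 0 := by
    intro z hz
    have : ∀ v, g (z.1, v) = 0 := fun v => hsupp (z.1, v) hz
    simp [a, this]
  have hlim := tendsto_avg hn hP hP1 hacont hasupp
  -- Ordinary scatterers contribute little by `unif`. Exceptional ones contribute a bounded amount
  -- each and have density zero.
  have hdiff : Tendsto (fun ρ : Radius => avg P T ρ fun p =>
      e ρ p ((ρ : ℝ) ^ n • (p : E n), mark p) - a ((ρ : ℝ) ^ n • (p : E n), mark p)) toZero
      (𝓝 0) := by
    rw [Metric.tendsto_nhds]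
    intro ε hε
    obtain ⟨A, hA0, hA⟩ := eventually_avg_one_le hn hP T
    set B := G * C * W + G * C * W with hB
    have hB0 : 0 ≤ B := by positivity
    have hEx : ∀ᶠ ρ in toZero, avg P T ρ (Exc.indicator 1) ≤ ε / 3 / (B + 1) := by
      have h0 := tendsto_avg_of_density hn hExc (T := max T 1) (lt_max_of_lt_right one_pos)
      rw [zero_mul] at h0
      filter_upwards [h0.eventually_lt_const (show 0 < ε / 3 / (B + 1) by positivity)] with ρ hρ
      refine le_trans ?_ hρ.le
      refine mul_le_mul_of_nonneg_left ?_ (pow_nonneg ρ.2.1.le _)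
      refine Finset.sum_le_sum_of_subset_of_nonneg (fun p hp => ?_)
        fun _ _ _ => indicator_nonneg (fun _ _ => zero_le_one) _
      rw [mem_nearPts] at hp ⊢
      exact hp.trans (le_max_left _ _)
    filter_upwards [hA, hEx, unif (ε / 3 / (A + 1)) (by positivity)] with ρ h1 h2 h3
    rw [dist_zero_right, Real.norm_eq_abs]
    refine (abs_avg_le _).trans_lt ?_
    have hle : ∀ p ∈ nearPts P T ρ,
        |e ρ p ((ρ : ℝ) ^ n • (p : E n), mark p) - a ((ρ : ℝ) ^ n • (p : E n), mark p)| ≤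
          ε / 3 / (A + 1) * 1 + B * Exc.indicator 1 p := by
      intro p hp
      have hpK : ((ρ : ℝ) ^ n • (p : E n), mark p) ∈ K :=
        ⟨by simpa using mem_nearPts.1 hp, mem_univ _⟩
      by_cases hpE : p ∈ Exc
      · have b1 := he ρ p ((ρ : ℝ) ^ n • (p : E n), mark p)
        have b2 := hl p ((ρ : ℝ) ^ n • (p : E n), mark p)
        have b3 := abs_sub (e ρ p ((ρ : ℝ) ^ n • (p : E n), mark p))
          (l p ((ρ : ℝ) ^ n • (p : E n), mark p))
        rw [indicator_of_mem hpE, Pi.one_apply, mul_one]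
        have : 0 < ε / 3 / (A + 1) * 1 := by positivity
        refine (b3.trans (add_le_add b1 b2)).trans (by linarith)
      · rw [indicator_of_notMem hpE, mul_zero, add_zero, mul_one]
        exact h3 p hp hpE _ hpK
    refine (avg_mono hle).trans_lt ?_
    rw [avg_add, avg_const_mul, avg_const_mul]
    have c1 : ε / 3 / (A + 1) * avg P T ρ (fun _ => 1) ≤ ε / 3 / (A + 1) * (A + 1) := by
      gcongr; linarith
    have c2 : B * avg P T ρ (Exc.indicator 1) ≤ (B + 1) * (ε / 3 / (B + 1)) := by
      refine mul_le_mul (by linarith) h2 (avg_nonneg fun p => ?_) (by positivity)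
      exact indicator_nonneg (fun _ _ => zero_le_one) _
    have c3 : ε / 3 / (A + 1) * (A + 1) = ε / 3 := by field_simp
    have c4 : (B + 1) * (ε / 3 / (B + 1)) = ε / 3 := by field_simp
    linarith
  have := hlim.add hdiff
  rw [add_zero] at this
  refine this.congr fun ρ => ?_
  rw [avg_sub]
  simp only [e, add_sub_cancel]

end Equidistribution

end LorentzGas

namespace LorentzGas

/-! ### Geometry of the particle frame. -/

section FrameGeometry

variable {n : ℕ}

theorem rowMul_add (x y : E n) (A : Matrix (Fin (n + 1)) (Fin (n + 1)) ℝ) :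
    rowMul (x + y) A = rowMul x A + rowMul y A := by
  simp [rowMul, Matrix.add_vecMul]

theorem rowMul_smul (t : ℝ) (x : E n) (A : Matrix (Fin (n + 1)) (Fin (n + 1)) ℝ) :
    rowMul (t • x) A = t • rowMul x A := by
  simp [rowMul, Matrix.smul_vecMul]

/-- The linear map `x ↦ x A`. -/
noncomputable def rowMulLin (A : Matrix (Fin (n + 1)) (Fin (n + 1)) ℝ) : E n →ₗ[ℝ] E n where
  toFun x := rowMul x A
  map_add' x y := rowMul_add x y A
  map_smul' t x := rowMul_smul t x A

theorem det_rowMulLin (A : Matrix (Fin (n + 1)) (Fin (n + 1)) ℝ) :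
    LinearMap.det (rowMulLin A) = A.det := by
  have h : rowMulLin A = Matrix.toLpLin 2 2 A.transpose := by
    ext x i
    simp [rowMulLin, rowMul, Matrix.toLpLin_apply, Matrix.mulVec_transpose]
  rw [h, Matrix.toLpLin_eq_toLin, LinearMap.det_toLin, Matrix.det_transpose]

theorem rowMul_sub (x y : E n) (A : Matrix (Fin (n + 1)) (Fin (n + 1)) ℝ) :
    rowMul (x - y) A = rowMul x A - rowMul y A :=
  (rowMulLin A).map_sub x y

theorem rowMul_Dmat_zero (ρ : ℝ) (x : E n) : rowMul x (Dmat n ρ) 0 = ρ ^ n * x 0 := by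
  simp [rowMul, Dmat, Matrix.vecMul_diagonal, mul_comm]

theorem rowMul_Dmat_succ (ρ : ℝ) (x : E n) (i : Fin n) :
    rowMul x (Dmat n ρ) i.succ = ρ⁻¹ * x i.succ := by
  simp [rowMul, Dmat, Matrix.vecMul_diagonal, mul_comm]

theorem det_Dmat (ρ : Radius) : (Dmat n ρ).det = 1 := by
  have h2 : (ρ : ℝ) ≠ 0 := ne_of_gt ρ.2.1
  rw [Dmat, Matrix.det_diagonal, Fin.prod_univ_succ]
  simp [h2]

variable (R : FrameRotation n) (ρ : Radius)

theorem frame_apply (q : E n) (v : Sph n) (x : E n) :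
    frame R ρ q v x = rowMul (x - q) ((R.toFun v).1 * Dmat n ρ) := rfl

/-- The frame is affine with a linear part independent of the base point. So a change of observer is
a translation, the fact behind both the change of base scatterer and the mass transport. -/
theorem frame_sub_frame (q x y : E n) (v : Sph n) :
    frame R ρ q v x - frame R ρ q v y = frame R ρ y v x := by
  simp only [frame_apply, ← rowMul_sub, sub_sub_sub_cancel_right]

theorem frame_self (q : E n) (v : Sph n) : frame R ρ q v q = 0 := by
  rw [← frame_sub_frame R ρ q q q, sub_self]

theorem frame_swap (x y : E n) (v : Sph n) : frame R ρ x v y = -frame R ρ y v x := by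
  rw [← frame_sub_frame R ρ y y x, frame_self, zero_sub]

/-- The inverse of the particle frame at macroscopic scale: the position, relative to the
particle and multiplied by `ρ^{d-1}`, of the point with coordinates `y` in the particle frame. -/
noncomputable def unframe (v : Sph n) (y : E n) : E n :=
  (ρ : ℝ) ^ n • rowMul y ((R.toFun v).1 * Dmat n ρ)⁻¹

theorem frame_unframe (q : E n) (v : Sph n) (y : E n) :
    frame R ρ (((ρ : ℝ) ^ n)⁻¹ • (q - unframe R ρ v y)) v (((ρ : ℝ) ^ n)⁻¹ • q) = y := by
  have hp : (ρ : ℝ) ^ n ≠ 0 := (pow_pos ρ.2.1 n).ne'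
  rw [frame_apply, ← smul_sub, sub_sub_cancel, unframe, smul_smul, inv_mul_cancel₀ hp, one_smul,
    rowMul_mul, Matrix.nonsing_inv_mul _ (isUnit_det_frame (R.toFun v) ρ), rowMul_one]

theorem unframe_frame (q x : E n) (v : Sph n) :
    unframe R ρ v (frame R ρ q v x) = (ρ : ℝ) ^ n • (x - q) := by
  rw [unframe, frame_apply, rowMul_mul,
    Matrix.mul_nonsing_inv _ (isUnit_det_frame (R.toFun v) ρ), rowMul_one]

/-- No direction is contracted by `frame` more strongly than by ρ^n, which the prefactor ρ^n in
`unframe` compensates. -/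
theorem norm_unframe_le (v : Sph n) (y : E n) : ‖unframe R ρ v y‖ ≤ ‖y‖ := by
  have h := le_norm_frame R ρ (((ρ : ℝ) ^ n)⁻¹ • (0 - unframe R ρ v y)) v (((ρ : ℝ) ^ n)⁻¹ • 0)
  rw [frame_unframe, ← smul_sub, sub_sub_cancel, norm_smul, norm_inv, norm_pow,
    Real.norm_of_nonneg ρ.2.1.le, ← mul_assoc, mul_inv_cancel₀ (pow_pos ρ.2.1 n).ne',
    one_mul] at h
  exact h

theorem norm_scaled_sub_le (q x : E n) (v : Sph n) :
    ‖(ρ : ℝ) ^ n • x - (ρ : ℝ) ^ n • q‖ ≤ ‖frame R ρ q v x‖ := by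
  rw [← smul_sub, ← unframe_frame R ρ q x v]
  exact norm_unframe_le R ρ v _

/-- In coordinates rotated by R(v), `unframe` keeps the first coordinate and multiplies the others
by ρ^(n+1). At macroscopic scale the cylinder thus collapses to a line in direction v. -/
theorem norm_unframe_sub_le (v : Sph n) (y : E n) :
    ‖unframe R ρ v y - y 0 • (v : E n)‖ ≤ (ρ : ℝ) ^ (n + 1) * ‖y‖ := by
  have hρ := ρ.2.1
  have hp : (0 : ℝ) < (ρ : ℝ) ^ n := pow_pos hρ n
  set u := rowMul (unframe R ρ v y) (R.toFun v).1 with hu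
  have h1 : rowMul u (Dmat n ρ) = (ρ : ℝ) ^ n • y := by
    rw [hu, rowMul_mul, unframe, rowMul_smul, rowMul_mul,
      Matrix.nonsing_inv_mul _ (isUnit_det_frame (R.toFun v) ρ), rowMul_one]
  have h0 : u 0 = y 0 := by
    have := congrArg (fun x : E n => x 0) h1
    simp only [rowMul_Dmat_zero, PiLp.smul_apply, smul_eq_mul] at this
    exact mul_left_cancel₀ hp.ne' this
  have hs : ∀ i : Fin n, u i.succ = (ρ : ℝ) ^ (n + 1) * y i.succ := fun i => by
    have := congrArg (fun x : E n => x i.succ) h1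
    simp only [rowMul_Dmat_succ, PiLp.smul_apply, smul_eq_mul] at this
    rw [inv_mul_eq_iff_eq_mul₀ hρ.ne'] at this
    rw [this]; ring
  rw [← norm_rowMul_orthogonal (R.toFun v), rowMul_sub, rowMul_smul, R.rowMul_eq, ← hu]
  refine (sq_le_sq₀ (norm_nonneg _) (by positivity)).1 ?_
  rw [mul_pow, EuclideanSpace.norm_sq_eq, EuclideanSpace.norm_sq_eq, Finset.mul_sum]
  refine Finset.sum_le_sum fun i _ => ?_
  refine Fin.cases ?_ (fun j => ?_) i
  · simp only [PiLp.sub_apply, PiLp.smul_apply, h0]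
    simp
    positivity
  · simp [hs, mul_pow, abs_of_pos hρ]

/-- Since R(v) is orthogonal and sends v to e_1, its first column is v. Equal first coordinates of
two scatterers therefore mean that their difference is orthogonal to v. -/
theorem frame_zero_eq (v : Sph n) (q x : E n) :
    frame R ρ q v x 0 = (ρ : ℝ) ^ n * inner ℝ (x - q) (v : E n) := by
  have h : (R.toFun v).1 * (R.toFun v).1.transpose = 1 :=
    (Matrix.mem_orthogonalGroup_iff _ _).1 (Matrix.mem_specialOrthogonalGroup_iff.1 (R.toFun v).2).1
  have hv : ∀ j, (v : E n) j = (R.toFun v).1 j 0 := by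
    have h1 : rowMul (rowMul (v : E n) (R.toFun v).1) (R.toFun v).1.transpose = (v : E n) := by
      rw [rowMul_mul, h, rowMul_one]
    rw [R.rowMul_eq] at h1
    intro j
    rw [← h1]
    simp [rowMul]
  rw [frame_apply, ← rowMul_mul, rowMul_Dmat_zero]
  congr 1
  simp only [rowMul, Matrix.vecMul, dotProduct, PiLp.inner_apply]
  refine Finset.sum_congr rfl fun j _ => ?_
  rw [hv j]
  simp [mul_comm]

end FrameGeometry

/-! ### Integrals over the rescaled configuration as finite sums. -/

section QsetIntegral

variable {n : ℕ} {M : Type*} [MetricSpace M] (R : FrameRotation n) (P : PointSet (E n))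
  (mark : P.carrier → M) (ρ : Radius)

theorem Qset_carrier (q : E n) (v : Sph n) :
    (Qset R P mark ρ q v).carrier =
      (fun p : P.carrier => (frame R ρ q v p, mark p)) '' {p | (p : E n) ≠ q} := by
  ext x
  constructor
  · rintro ⟨_, ⟨⟨p, rfl⟩, hp⟩, rfl⟩
    exact ⟨p, hp, rfl⟩
  · rintro ⟨p, hp, rfl⟩
    exact ⟨_, ⟨⟨p, rfl⟩, hp⟩, rfl⟩

theorem zero_notMem_Qset (q : E n) (v : Sph n) (s : M) :
    ((0 : E n), s) ∉ (Qset R P mark ρ q v).carrier := by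
  rw [Qset_carrier]
  rintro ⟨p, hp, h⟩
  have h1 : frame R ρ q v p = frame R ρ q v q := by
    rw [frame_self]; exact congrArg Prod.fst h
  exact hp ((frame R ρ q v).injective h1)

variable [CompactSpace M] [MeasurableSpace M] [BorelSpace M]

/-- A scatterer seen within distance r of q has macroscopic distance at most r from q, so a larger
ball around the origin contains all contributions. The index set does not depend on q, which is what
makes exchanges of sums possible. -/
theorem integral_Qset {q : E n} {T r T' : ℝ} (hq : ‖(ρ : ℝ) ^ n • q‖ ≤ T) (hT : T + r ≤ T')
    (v : Sph n) {f : E n × M → ℝ} (hf : Continuous f) (hr : ∀ x, r < ‖x.1‖ → f x = 0) :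
    ∫ x, f x ∂(Qset R P mark ρ q v).toCounting.1 =
      ∑ p ∈ nearPts P T' ρ, if (p : E n) = q then 0 else f (frame R ρ q v p, mark p) := by
  classical
  have hcs : HasCompactSupport f := by
    refine HasCompactSupport.intro ((isCompact_closedBall (0 : E n) r).prod
      (isCompact_univ (X := M))) fun z hz => hr z ?_
    by_contra! h
    exact hz ⟨by simpa using h, mem_univ _⟩
  have h1 := PointSet.integral_toCounting (Qset R P mark ρ q v) ⟨⟨f, hf⟩, hcs⟩
  refine h1.trans ?_
  change ∑' y : (Qset R P mark ρ q v).carrier, f y = _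
  rw [Qset_carrier]
  have hinj : Function.Injective fun p : P.carrier => (frame R ρ q v p, mark p) := fun a b h =>
    Subtype.ext ((frame R ρ q v).injective (congrArg Prod.fst h))
  rw [tsum_image f hinj.injOn, tsum_subtype {p : P.carrier | (p : E n) ≠ q}
    (fun p : P.carrier => f (frame R ρ q v p, mark p)), tsum_eq_sum (s := nearPts P T' ρ)]
  · refine Finset.sum_congr rfl fun p _ => ?_
    by_cases hp : (p : E n) = q <;> simp [hp]
  · intro p hp
    rw [mem_nearPts, not_le] at hp
    refine indicator_apply_eq_zero.2 fun _ => hr _ ?_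
    have h2 := norm_scaled_sub_le R ρ q p v
    have h3 := norm_sub_norm_le ((ρ : ℝ) ^ n • (p : E n)) ((ρ : ℝ) ^ n • q)
    change r < ‖frame R ρ q v p‖
    linarith

end QsetIntegral

end LorentzGas

namespace LorentzGas

/-! ### Cutoff functions. -/

section Bump

variable {n : ℕ} {M : Type*}

/-- A continuous cutoff function: `1` on the ball of radius `r`, `0` off the ball of radius
`r + 1`. -/
noncomputable def bump (r : ℝ) (x : E n) : ℝ := max 0 (min 1 (r + 1 - ‖x‖))

theorem continuous_bump (r : ℝ) : Continuous (bump r : E n → ℝ) := by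
  unfold bump
  fun_prop

theorem bump_nonneg (r : ℝ) (x : E n) : 0 ≤ bump r x := le_max_left _ _

theorem bump_le_one (r : ℝ) (x : E n) : bump r x ≤ 1 := max_le zero_le_one (min_le_left _ _)

theorem bump_eq_one {r : ℝ} {x : E n} (h : ‖x‖ ≤ r) : bump r x = 1 := by
  unfold bump
  rw [min_eq_left (by linarith), max_eq_right zero_le_one]

theorem bump_eq_zero {r : ℝ} {x : E n} (h : r + 1 ≤ ‖x‖) : bump r x = 0 :=
  max_eq_left ((min_le_right _ _).trans (by linarith))

theorem norm_lt_of_bump_ne_zero {r : ℝ} {x : E n} (h : bump r x ≠ 0) : ‖x‖ < r + 1 := by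
  by_contra! h'
  exact h (bump_eq_zero h')

/-- A continuous cutoff function on the line: `1` up to `k` and `0` from `k + 1` on. -/
noncomputable def ramp (k t : ℝ) : ℝ := max 0 (min 1 (k + 1 - t))

theorem continuous_ramp (k : ℝ) : Continuous (ramp k) := by
  unfold ramp
  fun_prop

theorem ramp_nonneg (k t : ℝ) : 0 ≤ ramp k t := le_max_left _ _

theorem ramp_le_one (k t : ℝ) : ramp k t ≤ 1 := max_le zero_le_one (min_le_left _ _)

theorem ramp_eq_one {k t : ℝ} (h : t ≤ k) : ramp k t = 1 := by
  unfold ramp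
  rw [min_eq_left (by linarith), max_eq_right zero_le_one]

theorem lt_of_ramp_ne_zero {k t : ℝ} (h : ramp k t ≠ 0) : t < k + 1 := by
  by_contra! h'
  exact h (max_eq_left ((min_le_right _ _).trans (by linarith)))

/-- The tent function of width `δ`. -/
noncomputable def tent (δ t : ℝ) : ℝ := max 0 (1 - |t| / δ)

theorem continuous_tent (δ : ℝ) : Continuous (tent δ) := by
  unfold tent
  fun_prop

theorem tent_nonneg (δ t : ℝ) : 0 ≤ tent δ t := le_max_left _ _

theorem tent_le_one {δ : ℝ} (hδ : 0 < δ) (t : ℝ) : tent δ t ≤ 1 :=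
  max_le zero_le_one (by have : 0 ≤ |t| / δ := by positivity
                         linarith)

theorem tent_zero (δ : ℝ) : tent δ 0 = 1 := by simp [tent]

theorem lt_of_tent_ne_zero {δ t : ℝ} (hδ : 0 < δ) (h : tent δ t ≠ 0) : |t| < δ := by
  by_contra! h'
  refine h (max_eq_left ?_)
  have : 1 ≤ |t| / δ := (one_le_div hδ).2 h'
  linarith

theorem tent_eq_zero {δ t : ℝ} (hδ : 0 < δ) (h : δ ≤ |t|) : tent δ t = 0 := by
  by_contra h'
  exact absurd (lt_of_tent_ne_zero hδ h') (not_lt.2 h)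

theorem isCompact_closedBall_prod [TopologicalSpace M] [CompactSpace M] (r : ℝ) :
    IsCompact (Metric.closedBall (0 : E n) r ×ˢ (univ : Set M)) :=
  (isCompact_closedBall (0 : E n) r).prod isCompact_univ

theorem hasCompactSupport_of_norm [TopologicalSpace M] [T2Space M] [CompactSpace M] {f : E n × M → ℝ} {r : ℝ}
    (h : ∀ x, r < ‖x.1‖ → f x = 0) : HasCompactSupport f := by
  have hK := isCompact_closedBall_prod (n := n) (M := M) r
  refine HasCompactSupport.of_support_subset_isCompact hK fun x hx => ?_
  by_contra h'
  refine hx (h x ?_)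
  by_contra! h2
  exact h' ⟨by simpa using h2, mem_univ _⟩

end Bump

/-! ### A pair interaction detecting near coincidences of first coordinates. -/

section FaceNull

variable {n : ℕ} {M : Type*} [MetricSpace M] [CompactSpace M] [MeasurableSpace M] [BorelSpace M]

/-- The pair interaction detecting points with almost equal first coordinates. -/
noncomputable def pairKer (r δ : ℝ) (z z' : E n × M) : ℝ :=
  bump r z.1 * bump r z'.1 * tent δ (z.1 0 - z'.1 0)

theorem continuous_pairKer_right (r δ : ℝ) (z : E n × M) :
    Continuous fun z' : E n × M => pairKer r δ z z' := by
  unfold pairKer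
  have := continuous_bump (n := n) r
  have := continuous_tent δ
  fun_prop

theorem continuous_pairKer_left (r δ : ℝ) (z' : E n × M) :
    Continuous fun z : E n × M => pairKer r δ z z' := by
  unfold pairKer
  have := continuous_bump (n := n) r
  have := continuous_tent δ
  fun_prop

theorem continuous_pairKer_swap (r δ : ℝ) :
    Continuous fun p : (E n × M) × (E n × M) => pairKer r δ p.2 p.1 := by
  unfold pairKer
  have := continuous_bump (n := n) r
  have := continuous_tent δ
  fun_prop

theorem continuous_pairKer_diag (r δ : ℝ) :
    Continuous fun z : E n × M => pairKer r δ z z := by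
  unfold pairKer
  have := continuous_bump (n := n) r
  have := continuous_tent δ
  fun_prop

theorem pairKer_nonneg (r δ : ℝ) (z z' : E n × M) : 0 ≤ pairKer r δ z z' :=
  mul_nonneg (mul_nonneg (bump_nonneg _ _) (bump_nonneg _ _)) (tent_nonneg _ _)

theorem pairKer_eq_zero_left {r δ : ℝ} {z : E n × M} (h : r + 1 < ‖z.1‖) (z' : E n × M) :
    pairKer r δ z z' = 0 := by simp [pairKer, bump_eq_zero h.le]

theorem pairKer_eq_zero_right {r δ : ℝ} {z' : E n × M} (h : r + 1 < ‖z'.1‖) (z : E n × M) :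
    pairKer r δ z z' = 0 := by simp [pairKer, bump_eq_zero h.le]

theorem pairKer_eq_zero_of_le {r δ : ℝ} (hδ : 0 < δ) {z z' : E n × M}
    (h : δ ≤ |z.1 0 - z'.1 0|) : pairKer r δ z z' = 0 := by
  rw [pairKer, tent_eq_zero hδ h, mul_zero]

theorem pairKer_eq {r δ : ℝ} {z z' : E n × M} (h : ‖z.1‖ ≤ r) (h' : ‖z'.1‖ ≤ r) :
    pairKer r δ z z' = tent δ (z.1 0 - z'.1 0) := by
  rw [pairKer, bump_eq_one h, bump_eq_one h', one_mul, one_mul]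

theorem pairKer_le {r δ : ℝ} (hδ : 0 < δ) (z z' : E n × M) :
    pairKer r δ z z' ≤ bump r z.1 * bump r z'.1 :=
  mul_le_of_le_one_right (mul_nonneg (bump_nonneg _ _) (bump_nonneg _ _)) (tent_le_one hδ _)

attribute [irreducible] pairKer

/-- The sum of the pair interaction over pairs of distinct atoms. -/
noncomputable def pairSum (r δ : ℝ) (η : CountingMeasure (E n × M)) : ℝ :=
  ∫ z, ∫ z', pairKer r δ z z' ∂η.1 ∂η.1 - ∫ z, pairKer r δ z z ∂η.1

/-- The double integral is continuous in two separate measure arguments, by applying the parametric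
continuity twice, and is then restricted to the diagonal. -/
theorem continuous_pairSum (r δ : ℝ) :
    Continuous (pairSum r δ : CountingMeasure (E n × M) → ℝ) := by
  have hK := isCompact_closedBall_prod (n := n) (M := M) (r + 1)
  have hout : ∀ x : E n × M, x ∉ Metric.closedBall (0 : E n) (r + 1) ×ˢ (univ : Set M) →
      r + 1 < ‖x.1‖ := fun x hx => by
    by_contra! h
    exact hx ⟨by simpa using h, mem_univ _⟩
  have h1 : Continuous fun p : CountingMeasure (E n × M) × (E n × M) =>
      ∫ z', pairKer r δ p.2 z' ∂p.1.1 :=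
    CountingMeasure.continuous_integral_param (θ := fun z' z => pairKer r δ z z')
      (continuous_pairKer_swap r δ) fun y₀ =>
        ⟨_, hK, Eventually.of_forall fun y x hx => pairKer_eq_zero_right (hout x hx) y⟩
  have h2 : Continuous fun p : CountingMeasure (E n × M) × CountingMeasure (E n × M) =>
      ∫ z, ∫ z', pairKer r δ z z' ∂p.2.1 ∂p.1.1 := by
    refine CountingMeasure.continuous_integral_param
      (θ := fun z (η : CountingMeasure (E n × M)) => ∫ z', pairKer r δ z z' ∂η.1)
      (h1.comp (continuous_snd.prodMk continuous_fst)) fun y₀ =>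
        ⟨_, hK, Eventually.of_forall fun y x hx => ?_⟩
    simp [pairKer_eq_zero_left (hout x hx)]
  have hd : Continuous fun η : CountingMeasure (E n × M) => (η, η) :=
    continuous_id.prodMk continuous_id
  have h3 : Continuous fun η : CountingMeasure (E n × M) =>
      ∫ z, ∫ z', pairKer r δ z z' ∂η.1 ∂η.1 := h2.comp hd
  have h4 : Continuous fun η : CountingMeasure (E n × M) => ∫ z, pairKer r δ z z ∂η.1 :=
    CountingMeasure.continuous_integral (continuous_pairKer_diag r δ)
      (hasCompactSupport_of_norm fun x hx => pairKer_eq_zero_left hx x)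
  exact h3.sub h4

theorem integrable_bump (η : CountingMeasure (E n × M)) (r : ℝ) :
    Integrable (fun x : E n × M => bump r x.1) η.1 :=
  ((continuous_bump r).comp continuous_fst).integrable_of_hasCompactSupport
    (hasCompactSupport_of_norm (r := r + 1) fun _ hx => bump_eq_zero hx.le)

theorem abs_pairSum_le {r δ : ℝ} (hδ : 0 < δ) (η : CountingMeasure (E n × M)) :
    |pairSum r δ η| ≤ (∫ z, bump r z.1 ∂η.1) ^ 2 + ∫ z, bump r z.1 ∂η.1 := by
  set b := ∫ z, bump r z.1 ∂η.1 with hb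
  have hb0 : 0 ≤ b := integral_nonneg fun z => bump_nonneg _ _
  have hi := integrable_bump η r
  have h1 : ∀ z : E n × M, ∫ z', pairKer r δ z z' ∂η.1 ≤ bump r z.1 * b := fun z => by
    rw [hb, ← integral_const_mul]
    exact integral_mono_of_nonneg (Eventually.of_forall fun z' => pairKer_nonneg _ _ _ _)
      (hi.const_mul _) (Eventually.of_forall fun z' => pairKer_le hδ z z')
  have h2 : ∫ z, ∫ z', pairKer r δ z z' ∂η.1 ∂η.1 ≤ b ^ 2 := by
    rw [sq, hb, ← integral_mul_const]
    exact integral_mono_of_nonneg (Eventually.of_forall fun z => integral_nonneg fun z' =>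
      pairKer_nonneg _ _ _ _) (hi.mul_const _) (Eventually.of_forall h1)
  have h3 : ∫ z, pairKer r δ z z ∂η.1 ≤ b :=
    integral_mono_of_nonneg (Eventually.of_forall fun z => pairKer_nonneg _ _ _ _) hi
      (Eventually.of_forall fun z => (pairKer_le hδ z z).trans
        (mul_le_of_le_one_right (bump_nonneg _ _) (bump_le_one _ _)))
  have h4 : 0 ≤ ∫ z, ∫ z', pairKer r δ z z' ∂η.1 ∂η.1 :=
    integral_nonneg fun z => integral_nonneg fun z' => pairKer_nonneg _ _ _ _
  have h5 : 0 ≤ ∫ z, pairKer r δ z z ∂η.1 := integral_nonneg fun z => pairKer_nonneg _ _ _ _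
  rw [pairSum, abs_le]
  constructor <;> nlinarith

theorem PointSet.integral_eq_sum (Y : PointSet (E n × M)) {r : ℝ} {f : E n × M → ℝ}
    (hf : Continuous f) (hr : ∀ x, r < ‖x.1‖ → f x = 0) :
    ∫ x, f x ∂Y.toCounting.1 =
      ∑ x ∈ (Y.finite_inter _ (isCompact_closedBall_prod r)).toFinset, f x := by
  have h1 := PointSet.integral_toCounting Y ⟨⟨f, hf⟩, hasCompactSupport_of_norm hr⟩
  refine h1.trans ?_
  change ∑' y : Y.carrier, f y = _
  rw [tsum_subtype Y.carrier f, tsum_eq_sum (s := (Y.finite_inter _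
    (isCompact_closedBall_prod r)).toFinset)]
  · refine Finset.sum_congr rfl fun x hx => ?_
    rw [Finite.mem_toFinset] at hx
    exact indicator_of_mem hx.1 f
  · intro x hx
    rw [Finite.mem_toFinset] at hx
    refine indicator_apply_eq_zero.2 fun hY => hr x ?_
    by_contra! h
    exact hx ⟨hY, by simpa using h, mem_univ _⟩

theorem PointSet.pairSum_toCounting (Y : PointSet (E n × M)) (r δ : ℝ) :
    pairSum r δ Y.toCounting =
      ∑ z ∈ (Y.finite_inter _ (isCompact_closedBall_prod (r + 1))).toFinset,
        ∑ z' ∈ (Y.finite_inter _ (isCompact_closedBall_prod (r + 1))).toFinset, pairKer r δ z z' -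
      ∑ z ∈ (Y.finite_inter _ (isCompact_closedBall_prod (r + 1))).toFinset, pairKer r δ z z := by
  set A := (Y.finite_inter _ (isCompact_closedBall_prod (r + 1))).toFinset
  have h1 : ∀ z : E n × M, ∫ z', pairKer r δ z z' ∂Y.toCounting.1 =
      ∑ z' ∈ A, pairKer r δ z z' := fun z =>
    Y.integral_eq_sum (continuous_pairKer_right r δ z) fun x hx =>
      pairKer_eq_zero_right hx z
  unfold pairSum
  simp_rw [h1]
  congr 1
  · refine Y.integral_eq_sum (continuous_finsetSum _ fun z' _ =>
      continuous_pairKer_left r δ z') fun x hx => ?_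
    simp [pairKer_eq_zero_left hx]
  · exact Y.integral_eq_sum (continuous_pairKer_diag r δ) fun x hx =>
      pairKer_eq_zero_right hx x

theorem PointSet.pairSum_toCounting_nonneg (Y : PointSet (E n × M)) (r δ : ℝ) :
    0 ≤ pairSum r δ Y.toCounting := by
  rw [Y.pairSum_toCounting, sub_nonneg]
  exact Finset.sum_le_sum fun z hz =>
    Finset.single_le_sum (f := fun z' => pairKer r δ z z') (fun z' _ => pairKer_nonneg _ _ _ _) hz

/-- The pair interaction of configurations without coincidences vanishes in the limit. -/
theorem tendsto_pairSum (r : ℝ) {η : CountingMeasure (E n × M)}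
    (hη : ¬ ∃ t : ℝ, 1 < η.1 {x : E n × M | x.1 0 = t}) :
    Tendsto (fun j : ℕ => pairSum r ((j : ℝ) + 1)⁻¹ η) atTop (𝓝 0) := by
  simp only [not_exists, not_lt] at hη
  -- A double atom would already be a coincidence, so η is simple.
  obtain ⟨Y, rfl⟩ := η.mem_range_toCounting fun x =>
    (measure_mono (singleton_subset_iff.2 (show x ∈ {z : E n × M | z.1 0 = x.1 0} from rfl))).trans
      (hη (x.1 0))
  have hdist : ∀ z ∈ Y.carrier, ∀ z' ∈ Y.carrier, z ≠ z' → z.1 0 ≠ z'.1 0 := by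
    classical
    intro z hz z' hz' hne h0
    have hm : MeasurableSet {x : E n × M | x.1 0 = z.1 0} :=
      (isClosed_eq (by fun_prop) continuous_const).measurableSet
    have h1 := hη (z.1 0)
    rw [Y.toCounting_apply hm] at h1
    have h2 := ENNReal.sum_le_tsum (f := fun y : Y.carrier =>
      {x : E n × M | x.1 0 = z.1 0}.indicator (1 : E n × M → ℝ≥0∞) y) {⟨z, hz⟩, ⟨z', hz'⟩}
    rw [Finset.sum_pair (by simpa using hne)] at h2
    rw [indicator_of_mem (show z ∈ {x : E n × M | x.1 0 = z.1 0} from rfl),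
      indicator_of_mem (show z' ∈ {x : E n × M | x.1 0 = z.1 0} from h0.symm)] at h2
    have := h2.trans h1
    norm_num at this
  set A := (Y.finite_inter _ (isCompact_closedBall_prod (r + 1))).toFinset with hA
  have hAY : ∀ z ∈ A, z ∈ Y.carrier := fun z hz => by
    rw [hA, Finite.mem_toFinset] at hz
    exact hz.1
  have e : ∀ δ, pairSum r δ Y.toCounting =
      ∑ z ∈ A, ∑ z' ∈ A, pairKer r δ z z' - ∑ z ∈ A, pairKer r δ z z := Y.pairSum_toCounting r
  have hlim : ∀ z ∈ A, ∀ z' ∈ A, z ≠ z' →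
      ∀ᶠ j : ℕ in atTop, pairKer r ((j : ℝ) + 1)⁻¹ z z' = 0 := by
    intro z hz z' hz' hne
    have hpos : 0 < |z.1 0 - z'.1 0| :=
      abs_pos.2 (sub_ne_zero.2 (hdist z (hAY z hz) z' (hAY z' hz') hne))
    have h1 : Tendsto (fun j : ℕ => ((j : ℝ) + 1)⁻¹) atTop (𝓝 0) :=
      tendsto_inv_atTop_zero.comp (tendsto_atTop_add_const_right _ _ tendsto_natCast_atTop_atTop)
    filter_upwards [h1.eventually_lt_const hpos] with j hj
    exact pairKer_eq_zero_of_le (by positivity) hj.le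
  have hall : ∀ᶠ j : ℕ in atTop, ∀ z ∈ A, ∀ z' ∈ A, z ≠ z' →
      pairKer r ((j : ℝ) + 1)⁻¹ z z' = 0 := by
    refine (Filter.eventually_all_finset A).2 fun z hz =>
      (Filter.eventually_all_finset A).2 fun z' hz' => ?_
    by_cases hne : z = z'
    · exact Eventually.of_forall fun _ h => absurd hne h
    · filter_upwards [hlim z hz z' hz' hne] with j hj _
      exact hj
  refine tendsto_const_nhds.congr' ?_
  filter_upwards [hall] with j hj
  rw [e, ← Finset.sum_sub_distrib]
  refine (Finset.sum_eq_zero fun z hz => ?_).symm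
  rw [Finset.sum_eq_single_of_mem z hz fun z' hz' hne => hj z hz z' hz' hne.symm, sub_self]

end FaceNull

end LorentzGas

namespace LorentzGas

/-! ### The mass transport inequality. -/

section Transport

variable {n : ℕ} {M : Type*} [MetricSpace M] [CompactSpace M] [MeasurableSpace M] [BorelSpace M]

/-- The number, truncated at one, of points close to the hyperplane `x₁ = 0`. -/
noncomputable def slabCount (L δ : ℝ) (η : CountingMeasure (E n × M)) : ℝ :=
  min 1 (∫ x, bump L x.1 * tent δ (x.1 0) ∂η.1)

/-- The number, truncated at one, of points close to `x₀`. -/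
noncomputable def ballCount (r : ℝ) (x₀ : E n) (η : CountingMeasure (E n × M)) : ℝ :=
  min 1 (∫ x, bump r (x.1 - x₀) ∂η.1)

/-- A continuous cutoff to the configurations with at most `k` points in the ball of radius `r`. -/
noncomputable def fewPoints (k r : ℝ) (η : CountingMeasure (E n × M)) : ℝ :=
  ramp k (∫ x, bump r x.1 ∂η.1)

theorem continuous_slab (L δ : ℝ) :
    Continuous fun x : E n × M => bump L x.1 * tent δ (x.1 0) := by
  have := continuous_bump (n := n) L
  have := continuous_tent δ
  fun_prop

theorem slab_eq_zero {L δ : ℝ} {x : E n × M} (h : L + 1 < ‖x.1‖) :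
    bump L x.1 * tent δ (x.1 0) = 0 := by
  rw [bump_eq_zero h.le, zero_mul]

theorem continuous_bump_sub (r : ℝ) (x₀ : E n) :
    Continuous fun x : E n × M => bump r (x.1 - x₀) := by
  have := continuous_bump (n := n) r
  fun_prop

theorem bump_sub_eq_zero {r : ℝ} {x₀ : E n} {x : E n × M} (h : ‖x₀‖ + r + 1 < ‖x.1‖) :
    bump r (x.1 - x₀) = 0 := by
  refine bump_eq_zero ?_
  have := norm_sub_norm_le x.1 x₀
  linarith

theorem continuous_bump_fst (r : ℝ) : Continuous fun x : E n × M => bump r x.1 :=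
  (continuous_bump r).comp continuous_fst

theorem bump_fst_eq_zero {r : ℝ} {x : E n × M} (h : r + 1 < ‖x.1‖) : bump r x.1 = 0 :=
  bump_eq_zero h.le

theorem continuous_slabCount (L δ : ℝ) :
    Continuous (slabCount L δ : CountingMeasure (E n × M) → ℝ) :=
  continuous_const.min (CountingMeasure.continuous_integral (continuous_slab L δ)
    (hasCompactSupport_of_norm fun _ => slab_eq_zero))

theorem continuous_ballCount (r : ℝ) (x₀ : E n) :
    Continuous (ballCount r x₀ : CountingMeasure (E n × M) → ℝ) :=
  continuous_const.min (CountingMeasure.continuous_integral (continuous_bump_sub r x₀)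
    (hasCompactSupport_of_norm fun _ => bump_sub_eq_zero))

theorem continuous_fewPoints (k r : ℝ) :
    Continuous (fewPoints k r : CountingMeasure (E n × M) → ℝ) :=
  (continuous_ramp k).comp (CountingMeasure.continuous_integral (continuous_bump_fst r)
    (hasCompactSupport_of_norm fun _ => bump_fst_eq_zero))

theorem slabCount_nonneg (L δ : ℝ) (η : CountingMeasure (E n × M)) : 0 ≤ slabCount L δ η :=
  le_min zero_le_one (integral_nonneg fun _ => mul_nonneg (bump_nonneg _ _) (tent_nonneg _ _))

theorem slabCount_le_one (L δ : ℝ) (η : CountingMeasure (E n × M)) : slabCount L δ η ≤ 1 :=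
  min_le_left _ _

theorem ballCount_nonneg (r : ℝ) (x₀ : E n) (η : CountingMeasure (E n × M)) :
    0 ≤ ballCount r x₀ η :=
  le_min zero_le_one (integral_nonneg fun _ => bump_nonneg _ _)

theorem ballCount_le_one (r : ℝ) (x₀ : E n) (η : CountingMeasure (E n × M)) :
    ballCount r x₀ η ≤ 1 :=
  min_le_left _ _

theorem fewPoints_nonneg (k r : ℝ) (η : CountingMeasure (E n × M)) : 0 ≤ fewPoints k r η :=
  ramp_nonneg _ _

theorem fewPoints_le_one (k r : ℝ) (η : CountingMeasure (E n × M)) : fewPoints k r η ≤ 1 :=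
  ramp_le_one _ _

theorem norm_frame_le_add (R : FrameRotation n) (ρ : Radius) (v : Sph n) (p q s : E n) :
    ‖frame R ρ p v q‖ ≤ ‖frame R ρ s v q‖ + ‖frame R ρ p v s‖ := by
  have h : frame R ρ p v q = frame R ρ s v q + frame R ρ p v s := by
    rw [← frame_sub_frame R ρ p q s]; abel
  rw [h]
  exact norm_add_le _ _

variable (R : FrameRotation n) (P : PointSet (E n)) (mark : P.carrier → M) (ρ : Radius)
  (v : Sph n)

/-- If a scatterer sees few points, then so do the scatterers close to it. -/
theorem fewPoints_eq_one_of_near {k r s T : ℝ} {p q : P.carrier}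
    (hp : ‖(ρ : ℝ) ^ n • (p : E n)‖ ≤ T) (hq : ‖(ρ : ℝ) ^ n • (q : E n)‖ ≤ T)
    (hqp : ‖frame R ρ p v q‖ ≤ s)
    (hk : fewPoints k (r + 1 + s) (Qset R P mark ρ p v).toCounting ≠ 0) :
    fewPoints (k + 2) r (Qset R P mark ρ q v).toCounting = 1 := by
  classical
  have hs : 0 ≤ s := (norm_nonneg _).trans hqp
  refine ramp_eq_one ?_
  have h1 := lt_of_ramp_ne_zero hk
  rw [integral_Qset R P mark ρ hp (T' := T + (r + 1 + s + 1)) le_rfl v (continuous_bump_fst _)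
    fun _ => bump_fst_eq_zero] at h1
  rw [integral_Qset R P mark ρ hq (T' := T + (r + 1 + s + 1)) (by linarith) v
    (continuous_bump_fst _) fun _ => bump_fst_eq_zero]
  set F := nearPts P (T + (r + 1 + s + 1)) ρ
  -- Everything q sees within r + 1 is seen by p within r + 1 + s, except p, which q may see but p
  -- never counts. This extra point turns the bound k + 1 into (k + 2), the level of the new ramp.
  have h2 : ∑ a ∈ F, (if (a : E n) = q then 0 else bump r (frame R ρ q v a)) ≤
      ∑ a ∈ F, ((if (a : E n) = p then 0 else bump (r + 1 + s) (frame R ρ p v a)) +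
        if a = p then 1 else 0) := by
    refine Finset.sum_le_sum fun a _ => ?_
    by_cases hap : a = p
    · subst hap
      simp only [if_true]
      split_ifs
      · norm_num
      · simpa using bump_le_one _ _
    · have hap' : (a : E n) ≠ p := fun h => hap (Subtype.ext h)
      rw [if_neg hap, if_neg hap', add_zero]
      split_ifs
      · exact bump_nonneg _ _
      · by_cases hb : bump r (frame R ρ q v a) = 0
        · rw [hb]
          exact bump_nonneg _ _
        · have h3 := norm_lt_of_bump_ne_zero hb
          have h4 := norm_frame_le_add R ρ v p a q
          rw [bump_eq_one (r := r + 1 + s) (by linarith)]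
          exact bump_le_one _ _
  rw [Finset.sum_add_distrib, Finset.sum_ite_eq'] at h2
  have h3 : (if p ∈ F then (1 : ℝ) else 0) ≤ 1 := by split_ifs <;> norm_num
  linarith

/-- The mass transport inequality: the number of scatterers having a neighbour in the same
hyperplane and a neighbour close to `x₀` is controlled by the number of coincidences seen by the
latter. -/
theorem sum_slabCount_le {L δ r k T : ℝ} {x₀ : E n} (hδ : 0 < δ) (hδ1 : δ ≤ 1)
    (hx₀ : r + 3 ≤ x₀ 0) (hL : 0 ≤ L) (hr : 0 ≤ r) :
    ∑ p ∈ nearPts P T ρ, slabCount L δ (Qset R P mark ρ p v).toCounting *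
        ballCount r x₀ (Qset R P mark ρ p v).toCounting *
        fewPoints k (‖x₀‖ + r + 1 + (L + 1) + 1 + (‖x₀‖ + r + 1))
          (Qset R P mark ρ p v).toCounting ≤
      ∑ p ∈ nearPts P (T + (‖x₀‖ + r + 1)) ρ,
        pairSum (‖x₀‖ + r + 1 + (L + 1)) δ (Qset R P mark ρ p v).toCounting *
        fewPoints (k + 2) (‖x₀‖ + r + 1 + (L + 1)) (Qset R P mark ρ p v).toCounting := by
  classical
  set s := ‖x₀‖ + r + 1 with hs
  have hs0 : 0 ≤ s := by positivity
  set r' := s + (L + 1) with hr'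
  set F := nearPts P (T + s + (r' + 1) + (L + 1)) ρ with hF
  -- The mass sent from p to q on account of a: seen from q, the distinct points p and a have almost
  -- equal first coordinates. Summed over p and a it is the pair sum at q; summed over q and a it
  -- bounds from above the product attached to p.
  let t : P.carrier → P.carrier → P.carrier → ℝ := fun p q a =>
    if p = q ∨ a = q ∨ p = a then 0 else
      pairKer r' δ (frame R ρ q v p, mark p) (frame R ρ q v a, mark a)
  have ht0 : ∀ p q a, 0 ≤ t p q a := fun p q a => by
    simp only [t]
    split_ifs
    · exact le_rfl
    · exact pairKer_nonneg _ _ _ _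
  have hB : ∀ q ∈ nearPts P (T + s) ρ, ∑ p ∈ F, ∑ a ∈ F, t p q a =
      pairSum r' δ (Qset R P mark ρ q v).toCounting := by
    intro q hq
    have hq' := mem_nearPts.1 hq
    have hTr : T + s + (r' + 1) ≤ T + s + (r' + 1) + (L + 1) := by linarith
    unfold pairSum
    have h1 : ∀ z : E n × M, ∫ z', pairKer r' δ z z' ∂(Qset R P mark ρ q v).toCounting.1 =
        ∑ a ∈ F, if (a : E n) = q then 0 else pairKer r' δ z (frame R ρ q v a, mark a) :=
      fun z => integral_Qset R P mark ρ hq' hTr v (continuous_pairKer_right r' δ z)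
        fun x hx => pairKer_eq_zero_right hx z
    simp_rw [h1]
    rw [integral_Qset R P mark ρ hq' hTr v (continuous_pairKer_diag r' δ)
      fun x hx => pairKer_eq_zero_right hx x]
    rw [integral_Qset R P mark ρ hq' hTr v (f := fun z => ∑ a ∈ F, if (a : E n) = q then 0 else
      pairKer r' δ z (frame R ρ q v a, mark a)), ← Finset.sum_sub_distrib]
    · refine Finset.sum_congr rfl fun p hp => ?_
      by_cases hpq : p = q
      · simp [t, hpq]
      have hpq' : (p : E n) ≠ q := fun h => hpq (Subtype.ext h)
      rw [if_neg hpq', if_neg hpq', ← Finset.add_sum_erase F _ hp, ← Finset.add_sum_erase F _ hp]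
      simp only [if_neg hpq']
      rw [add_sub_cancel_left]
      simp only [t, hpq, or_true, if_true, zero_add, false_or]
      refine Finset.sum_congr rfl fun a ha => ?_
      have hap : p ≠ a := (Finset.ne_of_mem_erase ha).symm
      simp only [hap, or_false, ← Subtype.ext_iff]
    · refine continuous_finsetSum _ fun a _ => ?_
      split_ifs
      · exact continuous_const
      · exact continuous_pairKer_left _ _ _
    · intro x hx
      refine Finset.sum_eq_zero fun a _ => ?_
      rw [pairKer_eq_zero_left hx, ite_self]
  have hA : ∀ p ∈ nearPts P T ρ, slabCount L δ (Qset R P mark ρ p v).toCounting *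
        ballCount r x₀ (Qset R P mark ρ p v).toCounting *
        fewPoints k (r' + 1 + s) (Qset R P mark ρ p v).toCounting ≤
      ∑ q ∈ nearPts P (T + s) ρ, ∑ a ∈ F, t p q a *
        fewPoints (k + 2) r' (Qset R P mark ρ q v).toCounting := by
    intro p hp
    have hp' := mem_nearPts.1 hp
    have hpos : 0 ≤ ∑ q ∈ nearPts P (T + s) ρ, ∑ a ∈ F, t p q a *
        fewPoints (k + 2) r' (Qset R P mark ρ q v).toCounting :=
      Finset.sum_nonneg fun q _ => Finset.sum_nonneg fun a _ =>
        mul_nonneg (ht0 _ _ _) (fewPoints_nonneg _ _ _)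
    by_cases hk : fewPoints k (r' + 1 + s) (Qset R P mark ρ p v).toCounting = 0
    · rw [hk, mul_zero]
      exact hpos
    refine (mul_le_of_le_one_right (mul_nonneg (slabCount_nonneg _ _ _)
      (ballCount_nonneg _ _ _)) (fewPoints_le_one _ _ _)).trans ?_
    have e1 : slabCount L δ (Qset R P mark ρ p v).toCounting ≤ ∑ a ∈ F,
        if (a : E n) = p then 0 else bump L (frame R ρ p v a) * tent δ (frame R ρ p v a 0) := by
      refine (min_le_right _ _).trans_eq ?_
      exact integral_Qset R P mark ρ hp' (by linarith) v (continuous_slab L δ)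
        fun _ => slab_eq_zero
    have e2 : ballCount r x₀ (Qset R P mark ρ p v).toCounting ≤ ∑ q ∈ nearPts P (T + s) ρ,
        if (q : E n) = p then 0 else bump r (frame R ρ p v q - x₀) := by
      refine (min_le_right _ _).trans_eq ?_
      exact integral_Qset R P mark ρ hp' le_rfl v (continuous_bump_sub r x₀)
        fun _ => bump_sub_eq_zero
    refine (mul_le_mul e1 e2 (ballCount_nonneg _ _ _) ?_).trans ?_
    · refine Finset.sum_nonneg fun a _ => ?_
      split_ifs
      · exact le_rfl
      · exact mul_nonneg (bump_nonneg _ _) (tent_nonneg _ _)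
    rw [mul_comm, Finset.sum_mul_sum]
    refine Finset.sum_le_sum fun q hq => Finset.sum_le_sum fun a ha => ?_
    have hnn : 0 ≤ t p q a * fewPoints (k + 2) r' (Qset R P mark ρ q v).toCounting :=
      mul_nonneg (ht0 _ _ _) (fewPoints_nonneg _ _ _)
    by_cases hqp : (q : E n) = p
    · rw [if_pos hqp, zero_mul]; exact hnn
    by_cases hap : (a : E n) = p
    · rw [if_pos hap, mul_zero]; exact hnn
    rw [if_neg hqp, if_neg hap]
    by_cases hb : bump r (frame R ρ p v q - x₀) = 0
    · rw [hb, zero_mul]; exact hnn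
    by_cases hb' : bump L (frame R ρ p v a) = 0
    · rw [hb', zero_mul, mul_zero]; exact hnn
    by_cases htt : tent δ (frame R ρ p v a 0) = 0
    · rw [htt, mul_zero, mul_zero]; exact hnn
    have n1 := norm_lt_of_bump_ne_zero hb
    have n2 := norm_lt_of_bump_ne_zero hb'
    have n3 := lt_of_tent_ne_zero hδ htt
    have n4 : ‖frame R ρ p v q‖ ≤ s := by
      have := norm_sub_norm_le (frame R ρ p v q) x₀
      linarith
    -- The point q lies within r + 1 of x₀, whose first coordinate is at least r + 3. Since a has
    -- first coordinate below δ ≤ 1, it follows that a and q are different.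
    have n5 : 1 < frame R ρ p v q 0 := by
      have h1 : ‖(frame R ρ p v q - x₀) 0‖ ≤ ‖frame R ρ p v q - x₀‖ :=
        PiLp.norm_apply_le _ _
      rw [Real.norm_eq_abs, PiLp.sub_apply] at h1
      have := (abs_le.1 (h1.trans n1.le)).1
      linarith
    have haq : a ≠ q := by
      rintro rfl
      have := (abs_lt.1 n3).2
      linarith
    rw [fewPoints_eq_one_of_near R P mark ρ v (T := T + s) (by linarith) (mem_nearPts.1 hq) n4 hk,
      mul_one]
    have hpq : p ≠ q := fun h => hqp (congrArg Subtype.val h).symm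
    have hpa : p ≠ a := fun h => hap (congrArg Subtype.val h).symm
    have m1 : ‖frame R ρ q v p‖ ≤ r' := by
      rw [frame_swap, norm_neg]
      linarith
    have m2 : ‖frame R ρ q v a‖ ≤ r' := by
      have := norm_frame_le_add R ρ v q a p
      rw [frame_swap R ρ q p, norm_neg] at this
      linarith
    simp only [t, hpq, hpa, haq, or_self, if_false]
    rw [pairKer_eq (z := (frame R ρ q v p, mark p)) (z' := (frame R ρ q v a, mark a)) m1 m2]
    have e3 : frame R ρ q v p 0 - frame R ρ q v a 0 = -frame R ρ p v a 0 := by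
      rw [← PiLp.sub_apply, frame_sub_frame, frame_swap, PiLp.neg_apply]
    have e4 : tent δ (-frame R ρ p v a 0) = tent δ (frame R ρ p v a 0) := by simp [tent]
    simp only [e3, e4]
    have l1 := tent_nonneg δ (frame R ρ p v a 0)
    calc _ ≤ 1 * (1 * tent δ (frame R ρ p v a 0)) := by
          gcongr
          · exact mul_nonneg (bump_nonneg _ _) l1
          · exact bump_le_one _ _
          · exact bump_le_one _ _
      _ = _ := by ring
  refine (Finset.sum_le_sum hA).trans ?_
  have hsub : nearPts P T ρ ⊆ F := fun p hp => by
    rw [hF, mem_nearPts]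
    have := mem_nearPts.1 hp
    linarith
  refine (Finset.sum_le_sum_of_subset_of_nonneg hsub fun p _ _ => Finset.sum_nonneg fun q _ =>
    Finset.sum_nonneg fun a _ => mul_nonneg (ht0 _ _ _) (fewPoints_nonneg _ _ _)).trans_eq ?_
  -- The exchange of sums: the mass sent out by all p equals the mass received by all q.
  rw [Finset.sum_comm]
  refine Finset.sum_congr rfl fun q hq => ?_
  simp_rw [← Finset.sum_mul]
  rw [hB q hq]

end Transport

end LorentzGas

namespace LorentzGas

/-! ### No points in the hyperplane of a typical scatterer. -/

section FaceNull

variable {n : ℕ} {M : Type*} [MetricSpace M] [CompactSpace M] [MeasurableSpace M] [BorelSpace M]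

theorem omega_real_univ_pos : 0 < (omega n).real univ := by
  have h : omega n ≠ 0 := Measure.toSphere_ne_zero _
  have : NeZero (omega n) := ⟨h⟩
  exact measureReal_univ_pos

theorem MarkedObservable.of_continuous {f : CountingMeasure (E n × M) → ℝ} (hf : Continuous f)
    {C : ℝ} (hC : ∀ η, |f η| ≤ C) : MarkedObservable (fun _ : M => f) C :=
  ⟨fun _ => hf, fun _ => hC, fun ε hε => ⟨1, one_pos, fun _ _ _ η => by simpa using hε.le⟩⟩

theorem integral_bump_pos {r : ℝ} (hr : 0 ≤ r) : 0 < ∫ x : E n, bump r x := by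
  have hc : HasCompactSupport (bump r : E n → ℝ) := by
    refine HasCompactSupport.intro (isCompact_closedBall 0 (r + 1)) fun x hx => bump_eq_zero ?_
    by_contra! h
    exact hx (by simpa using h.le)
  refine (continuous_bump r).integral_pos_of_hasCompactSupport_nonneg_nonzero hc
    (fun x => bump_nonneg r x) (x := 0) ?_
  rw [bump_eq_one (by simpa using hr)]
  exact one_ne_zero

variable {R : FrameRotation n} {P : PointSet (E n)} {mark : P.carrier → M}
  {μ : M → ProbabilityMeasure (CountingMeasure (E n × M))}

/-- The average over the scatterers of an unmarked observable. -/
theorem tendsto_avg_unmarked (hn : 1 ≤ n) {cP : ℝ}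
    (hP : HasAsymptoticDensity P.carrier cP) {m : Measure M} [IsProbabilityMeasure m]
    (hP1 : UniformDensity P mark cP m) (hP2 : SphericalEquidistribution R P mark μ)
    (hμ : Continuous μ) (r : ℝ) {f : CountingMeasure (E n × M) → ℝ}
    (hf : Continuous f) {C : ℝ} (hC : ∀ η, |f η| ≤ C) :
    Tendsto (fun ρ : Radius => avg P (r + 1) ρ fun p => bump r ((ρ : ℝ) ^ n • (p : E n)) *
        ∫ v, f (Qset R P mark ρ p v).toCounting ∂(omega n)) toZero
      (𝓝 (cP * ((∫ x : E n, bump r x) * ((omega n).real univ *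
        ∫ s, ∫ η, f η ∂(μ s : Measure (CountingMeasure (E n × M))) ∂m)))) := by
  have h := tendsto_avg_observable hn hP hP1 hP2 hμ (T := r + 1)
    (g := fun z : E n × Sph n => bump r z.1) ((continuous_bump r).comp continuous_fst)
    (fun z => bump_nonneg _ _) (fun z hz => bump_eq_zero hz.le)
    (MarkedObservable.of_continuous hf hC)
  simp only [integral_const, smul_eq_mul, integral_const_mul] at h
  have e : ∫ z : E n × M, (omega n).real univ * bump r z.1 *
      ∫ η, f η ∂(μ z.2 : Measure (CountingMeasure (E n × M))) ∂(volume.prod m) =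
      (∫ x : E n, bump r x) * ((omega n).real univ *
        ∫ s, ∫ η, f η ∂(μ s : Measure (CountingMeasure (E n × M))) ∂m) := by
    rw [← integral_const_mul, ← integral_prod_mul]
    congr 1
    ext z
    ring
  rw [e] at h
  exact h

/-- By [Q2] the pair sum tends to zero almost surely. The cutoff `fewPoints` is there to dominate
it, since no moment bound on the number of points is available. -/
theorem tendsto_pairSum_expect (hμ : Continuous μ) (hQ2 : CoincidenceFree μ) (m : Measure M)
    [IsProbabilityMeasure m] (k r : ℝ) (hk : 0 ≤ k) :
    Tendsto (fun j : ℕ => ∫ s, ∫ η, pairSum r ((j : ℝ) + 1)⁻¹ η * fewPoints k r η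
      ∂(μ s : Measure (CountingMeasure (E n × M))) ∂m) atTop (𝓝 0) := by
  have hb : ∀ (j : ℕ) (η : CountingMeasure (E n × M)),
      |pairSum r ((j : ℝ) + 1)⁻¹ η * fewPoints k r η| ≤ (k + 1) ^ 2 + (k + 1) := by
    intro j η
    by_cases h : fewPoints k r η = 0
    · rw [h, mul_zero, abs_zero]; positivity
    · have h1 := lt_of_ramp_ne_zero h
      have h2 := abs_pairSum_le (r := r) (δ := ((j : ℝ) + 1)⁻¹) (by positivity) η
      have h0 : 0 ≤ ∫ z, bump r z.1 ∂η.1 := integral_nonneg fun z => bump_nonneg _ _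
      rw [abs_mul, abs_of_nonneg (fewPoints_nonneg _ _ _)]
      refine (mul_le_of_le_one_right (abs_nonneg _) (fewPoints_le_one _ _ _)).trans (h2.trans ?_)
      gcongr
  have hc : ∀ j : ℕ, Continuous fun η : CountingMeasure (E n × M) =>
      pairSum r ((j : ℝ) + 1)⁻¹ η * fewPoints k r η := fun j =>
    (continuous_pairSum _ _).mul (continuous_fewPoints _ _)
  have h1 : ∀ s, Tendsto (fun j : ℕ => ∫ η, pairSum r ((j : ℝ) + 1)⁻¹ η * fewPoints k r η
      ∂(μ s : Measure (CountingMeasure (E n × M)))) atTop (𝓝 0) := by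
    intro s
    have h0 : ∫ η : CountingMeasure (E n × M), (0 : ℝ)
      ∂(μ s : Measure (CountingMeasure (E n × M))) = 0 := integral_zero _ _
    rw [← h0]
    refine tendsto_integral_of_dominated_convergence (fun _ => (k + 1) ^ 2 + (k + 1))
      (fun j => (hc j).measurable.aestronglyMeasurable) (integrable_const _)
      (fun j => Eventually.of_forall (hb j)) ?_
    filter_upwards [measure_eq_zero_iff_ae_notMem.1 (hQ2 s)] with η hη
    have h2 : Tendsto (fun j : ℕ => pairSum r ((j : ℝ) + 1)⁻¹ η) atTop (𝓝 0) := tendsto_pairSum r hη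
    simpa using h2.mul_const (fewPoints k r η)
  have h0 : ∫ s : M, (0 : ℝ) ∂m = 0 := integral_zero _ _
  rw [← h0]
  refine tendsto_integral_of_dominated_convergence (fun _ => (k + 1) ^ 2 + (k + 1))
    (fun j => (continuous_integral_prob hμ (hc j) (hb j)).aestronglyMeasurable)
    (integrable_const _) (fun j => Eventually.of_forall fun s => ?_) (Eventually.of_forall h1)
  have h3 : ∀ᵐ η ∂(μ s : Measure (CountingMeasure (E n × M))),
      ‖pairSum r ((j : ℝ) + 1)⁻¹ η * fewPoints k r η‖ ≤ (k + 1) ^ 2 + (k + 1) :=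
    Eventually.of_forall (hb j)
  have h4 := norm_integral_le_of_norm_le_const h3
  rwa [probReal_univ, mul_one] at h4

/-- For fixed slab width δ = 1/(j+1), letting ρ → 0 in the mass transport inequality bounds this
expectation by a constant times an expected truncated pair sum, which vanishes as δ → 0. The radius
r₁ does not depend on k, so that k can later run through all integers. -/
theorem tendsto_slabCount_expect (hn : 1 ≤ n) {cP : ℝ} (hcP : 0 < cP)
    (hP : HasAsymptoticDensity P.carrier cP) {m : Measure M} [IsProbabilityMeasure m]
    (hP1 : UniformDensity P mark cP m) (hP2 : SphericalEquidistribution R P mark μ)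
    (hμ : Continuous μ) (hQ2 : CoincidenceFree μ) {L r : ℝ} {x₀ : E n} (hx₀ : r + 3 ≤ x₀ 0)
    (hL : 0 ≤ L) (hr : 0 ≤ r) :
    ∃ r₁ : ℝ, ∀ k : ℝ, 0 ≤ k → Tendsto (fun j : ℕ => ∫ s, ∫ η, slabCount L ((j : ℝ) + 1)⁻¹ η * ballCount r x₀ η *
      fewPoints k r₁ η ∂(μ s : Measure (CountingMeasure (E n × M))) ∂m) atTop (𝓝 0) := by
  set w := ‖x₀‖ + r + 1 with hw
  have hw0 : 0 ≤ w := by positivity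
  set r' := w + (L + 1) with hr'
  refine ⟨r' + 1 + w, fun k hk => ?_⟩
  set A : ℕ → ℝ := fun j => ∫ s, ∫ η, slabCount L ((j : ℝ) + 1)⁻¹ η * ballCount r x₀ η *
      fewPoints k (r' + 1 + w) η ∂(μ s : Measure (CountingMeasure (E n × M))) ∂m with hA
  set B : ℕ → ℝ := fun j => ∫ s, ∫ η, pairSum r' ((j : ℝ) + 1)⁻¹ η * fewPoints (k + 2) r' η
      ∂(μ s : Measure (CountingMeasure (E n × M))) ∂m with hB
  have hB0 : Tendsto B atTop (𝓝 0) := tendsto_pairSum_expect hμ hQ2 m (k + 2) r' (by positivity)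
  set I0 := ∫ x : E n, bump 0 x with hI0
  set I1 := ∫ x : E n, bump (1 + w) x with hI1
  have hI0pos : 0 < I0 := integral_bump_pos le_rfl
  set W := (omega n).real univ with hW
  have hWpos : 0 < W := omega_real_univ_pos
  have hcA : ∀ j : ℕ, Continuous fun η : CountingMeasure (E n × M) =>
      slabCount L ((j : ℝ) + 1)⁻¹ η * ballCount r x₀ η * fewPoints k (r' + 1 + w) η := fun j =>
    ((continuous_slabCount _ _).mul (continuous_ballCount _ _)).mul (continuous_fewPoints _ _)
  have hA0 : ∀ (j : ℕ) (η : CountingMeasure (E n × M)), 0 ≤ slabCount L ((j : ℝ) + 1)⁻¹ η *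
      ballCount r x₀ η * fewPoints k (r' + 1 + w) η := fun j η =>
    mul_nonneg (mul_nonneg (slabCount_nonneg _ _ _) (ballCount_nonneg _ _ _))
      (fewPoints_nonneg _ _ _)
  have hA1 : ∀ (j : ℕ) (η : CountingMeasure (E n × M)), |slabCount L ((j : ℝ) + 1)⁻¹ η *
      ballCount r x₀ η * fewPoints k (r' + 1 + w) η| ≤ 1 := fun j η => by
    rw [abs_of_nonneg (hA0 j η)]
    exact mul_le_one₀ (mul_le_one₀ (slabCount_le_one _ _ _) (ballCount_nonneg _ _ _)
      (ballCount_le_one _ _ _)) (fewPoints_nonneg _ _ _) (fewPoints_le_one _ _ _)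
  have hcB : ∀ j : ℕ, Continuous fun η : CountingMeasure (E n × M) =>
      pairSum r' ((j : ℝ) + 1)⁻¹ η * fewPoints (k + 2) r' η := fun j =>
    (continuous_pairSum _ _).mul (continuous_fewPoints _ _)
  have hB1 : ∀ (j : ℕ) (η : CountingMeasure (E n × M)),
      |pairSum r' ((j : ℝ) + 1)⁻¹ η * fewPoints (k + 2) r' η| ≤ (k + 3) ^ 2 + (k + 3) := by
    intro j η
    by_cases h : fewPoints (k + 2) r' η = 0
    · rw [h, mul_zero, abs_zero]; positivity
    · have h1 := lt_of_ramp_ne_zero h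
      have h2 := abs_pairSum_le (r := r') (δ := ((j : ℝ) + 1)⁻¹) (by positivity) η
      have h0 : 0 ≤ ∫ z, bump r' z.1 ∂η.1 := integral_nonneg fun z => bump_nonneg _ _
      rw [abs_mul, abs_of_nonneg (fewPoints_nonneg _ _ _)]
      refine (mul_le_of_le_one_right (abs_nonneg _) (fewPoints_le_one _ _ _)).trans (h2.trans ?_)
      have : ∫ z, bump r' z.1 ∂η.1 ≤ k + 3 := by linarith
      gcongr
  have hAnn : ∀ j, 0 ≤ A j := fun j => integral_nonneg fun s => integral_nonneg fun η => hA0 j η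
  -- The continuous spatial weights fit the two index sets of the transport inequality: `bump 0` is
  -- at most 1 and lives on the unit ball, while `bump (1 + w)` equals 1 on the ball of radius 1 + w
  -- where the mass is received.
  have key : ∀ j, cP * (I0 * (W * A j)) ≤ cP * (I1 * (W * B j)) := by
    intro j
    refine le_of_tendsto_of_tendsto
      (tendsto_avg_unmarked hn hP hP1 hP2 hμ 0 (hcA j) (hA1 j))
      (tendsto_avg_unmarked hn hP hP1 hP2 hμ (1 + w) (hcB j) (hB1 j))
      (Eventually.of_forall fun ρ => ?_)
    have hQA : ∀ p : P.carrier, Integrable (fun v => slabCount L ((j : ℝ) + 1)⁻¹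
        (Qset R P mark ρ p v).toCounting * ballCount r x₀ (Qset R P mark ρ p v).toCounting *
        fewPoints k (r' + 1 + w) (Qset R P mark ρ p v).toCounting) (omega n) := fun p =>
      integrable_bounded ((hcA j).measurable.comp
        (measurable_toCounting.comp (measurable_Qset_dir R P mark ρ p))) fun v => hA1 j _
    have hQB : ∀ p : P.carrier, Integrable (fun v => pairSum r' ((j : ℝ) + 1)⁻¹
        (Qset R P mark ρ p v).toCounting *
        fewPoints (k + 2) r' (Qset R P mark ρ p v).toCounting) (omega n) := fun p =>
      integrable_bounded ((hcB j).measurable.comp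
        (measurable_toCounting.comp (measurable_Qset_dir R P mark ρ p))) fun v => hB1 j _
    have i1 : ∀ v, ∑ p ∈ nearPts P 1 ρ, slabCount L ((j : ℝ) + 1)⁻¹
        (Qset R P mark ρ p v).toCounting * ballCount r x₀ (Qset R P mark ρ p v).toCounting *
        fewPoints k (r' + 1 + w) (Qset R P mark ρ p v).toCounting ≤
        ∑ p ∈ nearPts P (1 + w) ρ, pairSum r' ((j : ℝ) + 1)⁻¹
        (Qset R P mark ρ p v).toCounting *
        fewPoints (k + 2) r' (Qset R P mark ρ p v).toCounting := fun v =>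
      sum_slabCount_le R P mark ρ v (by positivity)
        (inv_le_one_of_one_le₀ (by simp)) hx₀ hL hr
    have i2 := integral_mono (μ := omega n) (integrable_finsetSum _ fun p _ => hQA p)
      (integrable_finsetSum _ fun p _ => hQB p) i1
    rw [integral_finsetSum _ fun p _ => hQA p, integral_finsetSum _ fun p _ => hQB p] at i2
    refine mul_le_mul_of_nonneg_left (le_trans ?_ (i2.trans ?_)) (pow_nonneg ρ.2.1.le _)
    · rw [zero_add]
      refine Finset.sum_le_sum fun p _ => ?_
      exact mul_le_of_le_one_left (integral_nonneg fun v => hA0 j _) (bump_le_one _ _)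
    · have hnn : ∀ p : P.carrier, 0 ≤ ∫ v, pairSum r' ((j : ℝ) + 1)⁻¹
          (Qset R P mark ρ p v).toCounting *
          fewPoints (k + 2) r' (Qset R P mark ρ p v).toCounting ∂(omega n) := fun p =>
        integral_nonneg fun v => mul_nonneg (PointSet.pairSum_toCounting_nonneg _ _ _)
          (fewPoints_nonneg _ _ _)
      refine le_trans (Finset.sum_le_sum fun p hp => ?_)
        (Finset.sum_le_sum_of_subset_of_nonneg (fun p hp => ?_)
          fun p _ _ => mul_nonneg (bump_nonneg _ _) (hnn p))
      · rw [bump_eq_one (mem_nearPts.1 hp), one_mul]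
      · rw [mem_nearPts] at hp ⊢
        linarith
  have hup : Tendsto (fun j => I1 / I0 * B j) atTop (𝓝 0) := by
    simpa using hB0.const_mul (I1 / I0)
  refine squeeze_zero hAnn (fun j => ?_) hup
  have h1 := le_of_mul_le_mul_left (key j) hcP
  have h2 : W * (I0 * A j) ≤ W * (I1 * B j) := by linarith
  have h3 := le_of_mul_le_mul_left h2 hWpos
  rw [div_mul_eq_mul_div, le_div_iff₀ hI0pos]
  linarith

/-- A nonempty B contains an atom, and f equals 1 there. -/
theorem CountingMeasure.one_le_integral (η : CountingMeasure (E n × M)) {f : E n × M → ℝ}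
    (hf : Continuous f) {r : ℝ} (hr : ∀ x, r < ‖x.1‖ → f x = 0) (h0 : ∀ x, 0 ≤ f x)
    {B : Set (E n × M)} (hB : MeasurableSet B) (h1 : ∀ x ∈ B, f x = 1) (h : η.1 B ≠ 0) :
    1 ≤ ∫ x, f x ∂η.1 := by
  have hsub : B ⊆ Metric.closedBall (0 : E n) r ×ˢ (univ : Set M) := fun x hx => by
    by_contra h'
    have := hr x (by by_contra! h2; exact h' ⟨by simpa using h2, mem_univ _⟩)
    rw [h1 x hx] at this
    exact one_ne_zero this
  have hlt : η.1 B < ∞ := (measure_mono hsub).trans_lt (η.2.1 _ (isCompact_closedBall_prod r))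
  have h2 := η.one_le_of_ne_zero hB h
  have h3 : (1 : ℝ) ≤ η.1.real B := by
    have := ENNReal.toReal_mono hlt.ne h2
    simpa [Measure.real] using this
  refine h3.trans ?_
  rw [← integral_indicator_one hB]
  refine integral_mono ((integrable_indicator_iff hB).2 (integrableOn_const hlt.ne))
    (hf.integrable_of_hasCompactSupport (hasCompactSupport_of_norm hr)) fun x => ?_
  by_cases hx : x ∈ B
  · simp [hx, h1 x hx]
  · simp [hx, h0 x]

theorem measure_le_lintegral_of_one_le {Ω : Type*} [MeasurableSpace Ω] {ν : Measure Ω} {A : Set Ω}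
    {f : Ω → ℝ} (hf : Measurable f) (h : ∀ x ∈ A, 1 ≤ f x) :
    ν A ≤ ∫⁻ x, ENNReal.ofReal (f x) ∂ν := by
  have h1 := mul_meas_ge_le_lintegral (μ := ν) (ENNReal.measurable_ofReal.comp hf) 1
  rw [one_mul] at h1
  refine (measure_mono fun x hx => ?_).trans h1
  exact ENNReal.one_le_ofReal.2 (h x hx)

theorem measurableSet_slab (L : ℝ) :
    MeasurableSet {x : E n × M | x.1 0 = 0 ∧ ‖x.1‖ ≤ L} := by
  have h1 : IsClosed {x : E n × M | x.1 0 = 0} := isClosed_eq (by fun_prop) continuous_const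
  have h2 : IsClosed {x : E n × M | ‖x.1‖ ≤ L} := isClosed_le (by fun_prop) continuous_const
  exact (h1.inter h2).measurableSet

/-- Almost surely, a typical scatterer does not see any other scatterer in its own hyperplane. -/
theorem ae_measure_face_eq_zero (hn : 1 ≤ n) {cP : ℝ} (hcP : 0 < cP)
    (hP : HasAsymptoticDensity P.carrier cP) {m : Measure M} [IsProbabilityMeasure m]
    (hP1 : UniformDensity P mark cP m) (hP2 : SphericalEquidistribution R P mark μ)
    (hμ : Continuous μ) (hQ2 : CoincidenceFree μ) (hQ3 : SmallVoids μ) :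
    ∀ᵐ s ∂m, (μ s : Measure (CountingMeasure (E n × M)))
      {η | η.1 {x : E n × M | x.1 0 = 0} ≠ 0} = 0 := by
  choose r hr hvoid using fun i : ℕ => hQ3 ((i : ℝ) + 1)⁻¹ (by positivity)
  -- The ball of radius r i is void with probability below 1/(i+1) wherever it is centred; its
  -- centre is put just high enough for the transport inequality.
  let x₀ : ℕ → E n := fun i => EuclideanSpace.single 0 (r i + 3)
  have hx₀ : ∀ i, r i + 3 ≤ x₀ i 0 := fun i => by simp [x₀]
  choose r₁ hr₁ using fun (L i : ℕ) => tendsto_slabCount_expect hn hcP hP hP1 hP2 hμ hQ2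
    (hx₀ i) (Nat.cast_nonneg L) (hr i).le
  have key : ∀ L i k : ℕ, ∀ᵐ s ∂m, (μ s : Measure (CountingMeasure (E n × M)))
      {η | η.1 {x : E n × M | x.1 0 = 0 ∧ ‖x.1‖ ≤ L} ≠ 0 ∧ ballCount (r i) (x₀ i) η = 1 ∧
        ∫ x, bump (r₁ L i) x.1 ∂η.1 ≤ k} = 0 := by
    intro L i k
    let F : ℕ → CountingMeasure (E n × M) → ℝ := fun j η =>
      slabCount L ((j : ℝ) + 1)⁻¹ η * ballCount (r i) (x₀ i) η * fewPoints k (r₁ L i) η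
    have hF : ∀ j, Continuous (F j) := fun j =>
      ((continuous_slabCount _ _).mul (continuous_ballCount _ _)).mul (continuous_fewPoints _ _)
    have hF0 : ∀ j η, 0 ≤ F j η := fun j η =>
      mul_nonneg (mul_nonneg (slabCount_nonneg _ _ _) (ballCount_nonneg _ _ _))
        (fewPoints_nonneg _ _ _)
    have hF1 : ∀ j η, |F j η| ≤ 1 := fun j η => by
      rw [abs_of_nonneg (hF0 j η)]
      exact mul_le_one₀ (mul_le_one₀ (slabCount_le_one _ _ _) (ballCount_nonneg _ _ _)
        (ballCount_le_one _ _ _)) (fewPoints_nonneg _ _ _) (fewPoints_le_one _ _ _)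
    have hint : ∀ j s, Integrable (F j) (μ s : Measure (CountingMeasure (E n × M))) :=
      fun j s => integrable_bounded (hF j).measurable (hF1 j)
    have hcont : ∀ j, Continuous fun s =>
        ∫ η, F j η ∂(μ s : Measure (CountingMeasure (E n × M))) := fun j =>
      continuous_integral_prob hμ (hF j) (hF1 j)
    have hmeas : ∀ j, Measurable fun s =>
        ENNReal.ofReal (∫ η, F j η ∂(μ s : Measure (CountingMeasure (E n × M)))) := fun j =>
      ENNReal.measurable_ofReal.comp (hcont j).measurable
    have hlim : Tendsto (fun j => ∫⁻ s, ENNReal.ofReal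
        (∫ η, F j η ∂(μ s : Measure (CountingMeasure (E n × M)))) ∂m) atTop (𝓝 0) := by
      have h1 := (ENNReal.continuous_ofReal.tendsto _).comp (hr₁ L i k (Nat.cast_nonneg k))
      rw [ENNReal.ofReal_zero] at h1
      refine h1.congr fun j => ?_
      exact ofReal_integral_eq_lintegral_ofReal
        ((hcont j).integrable_of_hasCompactSupport (HasCompactSupport.of_compactSpace _))
        (Eventually.of_forall fun s => integral_nonneg fun η => hF0 j η)
    -- By Fatou, the lim inf over j of the expectations of `F j` is zero for almost every mark. On
    -- the event in question every `F j` equals 1, so the probability of this event is at most that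
    -- lim inf.
    have h2 := lintegral_liminf_le (μ := m) (u := atTop) hmeas
    have hml : Measurable fun s => liminf (fun j => ENNReal.ofReal
        (∫ η, F j η ∂(μ s : Measure (CountingMeasure (E n × M))))) atTop := Measurable.liminf hmeas
    rw [hlim.liminf_eq, nonpos_iff_eq_zero, lintegral_eq_zero_iff hml] at h2
    filter_upwards [h2] with s hs
    rw [← nonpos_iff_eq_zero]
    refine le_trans ?_ (le_of_eq hs)
    refine le_liminf_of_le (by isBoundedDefault) (Eventually.of_forall fun j => ?_)
    rw [ofReal_integral_eq_lintegral_ofReal (hint j s) (Eventually.of_forall fun η => hF0 j η)]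
    refine measure_le_lintegral_of_one_le (hF j).measurable ?_
    rintro η ⟨hη1, hη2, hη3⟩
    have h3 : slabCount L ((j : ℝ) + 1)⁻¹ η = 1 := min_eq_left <|
      η.one_le_integral (continuous_slab L _) (fun _ => slab_eq_zero)
        (fun _ => mul_nonneg (bump_nonneg _ _) (tent_nonneg _ _)) (measurableSet_slab L)
        (fun x hx => by rw [hx.1, tent_zero, bump_eq_one hx.2, mul_one]) hη1
    have h4 : fewPoints k (r₁ L i) η = 1 := ramp_eq_one hη3
    simp only [F]
    rw [h3, h4, hη2, one_mul, one_mul]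
  have hall : ∀ᵐ s ∂m, ∀ L i k : ℕ, (μ s : Measure (CountingMeasure (E n × M)))
      {η | η.1 {x : E n × M | x.1 0 = 0 ∧ ‖x.1‖ ≤ L} ≠ 0 ∧ ballCount (r i) (x₀ i) η = 1 ∧
        ∫ x, bump (r₁ L i) x.1 ∂η.1 ≤ k} = 0 :=
    ae_all_iff.2 fun L => ae_all_iff.2 fun i => ae_all_iff.2 fun k => key L i k
  filter_upwards [hall] with s hs
  have h1 : ∀ L : ℕ, (μ s : Measure (CountingMeasure (E n × M)))
      {η | η.1 {x : E n × M | x.1 0 = 0 ∧ ‖x.1‖ ≤ L} ≠ 0} = 0 := by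
    intro L
    have h2 : ∀ i : ℕ, (μ s : Measure (CountingMeasure (E n × M)))
        {η | η.1 {x : E n × M | x.1 0 = 0 ∧ ‖x.1‖ ≤ L} ≠ 0} ≤
          ENNReal.ofReal ((i : ℝ) + 1)⁻¹ := by
      intro i
      -- Either the ball around x₀ i is void, which is improbable, or it contains a point; in the
      -- latter case the number of visible points is finite, hence below some k, and the event is
      -- among the null ones.
      refine le_trans (measure_mono (t := (⋃ k : ℕ, {η : CountingMeasure (E n × M) |
        η.1 {x : E n × M | x.1 0 = 0 ∧ ‖x.1‖ ≤ L} ≠ 0 ∧ ballCount (r i) (x₀ i) η = 1 ∧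
        ∫ x, bump (r₁ L i) x.1 ∂η.1 ≤ k}) ∪
        {η | η.1 (Metric.ball (x₀ i) (r i) ×ˢ univ) = 0}) fun η hη => ?_) ?_
      · by_cases hv : η.1 (Metric.ball (x₀ i) (r i) ×ˢ univ) = 0
        · exact Or.inr hv
        · obtain ⟨k, hk⟩ := exists_nat_ge (∫ x, bump (r₁ L i) x.1 ∂η.1)
          refine Or.inl (mem_iUnion.2 ⟨k, hη, min_eq_left ?_, hk⟩)
          refine η.one_le_integral (continuous_bump_sub _ _) (fun _ => bump_sub_eq_zero)
            (fun _ => bump_nonneg _ _) (Metric.isOpen_ball.prod isOpen_univ).measurableSet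
            (fun x hx => bump_eq_one ?_) hv
          have := hx.1
          rw [mem_ball_iff_norm] at this
          exact this.le
      · refine (measure_union_le _ _).trans ?_
        rw [measure_iUnion_null fun k => hs L i k, zero_add]
        exact (hvoid i s (x₀ i)).le
    have h3 : Tendsto (fun i : ℕ => ENNReal.ofReal ((i : ℝ) + 1)⁻¹) atTop (𝓝 0) := by
      have : Tendsto (fun j : ℕ => ((j : ℝ) + 1)⁻¹) atTop (𝓝 0) :=
        tendsto_inv_atTop_zero.comp (tendsto_atTop_add_const_right _ _ tendsto_natCast_atTop_atTop)
      have h := (ENNReal.continuous_ofReal.tendsto _).comp this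
      rw [ENNReal.ofReal_zero] at h
      exact h
    exact nonpos_iff_eq_zero.1 (ge_of_tendsto' h3 h2)
  refine measure_mono_null (fun η hη => ?_) (measure_iUnion_null h1)
  by_contra h'
  simp only [mem_iUnion, mem_ofPred_eq, not_exists, not_not] at h'
  refine hη (measure_mono_null (fun x hx => ?_) (measure_iUnion_null h'))
  obtain ⟨L, hL⟩ := exists_nat_ge ‖x.1‖
  exact mem_iUnion.2 ⟨L, hx, hL⟩

end FaceNull

end LorentzGas

namespace LorentzGas

/-! ### Void events and their continuous approximation. -/

section Voids

variable {n : ℕ} {M : Type*} [MetricSpace M] [CompactSpace M] [MeasurableSpace M] [BorelSpace M]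

/-- The set of counting measures without points in the varying open set `V_y` is closed. -/
theorem isClosed_void {Y : Type*} [TopologicalSpace Y] {V : Set ((E n × M) × Y)} (hV : IsOpen V) :
    IsClosed {p : CountingMeasure (E n × M) × Y | p.1.1 {x | (x, p.2) ∈ V} = 0} := by
  rw [← isOpen_compl_iff, isOpen_iff_mem_nhds]
  rintro ⟨η₀, y₀⟩ h
  -- A set covered by null neighbourhoods is null, so a nonvoid set contains a point x₀ of the
  -- support. A bump at x₀ keeps a positive integral for nearby measures, and its support stays
  -- inside the open set for nearby y.
  have h1 : ∃ x₀ ∈ {x | (x, y₀) ∈ V}, ∀ N ∈ 𝓝 x₀, η₀.1 N ≠ 0 := by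
    by_contra! h'
    refine h (measure_null_of_locally_null _ fun x hx => ?_)
    obtain ⟨N, hN, hN0⟩ := h' x hx
    exact ⟨N, mem_nhdsWithin_of_mem_nhds hN, hN0⟩
  obtain ⟨x₀, hx₀, hpos⟩ := h1
  obtain ⟨A, hA, B, hB, hAB⟩ := mem_nhds_prod_iff.1 (hV.mem_nhds hx₀)
  obtain ⟨K, hK, hKA, hKc⟩ := local_compact_nhds (interior_mem_nhds.2 hA)
  obtain ⟨φ, hφ1, hφ0, hφc, hφ⟩ := exists_continuous_one_zero_of_isCompact hKc
    (isOpen_interior (s := A)).isClosed_compl (disjoint_compl_right_iff_subset.2 hKA)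
  have h2 : 0 < ∫ x, φ x ∂η₀.1 := by
    rw [integral_pos_iff_support_of_nonneg (fun x => (hφ x).1)
      (φ.continuous.integrable_of_hasCompactSupport hφc)]
    refine (pos_iff_ne_zero.2 (hpos K hK)).trans_le (measure_mono fun x hx => ?_)
    rw [Function.mem_support, hφ1 hx]
    exact one_ne_zero
  have h3 : ∀ᶠ p : CountingMeasure (E n × M) × Y in 𝓝 (η₀, y₀), 0 < ∫ x, φ x ∂p.1.1 :=
    ((CountingMeasure.continuous_integral φ.continuous hφc).comp
      continuous_fst).continuousAt.eventually_const_lt h2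
  filter_upwards [h3, (continuous_snd.tendsto (η₀, y₀)).eventually_mem hB] with p hp hpB hp0
  replace hp0 : p.1.1 {x | (x, p.2) ∈ V} = 0 := hp0
  refine hp.ne' (integral_eq_zero_of_ae ?_)
  filter_upwards [compl_mem_ae_iff.2 hp0] with x hx
  by_contra h'
  refine hx (hAB ⟨interior_subset (s := A) ?_, hpB⟩)
  by_contra h''
  exact h' (hφ0 h'')

theorem measurableSet_void {W : Set (E n × M)} (hW : IsOpen W) :
    MeasurableSet {η : CountingMeasure (E n × M) | η.1 W = 0} := by
  have h := (isClosed_void (Y := Unit) (hW.preimage continuous_fst)).preimage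
    (Continuous.prodMk_left (X := CountingMeasure (E n × M)) ())
  exact h.measurableSet

/-- The indicator function of the absence of points in `B`. -/
noncomputable def voidInd (B : Set (E n × M)) (η : CountingMeasure (E n × M)) : ℝ :=
  {η : CountingMeasure (E n × M) | η.1 B = 0}.indicator 1 η

theorem voidInd_nonneg (B : Set (E n × M)) (η) : 0 ≤ voidInd B η :=
  indicator_nonneg (fun _ _ => zero_le_one) _

theorem voidInd_le_one (B : Set (E n × M)) (η) : voidInd B η ≤ 1 :=
  indicator_le_self' (fun _ _ => zero_le_one) _

theorem voidInd_eq_one {B : Set (E n × M)} {η : CountingMeasure (E n × M)} (h : η.1 B = 0) :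
    voidInd B η = 1 := indicator_of_mem (s := {η : CountingMeasure (E n × M) | η.1 B = 0}) h _

theorem voidInd_eq_zero {B : Set (E n × M)} {η : CountingMeasure (E n × M)} (h : η.1 B ≠ 0) :
    voidInd B η = 0 := indicator_of_notMem (s := {η : CountingMeasure (E n × M) | η.1 B = 0}) h _

theorem measurable_voidInd {W : Set (E n × M)} (hW : IsOpen W) :
    Measurable (voidInd W) :=
  measurable_one.indicator (measurableSet_void hW)

/-- A smoothed version of `voidInd`. -/
noncomputable def smoothVoid (θ : E n × M → ℝ) (η : CountingMeasure (E n × M)) : ℝ :=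
  max 0 (1 - ∫ x, θ x ∂η.1)

theorem smoothVoid_nonneg (θ : E n × M → ℝ) (η) : 0 ≤ smoothVoid θ η := le_max_left _ _

theorem smoothVoid_le_one {θ : E n × M → ℝ} (h0 : ∀ x, 0 ≤ θ x) (η) : smoothVoid θ η ≤ 1 :=
  max_le zero_le_one (sub_le_self _ (integral_nonneg h0))

theorem continuous_smoothVoid {θ : E n × M → ℝ} (hθ : Continuous θ) {r : ℝ}
    (hr : ∀ x, r < ‖x.1‖ → θ x = 0) : Continuous (smoothVoid θ) :=
  continuous_const.max (continuous_const.sub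
    (CountingMeasure.continuous_integral hθ (hasCompactSupport_of_norm hr)))

/-- The integrals tend to η(B), which is either 0 or at least 1, and max(0, 1 - η(B)) is then
exactly the void indicator. The common bump gives the dominating function. -/
theorem tendsto_smoothVoid {θ : ℕ → E n × M → ℝ} (hθ : ∀ k, Continuous (θ k)) {r : ℝ}
    (hr : ∀ k x, r + 1 < ‖x.1‖ → θ k x = 0) (h0 : ∀ k x, 0 ≤ θ k x) (h1 : ∀ k x, θ k x ≤ bump r x.1)
    {B : Set (E n × M)} (hB : MeasurableSet B)
    (hlim : ∀ x, Tendsto (fun k => θ k x) atTop (𝓝 (B.indicator 1 x)))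
    (η : CountingMeasure (E n × M)) :
    Tendsto (fun k => smoothVoid (θ k) η) atTop (𝓝 (voidInd B η)) := by
  have hB' : B ⊆ Metric.closedBall (0 : E n) (r + 1) ×ˢ univ := fun x hx => by
    by_contra h'
    have h2 : r + 1 < ‖x.1‖ := by
      by_contra! h2
      exact h' ⟨by simpa using h2, mem_univ _⟩
    have h3 := hlim x
    simp only [hr _ x h2, indicator_of_mem hx, Pi.one_apply] at h3
    exact zero_ne_one (tendsto_nhds_unique tendsto_const_nhds h3)
  have hfin : η.1 B ≠ ∞ :=
    ((measure_mono hB').trans_lt (η.2.1 _ (isCompact_closedBall_prod _))).ne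
  have h2 : Tendsto (fun k => ∫ x, θ k x ∂η.1) atTop (𝓝 (η.1.real B)) := by
    have e : ∫ x, B.indicator 1 x ∂η.1 = η.1.real B := integral_indicator_one hB
    rw [← e]
    refine tendsto_integral_of_dominated_convergence (fun x => bump r x.1)
      (fun k => (hθ k).aestronglyMeasurable) (integrable_bump η r) (fun k => ?_)
      (Eventually.of_forall hlim)
    refine Eventually.of_forall fun x => ?_
    rw [Real.norm_of_nonneg (h0 k x)]
    exact h1 k x
  have h3 := (tendsto_const_nhds (x := (0 : ℝ))).max ((tendsto_const_nhds (x := (1 : ℝ))).sub h2)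
  refine h3.trans (le_of_eq ?_)
  congr 1
  by_cases h : η.1 B = 0
  · rw [voidInd_eq_one h, Measure.real, h]; simp
  · rw [voidInd_eq_zero h]
    have h4 : 1 ≤ η.1.real B := by
      simpa [Measure.real] using ENNReal.toReal_mono hfin (η.one_le_of_ne_zero hB h)
    exact max_eq_left (by linarith)

/-- Continuous approximation of the void indicator of a bounded open set from above. -/
theorem exists_upper_void {W : Set (E n × M)} (hW : IsOpen W) {r : ℝ} (hr : ∀ x ∈ W, ‖x.1‖ ≤ r) :
    ∃ u : ℕ → CountingMeasure (E n × M) → ℝ, (∀ k, Continuous (u k)) ∧ (∀ k η, u k η ≤ 1) ∧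
      (∀ k η, voidInd W η ≤ u k η) ∧ ∀ η, Tendsto (fun k => u k η) atTop (𝓝 (voidInd W η)) := by
  let θ : ℕ → E n × M → ℝ := fun k x => 1 - (hW.isClosed_compl.apprSeq k x : ℝ)
  have h1 : ∀ k x, (hW.isClosed_compl.apprSeq k x : ℝ) ≤ 1 := fun k x =>
    HasOuterApproxClosed.apprSeq_apply_le_one hW.isClosed_compl k x
  have hθ0 : ∀ k x, 0 ≤ θ k x := fun k x => sub_nonneg.2 (h1 k x)
  have hθ1 : ∀ k x, θ k x ≤ 1 := fun k x => sub_le_self _ (NNReal.coe_nonneg _)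
  have hθW : ∀ k, ∀ x ∉ W, θ k x = 0 := fun k x hx => by
    simp only [θ]
    rw [HasOuterApproxClosed.apprSeq_apply_eq_one hW.isClosed_compl k hx]
    simp
  have hθc : ∀ k, Continuous (θ k) := fun k => by
    have := (hW.isClosed_compl.apprSeq k).continuous
    fun_prop
  have hθr : ∀ k x, r < ‖x.1‖ → θ k x = 0 := fun k x hx =>
    hθW k x fun h => (hr x h).not_gt hx
  refine ⟨fun k => smoothVoid (θ k), fun k => continuous_smoothVoid (hθc k) (hθr k),
    fun k η => smoothVoid_le_one (hθ0 k) η, fun k η => ?_, ?_⟩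
  · by_cases h : η.1 W = 0
    · have h2 : ∫ x, θ k x ∂η.1 = 0 := by
        refine integral_eq_zero_of_ae ?_
        filter_upwards [compl_mem_ae_iff.2 h] with x hx
        exact hθW k x hx
      change voidInd W η ≤ max 0 (1 - ∫ x, θ k x ∂η.1)
      rw [voidInd_eq_one h, h2]
      simp
    · rw [voidInd_eq_zero h]
      exact smoothVoid_nonneg _ _
  · refine tendsto_smoothVoid hθc (r := r) (fun k x hx => hθr k x (by linarith)) hθ0
      (fun k x => ?_) hW.measurableSet fun x => ?_
    · by_cases h : x ∈ W
      · rw [bump_eq_one (hr x h)]; exact hθ1 k x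
      · rw [hθW k x h]; exact bump_nonneg _ _
    · have h2 := (NNReal.continuous_coe.tendsto _).comp (tendsto_pi_nhds.1
        (HasOuterApproxClosed.tendsto_apprSeq hW.isClosed_compl) x)
      have h3 := h2.const_sub 1
      refine h3.trans (le_of_eq ?_)
      by_cases h : x ∈ W <;> simp [h]

/-- Continuous approximation of the void indicator of a bounded closed set from below. -/
theorem exists_lower_void {W : Set (E n × M)} (hW : IsClosed W) {r : ℝ}
    (hr : ∀ x ∈ W, ‖x.1‖ ≤ r) :
    ∃ u : ℕ → CountingMeasure (E n × M) → ℝ, (∀ k, Continuous (u k)) ∧ (∀ k η, 0 ≤ u k η) ∧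
      (∀ k η, u k η ≤ voidInd W η) ∧ ∀ η, Tendsto (fun k => u k η) atTop (𝓝 (voidInd W η)) := by
  let θ : ℕ → E n × M → ℝ := fun k x => bump r x.1 * (hW.apprSeq k x : ℝ)
  have h1 : ∀ k x, (hW.apprSeq k x : ℝ) ≤ 1 := fun k x =>
    HasOuterApproxClosed.apprSeq_apply_le_one hW k x
  have hθ0 : ∀ k x, 0 ≤ θ k x := fun k x => mul_nonneg (bump_nonneg _ _) (NNReal.coe_nonneg _)
  have hθW : ∀ k, ∀ x ∈ W, θ k x = 1 := fun k x hx => by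
    simp only [θ]
    rw [HasOuterApproxClosed.apprSeq_apply_eq_one hW k hx, bump_eq_one (hr x hx)]
    simp
  have hθc : ∀ k, Continuous (θ k) := fun k => by
    have := (hW.apprSeq k).continuous
    have := (continuous_bump (n := n) r).comp (continuous_fst (Y := M))
    fun_prop
  have hθr : ∀ k x, r + 1 < ‖x.1‖ → θ k x = 0 := fun k x hx => by
    simp only [θ]
    rw [bump_eq_zero hx.le, zero_mul]
  refine ⟨fun k => smoothVoid (θ k), fun k => continuous_smoothVoid (hθc k) (hθr k),
    fun k η => smoothVoid_nonneg _ _, fun k η => ?_, ?_⟩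
  · by_cases h : η.1 W = 0
    · rw [voidInd_eq_one h]
      exact smoothVoid_le_one (hθ0 k) η
    · rw [voidInd_eq_zero h]
      have := η.one_le_integral (hθc k) (hθr k) (hθ0 k) hW.measurableSet (hθW k) h
      exact max_le le_rfl (by linarith)
  · refine tendsto_smoothVoid hθc (r := r) hθr hθ0
      (fun k x => mul_le_of_le_one_right (bump_nonneg _ _) (h1 k x)) hW.measurableSet fun x => ?_
    have h2 := (NNReal.continuous_coe.tendsto _).comp (tendsto_pi_nhds.1
        (HasOuterApproxClosed.tendsto_apprSeq hW) x)
    have h3 := h2.const_mul (bump r x.1)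
    refine h3.trans (le_of_eq ?_)
    by_cases h : x ∈ W
    · simp [h, bump_eq_one (hr x h)]
    · simp [h]

end Voids

/-- For squeezing a discontinuous observable between continuous ones: the limit along `L` is taken
for each approximation, and the approximation is refined afterwards. -/
theorem tendsto_of_squeeze_family {ι : Type*} {L : Filter ι} {a b : ℕ → ι → ℝ} {x : ι → ℝ}
    {A B : ℕ → ℝ} {l : ℝ} (ha : ∀ k, Tendsto (a k) L (𝓝 (A k))) (hb : ∀ k, Tendsto (b k) L (𝓝 (B k)))
    (hA : Tendsto A atTop (𝓝 l)) (hB : Tendsto B atTop (𝓝 l)) (hax : ∀ k i, a k i ≤ x i)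
    (hxb : ∀ k i, x i ≤ b k i) : Tendsto x L (𝓝 l) := by
  refine tendsto_order.2 ⟨fun t ht => ?_, fun t ht => ?_⟩
  · obtain ⟨k, hk⟩ := (hA.eventually_const_lt ht).exists
    filter_upwards [(ha k).eventually_const_lt hk] with i hi using hi.trans_le (hax k i)
  · obtain ⟨k, hk⟩ := (hB.eventually_lt_const ht).exists
    filter_upwards [(hb k).eventually_lt_const hk] with i hi using (hxb k i).trans_lt hi

/-! ### Averages of observables restricted to void events. -/

section Limit

variable {n : ℕ} {M : Type*} [MetricSpace M] [CompactSpace M] [MeasurableSpace M] [BorelSpace M]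
  {R : FrameRotation n} {P : PointSet (E n)} {mark : P.carrier → M}
  {μ : M → ProbabilityMeasure (CountingMeasure (E n × M))}

theorem Tame.continuous_comp_shiftAdd {f : CountingMeasure (E n × M) → ℝ} (hf : Tame f) (y : E n)
    (s : M) : Continuous fun η => f (shiftAdd η y s) := by
  have h := continuous_shiftAdd.comp
    (Continuous.prodMk_left (X := CountingMeasure (E n × M)) (y, s))
  exact Continuous.comp (g := f) hf.continuous h

theorem Tame.markedObservable {f : CountingMeasure (E n × M) → ℝ} (hf : Tame f)
    (hf0 : ∀ η, 0 ≤ f η) (hf1 : ∀ η, f η ≤ 1) (y : E n) {u : CountingMeasure (E n × M) → ℝ}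
    (hu : Continuous u) (hu0 : ∀ η, 0 ≤ u η) (hu1 : ∀ η, u η ≤ 1) :
    MarkedObservable (fun s η => f (shiftAdd η y s) * u η) 1 := by
  refine ⟨fun s => ?_, fun s η => ?_, fun ε hε => ?_⟩
  · exact (hf.continuous_comp_shiftAdd y s).mul hu
  · rw [abs_of_nonneg (mul_nonneg (hf0 _) (hu0 _))]
    exact mul_le_one₀ (hf1 _) (hu0 _) (hu1 _)
  · obtain ⟨δ, hδ, h⟩ := hf.modulus y ε hε
    refine ⟨δ, hδ, fun s s' hs η => ?_⟩
    rw [← sub_mul, abs_mul, abs_of_nonneg (hu0 η)]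
    exact (mul_le_of_le_one_right (abs_nonneg _) (hu1 η)).trans (h s s' hs η)

/-- Dominated convergence over configurations, then over position and mark. Almost every mark is
enough, and the condition on boundaries is available only in that form. -/
theorem tendsto_expect {m : Measure M} [IsProbabilityMeasure m] (hμ : Continuous μ)
    {G : E n → ℝ} (hG : Integrable G) {F : ℕ → M → CountingMeasure (E n × M) → ℝ}
    (hF : ∀ k, MarkedObservable (F k) 1) {F' : M → CountingMeasure (E n × M) → ℝ}
    (hlim : ∀ᵐ s ∂m, ∀ᵐ η ∂(μ s : Measure (CountingMeasure (E n × M))),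
      Tendsto (fun k => F k s η) atTop (𝓝 (F' s η))) :
    Tendsto (fun k => ∫ z, G z.1 * (∫ η, F k z.2 η ∂(μ z.2 : Measure (CountingMeasure (E n × M))))
        ∂(volume.prod m)) atTop
      (𝓝 (∫ z, G z.1 * (∫ η, F' z.2 η ∂(μ z.2 : Measure (CountingMeasure (E n × M))))
        ∂(volume.prod m))) := by
  refine tendsto_integral_of_dominated_convergence (fun z => |G z.1|) (fun k => ?_) ?_ (fun k => ?_)
    ?_
  · exact hG.aestronglyMeasurable.comp_fst.mul
      (((hF k).continuous_expect hμ).comp continuous_snd).aestronglyMeasurable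
  · exact (hG.comp_fst m).abs
  · refine Eventually.of_forall fun z => ?_
    rw [norm_mul]
    refine mul_le_of_le_one_right (abs_nonneg _) ?_
    have h : ∀ᵐ η ∂(μ z.2 : Measure (CountingMeasure (E n × M))), ‖F k z.2 η‖ ≤ 1 :=
      Eventually.of_forall ((hF k).bound z.2)
    simpa using norm_integral_le_of_norm_le_const h
  · have h : ∀ᵐ z ∂((volume : Measure (E n)).prod m),
        ∀ᵐ η ∂(μ z.2 : Measure (CountingMeasure (E n × M))),
          Tendsto (fun k => F k z.2 η) atTop (𝓝 (F' z.2 η)) :=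
      Measure.quasiMeasurePreserving_snd.ae hlim
    filter_upwards [h] with z hz
    refine Tendsto.const_mul _ (tendsto_integral_of_dominated_convergence (fun _ => 1)
      (fun k => ((hF k).continuous _).aestronglyMeasurable) (integrable_const _) (fun k => ?_) hz)
    exact Eventually.of_forall ((hF k).bound z.2)

theorem measurable_toCounting_Qset (ρ : Radius) (q : E n) :
    Measurable fun v : Sph n => (Qset R P mark ρ q v).toCounting :=
  measurable_toCounting.comp (measurable_Qset_dir R P mark ρ q)

theorem Tame.integrable_dir {f : CountingMeasure (E n × M) → ℝ} (hf : Tame f)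
    (hf0 : ∀ η, 0 ≤ f η) (hf1 : ∀ η, f η ≤ 1) (y : E n) {w : CountingMeasure (E n × M) → ℝ}
    (hw : Measurable w) (hw0 : ∀ η, 0 ≤ w η) (hw1 : ∀ η, w η ≤ 1) {g : Sph n → ℝ}
    (hg : Continuous g) (ρ : Radius) (p : P.carrier) :
    Integrable (fun v => g v * (f (shiftAdd (Qset R P mark ρ p v).toCounting y (mark p)) *
      w (Qset R P mark ρ p v).toCounting)) (omega n) := by
  have hgi : Integrable g (omega n) :=
    hg.integrable_of_hasCompactSupport (HasCompactSupport.of_compactSpace _)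
  refine hgi.mul_bdd (c := 1) ?_ (Eventually.of_forall fun v => ?_)
  · have h := (((hf.continuous_comp_shiftAdd y (mark p)).measurable.mul hw).comp
      (measurable_toCounting_Qset (R := R) (mark := mark) ρ (p : E n)))
    exact h.aestronglyMeasurable
  · rw [Real.norm_of_nonneg (mul_nonneg (hf0 _) (hw0 _))]
    exact mul_le_one₀ (hf1 _) (hw0 _) (hw1 _)

theorem continuous_integral_dir {g : E n × Sph n → ℝ} (hg : Continuous g) :
    Continuous fun x => ∫ v, g (x, v) ∂(omega n) := by
  have h := continuous_parametric_integral_of_continuous (μ := omega n) (s := univ)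
    (f := fun x v => g (x, v)) hg isCompact_univ
  simpa using h

theorem integrable_integral_dir {g : E n × Sph n → ℝ} (hg : Continuous g) {T : ℝ}
    (hsupp : ∀ z : E n × Sph n, T < ‖z.1‖ → g z = 0) :
    Integrable fun x => ∫ v, g (x, v) ∂(omega n) := by
  refine (continuous_integral_dir hg).integrable_of_hasCompactSupport
    (HasCompactSupport.intro (isCompact_closedBall 0 T) fun x hx => ?_)
  have hx : T < ‖x‖ := by simpa using hx
  simp [hsupp (x, _) hx]

/-- Averages over the scatterers of tame observables, restricted to the configurations without
points in a given set with negligible boundary. -/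
theorem tendsto_avg_void (hn : 1 ≤ n) {cP : ℝ}
    (hP : HasAsymptoticDensity P.carrier cP) {m : Measure M} [IsProbabilityMeasure m]
    (hP1 : UniformDensity P mark cP m) (hP2 : SphericalEquidistribution R P mark μ)
    (hμ : Continuous μ) {T : ℝ} {g : E n × Sph n → ℝ} (hg : Continuous g) (hg0 : ∀ z, 0 ≤ g z)
    (hsupp : ∀ z : E n × Sph n, T < ‖z.1‖ → g z = 0)
    {f : CountingMeasure (E n × M) → ℝ} (hf : Tame f) (hf0 : ∀ η, 0 ≤ f η) (hf1 : ∀ η, f η ≤ 1)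
    (y : E n) {W : Set (E n × M)} (hW : IsOpen W) {r : ℝ} (hr : ∀ x ∈ W, ‖x.1‖ ≤ r)
    (hfr : ∀ᵐ s ∂m, (μ s : Measure (CountingMeasure (E n × M))) {η | η.1 (frontier W) ≠ 0} = 0) :
    Tendsto (fun ρ : Radius => avg P T ρ fun p =>
        ∫ v, g ((ρ : ℝ) ^ n • (p : E n), v) *
          (f (shiftAdd (Qset R P mark ρ p v).toCounting y (mark p)) *
            voidInd W (Qset R P mark ρ p v).toCounting) ∂(omega n)) toZero
      (𝓝 (cP * ∫ z, (∫ v, g (z.1, v) ∂(omega n)) *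
        (∫ η, f (shiftAdd η y z.2) * voidInd W η
          ∂(μ z.2 : Measure (CountingMeasure (E n × M)))) ∂(volume.prod m))) := by
  have hr' : ∀ x ∈ closure W, ‖x.1‖ ≤ r := by
    have h : IsClosed {x : E n × M | ‖x.1‖ ≤ r} := isClosed_le (by fun_prop) continuous_const
    exact fun x hx => closure_minimal hr h hx
  obtain ⟨u, huc, hu1, huW, hulim⟩ := exists_upper_void hW hr
  obtain ⟨l, hlc, hl0, hlW, hllim⟩ := exists_lower_void isClosed_closure hr'
  have hcl : ∀ η : CountingMeasure (E n × M), voidInd (closure W) η ≤ voidInd W η := fun η => by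
    by_cases h : η.1 (closure W) = 0
    · rw [voidInd_eq_one h, voidInd_eq_one (measure_mono_null subset_closure h)]
    · rw [voidInd_eq_zero h]; exact voidInd_nonneg _ _
  have hu0 : ∀ k η, 0 ≤ u k η := fun k η => (voidInd_nonneg _ _).trans (huW k η)
  have hl1 : ∀ k η, l k η ≤ 1 := fun k η => (hlW k η).trans (voidInd_le_one _ _)
  have hFu := fun k => hf.markedObservable hf0 hf1 y (huc k) (hu0 k) (hu1 k)
  have hFl := fun k => hf.markedObservable hf0 hf1 y (hlc k) (hl0 k) (hl1 k)
  have hG := integrable_integral_dir hg hsupp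
  have hgint : ∀ (ρ : Radius) (p : P.carrier) (w : CountingMeasure (E n × M) → ℝ),
      Measurable w → (∀ η, 0 ≤ w η) → (∀ η, w η ≤ 1) → Integrable (fun v =>
        g ((ρ : ℝ) ^ n • (p : E n), v) *
          (f (shiftAdd (Qset R P mark ρ p v).toCounting y (mark p)) *
            w (Qset R P mark ρ p v).toCounting)) (omega n) := fun ρ p w hw hw0 hw1 =>
    hf.integrable_dir hf0 hf1 y hw hw0 hw1 (hg.comp (Continuous.prodMk_right _)) ρ p
  -- The void indicator of W lies between continuous lower approximations for the closure of W and
  -- continuous upper ones for W itself.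
  refine tendsto_of_squeeze_family
    (fun k => tendsto_avg_observable hn hP hP1 hP2 hμ hg hg0 hsupp (hFl k))
    (fun k => tendsto_avg_observable hn hP hP1 hP2 hμ hg hg0 hsupp (hFu k))
    (Tendsto.const_mul _ (tendsto_expect (m := m) hμ hG hFl
      (F' := fun s η => f (shiftAdd η y s) * voidInd W η) ?_))
    (Tendsto.const_mul _ (tendsto_expect (m := m) hμ hG hFu
      (F' := fun s η => f (shiftAdd η y s) * voidInd W η) ?_)) (fun k ρ => ?_) (fun k ρ => ?_)
  · filter_upwards [hfr] with s hs
    filter_upwards [compl_mem_ae_iff.2 hs] with η hη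
    have hη : η.1 (frontier W) = 0 := by
      by_contra h; exact hη h
    -- The two limits agree because almost no configuration has a point on the boundary of W.
    have e : voidInd W η = voidInd (closure W) η := by
      refine le_antisymm ?_ (hcl η)
      by_cases h : η.1 W = 0
      · have h2 : η.1 (closure W) = 0 := by
          rw [closure_eq_self_union_frontier]
          exact measure_union_null h hη
        rw [voidInd_eq_one h2]; exact voidInd_le_one _ _
      · rw [voidInd_eq_zero h]; exact voidInd_nonneg _ _
    rw [e]
    exact (hllim η).const_mul _
  · exact Eventually.of_forall fun s => Eventually.of_forall fun η => (hulim η).const_mul _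
  · refine avg_mono fun p _ => integral_mono (hgint ρ p (l k) (hlc k).measurable (hl0 k) (hl1 k))
      (hgint ρ p _ (measurable_voidInd hW) (voidInd_nonneg W) (voidInd_le_one W)) fun v => ?_
    exact mul_le_mul_of_nonneg_left
      (mul_le_mul_of_nonneg_left ((hlW k _).trans (hcl _)) (hf0 _)) (hg0 _)
  · refine avg_mono fun p _ => integral_mono
      (hgint ρ p _ (measurable_voidInd hW) (voidInd_nonneg W) (voidInd_le_one W))
      (hgint ρ p (u k) (huc k).measurable (hu0 k) (hu1 k)) fun v => ?_
    exact mul_le_mul_of_nonneg_left (mul_le_mul_of_nonneg_left (huW k _) (hf0 _)) (hg0 _)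

end Limit

end LorentzGas

namespace LorentzGas

/-! ### Splitting off the first coordinate. -/

section Split

variable {n : ℕ}

theorem measurePreserving_split : MeasurePreserving
    (fun x : E n => (x 0, tailPt x)) volume (volume.prod volume) := by
  have h1 := PiLp.volume_preserving_ofLp (Fin (n + 1))
  have h2 := volume_preserving_piFinSuccAbove (fun _ : Fin (n + 1) => ℝ) 0
  have h3 := (MeasurePreserving.id (volume : Measure ℝ)).prod (PiLp.volume_preserving_toLp (Fin n))
  exact h3.comp (h2.comp h1)

theorem consPt_split (x : E n) : consPt (x 0) (tailPt x) = x := by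
  ext i
  refine Fin.cases ?_ (fun j => ?_) i <;> simp [consPt, tailPt]

@[simp] theorem consPt_zero (t : ℝ) (b : EuclideanSpace ℝ (Fin n)) : consPt t b 0 = t := rfl

@[simp] theorem tailPt_consPt (t : ℝ) (b : EuclideanSpace ℝ (Fin n)) : tailPt (consPt t b) = b := by
  ext j
  simp [consPt, tailPt]

theorem continuous_consPt :
    Continuous fun p : ℝ × EuclideanSpace ℝ (Fin n) => consPt p.1 p.2 := by
  refine (PiLp.continuous_toLp 2 _).comp (continuous_pi fun i => ?_)
  refine Fin.cases ?_ (fun j => ?_) i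
  · simpa using continuous_fst
  · simp only [Fin.cons_succ]
    fun_prop

theorem measurePreserving_consPt : MeasurePreserving
    (fun p : ℝ × EuclideanSpace ℝ (Fin n) => consPt p.1 p.2) (volume.prod volume) volume := by
  refine ⟨continuous_consPt.measurable, ?_⟩
  rw [← (measurePreserving_split (n := n)).map_eq,
    Measure.map_map continuous_consPt.measurable measurePreserving_split.measurable]
  have h : (fun p : ℝ × EuclideanSpace ℝ (Fin n) => consPt p.1 p.2) ∘
      (fun x : E n => (x 0, tailPt x)) = id := funext consPt_split
  rw [h, Measure.map_id]

theorem ae_zero_ne (t : ℝ) : ∀ᵐ y : E n, y 0 ≠ t := by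
  have h : ∀ᵐ p : ℝ × EuclideanSpace ℝ (Fin n) ∂(volume.prod volume), p.1 ≠ t :=
    Measure.quasiMeasurePreserving_fst.ae (compl_mem_ae_iff.2 (measure_singleton t))
  exact measurePreserving_split.quasiMeasurePreserving.ae h

theorem ae_tailPt_notMem {N : Set (EuclideanSpace ℝ (Fin n))} (hN : volume N = 0) :
    ∀ᵐ y : E n, tailPt y ∉ N := by
  have h : ∀ᵐ p : ℝ × EuclideanSpace ℝ (Fin n) ∂(volume.prod volume), p.2 ∉ N :=
    Measure.quasiMeasurePreserving_snd.ae (compl_mem_ae_iff.2 hN)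
  exact measurePreserving_split.quasiMeasurePreserving.ae h

end Split

/-! ### The boundary of the window carries no points. -/

section Frontier

variable {n : ℕ} {M : Type*} [MetricSpace M] [CompactSpace M] [MeasurableSpace M] [BorelSpace M]

theorem continuous_integral_bump_mul {Y : Type*} [TopologicalSpace Y] {θ : (E n × M) × Y → ℝ}
    (hθ : Continuous θ) (r : ℝ) :
    Continuous fun p : CountingMeasure (E n × M) × Y => ∫ x, bump r x.1 * θ (x, p.2) ∂p.1.1 := by
  refine CountingMeasure.continuous_integral_param (θ := fun x y => bump r x.1 * θ (x, y)) ?_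
    fun y₀ => ⟨_, isCompact_closedBall_prod (r + 1), Eventually.of_forall fun y x hx => ?_⟩
  · have := continuous_bump (n := n) r
    fun_prop
  · rw [bump_eq_zero, zero_mul]
    by_contra! h
    exact hx ⟨by simpa using h.le, mem_univ _⟩

/-- The void event for a closed set is in general neither open nor closed. It is the set where
countably many functionals vanish, one for each cutoff radius, and each of them is a limit of
continuous functionals. The joint measurability in y is needed for Fubini. -/
theorem measurableSet_void_of_isClosed {Y : Type*} [TopologicalSpace Y]
    [TopologicalSpace.PseudoMetrizableSpace Y] [MeasurableSpace Y] [BorelSpace Y]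
    [SecondCountableTopology Y] {S : Set ((E n × M) × Y)} (hS : IsClosed S) :
    MeasurableSet {p : CountingMeasure (E n × M) × Y | p.1.1 {x | (x, p.2) ∈ S} = 0} := by
  let φ : ℕ → (E n × M) × Y → ℝ := fun k z => (hS.apprSeq k z : ℝ)
  have hφ : ∀ k, Continuous (φ k) := fun k =>
    NNReal.continuous_coe.comp (hS.apprSeq k).continuous
  have hφ0 : ∀ k z, 0 ≤ φ k z := fun k z => NNReal.coe_nonneg _
  have hφ1 : ∀ k z, φ k z ≤ 1 := fun k z => HasOuterApproxClosed.apprSeq_apply_le_one hS k z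
  have hlim : ∀ z, Tendsto (fun k => φ k z) atTop (𝓝 (S.indicator 1 z)) := fun z => by
    have h := (NNReal.continuous_coe.tendsto _).comp
      (tendsto_pi_nhds.1 (HasOuterApproxClosed.tendsto_apprSeq hS) z)
    refine h.trans (le_of_eq ?_)
    by_cases hz : z ∈ S <;> simp [hz]
  have hSy : ∀ y, MeasurableSet {x | (x, y) ∈ S} := fun y =>
    (hS.preimage (Continuous.prodMk_left y)).measurableSet
  let H : ℕ → CountingMeasure (E n × M) × Y → ℝ := fun r p =>
    ∫ x, bump r x.1 * S.indicator 1 (x, p.2) ∂p.1.1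
  have hH : ∀ r, Measurable (H r) := fun r => by
    refine measurable_of_tendsto_metrizable
      (f := fun k p => ∫ x, bump r x.1 * φ k (x, p.2) ∂p.1.1)
      (fun k => (continuous_integral_bump_mul (hφ k) r).measurable) (tendsto_pi_nhds.2 fun p => ?_)
    refine tendsto_integral_of_dominated_convergence (fun x => bump r x.1)
      (fun k => ?_) (integrable_bump p.1 r) (fun k => ?_)
      (Eventually.of_forall fun x => (hlim _).const_mul _)
    · have h1 : Continuous fun x : E n × M => bump r x.1 := (continuous_bump _).comp continuous_fst
      exact (h1.mul ((hφ k).comp (Continuous.prodMk_left p.2))).aestronglyMeasurable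
    · refine Eventually.of_forall fun x => ?_
      rw [Real.norm_of_nonneg (mul_nonneg (bump_nonneg _ _) (hφ0 k _))]
      exact mul_le_of_le_one_right (bump_nonneg _ _) (hφ1 k _)
  have e : {p : CountingMeasure (E n × M) × Y | p.1.1 {x | (x, p.2) ∈ S} = 0} =
      ⋂ r : ℕ, {p | H r p = 0} := by
    ext p
    have hi : ∀ r : ℕ, Integrable (fun x : E n × M => bump r x.1 * S.indicator 1 (x, p.2)) p.1.1 := by
      intro r
      refine (integrable_bump p.1 r).mul_bdd (c := 1) ?_ (Eventually.of_forall fun x => ?_)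
      · exact (measurable_one.indicator (hSy p.2)).aestronglyMeasurable
      · by_cases h : (x, p.2) ∈ S <;> simp [h]
    have h0 : ∀ (r : ℕ) (x : E n × M), 0 ≤ bump r x.1 * S.indicator (1 : (E n × M) × Y → ℝ) (x, p.2) :=
      fun r x => mul_nonneg (bump_nonneg _ _) (indicator_nonneg (fun _ _ => zero_le_one) _)
    rw [mem_iInter]
    constructor
    · intro h r
      refine integral_eq_zero_of_ae ?_
      filter_upwards [compl_mem_ae_iff.2 (show p.1.1 {x | (x, p.2) ∈ S} = 0 from h)] with x hx
      have hx : (x, p.2) ∉ S := hx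
      simp [hx]
    · intro h
      have h1 : ∀ᵐ x ∂p.1.1, ∀ r : ℕ, bump r x.1 * S.indicator (1 : (E n × M) × Y → ℝ) (x, p.2) = 0 :=
        ae_all_iff.2 fun r => (integral_eq_zero_iff_of_nonneg (h0 r) (hi r)).1 (h r)
      refine compl_mem_ae_iff.1 ?_
      filter_upwards [h1] with x hx hxS
      have hxS : (x, p.2) ∈ S := hxS
      obtain ⟨r, hr⟩ := exists_nat_ge ‖x.1‖
      have h2 := hx r
      rw [bump_eq_one hr, indicator_of_mem hxS] at h2
      simp at h2
  rw [e]
  exact MeasurableSet.iInter fun r => hH r (measurableSet_singleton 0)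

/-- The pairs of a point and a translation for which the translated point lies on the boundary of
the cylinder, except possibly on its moving face. -/
def windowEdge (M : Type*) (c : ℝ) (U : Set (EuclideanSpace ℝ (Fin n))) : Set ((E n × M) × E n) :=
  {p | p.1.1 0 = c - p.2 0 ∨ tailPt p.1.1 + tailPt p.2 ∈ frontier U}

theorem isClosed_windowEdge (c : ℝ) (U : Set (EuclideanSpace ℝ (Fin n))) :
    IsClosed (windowEdge M c U) := by
  have ht := continuous_tailPt (n := n)
  have h1 : IsClosed {p : (E n × M) × E n | p.1.1 0 = c - p.2 0} :=
    isClosed_eq (by fun_prop) (by fun_prop)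
  have h2 : IsClosed {p : (E n × M) × E n | tailPt p.1.1 + tailPt p.2 ∈ frontier U} :=
    isClosed_frontier.preimage (by fun_prop)
  exact h1.union h2

/-- Two kinds of boundary are separated: the face x_1 = 0, the same for every y, and the remaining
edges, which move with y and can be averaged away. -/
theorem frontier_window_subset (c : ℝ) {U : Set (EuclideanSpace ℝ (Fin n))} (hU : IsOpen U)
    (y : E n) :
    frontier (window M c U y) ⊆ {x | x.1 0 = 0} ∪ {x | (x, y) ∈ windowEdge M c U} := by
  have ht := continuous_tailPt (n := n)
  have hcl : closure (window M c U y) ⊆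
      {x | c - y 0 ≤ x.1 0} ∩ ({x | x.1 0 ≤ 0} ∩ {x | tailPt x.1 + tailPt y ∈ closure U}) := by
    refine closure_minimal (fun x hx => ?_) ?_
    · obtain ⟨h1, h2, h3⟩ := mem_window.1 hx
      exact ⟨h1.le, h2.le, subset_closure h3⟩
    · have h1 : IsClosed {x : E n × M | c - y 0 ≤ x.1 0} := isClosed_le (by fun_prop) (by fun_prop)
      have h2 : IsClosed {x : E n × M | x.1 0 ≤ 0} := isClosed_le (by fun_prop) (by fun_prop)
      have h3 : IsClosed {x : E n × M | tailPt x.1 + tailPt y ∈ closure U} :=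
        isClosed_closure.preimage (by fun_prop)
      exact h1.inter (h2.inter h3)
  have hopen : IsOpen (window M c U y) := (isOpen_window hU).preimage (Continuous.prodMk_left y)
  intro x hx
  rw [hopen.frontier_eq] at hx
  obtain ⟨h1, h2, h3⟩ := hcl hx.1
  by_contra! h
  simp only [windowEdge, mem_union, mem_ofPred_eq, not_or, hU.frontier_eq] at h
  refine hx.2 (mem_window.2 ⟨lt_of_le_of_ne h1 (Ne.symm h.2.1), lt_of_le_of_ne h2 h.1, ?_⟩)
  by_contra h4
  exact h.2.2 ⟨h3, h4⟩

/-- Each fixed point x lies on an edge only for a null set of y, since hyperplanes and the boundary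
of U are null. Fubini exchanges the two quantifiers. -/
theorem ae_windowEdge (c : ℝ) {U : Set (EuclideanSpace ℝ (Fin n))}
    (hU : volume (frontier U) = 0) (η : CountingMeasure (E n × M)) :
    ∀ᵐ y : E n, η.1 {x | (x, y) ∈ windowEdge M c U} = 0 := by
  have h1 : ∀ᵐ x ∂η.1, ∀ᵐ y : E n, ¬ (x, y) ∈ windowEdge M c U := by
    refine Eventually.of_forall fun x => ?_
    have h2 : volume ((fun b => tailPt x.1 + b) ⁻¹' frontier U) = 0 := by
      rw [measure_preimage_add]; exact hU
    filter_upwards [ae_zero_ne (c - x.1 0), ae_tailPt_notMem h2] with y hy hy2 h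
    rcases h with h | h
    · exact hy (by linarith [show x.1 0 = c - y 0 from h])
    · exact hy2 h
  have h3 := (Measure.ae_ae_comm (p := fun x y => ¬ (x, y) ∈ windowEdge M c U)
    (isClosed_windowEdge c U).measurableSet.compl).1 h1
  filter_upwards [h3] with y hy
  rw [ae_iff] at hy
  simpa only [not_not] using hy

variable {μ : M → ProbabilityMeasure (CountingMeasure (E n × M))}

/-- A continuous family of point processes as a Markov kernel. -/
noncomputable def processKernel (hμ : Continuous μ) :
    ProbabilityTheory.Kernel M (CountingMeasure (E n × M)) :=
  ⟨fun s => μ s, measurable_measure_of_continuous hμ⟩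

instance (hμ : Continuous μ) : ProbabilityTheory.IsMarkovKernel (processKernel hμ) :=
  ⟨fun s => inferInstanceAs (IsProbabilityMeasure (μ s : Measure (CountingMeasure (E n × M))))⟩

/-- The moving edges are handled by Fubini over y and the joint law of mark and configuration. The
fixed face is the hypothesis `hface`, which no averaging in y could supply. -/
theorem ae_frontier_window {m : Measure M} [IsProbabilityMeasure m] (hμ : Continuous μ)
    (hface : ∀ᵐ s ∂m, (μ s : Measure (CountingMeasure (E n × M)))
      {η | η.1 {x : E n × M | x.1 0 = 0} ≠ 0} = 0)
    (c : ℝ) {U : Set (EuclideanSpace ℝ (Fin n))} (hU : IsOpen U) (hU' : volume (frontier U) = 0) :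
    ∀ᵐ y : E n, ∀ᵐ s ∂m, (μ s : Measure (CountingMeasure (E n × M)))
      {η | η.1 (frontier (window M c U y)) ≠ 0} = 0 := by
  have hm := measurableSet_void_of_isClosed (isClosed_windowEdge (n := n) (M := M) c U)
  have h1 : ∀ᵐ y : E n, ∀ᵐ z ∂(Measure.compProd m (processKernel hμ)),
      z.2.1 {x | (x, y) ∈ windowEdge M c U} = 0 := by
    refine (Measure.ae_ae_comm (p := fun (z : M × CountingMeasure (E n × M)) (y : E n) =>
      z.2.1 {x | (x, y) ∈ windowEdge M c U} = 0) ?_).1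
      (Eventually.of_forall fun z => ae_windowEdge c hU' z.2)
    exact ((measurable_snd.comp measurable_fst).prodMk measurable_snd) hm
  filter_upwards [h1] with y hy
  have h2 := Measure.ae_ae_of_ae_compProd hy
  filter_upwards [h2, hface] with s hs hs0
  have hs : ∀ᵐ η ∂(μ s : Measure (CountingMeasure (E n × M))),
    η.1 {x | (x, y) ∈ windowEdge M c U} = 0 := hs
  refine compl_mem_ae_iff.1 ?_
  filter_upwards [hs, compl_mem_ae_iff.2 hs0] with η h3 h4 h5
  refine h5 (measure_mono_null (frontier_window_subset c hU y) (measure_union_null ?_ h3))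
  by_contra h6
  exact h4 h6

end Frontier

end LorentzGas

namespace LorentzGas

/-! ### Measurability of the frame in position and direction. -/

section MeasurableFrames

variable {n : ℕ} (R : FrameRotation n) (ρ : Radius)

theorem FrameRotation.measurable_comp {Z Z' : Type*} [TopologicalSpace Z] [MeasurableSpace Z]
    [BorelSpace Z] [SecondCountableTopology Z] [TopologicalSpace Z'] [MeasurableSpace Z']
    [BorelSpace Z'] {Φ : Z × Matrix (Fin (n + 1)) (Fin (n + 1)) ℝ → Z'} (hΦ : Continuous Φ) :
    Measurable fun x : Z × Sph n => Φ (x.1, (R.toFun x.2).1) := by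
  obtain ⟨v₀, hv₀⟩ := R.exists_continuousOn
  have key : ∀ V : Set (Sph n), ContinuousOn R.toFun V →
      ContinuousOn (fun x : Z × Sph n => Φ (x.1, (R.toFun x.2).1)) (univ ×ˢ V) := fun V hV =>
    hΦ.comp_continuousOn (continuousOn_fst.prodMk (continuous_subtype_val.comp_continuousOn
      (hV.comp continuousOn_snd fun x hx => hx.2)))
  refine measurable_of_measurable_union_cover (univ ×ˢ {v₀}ᶜ) (univ ×ˢ {v₀})
    (MeasurableSet.univ.prod (measurableSet_singleton v₀).compl)
    (MeasurableSet.univ.prod (measurableSet_singleton v₀)) ?_ ?_ ?_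
  · rintro ⟨q, v⟩ -
    by_cases h : v = v₀ <;> simp [h]
  · exact (continuousOn_iff_continuous_domRestrict.1 (key _ hv₀)).measurable
  · exact (continuousOn_iff_continuous_domRestrict.1 (key _ (continuousOn_singleton _ _))).measurable

/-- The determinant is 1. The adjugate is polynomial in the entries, hence visibly continuous,
unlike the matrix inverse. -/
theorem inv_frame_matrix (v : Sph n) :
    ((R.toFun v).1 * Dmat n ρ)⁻¹ = ((R.toFun v).1 * Dmat n ρ).adjugate := by
  have h1 : (R.toFun v).1.det = 1 := (Matrix.mem_specialOrthogonalGroup_iff.1 (R.toFun v).2).2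
  rw [Matrix.inv_def, Matrix.det_mul, h1, det_Dmat, one_mul, Ring.inverse_one, one_smul]

theorem measurable_unframe : Measurable fun x : E n × Sph n => unframe R ρ x.2 x.1 := by
  simp only [unframe, inv_frame_matrix]
  have h : Continuous fun z : E n × Matrix (Fin (n + 1)) (Fin (n + 1)) ℝ =>
      (ρ : ℝ) ^ n • rowMul z.1 (z.2 * Dmat n ρ).adjugate := by
    have h1 : Continuous fun z : E n × Matrix (Fin (n + 1)) (Fin (n + 1)) ℝ =>
        (z.2 * Dmat n ρ).adjugate :=
      Continuous.matrix_adjugate (continuous_snd.matrix_mul continuous_const)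
    have h2 : Continuous fun z : E n × Matrix (Fin (n + 1)) (Fin (n + 1)) ℝ =>
        rowMul z.1 (z.2 * Dmat n ρ).adjugate := continuous_rowMul.comp (continuous_fst.prodMk h1)
    exact (continuous_const_smul ((ρ : ℝ) ^ n)).comp h2
  exact R.measurable_comp (Z := E n) (Z' := E n) h

theorem measurable_frame (p : E n) :
    Measurable fun x : E n × Sph n => frame R ρ x.1 x.2 p := by
  simp only [frame_apply]
  have h : Continuous fun z : E n × Matrix (Fin (n + 1)) (Fin (n + 1)) ℝ =>
      rowMul (p - z.1) (z.2 * Dmat n ρ) := by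
    have h1 : Continuous fun z : E n × Matrix (Fin (n + 1)) (Fin (n + 1)) ℝ => z.2 * Dmat n ρ :=
      continuous_snd.matrix_mul continuous_const
    exact continuous_rowMul.comp ((continuous_const.sub continuous_fst).prodMk h1)
  exact R.measurable_comp (Z := E n) (Z' := E n) h

end MeasurableFrames

/-! ### The density of the position of the first scatterer, and its limit. -/

section HitDensity

variable {n : ℕ} {M : Type*} [MetricSpace M] [CompactSpace M] [MeasurableSpace M] [BorelSpace M]
  (R : FrameRotation n) (P : PointSet (E n)) (mark : P.carrier → M)
  {μ : M → ProbabilityMeasure (CountingMeasure (E n × M))}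

theorem norm_le_of_mem_cylinder {c ξ : ℝ} {U : Set (EuclideanSpace ℝ (Fin n))}
    (hU : Bornology.IsBounded U) : ∃ r, 0 ≤ r ∧ ∀ x ∈ cylinder c U ξ, ‖x‖ ≤ r := by
  obtain ⟨r, hr⟩ := hU.exists_norm_le
  refine ⟨|c| + |ξ| + |r|, by positivity, fun x hx => ?_⟩
  have h1 : ‖x‖ ^ 2 = x 0 ^ 2 + ‖tailPt x‖ ^ 2 := by
    rw [EuclideanSpace.norm_sq_eq, EuclideanSpace.norm_sq_eq, Fin.sum_univ_succ]
    simp [tailPt]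
  have h2 : |x 0| ≤ |c| + |ξ| := by
    rw [abs_le]
    constructor <;> linarith [hx.1, hx.2.1, neg_abs_le c, le_abs_self c, le_abs_self ξ, abs_nonneg ξ]
  have h3 : ‖tailPt x‖ ≤ |r| := (hr _ hx.2.2).trans (le_abs_self r)
  refine (sq_le_sq₀ (norm_nonneg _) (by positivity)).1 ?_
  rw [h1, ← sq_abs (x 0)]
  nlinarith [abs_nonneg (x 0), norm_nonneg (tailPt x), abs_nonneg r, abs_nonneg c, abs_nonneg ξ]

theorem window_norm_le {c ξ r : ℝ} {U : Set (EuclideanSpace ℝ (Fin n))}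
    (hr : ∀ x ∈ cylinder c U ξ, ‖x‖ ≤ r) {y : E n} (hy : y ∈ cylinder c U ξ) :
    ∀ x ∈ window M c U y, ‖x.1‖ ≤ r + r := by
  intro x hx
  have h1 : x.1 + y ∈ cylinder c U ξ := ⟨hx.1, by linarith [hx.2.1, hy.2.1], hx.2.2⟩
  have h2 := norm_sub_le (x.1 + y) y
  rw [add_sub_cancel_right] at h2
  linarith [hr _ h1, hr _ hy]

theorem measurableSet_cylinder {c ξ : ℝ} {U : Set (EuclideanSpace ℝ (Fin n))} (hU : IsOpen U) :
    MeasurableSet (cylinder c U ξ) := by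
  have ht := continuous_tailPt (n := n)
  have h1 : IsOpen {x : E n | c < x 0} := isOpen_lt (by fun_prop) (by fun_prop)
  have h2 : IsOpen {x : E n | x 0 < c + ξ} := isOpen_lt (by fun_prop) (by fun_prop)
  exact (h1.inter (h2.inter (hU.preimage ht))).measurableSet

/-- The contribution of the scatterer `p` to the event that the first scatterer in the cylinder is
seen at the position `y` of the particle frame. -/
noncomputable def hitWeight (φ : E n × Sph n → ℝ) (f : CountingMeasure (E n × M) → ℝ) (c : ℝ)
    (U : Set (EuclideanSpace ℝ (Fin n))) (ρ : Radius) (p : P.carrier) (y : E n) (v : Sph n) : ℝ :=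
  φ ((ρ : ℝ) ^ n • (p : E n) - unframe R ρ v y, v) *
    (f (shiftAdd (Qset R P mark ρ p v).toCounting y (mark p)) *
      voidInd (window M c U y) (Qset R P mark ρ p v).toCounting)

variable {R P mark}

theorem measurable_comp_shiftAdd {f : CountingMeasure (E n × M) → ℝ} (hf : Continuous f) (s : M) :
    Measurable fun x : CountingMeasure (E n × M) × E n => f (shiftAdd x.1 x.2 s) := by
  have h1 : Continuous fun x : CountingMeasure (E n × M) × E n => (x.1, (x.2, s)) := by fun_prop
  have h2 := Continuous.comp continuous_shiftAdd h1
  exact (Continuous.comp (g := f) hf h2).measurable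

theorem measurable_voidInd_window {c : ℝ} {U : Set (EuclideanSpace ℝ (Fin n))} (hU : IsOpen U) :
    Measurable fun x : CountingMeasure (E n × M) × E n => voidInd (window M c U x.2) x.1 :=
  measurable_one.indicator (isClosed_void (isOpen_window (n := n) (M := M) (c := c) hU)).measurableSet

theorem measurable_hitWeight {φ : E n × Sph n → ℝ} (hφ : Continuous φ)
    {f : CountingMeasure (E n × M) → ℝ} (hf : Continuous f) {c : ℝ}
    {U : Set (EuclideanSpace ℝ (Fin n))} (hU : IsOpen U) (ρ : Radius) (p : P.carrier) :
    Measurable fun z : E n × Sph n => hitWeight R P mark φ f c U ρ p z.1 z.2 := by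
  have h1 : Measurable fun z : E n × Sph n => ((Qset R P mark ρ p z.2).toCounting, z.1) :=
    ((measurable_toCounting_Qset ρ (p : E n)).comp measurable_snd).prodMk measurable_fst
  have h2 := (measurable_comp_shiftAdd hf (mark p)).comp h1
  have h3 := (measurable_voidInd_window (M := M) (c := c) hU).comp h1
  have h4 : Measurable fun z : E n × Sph n => φ ((ρ : ℝ) ^ n • (p : E n) - unframe R ρ z.2 z.1, z.2) :=
    hφ.measurable.comp ((measurable_const.sub (measurable_unframe R ρ)).prodMk measurable_snd)
  exact h4.mul (h2.mul h3)

theorem abs_hitWeight_le {φ : E n × Sph n → ℝ} {C : ℝ} (hC : ∀ z, |φ z| ≤ C)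
    {f : CountingMeasure (E n × M) → ℝ} (hf0 : ∀ η, 0 ≤ f η) (hf1 : ∀ η, f η ≤ 1) {c : ℝ}
    {U : Set (EuclideanSpace ℝ (Fin n))} (ρ : Radius) (p : P.carrier) (y : E n) (v : Sph n) :
    |hitWeight R P mark φ f c U ρ p y v| ≤ C := by
  rw [hitWeight, abs_mul, abs_of_nonneg (mul_nonneg (hf0 _) (voidInd_nonneg _ _))]
  exact (mul_le_of_le_one_right (abs_nonneg _)
    (mul_le_one₀ (hf1 _) (voidInd_nonneg _ _) (voidInd_le_one _ _))).trans (hC _)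

theorem integrable_hitWeight {φ : E n × Sph n → ℝ} (hφ : Continuous φ) {C : ℝ}
    (hC : ∀ z, |φ z| ≤ C) {f : CountingMeasure (E n × M) → ℝ} (hf : Continuous f)
    (hf0 : ∀ η, 0 ≤ f η) (hf1 : ∀ η, f η ≤ 1) {c : ℝ}
    {U : Set (EuclideanSpace ℝ (Fin n))} (hU : IsOpen U) (ρ : Radius) (p : P.carrier) (y : E n) :
    Integrable (fun v => hitWeight R P mark φ f c U ρ p y v) (omega n) := by
  have h0 := measurable_hitWeight (R := R) (mark := mark) (c := c) hφ hf hU ρ p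
  have h1 : Measurable fun v : Sph n => (y, v) := measurable_prodMk_left
  have h := h0.comp h1
  exact integrable_bounded h fun v => abs_hitWeight_le hC hf0 hf1 ρ p y v

theorem abs_mul_le_of_mem_unit {a w ε : ℝ} (h : |a| ≤ ε) (h0 : 0 ≤ w) (h1 : w ≤ 1) :
    |a * w| ≤ ε := by
  rw [abs_mul, abs_of_nonneg h0]
  exact (mul_le_of_le_one_right (abs_nonneg _) h1).trans h

theorem abs_sub_hitWeight_le {φ : E n × Sph n → ℝ} {f : CountingMeasure (E n × M) → ℝ}
    (hf0 : ∀ η, 0 ≤ f η) (hf1 : ∀ η, f η ≤ 1) {c : ℝ} {U : Set (EuclideanSpace ℝ (Fin n))}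
    {ρ : Radius} {p : P.carrier} {y : E n} {v : Sph n} {a ε : ℝ}
    (h : |a - φ ((ρ : ℝ) ^ n • (p : E n) - unframe R ρ v y, v)| ≤ ε) :
    |a * (f (shiftAdd (Qset R P mark ρ p v).toCounting y (mark p)) *
      voidInd (window M c U y) (Qset R P mark ρ p v).toCounting) -
        hitWeight R P mark φ f c U ρ p y v| ≤ ε := by
  rw [hitWeight, ← sub_mul]
  exact abs_mul_le_of_mem_unit h (mul_nonneg (hf0 _) (voidInd_nonneg _ _))
    (mul_le_one₀ (hf1 _) (voidInd_nonneg _ _) (voidInd_le_one _ _))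

/-- For each v the shift by tv preserves volume, so the skew shift preserves the product measure.
This removes the dependence of the limit on the shape of φ. -/
theorem integral_translate {φ : E n × Sph n → ℝ} (hφ : Continuous φ) (hc : HasCompactSupport φ)
    (t : ℝ) : ∫ x : E n, ∫ v, φ (x - t • (v : E n), v) ∂(omega n) = ∫ z, φ z ∂(volume.prod (omega n)) := by
  have hmp : MeasurePreserving (fun z : E n × Sph n => (z.1 - t • (z.2 : E n), z.2))
      (volume.prod (omega n)) (volume.prod (omega n)) := by
    have h := (MeasurePreserving.id (omega n)).skew_product (μc := (volume : Measure (E n)))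
      (μd := volume) (g := fun v x => x - t • (v : E n)) (by unfold Function.uncurry; fun_prop)
      (Eventually.of_forall fun v => (measurePreserving_sub_right volume (t • (v : E n))).map_eq)
    exact (Measure.measurePreserving_swap.comp h).comp Measure.measurePreserving_swap
  have hi : Integrable φ (volume.prod (omega n)) := hφ.integrable_of_hasCompactSupport hc
  have h2 := hmp.integrable_comp_of_integrable hi
  have h3 := integral_prod _ h2
  refine h3.symm.trans ?_
  have h4 := integral_map (μ := volume.prod (omega n)) hmp.measurable.aemeasurable
    (f := φ) hφ.aestronglyMeasurable
  rw [hmp.map_eq] at h4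
  exact h4.symm

/-- The expectation of `f` over the limit process seen from `y`, with the cylinder before `y`
empty. -/
noncomputable def voidExpect (μ : M → ProbabilityMeasure (CountingMeasure (E n × M)))
    (f : CountingMeasure (E n × M) → ℝ) (c : ℝ) (U : Set (EuclideanSpace ℝ (Fin n))) (y : E n)
    (s : M) : ℝ :=
  ∫ η, f (shiftAdd η y s) * voidInd (window M c U y) η
    ∂(μ s : Measure (CountingMeasure (E n × M)))

/-- By `norm_unframe_sub_le` the two arguments are within ρ^(n+1)‖y‖ of each other, and φ is
uniformly continuous. -/
theorem eventually_abs_sub_le {φ : E n × Sph n → ℝ} (hφ : Continuous φ)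
    (hc : HasCompactSupport φ) (y : E n) {ε : ℝ} (hε : 0 < ε) :
    ∀ᶠ ρ : Radius in toZero, ∀ (x : E n) (v : Sph n),
      |φ (x - y 0 • (v : E n), v) - φ (x - unframe R ρ v y, v)| ≤ ε := by
  obtain ⟨δ, hδ, h⟩ := Metric.uniformContinuous_iff.1
    (hc.uniformContinuous_of_continuous hφ) ε hε
  filter_upwards [eventually_toZero_lt (δ := δ / (‖y‖ + 1)) (by positivity)] with ρ hρ x v
  refine (h ?_).le
  rw [Prod.dist_eq, dist_self, max_eq_left dist_nonneg, dist_eq_norm, sub_sub_sub_cancel_left]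
  refine (norm_unframe_sub_le R ρ v y).trans_lt ?_
  have h1 : (ρ : ℝ) ^ (n + 1) ≤ ρ := by
    rw [pow_succ]
    exact mul_le_of_le_one_left ρ.2.1.le (pow_le_one₀ ρ.2.1.le ρ.2.2.le)
  have h2 : (ρ : ℝ) * (‖y‖ + 1) < δ := by rwa [lt_div_iff₀ (by positivity)] at hρ
  nlinarith [norm_nonneg y, ρ.2.1]

/-- For a fixed position `y`, the hitting density converges. -/
theorem tendsto_avg_hitWeight (hn : 1 ≤ n) {cP : ℝ}
    (hP : HasAsymptoticDensity P.carrier cP) {m : Measure M} [IsProbabilityMeasure m]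
    (hP1 : UniformDensity P mark cP m) (hP2 : SphericalEquidistribution R P mark μ)
    (hμ : Continuous μ) {φ : E n × Sph n → ℝ} (hφ : Continuous φ) (hφ0 : ∀ z, 0 ≤ φ z) {T₀ T : ℝ}
    (hsupp : ∀ z : E n × Sph n, T₀ < ‖z.1‖ → φ z = 0)
    {f : CountingMeasure (E n × M) → ℝ} (hf : Tame f) (hf0 : ∀ η, 0 ≤ f η) (hf1 : ∀ η, f η ≤ 1)
    {c : ℝ} {U : Set (EuclideanSpace ℝ (Fin n))} (hU : IsOpen U)
    (y : E n) (hT : T₀ + ‖y‖ ≤ T) {r : ℝ} (hr : ∀ x ∈ window M c U y, ‖x.1‖ ≤ r)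
    (hfr : ∀ᵐ s ∂m, (μ s : Measure (CountingMeasure (E n × M)))
      {η | η.1 (frontier (window M c U y)) ≠ 0} = 0) :
    Tendsto (fun ρ : Radius => avg P T ρ fun p =>
        ∫ v, hitWeight R P mark φ f c U ρ p y v ∂(omega n)) toZero
      (𝓝 (cP * ((∫ z, φ z ∂(volume.prod (omega n))) * ∫ s, voidExpect μ f c U y s ∂m))) := by
  have hopen : IsOpen (window M c U y) := (isOpen_window hU).preimage (Continuous.prodMk_left y)
  -- The limiting form of the weight, with the initial position replaced by ρ^n p - y_1 v. It no
  -- longer depends on ρ except through ρ^n p, as the averaging result requires.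
  let g : E n × Sph n → ℝ := fun z => φ (z.1 - y 0 • (z.2 : E n), z.2)
  have hg : Continuous g := hφ.comp (by fun_prop)
  have hgs : ∀ z : E n × Sph n, T < ‖z.1‖ → g z = 0 := fun z hz => by
    refine hsupp _ ?_
    have h1 : |y 0| ≤ ‖y‖ := PiLp.norm_apply_le y 0
    have h2 := norm_sub_norm_le z.1 (y 0 • (z.2 : E n))
    rw [norm_smul, norm_eq_of_mem_sphere, mul_one, Real.norm_eq_abs] at h2
    change T₀ < ‖z.1 - y 0 • (z.2 : E n)‖
    linarith
  have hc : HasCompactSupport φ := by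
    refine HasCompactSupport.intro ((isCompact_closedBall (0 : E n) T₀).prod
      (isCompact_univ (X := Sph n))) fun z hz => hsupp z ?_
    by_contra! h
    exact hz ⟨by simpa using h, mem_univ _⟩
  have key := tendsto_avg_void hn hP hP1 hP2 hμ hg (fun z => hφ0 _) hgs hf hf0 hf1 y hopen hr hfr
  have e : ∫ z, (∫ v, g (z.1, v) ∂(omega n)) * (∫ η, f (shiftAdd η y z.2) *
      voidInd (window M c U y) η ∂(μ z.2 : Measure (CountingMeasure (E n × M))))
        ∂((volume : Measure (E n)).prod m) =
      (∫ z, φ z ∂(volume.prod (omega n))) * ∫ s, voidExpect μ f c U y s ∂m := by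
    rw [← integral_translate hφ hc (y 0)]
    exact integral_prod_mul (fun x : E n => ∫ v, g (x, v) ∂(omega n)) fun s => voidExpect μ f c U y s
  rw [e] at key
  -- The replacement is undone: it costs a uniformly small amount per scatterer, and the normalized
  -- number of scatterers is bounded.
  refine key.congr_dist ?_
  obtain ⟨C, hC0, hC⟩ := eventually_avg_one_le hn hP T
  obtain ⟨B, hB⟩ := hφ.bounded_above_of_compact_support hc
  rw [Metric.tendsto_nhds]
  intro ε hε
  have hω := omega_real_univ_pos (n := n)
  filter_upwards [hC, eventually_abs_sub_le (R := R) hφ hc y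
    (ε := ε / (2 * ((C + 1) * (omega n).real univ))) (by positivity)] with ρ h1 h2
  rw [dist_zero_right, Real.norm_of_nonneg dist_nonneg, Real.dist_eq, ← avg_sub]
  have hle : ∀ p : P.carrier, |∫ v, g ((ρ : ℝ) ^ n • (p : E n), v) *
      (f (shiftAdd (Qset R P mark ρ p v).toCounting y (mark p)) *
        voidInd (window M c U y) (Qset R P mark ρ p v).toCounting) ∂(omega n) -
      ∫ v, hitWeight R P mark φ f c U ρ p y v ∂(omega n)| ≤
      ε / (2 * ((C + 1) * (omega n).real univ)) * (omega n).real univ := fun p =>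
    abs_integral_sub_le (hf.integrable_dir hf0 hf1 y (measurable_voidInd hopen)
      (voidInd_nonneg _) (voidInd_le_one _) (hg.comp (Continuous.prodMk_right _)) ρ p)
      (integrable_hitWeight hφ hB hf.continuous hf0 hf1 hU ρ p y)
      fun v => abs_sub_hitWeight_le hf0 hf1 (h2 _ _)
  refine (abs_avg_le _).trans_lt ?_
  refine (avg_mono fun p _ => hle p).trans_lt ?_
  have e2 : (avg P T ρ fun _ => ε / (2 * ((C + 1) * (omega n).real univ)) * (omega n).real univ) =
      ε / (2 * ((C + 1) * (omega n).real univ)) * (omega n).real univ * avg P T ρ fun _ => 1 := by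
    rw [← avg_const_mul]; simp
  rw [e2]
  have e3 : ε / (2 * ((C + 1) * (omega n).real univ)) * (omega n).real univ = ε / (2 * (C + 1)) := by
    field_simp
  rw [e3]
  calc ε / (2 * (C + 1)) * avg P T ρ (fun _ => 1) ≤ ε / (2 * (C + 1)) * C := by gcongr
    _ < ε := by
      rw [div_mul_eq_mul_div, div_lt_iff₀ (by positivity)]
      nlinarith

/-- The integrated hitting density converges. -/
theorem tendsto_integral_hitWeight (hn : 1 ≤ n) {cP : ℝ}
    (hP : HasAsymptoticDensity P.carrier cP) {m : Measure M} [IsProbabilityMeasure m]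
    (hP1 : UniformDensity P mark cP m) (hP2 : SphericalEquidistribution R P mark μ)
    (hμ : Continuous μ)
    (hface : ∀ᵐ s ∂m, (μ s : Measure (CountingMeasure (E n × M)))
      {η | η.1 {x : E n × M | x.1 0 = 0} ≠ 0} = 0)
    {φ : E n × Sph n → ℝ} (hφ : Continuous φ) (hφ0 : ∀ z, 0 ≤ φ z) {T₀ T r : ℝ}
    (hsupp : ∀ z : E n × Sph n, T₀ < ‖z.1‖ → φ z = 0)
    {f : CountingMeasure (E n × M) → ℝ} (hf : Tame f) (hf0 : ∀ η, 0 ≤ f η) (hf1 : ∀ η, f η ≤ 1)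
    {c ξ : ℝ} {U : Set (EuclideanSpace ℝ (Fin n))} (hU : IsOpen U) (hU' : volume (frontier U) = 0)
    (hr : ∀ x ∈ cylinder c U ξ, ‖x‖ ≤ r) (hT : T₀ + r ≤ T) :
    Tendsto (fun ρ : Radius => ∫ y in cylinder c U ξ, avg P T ρ fun p =>
        ∫ v, hitWeight R P mark φ f c U ρ p y v ∂(omega n)) toZero
      (𝓝 (∫ y in cylinder c U ξ,
        cP * ((∫ z, φ z ∂(volume.prod (omega n))) * ∫ s, voidExpect μ f c U y s ∂m))) := by
  have hc : HasCompactSupport φ := by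
    refine HasCompactSupport.intro ((isCompact_closedBall (0 : E n) T₀).prod
      (isCompact_univ (X := Sph n))) fun z hz => hsupp z ?_
    by_contra! h
    exact hz ⟨by simpa using h, mem_univ _⟩
  obtain ⟨C, hC0, hC⟩ := eventually_avg_one_le hn hP T
  obtain ⟨B₀, hB⟩ := hφ.bounded_above_of_compact_support hc
  have hB' : ∀ z, |φ z| ≤ |B₀| := fun z => (hB z).trans (le_abs_self _)
  have hmeas := measurableSet_cylinder (c := c) (ξ := ξ) hU
  have hfin : IsFiniteMeasure ((volume : Measure (E n)).restrict (cylinder c U ξ)) := by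
    refine isFiniteMeasure_restrict.2 (((measure_mono fun x hx => ?_).trans_lt
      (measure_closedBall_lt_top (x := (0 : E n)) (r := r))).ne)
    simpa using hr x hx
  refine tendsto_integral_filter_of_dominated_convergence
    (fun _ => |B₀| * (omega n).real univ * C) ?_ ?_ (integrable_const _) ?_
  · refine Eventually.of_forall fun ρ => ?_
    have h1 : ∀ p : P.carrier, StronglyMeasurable fun y : E n =>
        ∫ v, hitWeight R P mark φ f c U ρ p y v ∂(omega n) := fun p =>
      (measurable_hitWeight hφ hf.continuous hU ρ p).stronglyMeasurable.integral_prod_right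
    unfold avg
    exact ((Finset.stronglyMeasurable_fun_sum _ fun p _ => h1 p).const_mul _).aestronglyMeasurable
  · filter_upwards [hC] with ρ hρ
    refine Eventually.of_forall fun y => ?_
    refine (abs_avg_le _).trans ?_
    have h1 : ∀ p : P.carrier, |∫ v, hitWeight R P mark φ f c U ρ p y v ∂(omega n)| ≤
        |B₀| * (omega n).real univ := fun p => by
      have h2 : ∀ᵐ v ∂(omega n), ‖hitWeight R P mark φ f c U ρ p y v‖ ≤ |B₀| :=
        Eventually.of_forall fun v => abs_hitWeight_le hB' hf0 hf1 ρ p y v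
      exact norm_integral_le_of_norm_le_const h2
    refine (avg_mono (h' := fun _ => |B₀| * (omega n).real univ * 1) fun p _ => by
      rw [mul_one]; exact h1 p).trans ?_
    rw [avg_const_mul]
    exact mul_le_mul_of_nonneg_left hρ (mul_nonneg (abs_nonneg B₀) measureReal_nonneg)
  -- Pointwise convergence is available only at those y, almost all, whose window has a negligible
  -- boundary for almost every mark.
  · have h1 := ae_frontier_window hμ hface c hU hU'
    filter_upwards [ae_restrict_of_ae h1, ae_restrict_mem hmeas] with y hy hyW
    exact tendsto_avg_hitWeight hn hP hP1 hP2 hμ hφ hφ0 hsupp hf hf0 hf1 hU y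
      ((add_le_add_right (hr y hyW) _).trans hT) (window_norm_le hr hyW) hy

end HitDensity

end LorentzGas

namespace LorentzGas

/-! ### Substituting the position of a scatterer for that of the particle. -/

section ChangeOfVariables

variable {n : ℕ} (R : FrameRotation n) (ρ : Radius)

/-- Surface measure is defined through volumes of cones, and the cone over this set lies in a proper
subspace. -/
theorem omega_orthogonal {w : E n} (hw : w ≠ 0) :
    omega n {v : Sph n | inner ℝ w (v : E n) = 0} = 0 := by
  have hm : MeasurableSet {v : Sph n | inner ℝ w (v : E n) = 0} :=
    (isClosed_eq (by fun_prop) continuous_const).measurableSet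
  rw [omega, Measure.toSphere_apply' _ hm]
  refine mul_eq_zero_of_right _ (measure_mono_null (t := (LinearMap.ker (innerSL ℝ w).toLinearMap :
    Set (E n))) ?_ (Measure.addHaar_submodule _ _ fun h => hw ?_))
  · rintro _ ⟨t, -, _, ⟨v, hv, rfl⟩, rfl⟩
    have hv : inner ℝ w (v : E n) = 0 := hv
    simp [hv]
  · have h1 : w ∈ LinearMap.ker (innerSL ℝ w).toLinearMap := h ▸ Submodule.mem_top
    simpa using h1

/-- The frame matrix has determinant 1, so only the scaling by ρ^(-n) in dimension n + 1
contributes. The resulting factor is exactly the normalization in `avg`. -/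
theorem map_frame_volume (v : Sph n) (p : E n) :
    Measure.map (fun q : E n => frame R ρ (((ρ : ℝ) ^ n)⁻¹ • q) v p) volume =
      ENNReal.ofReal ((ρ : ℝ) ^ (n * (n + 1))) • (volume : Measure (E n)) := by
  have hp : (0 : ℝ) < (ρ : ℝ) ^ n := pow_pos ρ.2.1 n
  set A := (R.toFun v).1 * Dmat n ρ
  let L : E n →ₗ[ℝ] E n := (-((ρ : ℝ) ^ n)⁻¹) • rowMulLin A
  have hA : A.det = 1 := by
    have h1 : (R.toFun v).1.det = 1 := (Matrix.mem_specialOrthogonalGroup_iff.1 (R.toFun v).2).2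
    rw [Matrix.det_mul, h1, det_Dmat, one_mul]
  have hdet : LinearMap.det L = (-((ρ : ℝ) ^ n)⁻¹) ^ (n + 1) := by
    rw [LinearMap.det_smul, det_rowMulLin, hA, mul_one, finrank_euclideanSpace, Fintype.card_fin]
  have hdet0 : LinearMap.det L ≠ 0 := by
    rw [hdet]; exact pow_ne_zero _ (neg_ne_zero.2 (inv_ne_zero hp.ne'))
  have e : (fun q : E n => frame R ρ (((ρ : ℝ) ^ n)⁻¹ • q) v p) =
      (fun x => rowMul p A + x) ∘ L := by
    funext q
    change rowMul (p - ((ρ : ℝ) ^ n)⁻¹ • q) A = rowMul p A + (-((ρ : ℝ) ^ n)⁻¹) • rowMul q A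
    rw [rowMul_sub, rowMul_smul, neg_smul, sub_eq_add_neg]
  have hL : Measurable L := L.continuous_of_finiteDimensional.measurable
  rw [e, ← Measure.map_map (measurable_const_add _) hL,
    Measure.map_linearMap_addHaar_eq_smul_addHaar _ hdet0, Measure.map_smul,
    map_add_left_eq_self]
  congr 2
  rw [hdet, abs_inv, abs_pow, abs_neg, abs_inv, abs_of_pos hp, inv_pow, inv_inv, pow_mul]

theorem measurable_frame_smul (p : E n) :
    Measurable fun z : E n × Sph n => (frame R ρ (((ρ : ℝ) ^ n)⁻¹ • z.1) z.2 p, z.2) := by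
  have hm : Measurable fun z : E n × Sph n => (((ρ : ℝ) ^ n)⁻¹ • z.1, z.2) := by fun_prop
  exact ((measurable_frame R ρ p).comp hm).prodMk measurable_snd

theorem map_skew_prod {g : E n × Sph n → E n} (hg : Measurable g) {a : ℝ≥0∞}
    (h : ∀ v, Measure.map (fun q => g (q, v)) volume = a • (volume : Measure (E n))) :
    Measure.map (fun z : E n × Sph n => (g z, z.2)) (volume.prod (omega n)) =
      a • ((volume : Measure (E n)).prod (omega n)) := by
  have h1 := (MeasurePreserving.id (omega n)).skew_product (μc := (volume : Measure (E n)))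
      (g := fun v q => g (q, v)) (hg.comp measurable_swap) (Eventually.of_forall h)
  have h3 := (Measure.measurePreserving_swap.comp h1).comp Measure.measurePreserving_swap
  rw [Measure.prod_smul_left] at h3
  exact h3.map_eq

theorem map_frame_prod (p : E n) :
    Measure.map (fun z : E n × Sph n => (frame R ρ (((ρ : ℝ) ^ n)⁻¹ • z.1) z.2 p, z.2))
      (volume.prod (omega n)) = ENNReal.ofReal ((ρ : ℝ) ^ (n * (n + 1))) •
        ((volume : Measure (E n)).prod (omega n)) :=
  map_skew_prod (g := fun z => frame R ρ (((ρ : ℝ) ^ n)⁻¹ • z.1) z.2 p)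
    (measurable_frame_smul R ρ p).fst fun v => map_frame_volume R ρ v p

theorem integral_comp_frame (p : E n) {H : E n × Sph n → ℝ} (hH : Measurable H) :
    ∫ z, H (frame R ρ (((ρ : ℝ) ^ n)⁻¹ • z.1) z.2 p, z.2) ∂(volume.prod (omega n)) =
      (ρ : ℝ) ^ (n * (n + 1)) * ∫ z, H z ∂(volume.prod (omega n)) := by
  have h4 := integral_map (μ := volume.prod (omega n)) (measurable_frame_smul R ρ p).aemeasurable
    (f := H) hH.aestronglyMeasurable
  rw [map_frame_prod, integral_smul_measure, ENNReal.toReal_ofReal (pow_nonneg ρ.2.1.le _)] at h4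
  exact h4.symm

theorem integrable_comp_frame (p : E n) {H : E n × Sph n → ℝ}
    (hH : Integrable H (volume.prod (omega n))) :
    Integrable (fun z => H (frame R ρ (((ρ : ℝ) ^ n)⁻¹ • z.1) z.2 p, z.2))
      (volume.prod (omega n)) := by
  have h : Integrable H (Measure.map
      (fun z : E n × Sph n => (frame R ρ (((ρ : ℝ) ^ n)⁻¹ • z.1) z.2 p, z.2))
      (volume.prod (omega n))) := by
    rw [map_frame_prod]
    exact hH.smul_measure ENNReal.ofReal_ne_top
  exact h.comp_measurable (measurable_frame_smul R ρ p)

end ChangeOfVariables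

/-! ### Decomposition according to the first scatterer in the cylinder. -/

section HitIdentity

variable {n : ℕ} {M : Type*} [MetricSpace M] {R : FrameRotation n} {P : PointSet (E n)}
  {mark : P.carrier → M}

/-- Passing from observer p to observer q translates the picture by the position of p as seen from
q. The scatterer p, invisible to itself, becomes visible, and q hides nothing because it is not a
scatterer. -/
theorem Qset_eq_shiftInsert {ρ : Radius} {q : E n} (hq : q ∉ P.carrier) (v : Sph n)
    (p : P.carrier) :
    Qset R P mark ρ q v = shiftInsert (Qset R P mark ρ p v) (frame R ρ q v p) (mark p) := by
  ext x
  constructor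
  · intro hx
    rw [Qset_carrier] at hx
    obtain ⟨p', -, rfl⟩ := hx
    by_cases h : p' = p
    · exact Or.inr (by rw [h]; rfl)
    · refine Or.inl ⟨(frame R ρ p v p', mark p'), ?_, ?_⟩
      · rw [Qset_carrier]
        exact ⟨p', fun h' => h (Subtype.ext h'), rfl⟩
      · refine Prod.ext ?_ rfl
        change frame R ρ p v p' + frame R ρ q v p = frame R ρ q v p'
        rw [← frame_sub_frame R ρ q, sub_add_cancel]
  · rw [Qset_carrier]
    rintro (⟨z, hz, rfl⟩ | hx)
    · rw [Qset_carrier] at hz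
      obtain ⟨p', -, rfl⟩ := hz
      refine ⟨p', fun h => hq (h ▸ p'.2), Prod.ext ?_ rfl⟩
      change frame R ρ q v p' = frame R ρ p v p' + frame R ρ q v p
      rw [← frame_sub_frame R ρ q p' p v, sub_add_cancel]
    · exact ⟨p, fun h => hq (h ▸ p.2), hx.symm⟩

/-- Directions and base points which are in general position with respect to the scatterers. -/
def Generic (P : PointSet (E n)) (ρ : Radius) (z : E n × Sph n) : Prop :=
  ((ρ : ℝ) ^ n)⁻¹ • z.1 ∉ P.carrier ∧
    ∀ p p' : P.carrier, p ≠ p' → inner ℝ ((p : E n) - p') (z.2 : E n) ≠ 0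

theorem ae_generic (P : PointSet (E n)) (ρ : Radius) :
    ∀ᵐ z ∂((volume : Measure (E n)).prod (omega n)), Generic P ρ z := by
  have hp : ((ρ : ℝ) ^ n) ≠ 0 := (pow_pos ρ.2.1 n).ne'
  have hc : Countable P.carrier := P.countable_carrier.to_subtype
  have h1 : ∀ᵐ q : E n, ((ρ : ℝ) ^ n)⁻¹ • q ∉ P.carrier := by
    have h : ((fun q : E n => ((ρ : ℝ) ^ n)⁻¹ • q) ⁻¹' P.carrier).Countable :=
      P.countable_carrier.preimage (smul_right_injective (E n) (inv_ne_zero hp))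
    have h0 := h.measure_zero volume
    exact compl_mem_ae_iff.2 h0
  have h2 : ∀ᵐ v : Sph n ∂(omega n), ∀ p p' : P.carrier, p ≠ p' →
      inner ℝ ((p : E n) - (p' : E n)) (v : E n) ≠ 0 := by
    refine ae_all_iff.2 fun p => ae_all_iff.2 fun p' => ?_
    by_cases h : p = p'
    · exact Eventually.of_forall fun v h' => (h' h).elim
    · have h3 := omega_orthogonal (w := (p : E n) - (p' : E n))
        (sub_ne_zero.2 fun h' => h (Subtype.ext h'))
      filter_upwards [compl_mem_ae_iff.2 h3] with v hv _ using hv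
  filter_upwards [Measure.quasiMeasurePreserving_fst.ae h1,
    Measure.quasiMeasurePreserving_snd.ae h2] with z h3 h4 using ⟨h3, h4⟩

variable [CompactSpace M] [MeasurableSpace M] [BorelSpace M]

theorem voidInd_congr {B B' : Set (E n × M)} {η η' : CountingMeasure (E n × M)}
    (h : η.1 B = 0 ↔ η'.1 B' = 0) : voidInd B η = voidInd B' η' := by
  by_cases h' : η.1 B = 0
  · rw [voidInd_eq_one h', voidInd_eq_one (h.1 h')]
  · rw [voidInd_eq_zero h', voidInd_eq_zero fun h'' => h' (h.2 h'')]

theorem Qset_void_iff {c t : ℝ} {U : Set (EuclideanSpace ℝ (Fin n))} (hU : IsOpen U) {ρ : Radius}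
    {q : E n} (hq : q ∉ P.carrier) (v : Sph n) :
    (Qset R P mark ρ q v).toCounting.1 (cylinder c U t ×ˢ univ) = 0 ↔
      ∀ p : P.carrier, frame R ρ q v p ∉ cylinder c U t := by
  rw [PointSet.toCounting_apply_eq_zero _ ((measurableSet_cylinder hU).prod MeasurableSet.univ),
    eq_empty_iff_forall_notMem, Qset_carrier]
  constructor
  · exact fun h' p hp => h' _ ⟨⟨p, fun e => hq (e ▸ p.2), rfl⟩, hp, mem_univ _⟩
  · rintro h' _ ⟨⟨p, -, rfl⟩, hp, -⟩
    exact h' p hp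

/-- At the actual position y of p the initial point is recovered exactly, the shifted configuration
is the one seen by the particle, and emptiness of the window means that the cylinder up to the
height of p is empty. -/
theorem hitWeight_frame {φ : E n × Sph n → ℝ} {f : CountingMeasure (E n × M) → ℝ} {c : ℝ}
    {U : Set (EuclideanSpace ℝ (Fin n))} (hU : IsOpen U) {ρ : Radius} {z : E n × Sph n}
    (hz : ((ρ : ℝ) ^ n)⁻¹ • z.1 ∉ P.carrier) (p : P.carrier) :
    hitWeight R P mark φ f c U ρ p (frame R ρ (((ρ : ℝ) ^ n)⁻¹ • z.1) z.2 p) z.2 =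
      φ z * (f (Qset R P mark ρ (((ρ : ℝ) ^ n)⁻¹ • z.1) z.2).toCounting *
        voidInd (cylinder c U (frame R ρ (((ρ : ℝ) ^ n)⁻¹ • z.1) z.2 p 0 - c) ×ˢ univ)
          (Qset R P mark ρ (((ρ : ℝ) ^ n)⁻¹ • z.1) z.2).toCounting) := by
  have hp : ((ρ : ℝ) ^ n) ≠ 0 := (pow_pos ρ.2.1 n).ne'
  set y := frame R ρ (((ρ : ℝ) ^ n)⁻¹ • z.1) z.2 p with hy
  have e1 : (ρ : ℝ) ^ n • (p : E n) - unframe R ρ z.2 y = z.1 := by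
    rw [hy, unframe_frame, smul_sub, smul_smul, mul_inv_cancel₀ hp, one_smul, sub_sub_cancel]
  have e2 := Qset_eq_shiftInsert (R := R) (mark := mark) (ρ := ρ) hz z.2 p
  rw [← hy] at e2
  have e3 := toCounting_shiftInsert (Qset R P mark ρ p z.2) y (mark p)
    (zero_notMem_Qset R P mark ρ p z.2 (mark p))
  have e4 := shiftInsert_inter_eq_empty (c := c) hU (Qset R P mark ρ p z.2) y (mark p)
  rw [hitWeight, e1, e2, e3]
  congr 2
  refine voidInd_congr ?_
  rw [← e4, ← e3, PointSet.toCounting_apply_eq_zero _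
    ((measurableSet_cylinder hU).prod MeasurableSet.univ)]

/-- Almost surely exactly one scatterer is the first one seen in the cylinder, if there is one. -/
theorem sum_hitWeight_eq {φ : E n × Sph n → ℝ} {T₀ T r : ℝ}
    (hsupp : ∀ z : E n × Sph n, T₀ < ‖z.1‖ → φ z = 0)
    (f : CountingMeasure (E n × M) → ℝ) {c ξ : ℝ}
    {U : Set (EuclideanSpace ℝ (Fin n))} (hU : IsOpen U)
    (hr : ∀ x ∈ cylinder c U ξ, ‖x‖ ≤ r) (hT : T₀ + r ≤ T) {ρ : Radius} {z : E n × Sph n}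
    (hz : Generic P ρ z) :
    φ z * (f (Qset R P mark ρ (((ρ : ℝ) ^ n)⁻¹ • z.1) z.2).toCounting *
      (1 - voidInd (cylinder c U ξ ×ˢ univ)
        (Qset R P mark ρ (((ρ : ℝ) ^ n)⁻¹ • z.1) z.2).toCounting)) =
      ∑ p ∈ nearPts P T ρ, (cylinder c U ξ).indicator
        (fun y => hitWeight R P mark φ f c U ρ p y z.2)
        (frame R ρ (((ρ : ℝ) ^ n)⁻¹ • z.1) z.2 p) := by
  classical
  have hρ : ((ρ : ℝ) ^ n) ≠ 0 := (pow_pos ρ.2.1 n).ne'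
  set q := ((ρ : ℝ) ^ n)⁻¹ • z.1 with hq
  have hq' : q ∉ P.carrier := hz.1
  have hqz : (ρ : ℝ) ^ n • q = z.1 := by rw [hq, smul_smul, mul_inv_cancel₀ hρ, one_smul]
  have hW := fun p => hitWeight_frame (R := R) (mark := mark) (φ := φ) (f := f) (c := c) hU hz.1 p
  simp only [← hq] at hW
  have hterm : ∀ p : P.carrier, (cylinder c U ξ).indicator
      (fun y => hitWeight R P mark φ f c U ρ p y z.2) (frame R ρ q z.2 p) =
      φ z * (f (Qset R P mark ρ q z.2).toCounting *
        (if frame R ρ q z.2 p ∈ cylinder c U ξ ∧ ∀ p' : P.carrier,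
          frame R ρ q z.2 p' ∉ cylinder c U (frame R ρ q z.2 p 0 - c) then 1 else 0)) := by
    intro p
    by_cases h : frame R ρ q z.2 p ∈ cylinder c U ξ
    · rw [indicator_of_mem h, hW p]
      congr 2
      have h2 := Qset_void_iff (R := R) (mark := mark) (ρ := ρ) (c := c)
        (t := frame R ρ q z.2 p 0 - c) hU hq' z.2
      by_cases h3 : ∀ p' : P.carrier, frame R ρ q z.2 p' ∉ cylinder c U (frame R ρ q z.2 p 0 - c)
      · rw [if_pos ⟨h, h3⟩, voidInd_eq_one (h2.2 h3)]
      · rw [if_neg fun h' => h3 h'.2, voidInd_eq_zero fun h' => h3 (h2.1 h')]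
    · rw [indicator_of_notMem h, if_neg fun h' => h h'.1, mul_zero, mul_zero]
  simp only [hterm, ← Finset.mul_sum]
  by_cases hφ : φ z = 0
  · rw [hφ, zero_mul, zero_mul]
  congr 2
  have hnear : ∀ p : P.carrier, frame R ρ q z.2 p ∈ cylinder c U ξ → p ∈ nearPts P T ρ := by
    intro p h
    rw [mem_nearPts]
    have h1 := norm_scaled_sub_le R ρ q p z.2
    have h2 := norm_sub_norm_le ((ρ : ℝ) ^ n • (p : E n)) ((ρ : ℝ) ^ n • q)
    have h3 : ‖z.1‖ ≤ T₀ := by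
      by_contra! h3
      exact hφ (hsupp z h3)
    rw [hqz] at h1 h2
    linarith [hr _ h]
  have hvoid := Qset_void_iff (R := R) (mark := mark) (ρ := ρ) (c := c) (t := ξ) hU hq' z.2
  by_cases h : ∀ p : P.carrier, frame R ρ q z.2 p ∉ cylinder c U ξ
  · rw [voidInd_eq_one (hvoid.2 h), sub_self]
    exact (Finset.sum_eq_zero fun p _ => if_neg fun h' => h p h'.1).symm
  · rw [voidInd_eq_zero fun h' => h (hvoid.1 h'), sub_zero]
    push Not at h
    obtain ⟨p₁, hp₁⟩ := h
    -- The scatterer with the least first coordinate among those in the cylinder; its indicator is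
    -- the only nonzero one.
    obtain ⟨p₀, hp₀, hmin⟩ := Finset.exists_min_image
      ((nearPts P T ρ).filter fun p : P.carrier => frame R ρ q z.2 p ∈ cylinder c U ξ)
      (fun p : P.carrier => frame R ρ q z.2 p 0) ⟨p₁, Finset.mem_filter.2 ⟨hnear p₁ hp₁, hp₁⟩⟩
    rw [Finset.mem_filter] at hp₀
    rw [Finset.sum_eq_single_of_mem p₀ hp₀.1]
    · rw [if_pos]
      refine ⟨hp₀.2, fun p' hp' => ?_⟩
      have h1 : frame R ρ q z.2 p' ∈ cylinder c U ξ :=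
        ⟨hp'.1, by linarith [hp'.2.1, hp₀.2.2.1], hp'.2.2⟩
      have h2 := hmin p' (Finset.mem_filter.2 ⟨hnear p' h1, h1⟩)
      linarith [hp'.2.1]
    · intro p hp hne
      rw [if_neg]
      rintro ⟨h1, h2⟩
      have h3 := hmin p (Finset.mem_filter.2 ⟨hp, h1⟩)
      -- Without a tie p₀ strictly precedes p and lies in the open cylinder in front of it. General
      -- position is needed because scatterers at the same height could all count as first.
      have h4 : frame R ρ q z.2 p 0 ≠ frame R ρ q z.2 p₀ 0 := by
        intro h4
        have h5 := congrArg (fun x : E n => x 0) (frame_sub_frame R ρ q p p₀ z.2)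
        simp only [PiLp.sub_apply, h4, sub_self, frame_zero_eq] at h5
        exact mul_ne_zero hρ (hz.2 p p₀ hne) h5.symm
      have h6 := lt_of_le_of_ne h3 h4.symm
      exact h2 p₀ ⟨hp₀.2.1, by linarith, hp₀.2.2.2⟩

/-- An exact identity for every ρ. Almost everywhere the integrand is a sum over the possible first
scatterers p, and in each term the position y of p replaces q as the variable of integration, at the
cost of a constant Jacobian. -/
theorem integral_hit_eq {φ : E n × Sph n → ℝ} (hφ : Continuous φ) {T₀ T r : ℝ}
    (hsupp : ∀ z : E n × Sph n, T₀ < ‖z.1‖ → φ z = 0)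
    {f : CountingMeasure (E n × M) → ℝ} (hf : Continuous f) (hf0 : ∀ η, 0 ≤ f η)
    (hf1 : ∀ η, f η ≤ 1) {c ξ : ℝ}
    {U : Set (EuclideanSpace ℝ (Fin n))} (hU : IsOpen U)
    (hr : ∀ x ∈ cylinder c U ξ, ‖x‖ ≤ r) (hT : T₀ + r ≤ T) (ρ : Radius) :
    ∫ z, φ z * (f (Qset R P mark ρ (((ρ : ℝ) ^ n)⁻¹ • z.1) z.2).toCounting *
      (1 - voidInd (cylinder c U ξ ×ˢ univ)
        (Qset R P mark ρ (((ρ : ℝ) ^ n)⁻¹ • z.1) z.2).toCounting)) ∂(volume.prod (omega n)) =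
      ∫ y in cylinder c U ξ, avg P T ρ fun p =>
        ∫ v, hitWeight R P mark φ f c U ρ p y v ∂(omega n) := by
  have hc : HasCompactSupport φ := by
    refine HasCompactSupport.intro ((isCompact_closedBall (0 : E n) T₀).prod
      (isCompact_univ (X := Sph n))) fun z hz => hsupp z ?_
    by_contra! h
    exact hz ⟨by simpa using h, mem_univ _⟩
  obtain ⟨B, hB⟩ := hφ.bounded_above_of_compact_support hc
  replace hB : ∀ z, |φ z| ≤ B := hB
  have hWm := measurableSet_cylinder (c := c) (ξ := ξ) hU
  have hfin : IsFiniteMeasure ((volume : Measure (E n)).restrict (cylinder c U ξ)) := by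
    refine isFiniteMeasure_restrict.2 (((measure_mono fun x hx => ?_).trans_lt
      (measure_closedBall_lt_top (x := (0 : E n)) (r := r))).ne)
    simpa using hr x hx
  let H : P.carrier → E n × Sph n → ℝ := fun p z =>
    (cylinder c U ξ).indicator (fun y => hitWeight R P mark φ f c U ρ p y z.2) z.1
  have hHe : ∀ p, H p = (cylinder c U ξ ×ˢ univ).indicator
      fun z => hitWeight R P mark φ f c U ρ p z.1 z.2 := fun p => by
    funext z
    by_cases h : z.1 ∈ cylinder c U ξ <;> simp [H, h]
  have hHm : ∀ p, Measurable (H p) := fun p => by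
    rw [hHe]
    exact (measurable_hitWeight hφ hf hU ρ p).indicator (hWm.prod MeasurableSet.univ)
  have hprod : ((volume : Measure (E n)).restrict (cylinder c U ξ)).prod (omega n) =
      ((volume : Measure (E n)).prod (omega n)).restrict (cylinder c U ξ ×ˢ univ) := by
    have h := Measure.prod_restrict (μ := (volume : Measure (E n))) (ν := omega n)
      (cylinder c U ξ) univ
    rwa [Measure.restrict_univ] at h
  have hHi' : ∀ p, Integrable (fun z : E n × Sph n => hitWeight R P mark φ f c U ρ p z.1 z.2)
      (((volume : Measure (E n)).restrict (cylinder c U ξ)).prod (omega n)) := fun p =>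
    integrable_bounded (measurable_hitWeight hφ hf hU ρ p)
      fun z => abs_hitWeight_le hB hf0 hf1 ρ p z.1 z.2
  have hHint : ∀ p, ∫ z, H p z ∂(volume.prod (omega n)) =
      ∫ y in cylinder c U ξ, ∫ v, hitWeight R P mark φ f c U ρ p y v ∂(omega n) := fun p => by
    rw [hHe, integral_indicator (hWm.prod MeasurableSet.univ), ← hprod]
    exact integral_prod _ (hHi' p)
  have hHi : ∀ p, Integrable (fun z : E n × Sph n =>
      H p (frame R ρ (((ρ : ℝ) ^ n)⁻¹ • z.1) z.2 p, z.2)) (volume.prod (omega n)) := fun p => by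
    have h1 : Integrable (H p) (volume.prod (omega n)) := by
      rw [hHe, integrable_indicator_iff (hWm.prod MeasurableSet.univ), IntegrableOn, ← hprod]
      exact hHi' p
    exact integrable_comp_frame R ρ p h1
  have hgen := ae_generic P ρ
  calc _ = ∫ z, ∑ p ∈ nearPts P T ρ, H p (frame R ρ (((ρ : ℝ) ^ n)⁻¹ • z.1) z.2 p, z.2)
        ∂(volume.prod (omega n)) := by
        refine integral_congr_ae ?_
        filter_upwards [hgen] with z hz
        exact sum_hitWeight_eq hsupp f hU hr hT hz
    _ = ∑ p ∈ nearPts P T ρ, (ρ : ℝ) ^ (n * (n + 1)) *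
        ∫ y in cylinder c U ξ, ∫ v, hitWeight R P mark φ f c U ρ p y v ∂(omega n) := by
        rw [integral_finsetSum _ fun p _ => hHi p]
        refine Finset.sum_congr rfl fun p _ => ?_
        rw [integral_comp_frame R ρ p (hHm p), hHint]
    _ = _ := by
        unfold avg
        rw [← Finset.mul_sum, integral_const_mul, integral_finsetSum _ fun p _ => ?_]
        exact (hHi' p).integral_prod_left

end HitIdentity

end LorentzGas

namespace LorentzGas

/-! ### No escape of mass for a general cylinder. -/

section Escape

variable {n : ℕ} {M : Type*} [MetricSpace M] {R : FrameRotation n} {P : PointSet (E n)}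
  {mark : P.carrier → M}

theorem Dmat_mul (a b : ℝ) : Dmat n (a * b) = Dmat n b * Dmat n a := by
  rw [Dmat, Dmat, Dmat, Matrix.diagonal_mul_diagonal]
  congr 1
  funext i
  refine Fin.cases ?_ (fun j => ?_) i
  · simp only [Fin.cons_zero]; rw [mul_pow, mul_comm]
  · simp only [Fin.cons_succ]; rw [mul_inv, mul_comm]

/-- The parameter `ρ` multiplied by a constant. -/
def scaleRadius (a : Radius) (ρ : Radius) : Radius :=
  ⟨a * ρ, mul_pos a.2.1 ρ.2.1, mul_lt_one_of_nonneg_of_lt_one_left a.2.1.le a.2.2 ρ.2.2.le⟩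

theorem tendsto_scaleRadius (a : Radius) : Tendsto (scaleRadius a) toZero toZero := by
  refine tendsto_comap_iff.2 ?_
  have h := (tendsto_toZero.const_mul (a : ℝ))
  rw [mul_zero] at h
  exact h

/-- The base point for which the frame with parameter `aρ` is obtained by moving the origin of the
frame with parameter `ρ` to `y` and rescaling. -/
noncomputable def moveBase (R : FrameRotation n) (a : Radius) (y : E n) (ρ : Radius)
    (z : E n × Sph n) : E n :=
  (a : ℝ) ^ n • (z.1 + unframe R ρ z.2 y)

/-- The matrices `Dmat` are multiplicative in their parameter. So shrinking ρ by the factor a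
applies one more diagonal matrix, which widens transversally by 1/a and shortens lengthwise by a^n.
-/
theorem frame_moveBase (a : Radius) (y : E n) (ρ : Radius) (z : E n × Sph n) (p : E n) :
    frame R (scaleRadius a ρ) (((scaleRadius a ρ : ℝ) ^ n)⁻¹ • moveBase R a y ρ z) z.2 p =
      rowMul (frame R ρ (((ρ : ℝ) ^ n)⁻¹ • z.1) z.2 p - y) (Dmat n a) := by
  have hρ : ((ρ : ℝ) ^ n) ≠ 0 := (pow_pos ρ.2.1 n).ne'
  have ha : ((a : ℝ) ^ n) ≠ 0 := (pow_pos a.2.1 n).ne'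
  have e1 : ((scaleRadius a ρ : ℝ) ^ n)⁻¹ • moveBase R a y ρ z =
      ((ρ : ℝ) ^ n)⁻¹ • z.1 + rowMul y ((R.toFun z.2).1 * Dmat n ρ)⁻¹ := by
    have e2 : ((scaleRadius a ρ : ℝ) ^ n)⁻¹ * (a : ℝ) ^ n = ((ρ : ℝ) ^ n)⁻¹ := by
      change (((a : ℝ) * ρ) ^ n)⁻¹ * (a : ℝ) ^ n = ((ρ : ℝ) ^ n)⁻¹
      rw [mul_pow, mul_inv, mul_comm, ← mul_assoc, mul_inv_cancel₀ ha, one_mul]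
    rw [moveBase, smul_smul, e2, smul_add, unframe, smul_smul, inv_mul_cancel₀ hρ, one_smul]
  have e3 : ((scaleRadius a ρ : Radius) : ℝ) = (a : ℝ) * ρ := rfl
  rw [frame_apply, e1, e3, Dmat_mul, ← Matrix.mul_assoc, ← rowMul_mul, frame_apply, ← sub_sub,
    rowMul_sub, rowMul_mul, Matrix.nonsing_inv_mul _ (isUnit_det_frame (R.toFun z.2) ρ), rowMul_one]

theorem norm_moveBase_le (a : Radius) (y : E n) (ρ : Radius) (z : E n × Sph n) :
    ‖moveBase R a y ρ z‖ ≤ ‖z.1‖ + ‖y‖ := by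
  rw [moveBase, norm_smul, Real.norm_of_nonneg (pow_nonneg a.2.1.le n)]
  refine (mul_le_of_le_one_left (norm_nonneg _) (pow_le_one₀ a.2.1.le a.2.2.le)).trans ?_
  exact (norm_add_le _ _).trans (add_le_add_right (norm_unframe_le R ρ z.2 y) _)

theorem measurable_moveBase (a : Radius) (y : E n) (ρ : Radius) :
    Measurable (moveBase R a y ρ) := by
  have h : Measurable fun z : E n × Sph n => (y, z.2) := by fun_prop
  have hu : Measurable fun z : E n × Sph n => unframe R ρ z.2 y := (measurable_unframe R ρ).comp h
  have h2 : Measurable fun z : E n × Sph n => z.1 + unframe R ρ z.2 y := measurable_fst.add hu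
  exact h2.const_smul ((a : ℝ) ^ n)

theorem map_moveBase (a : Radius) (y : E n) (ρ : Radius) :
    Measure.map (fun z : E n × Sph n => (moveBase R a y ρ z, z.2)) (volume.prod (omega n)) =
      ENNReal.ofReal (((a : ℝ) ^ n) ^ (n + 1))⁻¹ • ((volume : Measure (E n)).prod (omega n)) := by
  have ha : (0 : ℝ) < (a : ℝ) ^ n := pow_pos a.2.1 n
  refine map_skew_prod (measurable_moveBase a y ρ) fun v => ?_
  have e : (fun q : E n => moveBase R a y ρ (q, v)) =
      (fun x => (a : ℝ) ^ n • x) ∘ fun q => q + unframe R ρ v y := rfl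
  rw [e, ← Measure.map_map (measurable_const_smul _) (measurable_add_const _),
    map_add_right_eq_self, Measure.map_addHaar_smul _ ha.ne', finrank_euclideanSpace,
    Fintype.card_fin, abs_of_nonneg (inv_nonneg.2 (pow_nonneg ha.le _))]

/-- If the rescaled frame sees a scatterer in the unit cylinder, then the original frame sees one
in the given cylinder. -/
theorem void_moveBase {a : Radius} {c ξ : ℝ} {U : Set (EuclideanSpace ℝ (Fin n))}
    {b : EuclideanSpace ℝ (Fin n)} (hb : Metric.ball b a ⊆ U) {ρ : Radius} {z : E n × Sph n}
    (hz : ((ρ : ℝ) ^ n)⁻¹ • z.1 ∉ P.carrier)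
    (h : (Qset R P mark ρ (((ρ : ℝ) ^ n)⁻¹ • z.1) z.2).carrier ∩ cylinder c U ξ ×ˢ univ = ∅) :
    (Qset R P mark (scaleRadius a ρ)
      (((scaleRadius a ρ : ℝ) ^ n)⁻¹ • moveBase R a (consPt c b) ρ z) z.2).carrier ∩
        cylinder 0 (Metric.ball 0 1) ((a : ℝ) ^ n * ξ) ×ˢ univ = ∅ := by
  have ha : (0 : ℝ) < (a : ℝ) ^ n := pow_pos a.2.1 n
  rw [eq_empty_iff_forall_notMem] at h ⊢
  rintro x ⟨hx, hx2, -⟩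
  rw [Qset_carrier] at hx
  obtain ⟨p, -, rfl⟩ := hx
  refine h (frame R ρ (((ρ : ℝ) ^ n)⁻¹ • z.1) z.2 p, mark p) ⟨?_, ?_, mem_univ _⟩
  · rw [Qset_carrier]
    exact ⟨p, fun e => hz (e ▸ p.2), rfl⟩
  · set w := frame R ρ (((ρ : ℝ) ^ n)⁻¹ • z.1) z.2 p
    have hx3 : rowMul (w - consPt c b) (Dmat n a) ∈
        cylinder 0 (Metric.ball 0 1) ((a : ℝ) ^ n * ξ) := by
      rw [← frame_moveBase]; exact hx2
    obtain ⟨h1, h2, h3⟩ := hx3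
    rw [rowMul_Dmat_zero, PiLp.sub_apply, consPt_zero] at h1 h2
    have h1' : 0 < w 0 - c := pos_of_mul_pos_right h1 ha.le
    have h2' : w 0 - c < ξ := by
      rw [zero_add] at h2
      exact lt_of_mul_lt_mul_left h2 ha.le
    have e : tailPt (rowMul (w - consPt c b) (Dmat n a)) = (a : ℝ)⁻¹ • (tailPt w - b) := by
      ext i
      have e1 : tailPt (rowMul (w - consPt c b) (Dmat n a)) i =
        rowMul (w - consPt c b) (Dmat n a) i.succ := rfl
      rw [e1, rowMul_Dmat_succ]
      simp [tailPt, consPt]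
    rw [e, mem_ball_zero_iff, norm_smul, norm_inv, Real.norm_of_nonneg a.2.1.le,
      inv_mul_lt_iff₀ a.2.1, mul_one] at h3
    refine ⟨by linarith, by linarith, hb ?_⟩
    rwa [mem_ball_iff_norm]

variable [CompactSpace M] [MeasurableSpace M] [BorelSpace M]

/-- With high probability, a scatterer is seen in a sufficiently long cylinder. -/
theorem NoEscapeOfMass.eventually_void_le (hP3 : NoEscapeOfMass R P mark) (c : ℝ)
    {U : Set (EuclideanSpace ℝ (Fin n))} (hU : IsOpen U) (hne : U.Nonempty) (T : ℝ) {ε : ℝ≥0∞}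
    (hε : ε ≠ 0) :
    ∀ᶠ ξ : ℝ in atTop, ∀ᶠ ρ : Radius in toZero, ((volume : Measure (E n)).prod (omega n))
      {z | ‖z.1‖ ≤ T ∧ (Qset R P mark ρ (((ρ : ℝ) ^ n)⁻¹ • z.1) z.2).carrier ∩
        cylinder c U ξ ×ˢ univ = ∅} ≤ ε := by
  obtain ⟨b, hb⟩ := hne
  obtain ⟨r, hr, hrU⟩ := Metric.isOpen_iff.1 hU b hb
  -- With this factor the unit ball of [P3] corresponds to a ball of radius a around b that fits
  -- into U; the bound 1/2 keeps a below 1.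
  let a : Radius := ⟨min (r / 2) (1 / 2), by positivity,
    (min_le_right _ _).trans_lt (by norm_num)⟩
  have har : (a : ℝ) ≤ r := (min_le_left _ _).trans (half_le_self hr.le)
  have haU : Metric.ball b a ⊆ U := (Metric.ball_subset_ball har).trans hrU
  have ha : (0 : ℝ) < (a : ℝ) ^ n := pow_pos a.2.1 n
  set K : ℝ≥0∞ := ENNReal.ofReal (((a : ℝ) ^ n) ^ (n + 1))⁻¹ with hK
  have hK0 : K ≠ 0 := (ENNReal.ofReal_pos.2 (by positivity)).ne'
  have hKtop : K ≠ ∞ := ENNReal.ofReal_ne_top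
  have h1 := hP3 (Metric.closedBall 0 (T + ‖(consPt c b : E n)‖)) Metric.isBounded_closedBall
    Metric.isClosed_closedBall.measurableSet
  have h2 := h1.comp (tendsto_id.const_mul_atTop ha)
  -- Moving the base point multiplies the pushed-forward volume by K, so [P3] is applied with the
  -- threshold ε/K.
  have h3 : 0 < ε / K := ENNReal.div_pos hε hKtop
  filter_upwards [h2.eventually_lt_const h3] with ξ hξ
  have h4 := (tendsto_scaleRadius a).eventually (eventually_lt_of_limsup_lt hξ)
  filter_upwards [h4] with ρ hρ
  have hm : AEMeasurable (fun z : E n × Sph n => (moveBase R a (consPt c b) ρ z, z.2))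
    (volume.prod (omega n)) := ((measurable_moveBase a _ ρ).prodMk measurable_snd).aemeasurable
  have h5 := Measure.le_map_apply
    (μ := (volume : Measure (E n)).prod (omega n))
    (f := fun z : E n × Sph n => (moveBase R a (consPt c b) ρ z, z.2)) hm
    {x : E n × Sph n | x.1 ∈ Metric.closedBall 0 (T + ‖(consPt c b : E n)‖) ∧
      (Qset R P mark (scaleRadius a ρ) (((scaleRadius a ρ : ℝ) ^ n)⁻¹ • x.1) x.2).carrier ∩
        cylinder 0 (Metric.ball 0 1) ((a : ℝ) ^ n * ξ) ×ˢ Set.univ = ∅}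
  rw [map_moveBase] at h5
  refine le_trans (measure_mono_ae ?_) (h5.trans ?_)
  · filter_upwards [ae_generic P ρ] with z hz hz2
    refine ⟨?_, void_moveBase haU hz.1 hz2.2⟩
    rw [mem_closedBall_zero_iff]
    exact (norm_moveBase_le a _ ρ z).trans (add_le_add_left hz2.1 _)
  · rw [Measure.smul_apply, smul_eq_mul, ← hK]
    refine (mul_le_mul_right hρ.le K).trans ?_
    rw [ENNReal.mul_div_cancel hK0 hKtop]

end Escape

end LorentzGas

namespace LorentzGas

/-! ### A Borel set of simple configurations. -/

section SimpleSet

variable {n : ℕ} {M : Type*} [MetricSpace M] [CompactSpace M] [MeasurableSpace M] [BorelSpace M]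

/-- A measurable set of simple counting measures which contains all the coincidence-free ones. -/
def simpleSet (n : ℕ) (M : Type*) [MetricSpace M] [MeasurableSpace M] :
    Set (CountingMeasure (E n × M)) :=
  {η | ∀ r j : ℕ, ∃ k : ℕ, pairSum r ((k : ℝ) + 1)⁻¹ η < ((j : ℝ) + 1)⁻¹}

variable (n M) in
theorem measurableSet_simpleSet : MeasurableSet (simpleSet n M) := by
  have h : simpleSet n M = ⋂ r : ℕ, ⋂ j : ℕ, ⋃ k : ℕ,
      {η | pairSum r ((k : ℝ) + 1)⁻¹ η < ((j : ℝ) + 1)⁻¹} := by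
    ext η
    simp [simpleSet]
  rw [h]
  exact MeasurableSet.iInter fun r => MeasurableSet.iInter fun j => MeasurableSet.iUnion fun k =>
    (isOpen_lt (continuous_pairSum _ _) continuous_const).measurableSet

theorem mem_simpleSet {η : CountingMeasure (E n × M)}
    (hη : ¬ ∃ t : ℝ, 1 < η.1 {x : E n × M | x.1 0 = t}) : η ∈ simpleSet n M := fun r j =>
  ((tendsto_pairSum r hη).eventually_lt_const (by positivity)).exists

/-- A multiple atom of mass a coincides with itself: it keeps the pair sum at least a - 1 for every
width δ, while membership makes the pair sum arbitrarily small. This places a Borel set inside the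
range of `PointSet.toCounting`, whose own measurability is not used. -/
theorem le_one_of_mem_simpleSet {η : CountingMeasure (E n × M)} (hη : η ∈ simpleSet n M)
    (x : E n × M) : η.1 {x} ≤ 1 := by
  by_contra! h
  have hfin : η.1 {x} ≠ ∞ := (η.2.1 _ isCompact_singleton).ne
  have ha : 1 < η.1.real {x} := by
    have h1 := (ENNReal.toReal_lt_toReal ENNReal.one_ne_top hfin).2 h
    simpa [Measure.real] using h1
  obtain ⟨r, hr⟩ := exists_nat_ge ‖x.1‖
  obtain ⟨j, hj⟩ := exists_nat_gt (η.1.real {x} - 1)⁻¹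
  obtain ⟨k, hk⟩ := hη r j
  set δ : ℝ := ((k : ℝ) + 1)⁻¹
  have hδ : 0 < δ := by positivity
  have hKi : ∀ z : E n × M, Integrable (fun z' => pairKer r δ z z') η.1 := fun z =>
    (continuous_pairKer_right _ δ z).integrable_of_hasCompactSupport
      (hasCompactSupport_of_norm fun x hx => pairKer_eq_zero_right hx z)
  have hlow : ∀ z : E n × M, η.1.real {z} * pairKer r δ z z ≤ ∫ z', pairKer r δ z z' ∂η.1 := by
    intro z
    have h1 : ∫ z' in {z}, pairKer r δ z z' ∂η.1 = η.1.real {z} * pairKer r δ z z := by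
      rw [integral_singleton, smul_eq_mul]
    rw [← h1]
    exact setIntegral_le_integral (hKi z) (Eventually.of_forall fun z' => pairKer_nonneg _ _ _ _)
  let g : E n × M → ℝ := fun z => ∫ z', pairKer r δ z z' ∂η.1 - pairKer r δ z z
  have hc1 : Continuous fun z : E n × M => ∫ z', pairKer r δ z z' ∂η.1 := by
    have h1 := CountingMeasure.continuous_integral_param (θ := fun z' z : E n × M => pairKer r δ z z')
      (continuous_pairKer_swap r δ) fun y₀ =>
        ⟨_, isCompact_closedBall_prod (r + 1), Eventually.of_forall fun y x hx =>
          pairKer_eq_zero_right (by by_contra! h; exact hx ⟨by simpa using h, mem_univ _⟩) y⟩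
    exact h1.comp (Continuous.prodMk_right η)
  have hi1 : Integrable (fun z : E n × M => ∫ z', pairKer r δ z z' ∂η.1) η.1 :=
    hc1.integrable_of_hasCompactSupport (hasCompactSupport_of_norm (r := r + 1) fun z hz => by
      simp [pairKer_eq_zero_left hz])
  have hi2 : Integrable (fun z : E n × M => pairKer r δ z z) η.1 :=
    (continuous_pairKer_diag _ δ).integrable_of_hasCompactSupport
      (hasCompactSupport_of_norm fun x hx => pairKer_eq_zero_left hx x)
  have hg : pairSum r δ η = ∫ z, g z ∂η.1 := by
    rw [integral_sub hi1 hi2]; rfl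
  have hgi : Integrable g η.1 := hi1.sub hi2
  have hgx : η.1.real {x} - 1 ≤ g x := by
    have h1 := hlow x
    have h2 : pairKer r δ x x = 1 := by
      rw [pairKer_eq hr hr, sub_self, tent_zero]
    rw [h2, mul_one] at h1
    simp only [g, h2]
    linarith
  obtain ⟨ι, a, hιa⟩ := η.2.2
  have hatom : ∀ i, 1 ≤ η.1.real {a i} := by
    intro i
    have h1 : η.1 {a i} ≠ 0 := by
      rw [hιa, Measure.sum_apply _ (measurableSet_singleton _)]
      intro h0
      have := (ENNReal.tsum_eq_zero.1 h0) i
      simp at this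
    have h2 : η.1 {a i} ≠ ∞ := (η.2.1 _ isCompact_singleton).ne
    simpa [Measure.real] using ENNReal.toReal_mono h2 (η.one_le_of_ne_zero
      (measurableSet_singleton _) h1)
  -- Every atom has mass at least 1, so its interaction with itself in the double integral already
  -- outweighs the subtracted diagonal term. The pair sum is thus a sum of nonnegative terms, of
  -- which only the one at x is kept.
  have hg0 : ∀ i, 0 ≤ g (a i) := fun i => by
    have h1 := hlow (a i)
    have h2 := mul_le_mul_of_nonneg_right (hatom i) (pairKer_nonneg r δ (a i) (a i))
    simp only [g]
    linarith
  have hsum : HasSum (fun i => g (a i)) (∫ z, g z ∂η.1) := by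
    have h1 : Integrable g (Measure.sum fun i => Measure.dirac (a i)) := by rw [← hιa]; exact hgi
    have h2 := hasSum_integral_measure h1
    rw [← hιa] at h2
    simpa only [integral_dirac] using h2
  have hex : ∃ i, a i = x := by
    by_contra! h0
    have h1 : η.1 {x} = 0 := by
      rw [hιa, Measure.sum_apply _ (measurableSet_singleton _)]
      refine ENNReal.tsum_eq_zero.2 fun i => ?_
      rw [Measure.dirac_apply' _ (measurableSet_singleton _),
        indicator_of_notMem (by simpa using h0 i)]
    rw [h1] at h
    exact not_lt_zero h
  obtain ⟨i, hi⟩ := hex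
  have h1 := le_hasSum hsum i fun i' _ => hg0 i'
  rw [hi, ← hg] at h1
  have h2 : ((j : ℝ) + 1)⁻¹ < η.1.real {x} - 1 := by
    rw [inv_lt_comm₀ (by positivity) (by linarith)]
    linarith
  linarith

theorem mem_range_of_mem_simpleSet {η : CountingMeasure (E n × M)} (hη : η ∈ simpleSet n M) :
    η ∈ range (PointSet.toCounting : PointSet (E n × M) → CountingMeasure (E n × M)) :=
  η.mem_range_toCounting (le_one_of_mem_simpleSet hη)

end SimpleSet

/-! ### The limit process on counting measures. -/

section LimitMeasure

variable {n : ℕ} {M : Type*} [MetricSpace M] [CompactSpace M] [MeasurableSpace M] [BorelSpace M]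
  {μ : M → ProbabilityMeasure (CountingMeasure (E n × M))}

/-- The infinite cylinder `(c, ∞) × U`. -/
def halfCylinder (c : ℝ) (U : Set (EuclideanSpace ℝ (Fin n))) : Set (E n) :=
  {y | c < y 0 ∧ tailPt y ∈ U}

theorem measurableSet_halfCylinder {c : ℝ} {U : Set (EuclideanSpace ℝ (Fin n))} (hU : IsOpen U) :
    MeasurableSet (halfCylinder c U) := by
  have h1 : IsOpen {y : E n | c < y 0} := isOpen_lt (by fun_prop) (by fun_prop)
  exact (h1.inter (hU.preimage continuous_tailPt)).measurableSet

theorem halfCylinder_eq (c : ℝ) (U : Set (EuclideanSpace ℝ (Fin n))) :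
    halfCylinder c U = ⋃ k : ℕ, cylinder c U k := by
  ext y
  rw [mem_iUnion]
  constructor
  · rintro ⟨h1, h2⟩
    obtain ⟨k, hk⟩ := exists_nat_gt (y 0 - c)
    exact ⟨k, h1, by linarith, h2⟩
  · rintro ⟨k, h1, -, h2⟩
    exact ⟨h1, h2⟩

theorem cylinder_mono (c : ℝ) (U : Set (EuclideanSpace ℝ (Fin n))) :
    Monotone fun ξ : ℝ => cylinder c U ξ := fun _ _ h _ hx =>
  ⟨hx.1, by linarith [hx.2.1], hx.2.2⟩

/-- The coordinates (c + τ, b) preserve volume; this matches the integral over hitting positions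
with the order of integration in the theorem. -/
theorem lintegral_halfCylinder (c : ℝ) {U : Set (EuclideanSpace ℝ (Fin n))} (hU : IsOpen U)
    {h : E n → ℝ≥0∞} (hh : Measurable h) :
    ∫⁻ y in halfCylinder c U, h y =
      ∫⁻ τ in Ioi (0 : ℝ), ∫⁻ b in U, h (consPt (c + τ) b) := by
  have h1 : MeasurePreserving (fun p : ℝ × EuclideanSpace ℝ (Fin n) => consPt (c + p.1) p.2)
      (volume.prod volume) volume :=
    measurePreserving_consPt.comp
      ((measurePreserving_add_left volume c).prod (MeasurePreserving.id volume))
  have h2 := h1.setLIntegral_comp_preimage (measurableSet_halfCylinder (c := c) hU) hh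
  have h3 : (fun p : ℝ × EuclideanSpace ℝ (Fin n) => consPt (c + p.1) p.2) ⁻¹' halfCylinder c U =
      Ioi 0 ×ˢ U := by
    ext p
    simp [halfCylinder]
  rw [h3, ← Measure.prod_restrict] at h2
  rw [← h2]
  exact lintegral_prod _ (hh.comp h1.measurable).aemeasurable

/-- The position, mark and configuration seen at the first hit of the cylinder. -/
noncomputable def frontMeasure (hμ : Continuous μ) (m : Measure M) (c : ℝ)
    (U : Set (EuclideanSpace ℝ (Fin n))) : Measure (E n × (M × CountingMeasure (E n × M))) :=
  (((volume : Measure (E n)).restrict (halfCylinder c U)).prod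
    (Measure.compProd m (processKernel hμ))).restrict {z | z.2.2.1 (window M c U z.1) = 0}

/-- The configuration seen in the frame of the particle, given the data at the first hit. -/
noncomputable def insertMap (z : E n × (M × CountingMeasure (E n × M))) :
    CountingMeasure (E n × M) :=
  shiftAdd z.2.2 z.1 z.2.1

theorem measurable_insertMap :
    Measurable (insertMap : E n × (M × CountingMeasure (E n × M)) → CountingMeasure (E n × M)) := by
  have h : Continuous fun z : E n × (M × CountingMeasure (E n × M)) => (z.2.2, (z.1, z.2.1)) := by
    fun_prop
  exact (continuous_shiftAdd.comp h).measurable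

/-- The macroscopic limit process as a measure on counting measures. -/
noncomputable def limitProcess (cP : ℝ) (hμ : Continuous μ) (m : Measure M) (c : ℝ)
    (U : Set (EuclideanSpace ℝ (Fin n))) : Measure (CountingMeasure (E n × M)) :=
  ENNReal.ofReal cP • (frontMeasure hμ m c U).map insertMap

theorem measurableSet_front {c : ℝ} {U : Set (EuclideanSpace ℝ (Fin n))} (hU : IsOpen U) :
    MeasurableSet {z : E n × (M × CountingMeasure (E n × M)) |
      z.2.2.1 (window M c U z.1) = 0} := by
  have h := (isClosed_void (isOpen_window (n := n) (M := M) (c := c) hU)).measurableSet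
  have h2 : Measurable fun z : E n × (M × CountingMeasure (E n × M)) => (z.2.2, z.1) := by fun_prop
  exact h2 h

theorem lintegral_limitProcess {cP : ℝ} (hμ : Continuous μ) {m : Measure M}
    [IsProbabilityMeasure m] {c : ℝ} {U : Set (EuclideanSpace ℝ (Fin n))} (hU : IsOpen U)
    {F : CountingMeasure (E n × M) → ℝ≥0∞} (hF : Measurable F) :
    ∫⁻ η, F η ∂(limitProcess cP hμ m c U) = ENNReal.ofReal cP * ∫⁻ y in halfCylinder c U,
      ∫⁻ s, ∫⁻ η, F (shiftAdd η y s) * ENNReal.ofReal (voidInd (window M c U y) η)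
        ∂(μ s : Measure (CountingMeasure (E n × M))) ∂m := by
  have hFm : Measurable fun z : E n × (M × CountingMeasure (E n × M)) => F (insertMap z) :=
    hF.comp measurable_insertMap
  have hI := hFm.indicator (measurableSet_front (M := M) (c := c) hU)
  rw [limitProcess, lintegral_smul_measure, smul_eq_mul, lintegral_map hF measurable_insertMap,
    frontMeasure, ← lintegral_indicator (measurableSet_front hU), lintegral_prod _ hI.aemeasurable]
  congr 1
  refine lintegral_congr fun y => ?_
  refine (Measure.lintegral_compProd (hI.comp (measurable_prodMk_left (x := y)))).trans ?_
  refine lintegral_congr fun s => lintegral_congr fun η => ?_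
  by_cases h : η.1 (window M c U y) = 0
  · rw [voidInd_eq_one h, ENNReal.ofReal_one, mul_one]
    exact indicator_of_mem (show (y, s, η) ∈ {z : E n × (M × CountingMeasure (E n × M)) |
        z.2.2.1 (window M c U z.1) = 0} from h) _
  · rw [voidInd_eq_zero h, ENNReal.ofReal_zero, mul_zero]
    exact indicator_of_notMem (show (y, s, η) ∉ {z : E n × (M × CountingMeasure (E n × M)) |
        z.2.2.1 (window M c U z.1) = 0} from h) _

/-- Translation creates no coincidence, and the added point shares its hyperplane only with points
coming from x_1 = 0, of which there are none. -/
theorem shiftAdd_mem_simpleSet {η : CountingMeasure (E n × M)}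
    (hη : ¬ ∃ t : ℝ, 1 < η.1 {x : E n × M | x.1 0 = t})
    (h0 : η.1 {x : E n × M | x.1 0 = 0} = 0) (y : E n) (s : M) :
    shiftAdd η y s ∈ simpleSet n M := by
  refine mem_simpleSet ?_
  rintro ⟨t, ht⟩
  have hm : ∀ t : ℝ, MeasurableSet {x : E n × M | x.1 0 = t} := fun t =>
    (isClosed_eq (by fun_prop) continuous_const).measurableSet
  have h1 : (shiftAdd η y s).1 {x : E n × M | x.1 0 = t} =
      η.1 {x : E n × M | x.1 0 = t - y 0} +
        Measure.dirac ((y, s) : E n × M) {x : E n × M | x.1 0 = t} := by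
    change ((η.1.map (onPoints M (Homeomorph.addRight y))) + Measure.dirac ((y, s) : E n × M))
      {x : E n × M | x.1 0 = t} = _
    rw [Measure.add_apply, Measure.map_apply
      (onPoints M (Homeomorph.addRight y)).continuous.measurable (hm t)]
    congr 2
    ext x
    exact eq_sub_iff_add_eq.symm
  rw [h1] at ht
  by_cases hty : t = y 0
  · rw [hty, sub_self, h0, zero_add] at ht
    exact absurd ht (not_lt.2 prob_le_one)
  · rw [Measure.dirac_apply' _ (hm t), indicator_of_notMem
      (show ((y, s) : E n × M) ∉ {x : E n × M | x.1 0 = t} from fun h => hty h.symm),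
      add_zero] at ht
    exact hη ⟨_, ht⟩

/-- The limit process is almost surely given by a point set. -/
theorem limitProcess_compl_range {cP : ℝ} (hμ : Continuous μ) {m : Measure M}
    [IsProbabilityMeasure m] (hQ2 : CoincidenceFree μ)
    (hface : ∀ᵐ s ∂m, (μ s : Measure (CountingMeasure (E n × M)))
      {η | η.1 {x : E n × M | x.1 0 = 0} ≠ 0} = 0) (c : ℝ) (U : Set (EuclideanSpace ℝ (Fin n))) :
    limitProcess cP hμ m c U
      (range (PointSet.toCounting : PointSet (E n × M) → CountingMeasure (E n × M)))ᶜ = 0 := by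
  -- The complement of the range is replaced by the complement of a Borel subset of it, so that
  -- push-forwards and products can be computed.
  refine measure_mono_null (compl_subset_compl.2 fun η => mem_range_of_mem_simpleSet) ?_
  have hm := (measurableSet_simpleSet n M).compl
  have hZ := (measurable_insertMap (n := n) (M := M)) hm
  rw [limitProcess, Measure.smul_apply, Measure.map_apply measurable_insertMap hm, smul_eq_mul]
  refine mul_eq_zero_of_right _ (Measure.restrict_le_self.absolutelyContinuous ?_)
  rw [Measure.measure_prod_null hZ]
  refine Eventually.of_forall fun y => ?_
  refine (Measure.compProd_apply (measurable_prodMk_left (x := y) hZ)).trans ?_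
  refine (lintegral_congr_ae ?_).trans lintegral_zero
  filter_upwards [hface] with s hs
  refine measure_mono_null (fun η hη => ?_) (measure_union_null (hQ2 s) hs)
  by_contra hcon
  rw [mem_union, not_or] at hcon
  exact hη (shiftAdd_mem_simpleSet hcon.1 (not_not.1 hcon.2) y s)

end LimitMeasure

end LorentzGas

namespace LorentzGas

/-! ### Convergence of expectations, up to particles missing a long cylinder. -/

section Convergence

variable {n : ℕ} {M : Type*} [MetricSpace M] [CompactSpace M] [MeasurableSpace M] [BorelSpace M]
  {μ : M → ProbabilityMeasure (CountingMeasure (E n × M))}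

/-- The integrand of the limit process, as a function of position, mark and configuration. -/
noncomputable def frontWeight (f : CountingMeasure (E n × M) → ℝ) (c : ℝ)
    (U : Set (EuclideanSpace ℝ (Fin n))) (z : E n × (M × CountingMeasure (E n × M))) : ℝ :=
  f (insertMap z) * voidInd (window M c U z.1) z.2.2

theorem measurable_frontWeight {f : CountingMeasure (E n × M) → ℝ} (hf : Continuous f) (c : ℝ)
    {U : Set (EuclideanSpace ℝ (Fin n))} (hU : IsOpen U) :
    Measurable (frontWeight f c U) := by
  have h1 : Measurable fun z : E n × (M × CountingMeasure (E n × M)) => (z.2.2, z.1) := by fun_prop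
  have h2 := (measurable_voidInd_window (M := M) (c := c) hU).comp h1
  have h3 : Measurable fun z : E n × (M × CountingMeasure (E n × M)) => f (insertMap z) :=
    Measurable.comp (g := f) hf.measurable measurable_insertMap
  exact h3.mul h2

theorem frontWeight_nonneg {f : CountingMeasure (E n × M) → ℝ} (hf0 : ∀ η, 0 ≤ f η) (c : ℝ)
    (U : Set (EuclideanSpace ℝ (Fin n))) (z) : 0 ≤ frontWeight f c U z :=
  mul_nonneg (hf0 _) (voidInd_nonneg _ _)

theorem frontWeight_le_one {f : CountingMeasure (E n × M) → ℝ}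
    (hf1 : ∀ η, f η ≤ 1) (c : ℝ) (U : Set (EuclideanSpace ℝ (Fin n))) (z) :
    frontWeight f c U z ≤ 1 :=
  mul_le_one₀ (hf1 _) (voidInd_nonneg _ _) (voidInd_le_one _ _)

/-- The average over the marks of `voidExpect`. -/
noncomputable def voidMean (μ : M → ProbabilityMeasure (CountingMeasure (E n × M)))
    (m : Measure M) (f : CountingMeasure (E n × M) → ℝ) (c : ℝ)
    (U : Set (EuclideanSpace ℝ (Fin n))) (y : E n) : ℝ :=
  ∫ s, voidExpect μ f c U y s ∂m

variable {m : Measure M} [IsProbabilityMeasure m] {f : CountingMeasure (E n × M) → ℝ}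
  {c : ℝ} {U : Set (EuclideanSpace ℝ (Fin n))}

theorem integrable_frontWeight (hf : Continuous f) (hf0 : ∀ η, 0 ≤ f η) (hf1 : ∀ η, f η ≤ 1)
    (hU : IsOpen U) (y : E n) (ν : Measure (M × CountingMeasure (E n × M))) [IsFiniteMeasure ν] :
    Integrable (fun w => frontWeight f c U (y, w)) ν := by
  have h1 : Measurable fun w : M × CountingMeasure (E n × M) => (y, w) := measurable_prodMk_left
  exact integrable_bounded (C := 1) ((measurable_frontWeight hf c hU).comp h1) fun w => by
    rw [abs_of_nonneg (frontWeight_nonneg hf0 c U _)]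
    exact frontWeight_le_one hf1 c U _

theorem voidMean_eq (hμ : Continuous μ) (hf : Continuous f) (hf0 : ∀ η, 0 ≤ f η)
    (hf1 : ∀ η, f η ≤ 1) (hU : IsOpen U) (y : E n) :
    voidMean μ m f c U y =
      ∫ w, frontWeight f c U (y, w) ∂(Measure.compProd m (processKernel hμ)) :=
  (Measure.integral_compProd (integrable_frontWeight hf hf0 hf1 hU y
    (Measure.compProd m (processKernel hμ)))).symm

theorem ofReal_voidMean (hμ : Continuous μ) (hf : Continuous f) (hf0 : ∀ η, 0 ≤ f η)
    (hf1 : ∀ η, f η ≤ 1) (hU : IsOpen U) (y : E n) :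
    ENNReal.ofReal (voidMean μ m f c U y) =
      ∫⁻ s, ∫⁻ η, ENNReal.ofReal (f (shiftAdd η y s)) * ENNReal.ofReal (voidInd (window M c U y) η)
        ∂(μ s : Measure (CountingMeasure (E n × M))) ∂m := by
  have h1 : Measurable fun w : M × CountingMeasure (E n × M) => (y, w) := measurable_prodMk_left
  have h2 := (measurable_frontWeight hf c hU).comp h1
  rw [voidMean_eq hμ hf hf0 hf1 hU,
    ofReal_integral_eq_lintegral_ofReal (integrable_frontWeight hf hf0 hf1 hU y _)
      (Eventually.of_forall fun w => frontWeight_nonneg hf0 c U _)]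
  refine (Measure.lintegral_compProd h2.ennreal_ofReal).trans ?_
  refine lintegral_congr fun s => lintegral_congr fun η => ?_
  exact ENNReal.ofReal_mul (hf0 _)

theorem voidMean_nonneg (hf0 : ∀ η, 0 ≤ f η) (y : E n) : 0 ≤ voidMean μ m f c U y :=
  integral_nonneg fun _ => integral_nonneg fun _ => mul_nonneg (hf0 _) (voidInd_nonneg _ _)

theorem integrable_voidMean (hμ : Continuous μ) (hf : Continuous f) (hf0 : ∀ η, 0 ≤ f η)
    (hf1 : ∀ η, f η ≤ 1) (hU : IsOpen U) (ν : Measure (E n)) [IsFiniteMeasure ν] :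
    Integrable (voidMean μ m f c U) ν := by
  have h1 : voidMean μ m f c U = fun y =>
      ∫ w, frontWeight f c U (y, w) ∂(Measure.compProd m (processKernel hμ)) :=
    funext fun y => voidMean_eq hμ hf hf0 hf1 hU y
  have h2 : Measurable (voidMean μ m f c U) := by
    rw [h1]
    exact ((measurable_frontWeight hf c hU).stronglyMeasurable.integral_prod_right'
      (ν := Measure.compProd m (processKernel hμ))).measurable
  refine integrable_bounded (C := 1) h2 fun y => ?_
  rw [h1]
  have h3 : ∀ᵐ w ∂(Measure.compProd m (processKernel hμ)), ‖frontWeight f c U (y, w)‖ ≤ 1 :=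
    Eventually.of_forall fun w => by
      rw [Real.norm_of_nonneg (frontWeight_nonneg hf0 c U _)]
      exact frontWeight_le_one hf1 c U _
  have h4 := norm_integral_le_of_norm_le_const h3
  rwa [probReal_univ, mul_one] at h4

theorem isFiniteMeasure_restrict_cylinder (hUb : Bornology.IsBounded U) (c ξ : ℝ) :
    IsFiniteMeasure ((volume : Measure (E n)).restrict (cylinder c U ξ)) := by
  obtain ⟨r, -, hr⟩ := norm_le_of_mem_cylinder (c := c) (ξ := ξ) hUb
  refine isFiniteMeasure_restrict.2 (((measure_mono fun x hx => ?_).trans_lt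
    (measure_closedBall_lt_top (x := (0 : E n)) (r := r))).ne)
  simpa using hr x hx

/-- Monotone convergence along the cylinders of integer length, which exhaust the half cylinder.
Extended nonnegative values are used because finiteness of the limit process is not yet known. -/
theorem tendsto_lintegral_limitProcess {cP : ℝ} (hμ : Continuous μ) (hf : Continuous f)
    (hf0 : ∀ η, 0 ≤ f η) (hf1 : ∀ η, f η ≤ 1) (hU : IsOpen U) (hUb : Bornology.IsBounded U) :
    Tendsto (fun k : ℕ => ENNReal.ofReal cP *
        ENNReal.ofReal (∫ y in cylinder c U k, voidMean μ m f c U y)) atTop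
      (𝓝 (∫⁻ η, ENNReal.ofReal (f η) ∂(limitProcess cP hμ m c U))) := by
  rw [lintegral_limitProcess hμ hU hf.measurable.ennreal_ofReal]
  simp_rw [← ofReal_voidMean hμ hf hf0 hf1 hU]
  refine ENNReal.Tendsto.const_mul ?_ (Or.inr ENNReal.ofReal_ne_top)
  have hmono : Monotone fun k : ℕ => cylinder c U (k : ℝ) := fun i j h =>
    cylinder_mono c U (Nat.cast_le.2 h)
  rw [halfCylinder_eq, setLIntegral_iUnion_of_directed _ hmono.directed_le]
  have h1 : ∀ k : ℕ, ENNReal.ofReal (∫ y in cylinder c U k, voidMean μ m f c U y) =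
      ∫⁻ y in cylinder c U k, ENNReal.ofReal (voidMean μ m f c U y) := fun k => by
    have := isFiniteMeasure_restrict_cylinder hUb c k
    exact ofReal_integral_eq_lintegral_ofReal (integrable_voidMean hμ hf hf0 hf1 hU _)
      (Eventually.of_forall fun y => voidMean_nonneg hf0 y)
  simp_rw [h1]
  exact tendsto_atTop_iSup fun i j h => lintegral_mono_set (hmono h)

theorem voidMean_mul (a b : ℝ) (S : Set (E n)) :
    ∫ y in S, a * (b * ∫ s, voidExpect μ f c U y s ∂m) =
      b * (a * ∫ y in S, voidMean μ m f c U y) := by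
  rw [integral_const_mul, integral_const_mul, mul_left_comm]
  rfl

variable {R : FrameRotation n} {P : PointSet (E n)} {mark : P.carrier → M}

/-- The configuration in the frame of the particle, for a macroscopic initial position. -/
noncomputable def macroPoint (R : FrameRotation n) (P : PointSet (E n)) (mark : P.carrier → M)
    (ρ : Radius) (z : E n × Sph n) : PointSet (E n × M) :=
  Qset R P mark ρ (((ρ : ℝ) ^ n)⁻¹ • z.1) z.2

theorem measurable_macroPoint (ρ : Radius) : Measurable (macroPoint R P mark ρ) := by
  have h : Continuous fun z : E n × Sph n => (((ρ : ℝ) ^ n)⁻¹ • z.1, z.2) := by fun_prop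
  intro A hA
  exact h.measurable (measurable_Qset R P mark ρ hA)

theorem measurable_macroPoint_toCounting (ρ : Radius) :
    Measurable fun z => (macroPoint R P mark ρ z).toCounting :=
  measurable_toCounting.comp (measurable_macroPoint ρ)

/-- The integrand is at most B and vanishes off the event that [P3] makes small. -/
theorem integral_void_le {φ : E n × Sph n → ℝ} (hφ0 : ∀ z, 0 ≤ φ z) {B T₀ : ℝ} (hB : ∀ z, φ z ≤ B)
    (hsupp : ∀ z : E n × Sph n, T₀ < ‖z.1‖ → φ z = 0) (hf0 : ∀ η, 0 ≤ f η) (hf1 : ∀ η, f η ≤ 1)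
    (hU : IsOpen U) {ξ : ℝ} {ρ : Radius} {ε : ℝ} (hε : 0 ≤ ε)
    (h : ((volume : Measure (E n)).prod (omega n))
      {z | ‖z.1‖ ≤ T₀ ∧ (macroPoint R P mark ρ z).carrier ∩ cylinder c U ξ ×ˢ univ = ∅} ≤
        ENNReal.ofReal ε) :
    |∫ z, φ z * (f (macroPoint R P mark ρ z).toCounting *
      voidInd (cylinder c U ξ ×ˢ univ) (macroPoint R P mark ρ z).toCounting)
        ∂(volume.prod (omega n))| ≤ B * ε := by
  have hW : IsOpen (cylinder c U ξ ×ˢ univ : Set (E n × M)) := by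
    have h1 : IsOpen {x : E n | c < x 0} := isOpen_lt (by fun_prop) (by fun_prop)
    have h2 : IsOpen {x : E n | x 0 < c + ξ} := isOpen_lt (by fun_prop) (by fun_prop)
    exact (h1.inter (h2.inter (hU.preimage continuous_tailPt))).prod isOpen_univ
  set D : Set (E n × Sph n) :=
    {z | ‖z.1‖ ≤ T₀ ∧ (macroPoint R P mark ρ z).carrier ∩ cylinder c U ξ ×ˢ univ = ∅}
  have hD : MeasurableSet D := by
    have h1 : MeasurableSet {z : E n × Sph n | ‖z.1‖ ≤ T₀} :=
      (isClosed_le (by fun_prop) continuous_const).measurableSet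
    have h2 := measurable_macroPoint_toCounting (R := R) (P := P) (mark := mark) ρ
      (measurableSet_void hW)
    have h3 : D = {z : E n × Sph n | ‖z.1‖ ≤ T₀} ∩
        (fun z => (macroPoint R P mark ρ z).toCounting) ⁻¹'
          {η | η.1 (cylinder c U ξ ×ˢ univ) = 0} := by
      ext z
      refine and_congr Iff.rfl ?_
      exact (PointSet.toCounting_apply_eq_zero _ hW.measurableSet).symm
    rw [h3]
    exact h1.inter h2
  have hDfin : ((volume : Measure (E n)).prod (omega n)) D ≠ ∞ :=
    (h.trans_lt ENNReal.ofReal_lt_top).ne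
  have hg0 : ∀ z, 0 ≤ φ z * (f (macroPoint R P mark ρ z).toCounting *
      voidInd (cylinder c U ξ ×ˢ univ) (macroPoint R P mark ρ z).toCounting) := fun z =>
    mul_nonneg (hφ0 z) (mul_nonneg (hf0 _) (voidInd_nonneg _ _))
  have hB0 : 0 ≤ B := by
    obtain ⟨v⟩ : Nonempty (Sph n) := ⟨⟨EuclideanSpace.single 0 1, by simp⟩⟩
    exact (hφ0 ((0 : E n), v)).trans (hB _)
  have hle : ∀ z, φ z * (f (macroPoint R P mark ρ z).toCounting *
      voidInd (cylinder c U ξ ×ˢ univ) (macroPoint R P mark ρ z).toCounting) ≤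
        D.indicator (fun _ => B) z := by
    intro z
    by_cases hz : z ∈ D
    · rw [indicator_of_mem hz]
      exact (mul_le_of_le_one_right (hφ0 z)
        (mul_le_one₀ (hf1 _) (voidInd_nonneg _ _) (voidInd_le_one _ _))).trans (hB z)
    · rw [indicator_of_notMem hz]
      by_cases hz1 : T₀ < ‖z.1‖
      · rw [hsupp z hz1, zero_mul]
      · have h2 : (macroPoint R P mark ρ z).toCounting.1 (cylinder c U ξ ×ˢ univ) ≠ 0 := fun h0 =>
          hz ⟨not_lt.1 hz1, (PointSet.toCounting_apply_eq_zero _ hW.measurableSet).1 h0⟩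
        rw [voidInd_eq_zero h2, mul_zero, mul_zero]
  rw [abs_of_nonneg (integral_nonneg hg0)]
  refine (integral_mono_of_nonneg (Eventually.of_forall hg0)
    ((integrable_indicator_iff hD).2 (integrableOn_const hDfin)) (Eventually.of_forall hle)).trans ?_
  rw [integral_indicator_const _ hD, smul_eq_mul, mul_comm]
  refine mul_le_mul_of_nonneg_left ?_ hB0
  exact ENNReal.toReal_le_of_le_ofReal hε h

/-- The expectation of an observable is approximated by the contribution of the particles which hit
a long cylinder. -/
theorem eventually_abs_integral_sub_le (hn : 1 ≤ n) {cP : ℝ}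
    (hP : HasAsymptoticDensity P.carrier cP)
    (hP1 : UniformDensity P mark cP m) (hP2 : SphericalEquidistribution R P mark μ)
    (hP3 : NoEscapeOfMass R P mark) (hμ : Continuous μ)
    (hface : ∀ᵐ s ∂m, (μ s : Measure (CountingMeasure (E n × M)))
      {η | η.1 {x : E n × M | x.1 0 = 0} ≠ 0} = 0)
    {φ : E n × Sph n → ℝ} (hφ : Continuous φ) (hφ0 : ∀ z, 0 ≤ φ z) (hc : HasCompactSupport φ)
    (hf : Tame f) (hf0 : ∀ η, 0 ≤ f η) (hf1 : ∀ η, f η ≤ 1)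
    (hU : IsOpen U) (hne : U.Nonempty) (hUb : Bornology.IsBounded U)
    (hU' : volume (frontier U) = 0) {ε : ℝ} (hε : 0 < ε) :
    ∀ᶠ ξ : ℝ in atTop, ∀ᶠ ρ : Radius in toZero,
      |∫ z, φ z * f (macroPoint R P mark ρ z).toCounting ∂(volume.prod (omega n)) -
        (∫ z, φ z ∂(volume.prod (omega n))) * (cP * ∫ y in cylinder c U ξ, voidMean μ m f c U y)|
          ≤ ε := by
  obtain ⟨B, hB⟩ := hφ.bounded_above_of_compact_support hc
  obtain ⟨T₀, hT₀⟩ := (hc.isCompact.image continuous_fst).isBounded.exists_norm_le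
  have hsupp : ∀ z : E n × Sph n, T₀ < ‖z.1‖ → φ z = 0 := fun z hz => by
    by_contra h
    exact absurd (hT₀ z.1 ⟨z, subset_tsupport _ h, rfl⟩) (not_le.2 hz)
  have hB' : ∀ z, φ z ≤ |B| := fun z => (le_abs_self _).trans ((hB z).trans (le_abs_self _))
  have hδ : 0 < ε / (2 * (|B| + 1)) := by positivity
  filter_upwards [hP3.eventually_void_le c hU hne T₀ (ENNReal.ofReal_pos.2 hδ).ne'] with ξ hξ
  obtain ⟨r, -, hr⟩ := norm_le_of_mem_cylinder (c := c) (ξ := ξ) hUb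
  have hlim := tendsto_integral_hitWeight hn hP hP1 hP2 hμ hface hφ hφ0 hsupp hf hf0 hf1 hU hU' hr
    (le_refl (T₀ + r))
  rw [voidMean_mul] at hlim
  filter_upwards [hξ, Metric.tendsto_nhds.1 hlim (ε / 2) (half_pos hε)] with ρ h1 h2
  rw [← integral_hit_eq hφ hsupp hf.continuous hf0 hf1 hU hr le_rfl ρ, Real.dist_eq] at h2
  have h3 := integral_void_le (f := f) hφ0 hB' hsupp hf0 hf1 hU hδ.le h1
  have hfm : Measurable fun z => f (macroPoint R P mark ρ z).toCounting :=
    Measurable.comp (g := f) hf.continuous.measurable (measurable_macroPoint_toCounting ρ)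
  have hW : IsOpen (cylinder c U ξ ×ˢ univ : Set (E n × M)) := by
    have h1 : IsOpen {x : E n | c < x 0} := isOpen_lt (by fun_prop) (by fun_prop)
    have h2 : IsOpen {x : E n | x 0 < c + ξ} := isOpen_lt (by fun_prop) (by fun_prop)
    exact (h1.inter (h2.inter (hU.preimage continuous_tailPt))).prod isOpen_univ
  have hvm : Measurable fun z =>
      voidInd (cylinder c U ξ ×ˢ univ) (macroPoint R P mark ρ z).toCounting :=
    (measurable_voidInd hW).comp (measurable_macroPoint_toCounting ρ)
  have hφi : Integrable φ (volume.prod (omega n)) := hφ.integrable_of_hasCompactSupport hc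
  have hi : ∀ g : E n × Sph n → ℝ, Measurable g → (∀ z, 0 ≤ g z) → (∀ z, g z ≤ 1) →
      Integrable (fun z => φ z * g z) (volume.prod (omega n)) := fun g hg h0 h1 =>
    hφi.mul_bdd (c := 1) hg.aestronglyMeasurable
      (Eventually.of_forall fun z => by rw [Real.norm_of_nonneg (h0 z)]; exact h1 z)
  -- Particles hitting the cylinder are governed by the exact identity and its limit, those missing
  -- it by [P3]; each part receives an error ε/2.
  have hsplit : ∫ z, φ z * f (macroPoint R P mark ρ z).toCounting ∂(volume.prod (omega n)) =
      ∫ z, φ z * (f (macroPoint R P mark ρ z).toCounting *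
        (1 - voidInd (cylinder c U ξ ×ˢ univ) (macroPoint R P mark ρ z).toCounting))
          ∂(volume.prod (omega n)) +
      ∫ z, φ z * (f (macroPoint R P mark ρ z).toCounting *
        voidInd (cylinder c U ξ ×ˢ univ) (macroPoint R P mark ρ z).toCounting)
          ∂(volume.prod (omega n)) := by
    have i1 : Integrable (fun z => φ z * (f (macroPoint R P mark ρ z).toCounting *
        (1 - voidInd (cylinder c U ξ ×ˢ univ) (macroPoint R P mark ρ z).toCounting)))
          (volume.prod (omega n)) :=
      hi _ (hfm.mul (hvm.const_sub 1))
        (fun z => mul_nonneg (hf0 _) (sub_nonneg.2 (voidInd_le_one _ _)))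
        fun z => mul_le_one₀ (hf1 _) (sub_nonneg.2 (voidInd_le_one _ _))
          (sub_le_self _ (voidInd_nonneg _ _))
    have i2 : Integrable (fun z => φ z * (f (macroPoint R P mark ρ z).toCounting *
        voidInd (cylinder c U ξ ×ˢ univ) (macroPoint R P mark ρ z).toCounting))
          (volume.prod (omega n)) :=
      hi _ (hfm.mul hvm) (fun z => mul_nonneg (hf0 _) (voidInd_nonneg _ _))
        fun z => mul_le_one₀ (hf1 _) (voidInd_nonneg _ _) (voidInd_le_one _ _)
    refine Eq.trans ?_ (integral_add i1 i2)
    congr 1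
    funext z
    ring
  have h4 : |B| * (ε / (2 * (|B| + 1))) ≤ ε / 2 := by
    rw [mul_div_assoc', div_le_div_iff₀ (by positivity) (by positivity)]
    nlinarith [abs_nonneg B]
  rw [hsplit, add_sub_right_comm]
  refine (abs_add_le _ _).trans ?_
  have h5 : |∫ z, φ z * (f (macroPoint R P mark ρ z).toCounting *
        (1 - voidInd (cylinder c U ξ ×ˢ univ) (macroPoint R P mark ρ z).toCounting))
          ∂(volume.prod (omega n)) -
      (∫ z, φ z ∂(volume.prod (omega n))) * (cP * ∫ y in cylinder c U ξ, voidMean μ m f c U y)|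
        < ε / 2 := h2
  linarith

end Convergence

end LorentzGas

namespace LorentzGas

/-! ### Total mass one, and convergence for continuous densities. -/

section MassOne

variable {n : ℕ} {M : Type*} [MetricSpace M] [CompactSpace M] [MeasurableSpace M] [BorelSpace M]
  {μ : M → ProbabilityMeasure (CountingMeasure (E n × M))}
  {m : Measure M} [IsProbabilityMeasure m] {f : CountingMeasure (E n × M) → ℝ}
  {c : ℝ} {U : Set (EuclideanSpace ℝ (Fin n))}
  {R : FrameRotation n} {P : PointSet (E n)} {mark : P.carrier → M}

/-- For the observable 1 the expectation is ∫ φ for every ρ. Comparing it with its own approximation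
and cancelling ∫ φ > 0 forces the mass to converge to 1. -/
theorem tendsto_cylinder_voidMean_one (hn : 1 ≤ n) {cP : ℝ}
    (hP : HasAsymptoticDensity P.carrier cP)
    (hP1 : UniformDensity P mark cP m) (hP2 : SphericalEquidistribution R P mark μ)
    (hP3 : NoEscapeOfMass R P mark) (hμ : Continuous μ)
    (hface : ∀ᵐ s ∂m, (μ s : Measure (CountingMeasure (E n × M)))
      {η | η.1 {x : E n × M | x.1 0 = 0} ≠ 0} = 0)
    (hU : IsOpen U) (hne : U.Nonempty) (hUb : Bornology.IsBounded U)
    (hU' : volume (frontier U) = 0) :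
    Tendsto (fun ξ : ℝ => cP * ∫ y in cylinder c U ξ, voidMean μ m (fun _ => 1) c U y) atTop
      (𝓝 1) := by
  let φ : E n × Sph n → ℝ := fun z => bump 1 z.1
  have hφ : Continuous φ := (continuous_bump 1).comp continuous_fst
  have hc : HasCompactSupport φ := by
    refine HasCompactSupport.intro ((isCompact_closedBall (0 : E n) 2).prod
      (isCompact_univ (X := Sph n))) fun z hz => bump_eq_zero ?_
    by_contra! h
    exact hz ⟨by simpa using (h.trans_eq one_add_one_eq_two).le, mem_univ _⟩
  have hI : 0 < ∫ z, φ z ∂((volume : Measure (E n)).prod (omega n)) := by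
    have h := integral_prod_mul (μ := (volume : Measure (E n))) (ν := omega n)
      (bump 1) (fun _ => (1 : ℝ))
    simp only [mul_one, integral_const, smul_eq_mul] at h
    change 0 < ∫ z : E n × Sph n, bump 1 z.1 ∂((volume : Measure (E n)).prod (omega n))
    rw [h]
    exact mul_pos (integral_bump_pos zero_le_one) omega_real_univ_pos
  set I := ∫ z, φ z ∂((volume : Measure (E n)).prod (omega n))
  rw [Metric.tendsto_nhds]
  intro ε hε
  have h := eventually_abs_integral_sub_le (c := c) hn hP hP1 hP2 hP3 hμ hface hφ
    (fun z => bump_nonneg _ _) hc (Tame.const 1) (fun _ => zero_le_one) (fun _ => le_rfl)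
    hU hne hUb hU' (ε := I * (ε / 2)) (by positivity)
  filter_upwards [h] with ξ hξ
  -- The inequality no longer involves ρ, so a single admissible value is enough.
  obtain ⟨ρ, hρ⟩ := hξ.exists
  simp only [mul_one] at hρ
  change |I - I * _| ≤ _ at hρ
  rw [← mul_one_sub, abs_mul, abs_of_pos hI, mul_le_mul_iff_right₀ hI, abs_sub_comm] at hρ
  rw [Real.dist_eq]
  exact hρ.trans_lt (half_lt_self hε)

theorem isProbabilityMeasure_limitProcess (hn : 1 ≤ n) {cP : ℝ} (hcP : 0 < cP)
    (hP : HasAsymptoticDensity P.carrier cP)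
    (hP1 : UniformDensity P mark cP m) (hP2 : SphericalEquidistribution R P mark μ)
    (hP3 : NoEscapeOfMass R P mark) (hμ : Continuous μ)
    (hface : ∀ᵐ s ∂m, (μ s : Measure (CountingMeasure (E n × M)))
      {η | η.1 {x : E n × M | x.1 0 = 0} ≠ 0} = 0)
    (hU : IsOpen U) (hne : U.Nonempty) (hUb : Bornology.IsBounded U)
    (hU' : volume (frontier U) = 0) :
    IsProbabilityMeasure (limitProcess cP hμ m c U) := by
  have h1 := tendsto_lintegral_limitProcess (cP := cP) (m := m) (c := c) hμ
    (f := fun _ => 1) continuous_const (fun _ => zero_le_one) (fun _ => le_rfl) hU hUb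
  have h2 := ENNReal.tendsto_ofReal ((tendsto_cylinder_voidMean_one (c := c) hn hP hP1 hP2 hP3 hμ
    hface hU hne hUb hU').comp tendsto_natCast_atTop_atTop)
  simp_rw [← ENNReal.ofReal_mul hcP.le] at h1
  have h3 := tendsto_nhds_unique h1 h2
  simp only [ENNReal.ofReal_one, lintegral_const, one_mul] at h3
  exact ⟨h3⟩

/-- The expectations of tame observables converge for initial densities in `C_c`. -/
theorem tendsto_integral_macroPoint (hn : 1 ≤ n) {cP : ℝ} (hcP : 0 < cP)
    (hP : HasAsymptoticDensity P.carrier cP)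
    (hP1 : UniformDensity P mark cP m) (hP2 : SphericalEquidistribution R P mark μ)
    (hP3 : NoEscapeOfMass R P mark) (hμ : Continuous μ)
    (hface : ∀ᵐ s ∂m, (μ s : Measure (CountingMeasure (E n × M)))
      {η | η.1 {x : E n × M | x.1 0 = 0} ≠ 0} = 0)
    {φ : E n × Sph n → ℝ} (hφ : Continuous φ) (hφ0 : ∀ z, 0 ≤ φ z) (hc : HasCompactSupport φ)
    (hf : Tame f) (hf0 : ∀ η, 0 ≤ f η) (hf1 : ∀ η, f η ≤ 1)
    (hU : IsOpen U) (hne : U.Nonempty) (hUb : Bornology.IsBounded U)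
    (hU' : volume (frontier U) = 0) :
    Tendsto (fun ρ : Radius =>
        ∫ z, φ z * f (macroPoint R P mark ρ z).toCounting ∂(volume.prod (omega n))) toZero
      (𝓝 ((∫ z, φ z ∂(volume.prod (omega n))) * ∫ η, f η ∂(limitProcess cP hμ m c U))) := by
  have hprob := isProbabilityMeasure_limitProcess (c := c) hn hcP hP hP1 hP2 hP3 hμ hface hU hne
    hUb hU'
  have h1 := tendsto_lintegral_limitProcess (cP := cP) (m := m) (c := c) hμ hf.continuous hf0 hf1
    hU hUb
  have hfi : Integrable f (limitProcess cP hμ m c U) :=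
    integrable_bounded (C := 1) hf.continuous.measurable fun η => by
      rw [abs_of_nonneg (hf0 η)]; exact hf1 η
  rw [← ofReal_integral_eq_lintegral_ofReal hfi (Eventually.of_forall hf0)] at h1
  simp_rw [← ENNReal.ofReal_mul hcP.le] at h1
  have h2 := (ENNReal.tendsto_toReal ENNReal.ofReal_ne_top).comp h1
  have h3 : ∀ k : ℕ, 0 ≤ cP * ∫ y in cylinder c U k, voidMean μ m f c U y := fun k =>
    mul_nonneg hcP.le (integral_nonneg fun y => voidMean_nonneg hf0 y)
  have h4 : (ENNReal.toReal ∘ fun k : ℕ =>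
      ENNReal.ofReal (cP * ∫ y in cylinder c U k, voidMean μ m f c U y)) =
        fun k : ℕ => cP * ∫ y in cylinder c U k, voidMean μ m f c U y :=
    funext fun k => ENNReal.toReal_ofReal (h3 k)
  rw [h4, ENNReal.toReal_ofReal (integral_nonneg hf0)] at h2
  have h5 := h2.const_mul (∫ z, φ z ∂((volume : Measure (E n)).prod (omega n)))
  rw [Metric.tendsto_nhds]
  intro ε hε
  have h6 := tendsto_natCast_atTop_atTop.eventually (eventually_abs_integral_sub_le (c := c) hn hP
    hP1 hP2 hP3 hμ hface hφ hφ0 hc hf hf0 hf1 hU hne hUb hU' (ε := ε / 2) (half_pos hε))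
  -- The length k is fixed before ρ → 0: long enough both for the bound from [P3] and for the
  -- truncated limit process to be close to the full one.
  obtain ⟨k, hk1, hk2⟩ := (h6.and (Metric.tendsto_nhds.1 h5 (ε / 2) (half_pos hε))).exists
  filter_upwards [hk1] with ρ hρ
  refine (dist_triangle _ _ _).trans_lt ((add_lt_add_of_le_of_lt ?_ hk2).trans_eq (add_halves ε))
  rw [Real.dist_eq]
  exact hρ

end MassOne

end LorentzGas

namespace LorentzGas

/-! ### From counting measures to point sets, and the explicit formula. -/

section LimitLaw

variable {n : ℕ} {M : Type*} [MetricSpace M] [CompactSpace M] [MeasurableSpace M] [BorelSpace M]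
  {μ : M → ProbabilityMeasure (CountingMeasure (E n × M))}
  {m : Measure M} [IsProbabilityMeasure m]
  {c : ℝ} {U : Set (EuclideanSpace ℝ (Fin n))}

theorem PointSet.exists_measurableSet_preimage {A : Set (PointSet (E n × M))}
    (hA : MeasurableSet A) :
    ∃ A' : Set (CountingMeasure (E n × M)), MeasurableSet A' ∧ PointSet.toCounting ⁻¹' A' = A := by
  have h : (inferInstance : MeasurableSpace (PointSet (E n × M))) =
      MeasurableSpace.comap PointSet.toCounting inferInstance := borel_comap
  have hA' : MeasurableSet[MeasurableSpace.comap
      (PointSet.toCounting : PointSet (E n × M) → CountingMeasure (E n × M)) inferInstance] A :=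
    h ▸ hA
  exact hA'

/-- A measure on counting measures, as a measure on point sets. -/
noncomputable def toPointSetMeasure (ν : Measure (CountingMeasure (E n × M))) :
    Measure (PointSet (E n × M)) :=
  ν.comap PointSet.toCounting

/-- Images of Borel sets of point sets need not be known to be Borel. They are null measurable,
since up to the null complement of the range they agree with Borel sets of counting measures, and
this is enough for the pull-back. -/
theorem toPointSetMeasure_apply {ν : Measure (CountingMeasure (E n × M))}
    (hν : ν (range (PointSet.toCounting : PointSet (E n × M) → CountingMeasure (E n × M)))ᶜ = 0)
    {A : Set (CountingMeasure (E n × M))} (hA : MeasurableSet A) :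
    toPointSetMeasure ν (PointSet.toCounting ⁻¹' A) = ν A := by
  have hr : ∀ B : Set (CountingMeasure (E n × M)),
      (PointSet.toCounting '' ((PointSet.toCounting :
        PointSet (E n × M) → CountingMeasure (E n × M)) ⁻¹' B) : Set _) =ᵐ[ν] B := fun B => by
    rw [image_preimage_eq_inter_range]
    have h1 : ∀ᵐ η ∂ν, η ∈ range
        (PointSet.toCounting : PointSet (E n × M) → CountingMeasure (E n × M)) := hν
    filter_upwards [h1] with η hη
    exact propext ⟨fun h => h.1, fun h => ⟨h, hη⟩⟩
  have h0 := measurable_toCounting (n := n) (M := M) hA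
  refine (Measure.comap_apply₀ _ ν PointSet.toCounting_injective (fun B hB => ?_)
    h0.nullMeasurableSet).trans (measure_congr (hr A))
  obtain ⟨B', hB', rfl⟩ := PointSet.exists_measurableSet_preimage hB
  exact hB'.nullMeasurableSet.congr (hr B').symm

theorem map_toPointSetMeasure {ν : Measure (CountingMeasure (E n × M))}
    (hν : ν (range (PointSet.toCounting : PointSet (E n × M) → CountingMeasure (E n × M)))ᶜ = 0) :
    (toPointSetMeasure ν).map PointSet.toCounting = ν := by
  ext A hA
  rw [Measure.map_apply measurable_toCounting hA, toPointSetMeasure_apply hν hA]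

/-- The probability that the shifted configuration lies in `A` and the window is empty. -/
noncomputable def windowProb (μ : M → ProbabilityMeasure (CountingMeasure (E n × M))) (c : ℝ)
    (U : Set (EuclideanSpace ℝ (Fin n))) (A : Set (CountingMeasure (E n × M)))
    (z : E n × M) : ℝ≥0∞ :=
  ∫⁻ η, A.indicator 1 (shiftAdd η z.1 z.2) * ENNReal.ofReal (voidInd (window M c U z.1) η)
    ∂(μ z.2 : Measure (CountingMeasure (E n × M)))

theorem measurable_windowProb (hμ : Continuous μ) (hU : IsOpen U)
    {A : Set (CountingMeasure (E n × M))} (hA : MeasurableSet A) :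
    Measurable (windowProb μ c U A) := by
  have h1 : Measurable fun w : (E n × M) × CountingMeasure (E n × M) => (w.2, w.1.1) := by fun_prop
  have h2 := ((measurable_voidInd_window (M := M) (c := c) hU).comp h1).ennreal_ofReal
  have h3 : Continuous fun w : (E n × M) × CountingMeasure (E n × M) => (w.2, (w.1.1, w.1.2)) := by
    fun_prop
  have h4 : Measurable fun w : (E n × M) × CountingMeasure (E n × M) =>
      shiftAdd w.2 w.1.1 w.1.2 := (continuous_shiftAdd.comp h3).measurable
  have h5 : Measurable fun w : (E n × M) × CountingMeasure (E n × M) =>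
      A.indicator (1 : CountingMeasure (E n × M) → ℝ≥0∞) (shiftAdd w.2 w.1.1 w.1.2) :=
    (measurable_one.indicator hA).comp h4
  exact Measurable.lintegral_kernel_prod_right'
    (κ := (processKernel hμ).comap Prod.snd measurable_snd) (h5.mul h2)

theorem windowProb_eq_measure (hU : IsOpen U) {A : Set (CountingMeasure (E n × M))}
    (hA : MeasurableSet A) (z : E n × M) :
    windowProb μ c U A z = (μ z.2 : Measure (CountingMeasure (E n × M)))
      {η | η.1 (window M c U z.1) = 0 ∧ shiftAdd η z.1 z.2 ∈ A} := by
  have h1 : MeasurableSet {η : CountingMeasure (E n × M) | η.1 (window M c U z.1) = 0} :=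
    measurableSet_void ((isOpen_window hU).preimage (Continuous.prodMk_left z.1))
  have h3 : Continuous fun η : CountingMeasure (E n × M) => (η, (z.1, z.2)) := by fun_prop
  have h4 : Measurable fun η : CountingMeasure (E n × M) => shiftAdd η z.1 z.2 :=
    (continuous_shiftAdd.comp h3).measurable
  let S : Set (CountingMeasure (E n × M)) :=
    {η | η.1 (window M c U z.1) = 0 ∧ shiftAdd η z.1 z.2 ∈ A}
  have h5 : MeasurableSet S := h1.inter (h4 hA)
  refine Eq.trans (lintegral_congr fun η => ?_) (lintegral_indicator_one h5)
  by_cases ha : shiftAdd η z.1 z.2 ∈ A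
  · rw [indicator_of_mem ha, Pi.one_apply, one_mul]
    by_cases hb : η.1 (window M c U z.1) = 0
    · rw [voidInd_eq_one hb, ENNReal.ofReal_one]
      exact (indicator_of_mem (show η ∈ S from ⟨hb, ha⟩) (1 : CountingMeasure (E n × M) → ℝ≥0∞)).symm
    · rw [voidInd_eq_zero hb, ENNReal.ofReal_zero]
      exact (indicator_of_notMem (show η ∉ S from fun h => hb h.1) (1 : CountingMeasure (E n × M) → ℝ≥0∞)).symm
  · rw [indicator_of_notMem ha, zero_mul]
    exact (indicator_of_notMem (show η ∉ S from fun h => ha h.2) (1 : CountingMeasure (E n × M) → ℝ≥0∞)).symm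

/-- The left side is the outer measure of an image. Almost surely the configuration is simple by
[Q2] and has no point at the origin by the face condition, so inserting a point into the set and
adding an atom to the measure coincide. -/
theorem shiftedLaw_eq_windowProb (hQ2 : CoincidenceFree μ) (hU : IsOpen U) {s : M}
    (hs : (μ s : Measure (CountingMeasure (E n × M)))
      {η | η.1 {x : E n × M | x.1 0 = 0} ≠ 0} = 0)
    {A : Set (CountingMeasure (E n × M))} (hA : MeasurableSet A) (x : E n) :
    shiftedLaw (μ s) x s {Y | Y.carrier ∩ cylinder c U (x 0 - c) ×ˢ univ = ∅ ∧
      Y ∈ PointSet.toCounting ⁻¹' A} = windowProb μ c U A (x, s) := by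
  rw [windowProb_eq_measure hU hA, shiftedLaw]
  refine measure_congr ?_
  have h1 : ∀ᵐ η ∂(μ s : Measure (CountingMeasure (E n × M))),
      ¬ ∃ t : ℝ, 1 < η.1 {x : E n × M | x.1 0 = t} := compl_mem_ae_iff.2 (hQ2 s)
  have h2 : ∀ᵐ η ∂(μ s : Measure (CountingMeasure (E n × M))),
      ¬ η.1 {x : E n × M | x.1 0 = 0} ≠ 0 := compl_mem_ae_iff.2 hs
  filter_upwards [h1, h2] with η hη h0
  obtain ⟨Y, rfl⟩ := mem_range_of_mem_simpleSet (mem_simpleSet hη)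
  have hm : MeasurableSet {x : E n × M | x.1 0 = 0} :=
    (isClosed_eq (by fun_prop) continuous_const).measurableSet
  have hY : ((0 : E n), s) ∉ Y.carrier := fun h => by
    have h3 := (PointSet.toCounting_apply_eq_zero Y hm).1 (not_not.1 h0)
    exact eq_empty_iff_forall_notMem.1 h3 ((0 : E n), s) ⟨h, rfl⟩
  refine propext ((PointSet.toCounting_injective.mem_set_image).trans ?_)
  refine and_congr (shiftInsert_inter_eq_empty hU Y x s) ?_
  change (shiftInsert Y x s).toCounting ∈ A ↔ _
  rw [toCounting_shiftInsert Y x s hY]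

/-- The limit process has the distribution given by the explicit formula. -/
theorem limitProcess_apply_eq_limitValue {cP : ℝ} (hμ : Continuous μ) (hQ2 : CoincidenceFree μ)
    (hface : ∀ᵐ s ∂m, (μ s : Measure (CountingMeasure (E n × M)))
      {η | η.1 {x : E n × M | x.1 0 = 0} ≠ 0} = 0)
    (hU : IsOpen U) {A : Set (CountingMeasure (E n × M))} (hA : MeasurableSet A) :
    limitProcess cP hμ m c U A = limitValue cP m μ c U (PointSet.toCounting ⁻¹' A) := by
  have hG := measurable_windowProb (c := c) hμ hU hA
  have h1 : limitProcess cP hμ m c U A = ENNReal.ofReal cP * ∫⁻ y in halfCylinder c U,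
      ∫⁻ s, windowProb μ c U A (y, s) ∂m := by
    rw [← lintegral_indicator_one hA, lintegral_limitProcess hμ hU (measurable_one.indicator hA)]
    rfl
  rw [h1, limitValue]
  congr 1
  -- The formula integrates over the mark last. With the mark outside, the face condition can be
  -- used for almost every mark.
  rw [lintegral_lintegral_swap (f := fun y s => windowProb μ c U A (y, s)) hG.aemeasurable]
  refine lintegral_congr_ae ?_
  filter_upwards [hface] with s hs
  have hGs : Measurable fun y : E n => windowProb μ c U A (y, s) :=
    hG.comp measurable_prodMk_right
  rw [lintegral_halfCylinder c hU hGs]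
  refine lintegral_congr fun τ => lintegral_congr fun b => ?_
  have h2 := shiftedLaw_eq_windowProb (c := c) hQ2 hU hs hA (consPt (c + τ) b)
  rw [consPt_zero, add_sub_cancel_left] at h2
  exact h2.symm

end LimitLaw

/-! ### From continuous densities to absolutely continuous laws. -/

section Density

/-- Density of C_c in L^1; since h is nonnegative, taking the positive part of the approximant does
not increase the distance. -/
theorem exists_nonneg_compactSupport_integral_sub_le {α : Type*} [TopologicalSpace α]
    [T2Space α] [NormalSpace α] [WeaklyLocallyCompactSpace α] [MeasurableSpace α] [BorelSpace α]
    {ν : Measure α} [ν.Regular] {h : α → ℝ} (hh : Integrable h ν) (h0 : ∀ z, 0 ≤ h z) {ε : ℝ}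
    (hε : 0 < ε) : ∃ φ : α → ℝ, Continuous φ ∧ HasCompactSupport φ ∧ (∀ z, 0 ≤ φ z) ∧
      Integrable φ ν ∧ ∫ z, |h z - φ z| ∂ν ≤ ε := by
  obtain ⟨g, hgc, hg, hgcont, hgi⟩ := hh.exists_hasCompactSupport_integral_sub_le hε
  refine ⟨fun z => max (g z) 0, hgcont.max continuous_const,
    hgc.comp_left (g := fun x => max x 0) (max_self 0), fun z => le_max_right _ _,
    hgi.pos_part, (integral_mono (hh.sub hgi.pos_part).abs (hh.sub hgi).norm fun z => ?_).trans hg⟩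
  change |h z - max (g z) 0| ≤ |h z - g z|
  conv_lhs => rw [← max_eq_left (h0 z)]
  exact abs_max_sub_max_le_abs _ _ _

theorem abs_integral_mul_sub_le {α : Type*} [MeasurableSpace α] {ν : Measure α} {h φ g : α → ℝ}
    (hh : Integrable h ν) (hφ : Integrable φ ν) (hg : Measurable g) (g0 : ∀ z, 0 ≤ g z)
    (g1 : ∀ z, g z ≤ 1) :
    |∫ z, h z * g z ∂ν - ∫ z, φ z * g z ∂ν| ≤ ∫ z, |h z - φ z| ∂ν := by
  have hb : ∀ᵐ z ∂ν, ‖g z‖ ≤ 1 :=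
    Eventually.of_forall fun z => by rw [Real.norm_of_nonneg (g0 z)]; exact g1 z
  rw [← integral_sub (hh.mul_bdd hg.aestronglyMeasurable hb)
    (hφ.mul_bdd hg.aestronglyMeasurable hb)]
  refine (abs_integral_le_integral_abs).trans (integral_mono_of_nonneg
    (Eventually.of_forall fun z => abs_nonneg _) (hh.sub hφ).abs (Eventually.of_forall fun z => ?_))
  change |h z * g z - φ z * g z| ≤ |h z - φ z|
  rw [← sub_mul, abs_mul, abs_of_nonneg (g0 z)]
  exact mul_le_of_le_one_right (abs_nonneg _) (g1 z)

variable {n : ℕ} {M : Type*} [MetricSpace M] [CompactSpace M] [MeasurableSpace M] [BorelSpace M]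
  {μ : M → ProbabilityMeasure (CountingMeasure (E n × M))}
  {m : Measure M} [IsProbabilityMeasure m] {f : CountingMeasure (E n × M) → ℝ}
  {c : ℝ} {U : Set (EuclideanSpace ℝ (Fin n))}
  {R : FrameRotation n} {P : PointSet (E n)} {mark : P.carrier → M}

/-- The expectations of tame observables converge for integrable initial densities. -/
theorem tendsto_integral_macroPoint_of_integrable (hn : 1 ≤ n) {cP : ℝ} (hcP : 0 < cP)
    (hP : HasAsymptoticDensity P.carrier cP)
    (hP1 : UniformDensity P mark cP m) (hP2 : SphericalEquidistribution R P mark μ)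
    (hP3 : NoEscapeOfMass R P mark) (hμ : Continuous μ)
    (hface : ∀ᵐ s ∂m, (μ s : Measure (CountingMeasure (E n × M)))
      {η | η.1 {x : E n × M | x.1 0 = 0} ≠ 0} = 0)
    {h : E n × Sph n → ℝ} (hh : Integrable h (volume.prod (omega n))) (h0 : ∀ z, 0 ≤ h z)
    (hf : Tame f) (hf0 : ∀ η, 0 ≤ f η) (hf1 : ∀ η, f η ≤ 1)
    (hU : IsOpen U) (hne : U.Nonempty) (hUb : Bornology.IsBounded U)
    (hU' : volume (frontier U) = 0) :
    Tendsto (fun ρ : Radius =>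
        ∫ z, h z * f (macroPoint R P mark ρ z).toCounting ∂(volume.prod (omega n))) toZero
      (𝓝 ((∫ z, h z ∂(volume.prod (omega n))) * ∫ η, f η ∂(limitProcess cP hμ m c U))) := by
  have hprob := isProbabilityMeasure_limitProcess (c := c) hn hcP hP hP1 hP2 hP3 hμ hface hU hne
    hUb hU'
  have hfi : Integrable f (limitProcess cP hμ m c U) :=
    integrable_bounded (C := 1) hf.continuous.measurable fun η => by
      rw [abs_of_nonneg (hf0 η)]; exact hf1 η
  have ha0 : 0 ≤ ∫ η, f η ∂(limitProcess cP hμ m c U) := integral_nonneg hf0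
  have ha1 : ∫ η, f η ∂(limitProcess cP hμ m c U) ≤ 1 := by
    have h1 := integral_mono hfi (integrable_const 1) hf1
    rwa [integral_const, probReal_univ, one_smul] at h1
  set a := ∫ η, f η ∂(limitProcess cP hμ m c U)
  rw [Metric.tendsto_nhds]
  intro ε hε
  have : IsLocallyFiniteMeasure ((volume : Measure (E n)).prod (omega n)) :=
    isLocallyFiniteMeasure_of_isFiniteMeasureOnCompacts
  obtain ⟨φ, hφ, hc, hφ0, hφi, hφh⟩ := exists_nonneg_compactSupport_integral_sub_le hh h0
    (ε := ε / 4) (by positivity)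
  have hlim := tendsto_integral_macroPoint (c := c) hn hcP hP hP1 hP2 hP3 hμ hface hφ hφ0 hc hf hf0
    hf1 hU hne hUb hU'
  have e2 : |(∫ z, h z ∂((volume : Measure (E n)).prod (omega n))) * a -
      (∫ z, φ z ∂((volume : Measure (E n)).prod (omega n))) * a| ≤ ε / 4 := by
    have h1 := abs_integral_mul_sub_le hh hφi (g := fun _ => a) measurable_const (fun _ => ha0)
      fun _ => ha1
    rw [integral_mul_const, integral_mul_const] at h1
    exact h1.trans hφh
  filter_upwards [Metric.tendsto_nhds.1 hlim (ε / 4) (by positivity)] with ρ hρ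
  have hfm : Measurable fun z => f (macroPoint R P mark ρ z).toCounting :=
    Measurable.comp (g := f) hf.continuous.measurable (measurable_macroPoint_toCounting ρ)
  have e1 := (abs_integral_mul_sub_le hh hφi hfm (fun _ => hf0 _) fun _ => hf1 _).trans hφh
  have h3 := dist_triangle4
    (∫ z, h z * f (macroPoint R P mark ρ z).toCounting ∂((volume : Measure (E n)).prod (omega n)))
    (∫ z, φ z * f (macroPoint R P mark ρ z).toCounting ∂((volume : Measure (E n)).prod (omega n)))
    ((∫ z, φ z ∂((volume : Measure (E n)).prod (omega n))) * a)
    ((∫ z, h z ∂((volume : Measure (E n)).prod (omega n))) * a)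
  rw [← Real.dist_eq] at e1 e2
  rw [dist_comm] at e2
  linarith

/-- The Radon-Nikodym density of Λ is integrable with total integral 1, so the factor carrying the
initial data in the limit disappears. -/
theorem tendsto_integral_macroLaw (hn : 1 ≤ n) {cP : ℝ} (hcP : 0 < cP)
    (hP : HasAsymptoticDensity P.carrier cP)
    (hP1 : UniformDensity P mark cP m) (hP2 : SphericalEquidistribution R P mark μ)
    (hP3 : NoEscapeOfMass R P mark) (hμ : Continuous μ)
    (hface : ∀ᵐ s ∂m, (μ s : Measure (CountingMeasure (E n × M)))
      {η | η.1 {x : E n × M | x.1 0 = 0} ≠ 0} = 0)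
    (Lam : ProbabilityMeasure (E n × Sph n))
    (hLam : (Lam : Measure (E n × Sph n)) ≪ (volume : Measure (E n)).prod (omega n))
    (hf : Tame f) (hf0 : ∀ η, 0 ≤ f η) (hf1 : ∀ η, f η ≤ 1)
    (hU : IsOpen U) (hne : U.Nonempty) (hUb : Bornology.IsBounded U)
    (hU' : volume (frontier U) = 0) :
    Tendsto (fun ρ : Radius =>
        ∫ Y, f Y.toCounting ∂(macroLaw R P mark ρ Lam : Measure (PointSet (E n × M)))) toZero
      (𝓝 (∫ η, f η ∂(limitProcess cP hμ m c U))) := by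
  set V := (volume : Measure (E n)).prod (omega n)
  let h : E n × Sph n → ℝ := fun z => ((Lam : Measure (E n × Sph n)).rnDeriv V z).toReal
  have : SigmaFinite V :=
    inferInstanceAs (SigmaFinite ((volume : Measure (E n)).prod (omega n)))
  have hh : Integrable h V := Measure.integrable_toReal_rnDeriv
  have hint : ∀ g : E n × Sph n → ℝ, ∫ z, h z * g z ∂V = ∫ z, g z ∂(Lam : Measure (E n × Sph n)) :=
    fun g => integral_rnDeriv_smul hLam
  have h1 := tendsto_integral_macroPoint_of_integrable (c := c) hn hcP hP hP1 hP2 hP3 hμ hface hh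
    (fun z => ENNReal.toReal_nonneg) hf hf0 hf1 hU hne hUb hU'
  have h2 : ∫ z, h z ∂V = 1 := by
    have h3 := hint fun _ => 1
    simpa using h3
  rw [h2, one_mul] at h1
  refine h1.congr fun ρ => ?_
  have hfm : Measurable fun Y : PointSet (E n × M) => f Y.toCounting :=
    Measurable.comp (g := f) hf.continuous.measurable measurable_toCounting
  rw [hint]
  exact (integral_map (measurable_macroPoint ρ).aemeasurable hfm.aestronglyMeasurable).symm

end Density

end LorentzGas

theorem theorem2p13 {n : ℕ} (hn : 1 ≤ n)
    {M : Type*} [MetricSpace M] [CompactSpace M] [MeasurableSpace M] [BorelSpace M]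
    (R : LorentzGas.FrameRotation n)
    (P : LorentzGas.PointSet (LorentzGas.E n)) (mark : P.carrier → M)
    (cP : ℝ) (hcP : 0 < cP) (hP : LorentzGas.HasAsymptoticDensity P.carrier cP)
    (m : Measure M) [IsProbabilityMeasure m]
    (μ : M → ProbabilityMeasure (LorentzGas.CountingMeasure (LorentzGas.E n × M)))
    (hμ : Continuous μ)
    (hP1 : LorentzGas.UniformDensity P mark cP m)
    (hP2 : LorentzGas.SphericalEquidistribution R P mark μ)
    (hP3 : LorentzGas.NoEscapeOfMass R P mark)
    (hQ1 : LorentzGas.RotationInvariant μ)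
    (hQ2 : LorentzGas.CoincidenceFree μ)
    (hQ3 : LorentzGas.SmallVoids μ)
    (c : ℝ) (U : Set (EuclideanSpace ℝ (Fin n))) (hU : IsOpen U) (hU_ne : U.Nonempty)
    (hU_bdd : Bornology.IsBounded U) (hU_bdry : volume (frontier U) = 0) :
    ∃ μlim : ProbabilityMeasure (LorentzGas.PointSet (LorentzGas.E n × M)),
      (∀ A : Set (LorentzGas.PointSet (LorentzGas.E n × M)), MeasurableSet A →
        (μlim : Measure (LorentzGas.PointSet (LorentzGas.E n × M))) A =
          LorentzGas.limitValue cP m μ c U A) ∧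
      ∀ Lam : ProbabilityMeasure (LorentzGas.E n × LorentzGas.Sph n),
        (Lam : Measure (LorentzGas.E n × LorentzGas.Sph n)) ≪
          (volume : Measure (LorentzGas.E n)).prod (LorentzGas.omega n) →
        Tendsto (fun ρ : LorentzGas.Radius => LorentzGas.macroLaw R P mark ρ Lam)
          LorentzGas.toZero (𝓝 μlim) := by
  have hface := LorentzGas.ae_measure_face_eq_zero hn hcP hP hP1 hP2 hμ hQ2 hQ3
  have hprob := LorentzGas.isProbabilityMeasure_limitProcess (c := c) hn hcP hP hP1 hP2 hP3 hμ hface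
    hU hU_ne hU_bdd hU_bdry
  have hrange := LorentzGas.limitProcess_compl_range (cP := cP) hμ hQ2 hface c U
  set ν := LorentzGas.limitProcess cP hμ m c U with hν
  have hmap := LorentzGas.map_toPointSetMeasure hrange
  have hprob' : IsProbabilityMeasure (LorentzGas.toPointSetMeasure ν) := by
    have h1 := LorentzGas.toPointSetMeasure_apply hrange MeasurableSet.univ
    rw [preimage_univ, hprob.measure_univ] at h1
    exact ⟨h1⟩
  refine ⟨⟨LorentzGas.toPointSetMeasure ν, hprob'⟩, fun A hA => ?_, fun Lam hLam => ?_⟩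
  · obtain ⟨A', hA', rfl⟩ := LorentzGas.PointSet.exists_measurableSet_preimage hA
    exact (LorentzGas.toPointSetMeasure_apply hrange hA').trans
      (LorentzGas.limitProcess_apply_eq_limitValue hμ hQ2 hface hU hA')
  -- Tame test functions suffice, and their expectations under the pulled-back measure are those
  -- under the limit process on counting measures.
  · refine LorentzGas.tendsto_of_tame fun f hf hf0 hf1 => ?_
    have h1 := LorentzGas.tendsto_integral_macroLaw (c := c) hn hcP hP hP1 hP2 hP3 hμ hface Lam hLam
      hf hf0 hf1 hU hU_ne hU_bdd hU_bdry
    have h2 := integral_map (μ := LorentzGas.toPointSetMeasure ν)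
      LorentzGas.measurable_toCounting.aemeasurable (f := f)
      hf.continuous.measurable.aestronglyMeasurable
    rw [hmap] at h2
    rw [← hν, h2] at h1
    exact h1
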